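/- **Setting.** Let $H$ be a self-adjoint operator on a Hilbert space $\mathcal H$ with $H\ge -h_0$, $h_0\ge 0$, and $\operatorname{Tr}e^{-bH}<\infty$ for all $b>0$. Fix $\beta>0$ and $\sigma_E>0$, and put $\sigma_\beta=e^{-\beta H}/\operatorname{Tr}e^{-\beta H}$, $\widetilde H=H+h_0+1$. Let $\{A^\alpha\}_{\alpha\in\mathcal A}$ be a finite family of closed, densely defined operators. It is invariant under adjoints, that is, $(A^\alpha)^\dagger=A^{\tau(\alpha)}$ for a permutation $\tau$ of $\mathcal A$, and for some $0\le\gamma\le\mu$ the operators $A^\alpha\widetilde H^{-\gamma}$ and $\widetilde H^{\gamma}A^\alpha\widetilde H^{-\mu}$ are bounded for all $\alpha$. Let $f\in\mathcal S(\mathbb R)$, with $\widehat f(\nu)=\int f(s)e^{i\nu s}\,ds$, satisfy $\overline{\widehat f(\nu)}=\widehat f(-\nu)e^{-\beta\nu/2}$, with $\widehat f(\nu)$ and $e^{\beta\nu/2}\widehat f(\nu)$ bounded. **Exact dynamics.** For a Bohr frequency $\nu\in\operatorname{Sp}(H)-\operatorname{Sp}(H)$ let $A^\alpha_\nu=\sum_E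 \mathbf 1_{\{E+\nu\}}(H)A^\alpha \mathbf 1_{\{E\}}(H)$ and $\delta^\alpha_\nu(x)=e^{-\beta\nu/4}A^\alpha_\nu x-e^{\beta\nu/4}xA^\alpha_\nu$. On the span of $\sqrt{\sigma_\beta}$ and the matrix units of an eigenbasis of $H$, inside the Hilbert–Schmidt operators, consider the form $$\mathcal E(x,y)=\sum_{\alpha}\sum_{\nu_1,\nu_2}\frac{e^{-(\nu_1-\nu_2)^2/(8\sigma_E^2)}\,e^{\beta(\nu_1+\nu_2)/4}}{2\cosh(\beta(\nu_1-\nu_2)/4)}\,\overline{\widehat f(\nu_1)}\,\widehat f(\nu_2)\,\langle\delta^\alpha_{\nu_1}(x),\delta^\alpha_{\nu_2}(y)\rangle_2$$ (with $\mathcal E(\sqrt{\sigma_\beta},\cdot)=\mathcal E(\cdot,\sqrt{\sigma_\beta})=0$). Let $L\le 0$ be the self-adjoint operator of its closure. The exact dynamics $e^{t\mathcal L}$ is given by $e^{t\mathcal L}(\sigma_\beta^{1/4}x\sigma_\beta^{1/4})=\sigma_\beta^{1/4}(e^{tL}x)\sigma_\beta^{1/4}$ for Hilbert–Schmidt $x$;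 this covers every state $\rho\le\mathfrak c\sigma_\beta$. Its gap is $\lambda_2=\inf\{\langle x,-Lx\rangle_2: x\in\operatorname{dom}L,\ x\perp\sqrt{\sigma_\beta},\ \|x\|_2=1\}$. **Truncated dynamics.** For $M\in\mathbb N=\{1,2,\dots\}$ let $\pi^\alpha_M$ be orthogonal projections onto subspaces of $\operatorname{dom}A^\alpha$ with $\pi^{\tau(\alpha)}_M=\pi^\alpha_M$, and $P_M$ finite-rank orthogonal projections onto subspaces of $\operatorname{dom}H$. Put $(A^\alpha)^{\le M}=\pi^\alpha_MA^\alpha\pi^\alpha_M$, $H_{\le M}=P_MHP_M$, $B(s)=e^{isH_{\le M}}Be^{-isH_{\le M}}$, and $$L^\alpha=\int f(s)\,(A^\alpha)^{\le M}(s)\,ds,\qquad G=-\sum_\alpha\int g(s)\,\big((L^{\alpha})^\dagger L^\alpha\big)(s)\,ds,\qquad g(s)=\frac1{2\pi}\int\frac{e^{-\nu^2/(8\sigma_E^2)}}{1+e^{\beta\nu/2}}\,e^{-i\nu s}\,d\nu.$$ The truncated dynamics is $e^{t\mathcal L^{\le M}}$ with $$\mathcal L^{\le M}(\rho)=G\rho+\rho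 G^\dagger+\sigma_E\sqrt{2/\pi}\,\sum_\alpha\int e^{-2\sigma_E^2s^2}L^\alpha(s)\,\rho\,L^\alpha(s)^\dagger\,ds.$$ **Assumptions.** Let $\kappa\in(0,1/2)$, $r\ge 0$, $\int|t|e^{r|t|^{2\kappa}}|f(t)|\,dt<\infty$, let $N_{\mathcal A}\ge 0$ be self-adjoint, and let $q,q',p$ be polynomially bounded functions. For all $\alpha\in\mathcal A$ and $M\in\mathbb N$ assume: - $\|(A^\alpha)^{\le M}\|$, $\|e^{N_{\mathcal A}^\kappa}(A^\alpha)^{\le M}e^{-N_{\mathcal A}^\kappa}\|$ and $\|e^{-N_{\mathcal A}^\kappa}(A^\alpha)^{\le M}e^{N_{\mathcal A}^\kappa}\|$ are at most $q'(M)$; - $\|(A^\alpha-(A^\alpha)^{\le M})e^{-N_{\mathcal A}^\kappa}\|$ and $\|e^{N_{\mathcal A}^\kappa}(A^\alpha-(A^\alpha)^{\le M})e^{-2N_{\mathcal A}^\kappa}\|$ are at most $q(M)e^{-M^\kappa}$; - $\|(H-H_{\le M})e^{-N_{\mathcal A}^\kappa}\|\le p(|\mathcal A|,M)e^{-M^\kappa}$;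 - $\|e^{N_{\mathcal A}^\kappa}A^\alpha e^{-2N_{\mathcal A}^\kappa}\|+\|A^\alpha e^{-N_{\mathcal A}^\kappa}\|+\|e^{-N_{\mathcal A}^\kappa}A^\alpha\|\le C_A<\infty$; - $e^{-itH}e^{kN_{\mathcal A}^\kappa}e^{itH}\le e^{r|t|^{2\kappa}}e^{kN_{\mathcal A}^\kappa}$ as quadratic forms, for $k\in\{2,4\}$ and $t\in\mathbb R$; - $E_{\rm Gibbs}:=\operatorname{Tr}(e^{4N_{\mathcal A}^\kappa}\sigma_\beta)<\infty$. **Theorem.** There are constants $C_1\ge 0$ and $K_0>0$ depending only on $\beta,r,\kappa,\sigma_E,f,C_A$; a polynomially bounded function $p_4\ge 0$ depending only on these and on $q,q',p$; and constants $K>0$, $m\in\mathbb N_0$ depending only on the same data, such that the following holds for every such setting, every $\mathfrak c\ge 1$ and every state $\rho\le\mathfrak c\,\sigma_\beta$. 1. For all $t\ge 0$ and $M\in\mathbb N$, $$\big\|\big(e^{t\mathcal L}-e^{t\mathcal L^{\le M}}\big)(\rho)\big\|_1\le t\,C_1\,\mathfrak c\,p_4(|\mathcal A|,M)\,E_{\rm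 Gibbs}\,e^{-M^\kappa}.$$ 2. For all $t\ge 0$ and $\varepsilon>0$, this norm is at most $\varepsilon$ for every integer $M\ge K\,\Lambda^{1/\kappa}(1+\log\Lambda)^m$, where $\Lambda=\log\big(e+(1+t\,\mathfrak c\,E_{\rm Gibbs}/\varepsilon)|\mathcal A|\big)$. That is, $M=\widetilde{\mathcal O}\big(\log(t\,\mathfrak c\,E_{\rm Gibbs}|\mathcal A|/\varepsilon)^{1/\kappa}\big)$ suffices. 3. If $\lambda_2>0$, then for all $\varepsilon>0$, with $t=\frac{K_0}{\lambda_2}\log(1+\mathfrak c/\varepsilon)$ and every integer $M\ge K\,\Lambda^{1/\kappa}\big(1+\log(1+\log(1+\mathfrak c/\varepsilon))\big)^m$, where $\Lambda=\log\big(e+(1+\tfrac{\mathfrak c\,E_{\rm Gibbs}}{\lambda_2\varepsilon})|\mathcal A|\big)$, $$\big\|e^{t\mathcal L^{\le M}}(\rho)-\sigma_\beta\big\|_1\le\varepsilon.$$ -/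

import Mathlib

open scoped InnerProductSpace SchwartzMap

noncomputable section

namespace GibbsSampler

/-! ### Operators on a Hilbert space -/

section Operators

variable {F : Type*} [NormedAddCommGroup F] [InnerProductSpace ℂ F]

/-- The trace norm `‖T‖₁ = Tr |T|`, in its variational form: the supremum of
`∑ i, |⟨e i, T (f i)⟩|` over all finite orthonormal families `e`, `f`. The value is `∞` exactly
when `T` is not of trace class. -/
def traceNorm (T : F →L[ℂ] F) : ENNReal :=
  ⨆ (n : ℕ) (e : Fin n → F) (f : Fin n → F) (_ : Orthonormal ℂ e) (_ : Orthonormal ℂ f),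
    ∑ i, ENNReal.ofReal ‖⟪e i, T (f i)⟫_ℂ‖

/-- `‖S⁻¹ X T‖ ≤ c`, for a partially defined operator `X` and everywhere defined maps `S`, `T`:
the range of `T` lies in the domain of `X`, the range of `X T` lies in the range of `S`
(the domain of `S⁻¹`), and `‖S⁻¹ X T ψ‖ ≤ c ‖ψ‖` for all `ψ`.
It is only used with `S` injective. -/
def SandwichBound (S : F → F) (X : F →ₗ.[ℂ] F) (T : F → F) (c : ℝ) : Prop :=
  ∀ ψ : F, ∃ (h : T ψ ∈ X.domain) (η : F), S η = X ⟨T ψ, h⟩ ∧ ‖η‖ ≤ c * ‖ψ‖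

/-- A bounded operator seen as an operator with full domain. -/
def ofBounded (B : F →L[ℂ] F) : F →ₗ.[ℂ] F := (B : F →ₗ[ℂ] F).toPMap ⊤

open Classical in
/-- The value `X ψ` of a partially defined operator (and `0` off its domain). -/
def applyAt (X : F →ₗ.[ℂ] F) (ψ : F) : F :=
  if h : ψ ∈ X.domain then X ⟨ψ, h⟩ else 0

open Classical in
/-- The compression `π X π` of an operator `X` by a projection `π` whose range lies in the domain
of `X`. For closed `X` this is a bounded operator. -/
def compress (X : F →ₗ.[ℂ] F) (π : F →L[ℂ] F) : F →L[ℂ] F :=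
  if hB : ∃ B : F →L[ℂ] F, ∀ ψ, ∃ h : π ψ ∈ X.domain, B ψ = π (X ⟨π ψ, h⟩)
  then hB.choose else 0

open Classical in
/-- The resolvent `(1 + K)⁻¹` of a positive self-adjoint operator `K`, given by its graph. -/
def resolventOne (K : Set (F × F)) : F →L[ℂ] F :=
  if hR : ∃ R : F →L[ℂ] F, ∀ y, (R y, y - R y) ∈ K then hR.choose else 0

variable [CompleteSpace F]

/-- The bounded operator `φ(K)`, for a positive self-adjoint operator `K` given by its graph and
a continuous function `φ` on `[0, ∞)` that vanishes at infinity. With `R = (1 + K)⁻¹` one has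
`K = R⁻¹ - 1`, so that `φ(K) = g(R)` with `g(x) = φ(1/x - 1)` for `x > 0` and `g(0) = 0`. -/
def funcCalc (φ : ℝ → ℝ) (K : Set (F × F)) : F →L[ℂ] F :=
  cfc (fun x : ℝ => if 0 < x then φ (1 / x - 1) else 0) (resolventOne K)

open Classical in
/-- The contraction semigroup `e^{-tK}`, `t ≥ 0`, of a positive self-adjoint operator `K` given by
its graph. -/
def expNegSemigroup (K : Set (F × F)) (t : ℝ) : F →L[ℂ] F :=
  if t = 0 then 1 else funcCalc (fun k => Real.exp (-(t * k))) K

/-- The bounded injective operator `e^{-s N^κ}` (`s, κ > 0`), for `N` positive self-adjoint. -/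
def expNegPow (N : F →ₗ.[ℂ] F) (κ s : ℝ) : F →L[ℂ] F :=
  funcCalc (fun n => Real.exp (-(s * n ^ κ))) (N.graph : Set (F × F))

/-- The quadratic form `⟨ψ, e^{k N^κ} ψ⟩ = ‖e^{(k/2) N^κ} ψ‖²`, with value `∞` off the form domain.
The vector `η` is `e^{(k/2) N^κ} ψ`. -/
def expPowForm (N : F →ₗ.[ℂ] F) (κ k : ℝ) (ψ : F) : ENNReal :=
  ⨅ (η : F) (_ : expNegPow N κ (k / 2) η = ψ), ENNReal.ofReal (‖η‖ ^ 2)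

end Operators

/-! ### Scalar functions -/

/-- The transform `f̂(ν) = ∫ f(s) e^{isν} ds`. -/
def hat (f : 𝓢(ℝ, ℂ)) (ν : ℝ) : ℂ := ∫ s : ℝ, f s * Complex.exp (Complex.I * s * ν)

/-- The conditions on the filter function at inverse temperature `β`: the symmetry
`conj f̂(ν) = f̂(-ν) e^{-βν/2}` and the boundedness of `f̂(ν)` and `e^{βν/2} f̂(ν)`. -/
structure IsKMSFilter (β : ℝ) (f : 𝓢(ℝ, ℂ)) : Prop where
  symm : ∀ ν : ℝ, star (hat f ν) = hat f (-ν) * (Real.exp (-(β * ν / 2)) : ℂ)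
  bounded : ∃ C : ℝ, ∀ ν : ℝ, ‖hat f ν‖ ≤ C ∧ Real.exp (β * ν / 2) * ‖hat f ν‖ ≤ C

/-- `g(t) = (2π)⁻¹ ∫ e^{-ν²/(8σ²)} / (1 + e^{βν/2}) e^{-iνt} dν`. -/
def driftKernel (β σ t : ℝ) : ℂ :=
  (1 / (2 * Real.pi) : ℝ) * ∫ ν : ℝ,
    ((Real.exp (-(ν ^ 2 / (8 * σ ^ 2))) / (1 + Real.exp (β * ν / 2)) : ℝ) : ℂ) *
      Complex.exp (-(Complex.I * ν * t))

/-- A polynomially bounded function of one natural number. -/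
def PolyBounded (q : ℕ → ℝ) : Prop :=
  ∃ (C : ℝ) (k : ℕ), ∀ M : ℕ, |q M| ≤ C * (1 + M : ℝ) ^ k

/-- A polynomially bounded function of two natural numbers. -/
def PolyBounded₂ (p : ℕ → ℕ → ℝ) : Prop :=
  ∃ (C : ℝ) (k : ℕ), ∀ a M : ℕ, |p a M| ≤ C * (1 + a + M : ℝ) ^ k

/-! ### The Hamiltonian, its Gibbs state, and the jumps -/

/-- A Hamiltonian with an energy eigenbasis and a family of bare jump operators. -/
structure System (ι 𝒜 𝓗 : Type*) [NormedAddCommGroup 𝓗] [InnerProductSpace ℂ 𝓗] where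
  /-- the Hamiltonian -/
  H : 𝓗 →ₗ.[ℂ] 𝓗
  /-- `H ≥ -h₀` -/
  h₀ : ℝ
  /-- the energy eigenbasis `|E i⟩` -/
  basis : HilbertBasis ι ℂ 𝓗
  /-- the energies, repeated according to multiplicity -/
  energy : ι → ℝ
  /-- the bare jumps -/
  A : 𝒜 → 𝓗 →ₗ.[ℂ] 𝓗

namespace System

variable {ι 𝒜 𝓗 : Type*} [NormedAddCommGroup 𝓗] [InnerProductSpace ℂ 𝓗]
variable (S : System ι 𝒜 𝓗)

/-- `φ(H) ψ = ∑ i, φ(E i) ⟨E i, ψ⟩ |E i⟩`. -/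
def fun_H (φ : ℝ → ℂ) (ψ : 𝓗) : 𝓗 :=
  ∑' i, (φ (S.energy i) * ⟪S.basis i, ψ⟫_ℂ) • S.basis i

/-- `e^{itH} ψ`. -/
def evolve (t : ℝ) : 𝓗 → 𝓗 := S.fun_H fun x => Complex.exp (Complex.I * t * x)

/-- The negative powers `(H + h₀ + 1)^{-γ}`. -/
def negPow (γ : ℝ) : 𝓗 → 𝓗 := S.fun_H fun x => (((x + S.h₀ + 1) ^ (-γ) : ℝ) : ℂ)

/-- The Hamiltonian is self-adjoint, bounded below by `-h₀`, has the given eigenbasis and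
energies, and has finite partition functions at all temperatures. -/
structure IsGibbs [CompleteSpace 𝓗] : Prop where
  selfAdjoint : IsSelfAdjoint S.H
  eigen : ∀ i, ∃ h : S.basis i ∈ S.H.domain,
    S.H ⟨S.basis i, h⟩ = (S.energy i : ℂ) • S.basis i
  h₀_nonneg : 0 ≤ S.h₀
  lower : ∀ i, -S.h₀ ≤ S.energy i
  summable : ∀ b : ℝ, 0 < b → Summable fun i => Real.exp (-(b * S.energy i))

/-- The jumps are closed and densely defined, the family is invariant under adjoints (`τ` sends
the label of a jump to the label of its adjoint), and, with `H̃ = H + h₀ + 1`, both `A^α H̃^{-γ}`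
and `H̃^γ A^α H̃^{-μ}` are bounded for some exponents `0 ≤ γ ≤ μ`. The first bound implies
that the domains contain all energy eigenvectors. -/
structure JumpCondition [CompleteSpace 𝓗] (τ : Equiv.Perm 𝒜) : Prop where
  closed : ∀ α, (S.A α).IsClosed
  dense : ∀ α, Dense ((S.A α).domain : Set 𝓗)
  adjoint : ∀ α, S.A (τ α) = (S.A α).adjoint
  bounds : ∃ γ μ C : ℝ, 0 ≤ γ ∧ γ ≤ μ ∧ ∀ α,
    SandwichBound id (S.A α) (S.negPow γ) C ∧
    SandwichBound (S.negPow γ) (S.A α) (S.negPow μ) C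

/-- The eigenvalue `e^{-β E i} / Z(β)` of the Gibbs state. -/
def gibbsWeight (β : ℝ) (i : ι) : ℝ :=
  Real.exp (-(β * S.energy i)) / ∑' j, Real.exp (-(β * S.energy j))

/-- The operator `∑ i j, x (i, j) |E i⟩⟨E j|`, as a sum in the operator norm. -/
def ofMatrix (x : ι × ι → ℂ) : 𝓗 →L[ℂ] 𝓗 :=
  ∑' p : ι × ι, x p • InnerProductSpace.rankOne ℂ (S.basis p.1) (S.basis p.2)

/-- The Gibbs state `σ_β = e^{-βH} / Tr e^{-βH}`. -/
def gibbsState (β : ℝ) : 𝓗 →L[ℂ] 𝓗 :=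
  ∑' i, (S.gibbsWeight β i : ℂ) • InnerProductSpace.rankOne ℂ (S.basis i) (S.basis i)

/-- Density operators: positive with trace one. -/
def IsState (ρ : 𝓗 →L[ℂ] 𝓗) : Prop :=
  ρ.IsPositive ∧ HasSum (fun i => ⟪S.basis i, ρ (S.basis i)⟫_ℂ) 1

/-- `E_Gibbs = Tr (e^{4 N^κ} σ_β)`. -/
def gibbsEnergy [CompleteSpace 𝓗] (β : ℝ) (N : 𝓗 →ₗ.[ℂ] 𝓗) (κ : ℝ) : ENNReal :=
  ∑' i, ENNReal.ofReal (S.gibbsWeight β i) * expPowForm N κ 4 (S.basis i)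

/-! ### The exact dynamics

Hilbert-Schmidt operators are represented by their square-summable matrices in the energy
eigenbasis. -/

open Classical in
/-- The Hilbert-Schmidt operator with a given square-summable matrix. -/
def toHS {ι : Type*} (x : ι × ι → ℂ) : lp (fun _ : ι × ι => ℂ) 2 :=
  if h : Memℓp x 2 then ⟨x, h⟩ else 0

/-- The set `Sp(H) - Sp(H)` of Bohr frequencies. -/
def Bohr : Set ℝ := {ν | ∃ i j, ν = S.energy i - S.energy j}

open Classical in
/-- The matrix of the energy component `A^α_ν = ∑ E, P_{E + ν} A^α P_E`. -/
def jumpEntry (α : 𝒜) (ν : ℝ) (k l : ι) : ℂ :=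
  if S.energy k = S.energy l + ν then ⟪S.basis k, applyAt (S.A α) (S.basis l)⟫_ℂ else 0

/-- The matrix of `δ^α_ν(x) = e^{-βν/4} A^α_ν x - e^{βν/4} x A^α_ν`, for a finite linear
combination `x` of the matrix units `|E i⟩⟨E j|`. -/
def delta (β : ℝ) (α : 𝒜) (ν : ℝ) (x : ι × ι →₀ ℂ) (p : ι × ι) : ℂ :=
  (Real.exp (-(β * ν / 4)) : ℂ) * (∑' m, S.jumpEntry α ν p.1 m * x (m, p.2)) -
    (Real.exp (β * ν / 4) : ℂ) * ∑' m, x (p.1, m) * S.jumpEntry α ν m p.2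

/-- The coefficient
`e^{-(ν₁-ν₂)²/(8σ²)} conj f̂(ν₁) f̂(ν₂) e^{β(ν₁+ν₂)/4} / (2 cosh(β(ν₁-ν₂)/4))`. -/
def formCoeff (β σ : ℝ) (f : 𝓢(ℝ, ℂ)) (ν₁ ν₂ : ℝ) : ℂ :=
  (Real.exp (-((ν₁ - ν₂) ^ 2 / (8 * σ ^ 2))) * Real.exp (β * (ν₁ + ν₂) / 4) /
    (2 * Real.cosh ((ν₁ - ν₂) * β / 4)) : ℝ) * star (hat f ν₁) * hat f ν₂

/-- The sesquilinear form `∑ α ν₁ ν₂, coeff(ν₁, ν₂) ⟨δ^α_{ν₁} x, δ^α_{ν₂} y⟩` on finite linear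
combinations of the matrix units. -/
def form [Fintype 𝒜] (β σ : ℝ) (f : 𝓢(ℝ, ℂ)) (x y : ι × ι →₀ ℂ) : ℂ :=
  ∑ α, ∑' ν : S.Bohr × S.Bohr, formCoeff β σ f ν.1 ν.2 *
    ∑' p : ι × ι, star (S.delta β α ν.1 x p) * S.delta β α ν.2 y p

open Classical in
/-- The Hilbert-Schmidt operator `x + c √σ_β`, for a finite linear combination `x` of matrix
units. These operators are the core; on it the Dirichlet form is
`(x + c √σ_β, y + d √σ_β) ↦ form x y`. -/
def coreVec (β : ℝ) (x : ι × ι →₀ ℂ) (c : ℂ) : lp (fun _ : ι × ι => ℂ) 2 :=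
  toHS fun p => x p + if p.1 = p.2 then c * (Real.sqrt (S.gibbsWeight β p.1) : ℂ) else 0

/-- The graph of `-L`, where `L` is the nonpositive self-adjoint operator of the closure `ℰ` of
the Dirichlet form (the Friedrichs extension): the pairs `(x, -L x)` such that `x` is in the domain
of `ℰ`, that is, `x` is the limit of a sequence of the core that is Cauchy for the form, and
`ℰ(z, x) = ⟨z, -L x⟩` for all `z` in the core. -/
def negGenerator [Fintype 𝒜] (β σ : ℝ) (f : 𝓢(ℝ, ℂ)) :
    Set (lp (fun _ : ι × ι => ℂ) 2 × lp (fun _ : ι × ι => ℂ) 2) :=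
  {w | ∃ (u : ℕ → ι × ι →₀ ℂ) (c : ℕ → ℂ),
    Filter.Tendsto (fun n => S.coreVec β (u n) (c n)) Filter.atTop (nhds w.1) ∧
    (∀ ε : ℝ, 0 < ε → ∃ n₀, ∀ m ≥ n₀, ∀ n ≥ n₀,
      ‖S.form β σ f (u m - u n) (u m - u n)‖ < ε) ∧
    ∀ (z : ι × ι →₀ ℂ) (d : ℂ),
      Filter.Tendsto (fun n => S.form β σ f z (u n)) Filter.atTop
        (nhds ⟪S.coreVec β z d, w.2⟫_ℂ)}

/-- The spectral gap of `L` above its ground state `√σ_β`, in the variational form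
`inf {⟨x, -L x⟩ | x ⊥ √σ_β, ‖x‖ = 1}`. -/
def spectralGap [Fintype 𝒜] (β σ : ℝ) (f : 𝓢(ℝ, ℂ)) : ℝ :=
  sInf {r | ∃ w ∈ S.negGenerator β σ f,
    ⟪S.coreVec β 0 1, w.1⟫_ℂ = 0 ∧ ‖w.1‖ = 1 ∧ r = (⟪w.1, w.2⟫_ℂ).re}

/-- The exact dynamics `e^{t𝓛}`, which is determined by
`e^{t𝓛}(σ_β^{1/4} x σ_β^{1/4}) = σ_β^{1/4} (e^{tL} x) σ_β^{1/4}` for Hilbert-Schmidt operators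
`x`, evaluated at `ρ = σ_β^{1/4} x σ_β^{1/4}`. Every state `ρ ≤ 𝔠 σ_β` is of this form. -/
def exactDynamics [Fintype 𝒜] (β σ : ℝ) (f : 𝓢(ℝ, ℂ)) (t : ℝ) (ρ : 𝓗 →L[ℂ] 𝓗) :
    𝓗 →L[ℂ] 𝓗 :=
  let w : ι × ι → ℝ := fun p => (S.gibbsWeight β p.1 * S.gibbsWeight β p.2) ^ (1 / 4 : ℝ)
  let x := toHS fun p : ι × ι => ((w p)⁻¹ : ℂ) * ⟪S.basis p.1, ρ (S.basis p.2)⟫_ℂ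
  S.ofMatrix fun p => (w p : ℂ) * (expNegSemigroup (S.negGenerator β σ f) t x) p

end System

/-! ### The truncated dynamics -/

section Truncated

variable {𝒜 𝓗 : Type*} [NormedAddCommGroup 𝓗] [InnerProductSpace ℂ 𝓗] [CompleteSpace 𝓗]

/-- `e^{itH} B e^{-itH}`, for bounded `H` and `B`. -/
def heis (H B : 𝓗 →L[ℂ] 𝓗) (t : ℝ) : 𝓗 →L[ℂ] 𝓗 :=
  NormedSpace.exp ((Complex.I * t) • H) * B * NormedSpace.exp (-(Complex.I * t) • H)

/-- The integrated jump `L = ∫ f(s) e^{isH} B e^{-isH} ds`. -/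
def intJump (f : 𝓢(ℝ, ℂ)) (H B : 𝓗 →L[ℂ] 𝓗) : 𝓗 →L[ℂ] 𝓗 :=
  ∫ s : ℝ, f s • heis H B s

/-- The drift `G = - ∑ α, ∫ g(t) e^{itH} (L^α)† L^α e^{-itH} dt`. -/
def drift [Fintype 𝒜] (β σ : ℝ) (f : 𝓢(ℝ, ℂ)) (H : 𝓗 →L[ℂ] 𝓗) (B : 𝒜 → 𝓗 →L[ℂ] 𝓗) :
    𝓗 →L[ℂ] 𝓗 :=
  -∑ α, ∫ t : ℝ, driftKernel β σ t • heis H (star (intJump f H (B α)) * intJump f H (B α)) t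

/-- The Lindblad generator of bounded jumps `B α` and a bounded Hamiltonian `H`:
`ρ ↦ G ρ + ρ G† + σ √(2/π) ∑ α, ∫ e^{-2σ²s²} X_s^α ρ (X_s^α)† ds` with
`X_s^α = e^{isH} L^α e^{-isH}`. -/
def lindbladian [Fintype 𝒜] (β σ : ℝ) (f : 𝓢(ℝ, ℂ)) (H : 𝓗 →L[ℂ] 𝓗) (B : 𝒜 → 𝓗 →L[ℂ] 𝓗) :
    (𝓗 →L[ℂ] 𝓗) →L[ℂ] (𝓗 →L[ℂ] 𝓗) :=
  ContinuousLinearMap.mulLeftRight ℂ (𝓗 →L[ℂ] 𝓗) (drift β σ f H B) 1 +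
  ContinuousLinearMap.mulLeftRight ℂ (𝓗 →L[ℂ] 𝓗) 1 (star (drift β σ f H B)) +
  ∑ α, ((σ * Real.sqrt (2 / Real.pi) : ℝ) : ℂ) • ∫ s : ℝ,
    (Real.exp (-(2 * σ ^ 2 * s ^ 2)) : ℂ) •
      ContinuousLinearMap.mulLeftRight ℂ (𝓗 →L[ℂ] 𝓗)
        (heis H (intJump f H (B α)) s) (star (heis H (intJump f H (B α)) s))

/-- The energy observable and the projections that define the truncations. -/
structure Truncation (𝒜 𝓗 : Type*) [NormedAddCommGroup 𝓗] [InnerProductSpace ℂ 𝓗] where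
  /-- the energy observable `N_𝒜` -/
  N : 𝓗 →ₗ.[ℂ] 𝓗
  /-- the projections `π^α_M` -/
  proj : 𝒜 → ℕ → 𝓗 →L[ℂ] 𝓗
  /-- the projections `P_M` -/
  P : ℕ → 𝓗 →L[ℂ] 𝓗

/-- The truncated dynamics `e^{t𝓛^{≤M}}`, with jumps `π^α_M A^α π^α_M` and Hamiltonian
`P_M H P_M`. -/
def truncDynamics {ι : Type*} [Fintype 𝒜] (S : System ι 𝒜 𝓗) (T : Truncation 𝒜 𝓗) (β σ : ℝ)
    (f : 𝓢(ℝ, ℂ)) (M : ℕ) (t : ℝ) (ρ : 𝓗 →L[ℂ] 𝓗) : 𝓗 →L[ℂ] 𝓗 :=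
  NormedSpace.exp ((t : ℂ) • lindbladian β σ f (compress S.H (T.P M))
    (fun α => compress (S.A α) (T.proj α M))) ρ

/-- The assumptions on the truncations: leakage, norm bounds, and energy growth. Here `q`, `q'`
and `p` are the prefactors, `r` and `κ` are the parameters of the energy growth, and `C_A` bounds
the weighted norms of the jumps. -/
structure TruncationCondition {ι : Type*} [Fintype 𝒜] (S : System ι 𝒜 𝓗) (T : Truncation 𝒜 𝓗)
    (τ : Equiv.Perm 𝒜) (κ r C_A : ℝ) (q q' : ℕ → ℝ) (p : ℕ → ℕ → ℝ) : Prop where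
  /-- `N` is self-adjoint and positive semidefinite. -/
  selfAdjoint : IsSelfAdjoint T.N
  nonneg : ∀ ψ : T.N.domain, 0 ≤ (⟪(ψ : 𝓗), T.N ψ⟫_ℂ).re
  /-- The `π^α_M` are orthogonal projections onto subspaces of the domain of `A^α`, and a jump and
  its adjoint are truncated by the same projection. -/
  proj_star : ∀ α M, 1 ≤ M → IsStarProjection (T.proj α M)
  proj_mem : ∀ α M, 1 ≤ M → ∀ ψ, T.proj α M ψ ∈ (S.A α).domain
  proj_adjoint : ∀ α M, 1 ≤ M → T.proj (τ α) M = T.proj α M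
  /-- The `P_M` are finite-rank orthogonal projections onto subspaces of the domain of `H`. -/
  P_star : ∀ M, 1 ≤ M → IsStarProjection (T.P M)
  P_finite : ∀ M, 1 ≤ M → FiniteDimensional ℂ (LinearMap.range (T.P M : 𝓗 →ₗ[ℂ] 𝓗))
  P_mem : ∀ M, 1 ≤ M → ∀ ψ, T.P M ψ ∈ S.H.domain
  /-- `‖(A^α)^{≤M}‖ ≤ q'(M)`. -/
  norm_jump : ∀ α M, 1 ≤ M → ‖compress (S.A α) (T.proj α M)‖ ≤ q' M
  /-- `‖e^{N^κ} (A^α)^{≤M} e^{-N^κ}‖ ≤ q'(M)`. -/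
  norm_jump_left : ∀ α M, 1 ≤ M →
    SandwichBound (expNegPow T.N κ 1) (ofBounded (compress (S.A α) (T.proj α M)))
      (expNegPow T.N κ 1) (q' M)
  /-- `‖e^{-N^κ} (A^α)^{≤M} e^{N^κ} φ‖ ≤ q'(M) ‖φ‖` for all `φ = e^{-N^κ} η`. -/
  norm_jump_right : ∀ α M, 1 ≤ M → ∀ η : 𝓗,
    ‖expNegPow T.N κ 1 (compress (S.A α) (T.proj α M) η)‖ ≤ q' M * ‖expNegPow T.N κ 1 η‖
  /-- `‖(A^α - (A^α)^{≤M}) e^{-N^κ}‖ ≤ q(M) e^{-M^κ}`. -/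
  leak_one : ∀ α M, 1 ≤ M →
    SandwichBound id (S.A α - ofBounded (compress (S.A α) (T.proj α M)))
      (expNegPow T.N κ 1) (q M * Real.exp (-(M : ℝ) ^ κ))
  /-- `‖e^{N^κ} (A^α - (A^α)^{≤M}) e^{-2N^κ}‖ ≤ q(M) e^{-M^κ}`. -/
  leak_two : ∀ α M, 1 ≤ M →
    SandwichBound (expNegPow T.N κ 1) (S.A α - ofBounded (compress (S.A α) (T.proj α M)))
      (expNegPow T.N κ 2) (q M * Real.exp (-(M : ℝ) ^ κ))
  /-- `‖(H - H_{≤M}) e^{-N^κ}‖ ≤ p(|𝒜|, M) e^{-M^κ}`. -/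
  leak_H : ∀ M, 1 ≤ M →
    SandwichBound id (S.H - ofBounded (compress S.H (T.P M)))
      (expNegPow T.N κ 1) (p (Fintype.card 𝒜) M * Real.exp (-(M : ℝ) ^ κ))
  /-- `‖e^{N^κ} A^α e^{-2N^κ}‖ + ‖A^α e^{-N^κ}‖ + ‖e^{-N^κ} A^α‖ ≤ C_A`. -/
  weighted : ∀ α, ∃ c₁ c₂ c₃ : ℝ, c₁ + c₂ + c₃ ≤ C_A ∧
    SandwichBound (expNegPow T.N κ 1) (S.A α) (expNegPow T.N κ 2) c₁ ∧
    SandwichBound id (S.A α) (expNegPow T.N κ 1) c₂ ∧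
    ∀ ψ : (S.A α).domain, ‖expNegPow T.N κ 1 (S.A α ψ)‖ ≤ c₃ * ‖(ψ : 𝓗)‖
  /-- `e^{-itH} e^{kN^κ} e^{itH} ≤ e^{r|t|^{2κ}} e^{kN^κ}` as quadratic forms, for `k = 2, 4`. -/
  growth : ∀ k : ℝ, k = 2 ∨ k = 4 → ∀ (t : ℝ) (ψ : 𝓗),
    expPowForm T.N κ k (S.evolve t ψ) ≤
      ENNReal.ofReal (Real.exp (r * |t| ^ (2 * κ))) * expPowForm T.N κ k ψ

end Truncated

end GibbsSampler

end

open scoped InnerProductSpace SchwartzMap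

set_option linter.unusedSectionVars false

noncomputable section

namespace GibbsSampler

/-! ### The drift kernel -/

section DriftKernel
open MeasureTheory Filter Topology Complex

lemma integrable_of_gaussian_bound {F : ℝ → ℂ} {C c : ℝ} (hc : 0 < c) (hF : Continuous F)
    (hb : ∀ x, ‖F x‖ ≤ C * Real.exp (-c * x ^ 2)) : Integrable F :=
  ((integrable_exp_neg_mul_sq hc).const_mul C).mono' hF.aestronglyMeasurable
    (Eventually.of_forall hb)

lemma tendsto_gaussian_mul (C : ℝ) {c : ℝ} (hc : 0 < c) :
    Tendsto (fun T : ℝ => C * Real.exp (-c * T ^ 2)) atTop (𝓝 0) := by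
  have h : Tendsto (fun T : ℝ => Real.exp (-(c * T ^ 2))) atTop (𝓝 0) :=
    Real.tendsto_exp_neg_atTop_nhds_zero.comp
      ((tendsto_pow_atTop two_ne_zero).const_mul_atTop hc)
  simpa using h.const_mul C

/-- Horizontal contour shift for a function with Gaussian decay in a strip. -/
lemma integral_horizontal_shift {F : ℂ → ℂ} {a C c : ℝ} (hc : 0 < c)
    (hd : DifferentiableOn ℂ F {z | z.im ∈ Set.uIcc 0 a})
    (hb : ∀ z : ℂ, z.im ∈ Set.uIcc 0 a → ‖F z‖ ≤ C * Real.exp (-c * z.re ^ 2)) :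
    ∫ x : ℝ, F (x + a * I) = ∫ x : ℝ, F x := by
  have hcont : ∀ y ∈ Set.uIcc 0 a, Continuous fun x : ℝ => F (x + y * I) := fun y hy =>
    hd.continuousOn.comp_continuous (by fun_prop) (by simpa using hy)
  have hint : ∀ y ∈ Set.uIcc 0 a, Integrable fun x : ℝ => F (x + y * I) := fun y hy =>
    integrable_of_gaussian_bound hc (hcont y hy)
      (fun x => by simpa using hb (x + y * I) (by simpa using hy))
  have h0 : (0 : ℝ) ∈ Set.uIcc 0 a := Set.left_mem_uIcc
  have ha : a ∈ Set.uIcc 0 a := Set.right_mem_uIcc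
  have l1 := intervalIntegral_tendsto_integral (hint 0 h0) tendsto_neg_atTop_atBot tendsto_id
  have l2 := intervalIntegral_tendsto_integral (hint a ha) tendsto_neg_atTop_atBot tendsto_id
  have side : ∀ s : ℝ, s ^ 2 = 1 →
      Tendsto (fun T : ℝ => ∫ y : ℝ in (0 : ℝ)..a, F ((s * T : ℝ) + y * I)) atTop (𝓝 0) := by
    intro s hs
    refine squeeze_zero_norm (a := fun T : ℝ => C * Real.exp (-c * T ^ 2) * |a - 0|) (fun T => ?_)
      (by simpa using (tendsto_gaussian_mul C hc).mul_const |a - 0|)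
    refine intervalIntegral.norm_integral_le_of_norm_le_const fun y hy => ?_
    refine (hb _ (by simpa using Set.uIoc_subset_uIcc hy)).trans (le_of_eq ?_)
    simp [mul_pow, hs]
  have rect : ∀ T : ℝ, (∫ x : ℝ in (-T)..T, F (x + (0 : ℝ) * I)) - (∫ x : ℝ in (-T)..T, F (x + a * I)) +
      I • (∫ y : ℝ in (0 : ℝ)..a, F ((1 * T : ℝ) + y * I)) -
      I • (∫ y : ℝ in (0 : ℝ)..a, F ((-1 * T : ℝ) + y * I)) = 0 := by
    intro T
    have := Complex.integral_boundary_rect_eq_zero_of_differentiableOn F (-T : ℝ) (T + a * I)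
      (hd.mono fun z hz => by simpa using hz.2)
    simpa using this
  have lim := ((l1.sub l2).add ((side 1 (by norm_num)).const_smul I)).sub
    ((side (-1) (by norm_num)).const_smul I)
  have := tendsto_nhds_unique lim (tendsto_const_nhds.congr fun T => (rect T).symm)
  simp only [smul_zero, add_zero, sub_zero] at this
  have := (sub_eq_zero.1 this).symm
  simpa using this

/-- The Fourier weight of the drift kernel. -/
def driftWeight (β σ ν : ℝ) : ℝ :=
  Real.exp (-(ν ^ 2 / (8 * σ ^ 2))) / (1 + Real.exp (β * ν / 2))

lemma driftWeight_nonneg (β σ ν : ℝ) : 0 ≤ driftWeight β σ ν := by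
  unfold driftWeight; positivity

lemma driftWeight_le (β σ ν : ℝ) : driftWeight β σ ν ≤ 1 * Real.exp (-(1 / (8 * σ ^ 2)) * ν ^ 2) := by
  unfold driftWeight
  rw [one_mul, show -(1 / (8 * σ ^ 2)) * ν ^ 2 = -(ν ^ 2 / (8 * σ ^ 2)) by ring]
  exact div_le_self (Real.exp_pos _).le (by linarith [Real.exp_pos (β * ν / 2)])

lemma continuous_driftWeight (β σ : ℝ) : Continuous (driftWeight β σ) := by
  unfold driftWeight
  exact Continuous.div (by fun_prop) (by fun_prop) fun ν => by positivity

lemma driftKernel_eq (β σ t : ℝ) : driftKernel β σ t =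
    (1 / (2 * Real.pi) : ℝ) * ∫ ν : ℝ, (driftWeight β σ ν : ℂ) * Complex.exp (-(I * ν * t)) := rfl

lemma norm_exp_neg_I_mul (x y : ℝ) : ‖Complex.exp (-(I * x * y))‖ = 1 := by
  rw [Complex.norm_exp]; simp

variable {β σ : ℝ}

lemma integrable_driftWeight (β : ℝ) (hσ : 0 < σ) :
    Integrable fun ν : ℝ => (driftWeight β σ ν : ℂ) :=
  integrable_of_gaussian_bound (C := 1) (c := 1 / (8 * σ ^ 2)) (by positivity)
    (continuous_ofReal.comp (continuous_driftWeight β σ)) fun x => by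
      rw [Complex.norm_real, Real.norm_of_nonneg (driftWeight_nonneg _ _ _)]
      exact driftWeight_le β σ x

lemma norm_driftKernel_le (hβ : 0 < β) (hσ : 0 < σ) :
    ∃ C : ℝ, 0 ≤ C ∧ ∀ t : ℝ, ‖driftKernel β σ t‖ ≤ C * Real.exp (-(Real.pi / β * |t|)) := by
  set b : ℝ := Real.pi / β with hb
  have hb0 : 0 < b := by positivity
  set c : ℝ := 1 / (8 * σ ^ 2) with hc
  have hc0 : 0 < c := by positivity
  set J : ℝ := ∫ x : ℝ, Real.exp (-c * x ^ 2) with hJ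
  have key : ∀ (a : ℝ), |a| = b → ∀ t : ℝ, ‖∫ ν : ℝ, (driftWeight β σ ν : ℂ) *
      Complex.exp (-(I * ν * t))‖ ≤ Real.exp (c * b ^ 2) * J * Real.exp (a * t) := by
    intro a ha t
    set F : ℂ → ℂ := fun z => Complex.exp (-(c * z ^ 2)) / (1 + Complex.exp (β * z / 2)) *
      Complex.exp (-(I * z * t)) with hF
    have him : ∀ z : ℂ, z.im ∈ Set.uIcc 0 a → |z.im| ≤ b := by
      intro z hz
      rw [← ha]
      simpa using Set.abs_sub_left_of_mem_uIcc hz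
    have hden : ∀ z : ℂ, z.im ∈ Set.uIcc 0 a → 1 ≤ ‖1 + Complex.exp (β * z / 2)‖ := by
      intro z hz
      refine le_trans ?_ (Complex.re_le_norm _)
      have h1 : (β * z / 2 : ℂ).im = β * z.im / 2 := by
        simp
      have h2 : |β * z.im / 2| ≤ Real.pi / 2 := by
        rw [abs_div, abs_mul, abs_of_pos hβ, abs_two]
        have := mul_le_mul_of_nonneg_left (him z hz) hβ.le
        rw [hb, mul_div_cancel₀ _ hβ.ne'] at this
        linarith
      rw [abs_le] at h2
      have := Real.cos_nonneg_of_mem_Icc (x := β * z.im / 2) ⟨by linarith, h2.2⟩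
      rw [Complex.add_re, Complex.exp_re, h1, Complex.one_re]
      nlinarith [mul_nonneg (Real.exp_pos (β * z / 2 : ℂ).re).le this]
    have hnum : ∀ z : ℂ, ‖Complex.exp (-(c * z ^ 2))‖ =
        Real.exp (c * z.im ^ 2) * Real.exp (-c * z.re ^ 2) := by
      intro z
      rw [Complex.norm_exp, ← Real.exp_add]
      congr 1
      simp [pow_two, Complex.mul_re]
      ring
    have hph : ∀ z : ℂ, ‖Complex.exp (-(I * z * t))‖ = Real.exp (z.im * t) := by
      intro z
      rw [Complex.norm_exp]
      congr 1
      simp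
    have hFb : ∀ z : ℂ, z.im ∈ Set.uIcc 0 a →
        ‖F z‖ ≤ Real.exp (c * b ^ 2) * Real.exp (z.im * t) * Real.exp (-c * z.re ^ 2) := by
      intro z hz
      rw [hF, norm_mul, norm_div, hnum, hph]
      have h3 : Real.exp (c * z.im ^ 2) ≤ Real.exp (c * b ^ 2) := by
        refine Real.exp_le_exp.2 (mul_le_mul_of_nonneg_left ?_ hc0.le)
        rw [← sq_abs z.im]
        exact pow_le_pow_left₀ (abs_nonneg _) (him z hz) 2
      calc _ ≤ (Real.exp (c * z.im ^ 2) * Real.exp (-c * z.re ^ 2)) * Real.exp (z.im * t) := by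
              gcongr
              exact div_le_self (by positivity) (hden z hz)
        _ ≤ (Real.exp (c * b ^ 2) * Real.exp (-c * z.re ^ 2)) * Real.exp (z.im * t) := by gcongr
        _ = _ := by ring
    have hsh := integral_horizontal_shift (F := F) (a := a)
      (C := Real.exp (c * b ^ 2) * Real.exp (b * |t|)) hc0 (by
        intro z hz
        refine DifferentiableAt.differentiableWithinAt ?_
        have : 1 + Complex.exp (β * z / 2) ≠ 0 := by
          intro h0
          have := hden z hz
          rw [h0, norm_zero] at this
          linarith
        simp only [hF]
        fun_prop (disch := assumption)) (by
        intro z hz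
        refine (hFb z hz).trans ?_
        have h5 : z.im * t ≤ b * |t| :=
          calc z.im * t ≤ |z.im * t| := le_abs_self _
            _ = |z.im| * |t| := abs_mul _ _
            _ ≤ b * |t| := by gcongr; exact him z hz
        have h6 := Real.exp_le_exp.2 h5
        gcongr)
    have e1 : ∫ ν : ℝ, (driftWeight β σ ν : ℂ) * Complex.exp (-(I * ν * t)) = ∫ x : ℝ, F x := by
      congr 1
      ext ν
      simp only [hF, driftWeight]
      push_cast
      congr 4
      rw [hc]
      push_cast
      ring
    rw [e1, ← hsh]
    refine (norm_integral_le_of_norm_le ((integrable_exp_neg_mul_sq hc0).const_mul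
      (Real.exp (c * b ^ 2) * Real.exp (a * t))) (Eventually.of_forall fun x => ?_)).trans
      (le_of_eq ?_)
    · have := hFb (x + a * I) (by simp)
      simpa using this
    · rw [integral_const_mul]; ring
  refine ⟨1 / (2 * Real.pi) * (Real.exp (c * b ^ 2) * J), ?_, fun t => ?_⟩
  · have : 0 ≤ J := integral_nonneg fun x => (Real.exp_pos _).le
    positivity
  · rw [driftKernel_eq, norm_mul, Complex.norm_real, Real.norm_of_nonneg (by positivity), mul_assoc]
    refine mul_le_mul_of_nonneg_left ?_ (by positivity)
    rcases le_total 0 t with ht | ht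
    · rw [abs_of_nonneg ht]
      simpa using key (-b) (by rw [abs_neg, abs_of_pos hb0]) t
    · rw [abs_of_nonpos ht]
      simpa using key b (abs_of_pos hb0) t

lemma continuous_driftKernel (β : ℝ) (hσ : 0 < σ) : Continuous (driftKernel β σ) := by
  have : Continuous fun t : ℝ => ∫ ν : ℝ, (driftWeight β σ ν : ℂ) * Complex.exp (-(I * ν * t)) := by
    refine continuous_of_dominated (fun t => ?_) (fun t => ?_) (integrable_driftWeight β hσ).norm ?_
    · exact (Continuous.mul (continuous_ofReal.comp (continuous_driftWeight β σ))
        (by fun_prop)).aestronglyMeasurable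
    · exact Eventually.of_forall fun ν => by rw [norm_mul, norm_exp_neg_I_mul, mul_one]
    · exact Eventually.of_forall fun ν => by fun_prop
  simp only [funext (driftKernel_eq β σ)]
  exact this.const_mul _

/-- A subexponential weight is absorbed by exponential decay. -/
lemma integrable_subexp_mul_exp {a r κ : ℝ} (ha : 0 < a) (hr : 0 ≤ r) (hκ₀ : 0 < κ)
    (hκ₁ : κ < 1 / 2) :
    Integrable fun s : ℝ => (1 + |s|) * Real.exp (r * |s| ^ (2 * κ)) * Real.exp (-(a * |s|)) := by
  have hO : ∃ C : ℝ, 0 ≤ C ∧ ∀ s : ℝ, (1 + |s|) * Real.exp (r * |s| ^ (2 * κ)) ≤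
      C * Real.exp (a / 2 * |s|) := by
    obtain ⟨C, hC⟩ : ∃ C : ℝ, ∀ x : ℝ, 0 ≤ x → r * x ^ (2 * κ) ≤ C + a / 4 * x := by
      have h1 : Tendsto (fun x : ℝ => x ^ (2 * κ - 1) ) atTop (𝓝 0) := by
        have := tendsto_rpow_neg_atTop (y := 1 - 2 * κ) (by linarith)
        simpa using this
      have h2 : ∀ᶠ x : ℝ in atTop, r * x ^ (2 * κ) ≤ a / 4 * x := by
        filter_upwards [(h1.const_mul r).eventually_le_const (u := a / 4) (by simpa using by linarith),
          eventually_gt_atTop 0] with x hx hx0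
        have : x ^ (2 * κ) = x ^ (2 * κ - 1) * x := by
          rw [← Real.rpow_add_one hx0.ne']; ring_nf
        rw [this, ← mul_assoc]
        exact mul_le_mul_of_nonneg_right hx hx0.le
      obtain ⟨X, hX⟩ := eventually_atTop.1 h2
      refine ⟨r * (max X 0) ^ (2 * κ), fun x hx => ?_⟩
      rcases le_total X x with h | h
      · have := hX x h
        have : 0 ≤ r * (max X 0) ^ (2 * κ) := by positivity
        linarith
      · have : x ^ (2 * κ) ≤ (max X 0) ^ (2 * κ) :=
          Real.rpow_le_rpow hx (h.trans (le_max_left _ _)) (by linarith)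
        nlinarith [mul_le_mul_of_nonneg_left this hr, mul_nonneg ha.le hx]
    refine ⟨Real.exp C * (1 + 4 / a), by positivity, fun s => ?_⟩
    have h3 : 1 + |s| ≤ (1 + 4 / a) * Real.exp (a / 4 * |s|) := by
      have h4 := Real.add_one_le_exp (a / 4 * |s|)
      have h5 : |s| = 4 / a * (a / 4 * |s|) := by field_simp
      have h6 : 1 ≤ Real.exp (a / 4 * |s|) := Real.one_le_exp (by positivity)
      have h7 : 4 / a * (a / 4 * |s|) ≤ 4 / a * Real.exp (a / 4 * |s|) :=
        mul_le_mul_of_nonneg_left (by linarith) (by positivity)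
      linarith
    calc (1 + |s|) * Real.exp (r * |s| ^ (2 * κ))
        ≤ ((1 + 4 / a) * Real.exp (a / 4 * |s|)) * Real.exp (C + a / 4 * |s|) := by
          gcongr
          exact hC _ (abs_nonneg s)
      _ = _ := by
          rw [Real.exp_add, show a / 2 * |s| = a / 4 * |s| + a / 4 * |s| by ring, Real.exp_add]
          ring
  obtain ⟨C, hC0, hC⟩ := hO
  have hint : Integrable fun s : ℝ => Real.exp (-(a / 2) * |s|) := by
    have h8 := (integrable_one_add_norm (E := ℝ) (μ := volume) (r := 2) (by simp)).const_mul
      ((1 + 4 / a) ^ 2)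
    refine h8.mono' (Continuous.aestronglyMeasurable (by fun_prop))
      (Eventually.of_forall fun s => ?_)
    have h4 := Real.add_one_le_exp (a / 4 * |s|)
    have h5 : |s| = 4 / a * (a / 4 * |s|) := by field_simp
    have h6 : 1 ≤ Real.exp (a / 4 * |s|) := Real.one_le_exp (by positivity)
    have h7 : 4 / a * (a / 4 * |s|) ≤ 4 / a * Real.exp (a / 4 * |s|) :=
      mul_le_mul_of_nonneg_left (by linarith) (by positivity)
    have h9 : 1 + |s| ≤ (1 + 4 / a) * Real.exp (a / 4 * |s|) := by linarith
    have h10 := pow_le_pow_left₀ (by positivity) h9 2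
    rw [Real.norm_of_nonneg (Real.exp_pos _).le, Real.norm_eq_abs, Real.rpow_neg (by positivity),
      Real.rpow_ofNat, ← div_eq_mul_inv, le_div_iff₀ (by positivity)]
    calc Real.exp (-(a / 2) * |s|) * (1 + |s|) ^ 2
        ≤ Real.exp (-(a / 2) * |s|) * ((1 + 4 / a) * Real.exp (a / 4 * |s|)) ^ 2 := by gcongr
      _ = (1 + 4 / a) ^ 2 * Real.exp (-(a / 2) * |s| + (a / 4 * |s| + a / 4 * |s|)) := by
          rw [Real.exp_add, Real.exp_add]; ring
      _ = (1 + 4 / a) ^ 2 := by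
          rw [show -(a / 2) * |s| + (a / 4 * |s| + a / 4 * |s|) = 0 by ring, Real.exp_zero, mul_one]
  refine (hint.const_mul C).mono' ?_ (Eventually.of_forall fun s => ?_)
  · refine Continuous.aestronglyMeasurable ?_
    have : Continuous fun s : ℝ => |s| ^ (2 * κ) :=
      continuous_abs.rpow_const fun s => Or.inr (by linarith)
    fun_prop
  · rw [Real.norm_of_nonneg (by positivity)]
    calc _ ≤ C * Real.exp (a / 2 * |s|) * Real.exp (-(a * |s|)) := by
          exact mul_le_mul_of_nonneg_right (hC s) (Real.exp_pos _).le
      _ = _ := by rw [mul_assoc, ← Real.exp_add]; ring_nf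

lemma integrable_weighted_driftKernel {r κ : ℝ} (hβ : 0 < β) (hσ : 0 < σ) (hr : 0 ≤ r)
    (hκ₀ : 0 < κ) (hκ₁ : κ < 1 / 2) :
    Integrable fun s : ℝ => (1 + |s|) * Real.exp (r * |s| ^ (2 * κ)) * ‖driftKernel β σ s‖ := by
  obtain ⟨C, hC0, hC⟩ := norm_driftKernel_le hβ hσ
  refine ((integrable_subexp_mul_exp (a := Real.pi / β) (by positivity) hr hκ₀ hκ₁).const_mul
    C).mono' ?_ (Eventually.of_forall fun s => ?_)
  · have : Continuous fun s : ℝ => |s| ^ (2 * κ) :=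
      continuous_abs.rpow_const fun s => Or.inr (by linarith)
    have := continuous_driftKernel β hσ
    exact Continuous.aestronglyMeasurable (by fun_prop)
  · rw [Real.norm_of_nonneg (by positivity)]
    calc _ ≤ (1 + |s|) * Real.exp (r * |s| ^ (2 * κ)) * (C * Real.exp (-(Real.pi / β * |s|))) := by
          gcongr; exact hC s
      _ = _ := by ring

lemma integrable_driftKernel (hβ : 0 < β) (hσ : 0 < σ) : Integrable (driftKernel β σ) := by
  refine (integrable_weighted_driftKernel (κ := 1 / 4) hβ hσ le_rfl (by norm_num)
    (by norm_num)).mono' (continuous_driftKernel β hσ).aestronglyMeasurable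
    (Eventually.of_forall fun s => ?_)
  rw [zero_mul, Real.exp_zero, mul_one]
  exact le_mul_of_one_le_left (norm_nonneg _) (by linarith [abs_nonneg s])

open scoped FourierTransform in
lemma integral_driftKernel_mul_exp (hβ : 0 < β) (hσ : 0 < σ) (ω : ℝ) :
    ∫ s : ℝ, driftKernel β σ s * Complex.exp (I * s * ω) = driftWeight β σ ω := by
  set F : ℝ → ℂ := fun ν => (driftWeight β σ ν : ℂ) with hF
  have hp : (2 * Real.pi) ≠ 0 := by positivity
  have hFk : ∀ s : ℝ, 𝓕 F s = (2 * Real.pi : ℝ) * driftKernel β σ (2 * Real.pi * s) := by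
    intro s
    rw [driftKernel_eq, ← mul_assoc, ← Complex.ofReal_mul, mul_one_div_cancel hp, Complex.ofReal_one,
      one_mul, Real.fourier_eq']
    congr 1
    ext ν
    rw [smul_eq_mul, mul_comm]
    congr 2
    simp
    ring
  have hFi : Integrable (𝓕 F) := by
    simp only [funext hFk]
    exact ((integrable_driftKernel hβ hσ).comp_mul_left' hp).const_mul _
  have inv := MeasureTheory.Integrable.fourierInv_fourier_eq (integrable_driftWeight β hσ) hFi
    (v := ω) (continuous_ofReal.comp (continuous_driftWeight β σ)).continuousAt
  rw [Real.fourierInv_eq'] at inv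
  have e : ∀ s : ℝ, Complex.exp (((2 * Real.pi * ⟪s, ω⟫_ℝ : ℝ) : ℂ) * I) • 𝓕 F s =
      (2 * Real.pi : ℝ) * (fun u : ℝ => driftKernel β σ u * Complex.exp (I * u * ω))
        (2 * Real.pi * s) := by
    intro s
    rw [hFk, smul_eq_mul]
    simp only
    rw [show ((2 * Real.pi * ⟪s, ω⟫_ℝ : ℝ) : ℂ) * I = I * (2 * Real.pi * s : ℝ) * ω by
      simp; ring]
    ring
  rw [integral_congr_ae (Eventually.of_forall e)] at inv
  rw [integral_const_mul, Measure.integral_comp_mul_left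
    (fun u : ℝ => driftKernel β σ u * Complex.exp (I * u * ω))] at inv
  rw [← inv, abs_of_pos (by positivity), Complex.real_smul, ← mul_assoc, ← Complex.ofReal_mul,
    mul_inv_cancel₀ hp, Complex.ofReal_one, one_mul]

lemma gaussian_integral_exp (hσ : 0 < σ) (ω : ℝ) :
    ∫ s : ℝ, (Real.exp (-(2 * σ ^ 2 * s ^ 2)) : ℂ) * Complex.exp (I * s * ω) =
      (Real.sqrt (Real.pi / (2 * σ ^ 2)) * Real.exp (-(ω ^ 2 / (8 * σ ^ 2))) : ℝ) := by
  have h := fourierIntegral_gaussian (b := (2 * σ ^ 2 : ℝ)) (by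
    rw [Complex.ofReal_re]; positivity) ω
  have e : ∀ s : ℝ, (Real.exp (-(2 * σ ^ 2 * s ^ 2)) : ℂ) * Complex.exp (I * s * ω) =
      Complex.exp (I * ω * s) * Complex.exp (-((2 * σ ^ 2 : ℝ) : ℂ) * s ^ 2) := by
    intro s
    rw [mul_comm, Complex.ofReal_exp]
    congr 2
    · ring
    · push_cast; ring
  simp only [e, h]
  rw [Real.sqrt_eq_rpow]
  push_cast [Complex.ofReal_cpow (show 0 ≤ Real.pi / (2 * σ ^ 2) by positivity)]
  congr 2
  field_simp
  ring

lemma driftWeight_add_neg (β σ ν : ℝ) :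
    driftWeight β σ ν + driftWeight β σ (-ν) = Real.exp (-(ν ^ 2 / (8 * σ ^ 2))) := by
  unfold driftWeight
  rw [neg_sq, show β * -ν / 2 = -(β * ν / 2) by ring, Real.exp_neg (β * ν / 2)]
  have := Real.exp_pos (β * ν / 2)
  field_simp
  ring

lemma gauss_coeff (hσ : 0 < σ) :
    σ * Real.sqrt (2 / Real.pi) * Real.sqrt (Real.pi / (2 * σ ^ 2)) = 1 := by
  rw [mul_assoc, ← Real.sqrt_mul (by positivity)]
  rw [show 2 / Real.pi * (Real.pi / (2 * σ ^ 2)) = (σ⁻¹) ^ 2 by field_simp]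
  rw [Real.sqrt_sq (by positivity)]
  field_simp

lemma driftKernel_add_star (β : ℝ) (hσ : 0 < σ) (t : ℝ) :
    driftKernel β σ t + star (driftKernel β σ t) =
      ((σ * Real.sqrt (2 / Real.pi) * Real.exp (-(2 * σ ^ 2 * t ^ 2)) : ℝ) : ℂ) := by
  have h1 : star (driftKernel β σ t) = (1 / (2 * Real.pi) : ℝ) *
      ∫ ν : ℝ, (driftWeight β σ (-ν) : ℂ) * Complex.exp (-(I * ν * t)) := by
    rw [driftKernel_eq, star_mul', show star ((1 / (2 * Real.pi) : ℝ) : ℂ) = _ from Complex.conj_ofReal _]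
    congr 1
    rw [show star (∫ ν : ℝ, (driftWeight β σ ν : ℂ) * Complex.exp (-(I * ν * t))) = _ from
      (integral_conj).symm, ← integral_neg_eq_self]
    congr 1
    ext ν
    rw [map_mul, Complex.conj_ofReal, ← Complex.exp_conj]
    congr 2
    simp
  have hi : ∀ (F : ℝ → ℂ), Integrable F → Integrable fun ν : ℝ =>
      F ν * Complex.exp (-(I * ν * t)) := by
    intro F hF
    refine hF.mul_bdd (c := 1) (Continuous.aestronglyMeasurable (by fun_prop))
      (Eventually.of_forall fun ν => (norm_exp_neg_I_mul _ _).le)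
  rw [h1, driftKernel_eq, ← mul_add, ← integral_add (hi _ (integrable_driftWeight β hσ))
    (hi _ (integrable_driftWeight β hσ).comp_neg)]
  have e : ∀ ν : ℝ, (driftWeight β σ ν : ℂ) * Complex.exp (-(I * ν * t)) +
      (driftWeight β σ (-ν) : ℂ) * Complex.exp (-(I * ν * t)) =
      Complex.exp (I * (-t : ℝ) * ν) * Complex.exp (-((1 / (8 * σ ^ 2) : ℝ) : ℂ) * ν ^ 2) := by
    intro ν
    rw [← add_mul, ← Complex.ofReal_add, driftWeight_add_neg, mul_comm, Complex.ofReal_exp]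
    congr 2
    · push_cast; ring
    · push_cast; ring
  simp only [e]
  rw [fourierIntegral_gaussian (b := (1 / (8 * σ ^ 2) : ℝ)) (by
    rw [Complex.ofReal_re]; positivity)]
  have e2 : ((Real.pi : ℂ) / ((1 / (8 * σ ^ 2) : ℝ) : ℂ)) ^ (1 / 2 : ℂ) =
      (Real.sqrt (Real.pi * (8 * σ ^ 2)) : ℝ) := by
    rw [Real.sqrt_eq_rpow, Complex.ofReal_cpow (by positivity)]
    push_cast
    congr 1
    field_simp
  have e3 : Complex.exp (-((-t : ℝ) : ℂ) ^ 2 / (4 * ((1 / (8 * σ ^ 2) : ℝ) : ℂ))) =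
      (Real.exp (-(2 * σ ^ 2 * t ^ 2)) : ℝ) := by
    rw [Complex.ofReal_exp]
    congr 1
    push_cast
    have : (σ : ℂ) ≠ 0 := by exact_mod_cast hσ.ne'
    field_simp
    ring
  rw [e2, e3, ← Complex.ofReal_mul, ← Complex.ofReal_mul, ← mul_assoc]
  have h4 : Real.sqrt (Real.pi * (8 * σ ^ 2)) = σ * Real.sqrt (2 / Real.pi) * (2 * Real.pi) := by
    rw [show Real.pi * (8 * σ ^ 2) = 2 / Real.pi * (σ * (2 * Real.pi)) ^ 2 by
      field_simp; ring, Real.sqrt_mul (by positivity), Real.sqrt_sq (by positivity)]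
    ring
  rw [h4, show 1 / (2 * Real.pi) * (σ * Real.sqrt (2 / Real.pi) * (2 * Real.pi)) =
    σ * Real.sqrt (2 / Real.pi) by field_simp]

end DriftKernel

/-! ### Nonnegative forms and their resolvents -/

section AbstractForm
open Filter Topology

variable {V X : Type*} [AddCommGroup V] [Module ℂ V]
  [NormedAddCommGroup X] [InnerProductSpace ℂ X]

/-- A nonnegative hermitian form. -/
structure IsPosForm (E : V →ₗ⋆[ℂ] V →ₗ[ℂ] ℂ) : Prop where
  herm : ∀ u v, star (E v u) = E u v
  nonneg : ∀ u, 0 ≤ (E u u).re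

namespace IsPosForm
variable {E : V →ₗ⋆[ℂ] V →ₗ[ℂ] ℂ} (hE : IsPosForm E)
include hE

lemma ofReal_re (u : V) : ((E u u).re : ℂ) = E u u :=
  Complex.conj_eq_iff_re.1 (hE.herm u u)

lemma norm_self (u : V) : ‖E u u‖ = (E u u).re := by
  rw [← hE.ofReal_re u, Complex.norm_real, Real.norm_of_nonneg (hE.nonneg u), Complex.ofReal_re]

lemma re_add (u v : V) : (E (u + v) (u + v)).re = (E u u).re + 2 * (E u v).re + (E v v).re := by
  have : (E v u).re = (E u v).re := by rw [← hE.herm u v]; simp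
  simp only [map_add, LinearMap.add_apply, Complex.add_re]
  linarith

lemma re_sub (u v : V) : (E (u - v) (u - v)).re = (E u u).re - 2 * (E u v).re + (E v v).re := by
  have : (E v u).re = (E u v).re := by rw [← hE.herm u v]; simp
  simp only [map_sub, LinearMap.sub_apply, Complex.sub_re]
  linarith

lemma re_sub_le (u v : V) : (E (u - v) (u - v)).re ≤ 2 * (E u u).re + 2 * (E v v).re := by
  have h1 := hE.nonneg (u + v)
  rw [hE.re_add] at h1
  rw [hE.re_sub]
  linarith

lemma cauchy_schwarz (u v : V) : ‖E u v‖ ≤ Real.sqrt (E u u).re * Real.sqrt (E v v).re := by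
  let c : PreInnerProductSpace.Core ℂ V :=
    { inner := fun u v => E u v
      conj_inner_symm := fun u v => hE.herm u v
      re_inner_nonneg := hE.nonneg
      add_left := fun u v w => by simp
      smul_left := fun u v r => by simp }
  let _ : SeminormedAddCommGroup V := InnerProductSpace.Core.toSeminormedAddCommGroup (c := c)
  let _ : InnerProductSpace ℂ V := InnerProductSpace.ofCore c
  exact norm_inner_le_norm (𝕜 := ℂ) u v

end IsPosForm

/-- The resolvent of a nonnegative form, obtained from the Riesz representation in the completion
of the form domain. It maps into a closed set as soon as the energy functional can be decreased
by moving into that set. -/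
theorem exists_form_resolvent [CompleteSpace X] {E : V →ₗ⋆[ℂ] V →ₗ[ℂ] ℂ} (hE : IsPosForm E)
    (J : V →ₗ[ℂ] X) {h : ℝ} (hh : 0 < h) :
    ∃ R : X →L[ℂ] X, ‖R‖ ≤ 1 ∧ IsSelfAdjoint R ∧
      (∀ x, 0 ≤ (⟪x, R x⟫_ℂ).re) ∧
      (∀ y, ∃ u : ℕ → V, Tendsto (fun n => J (u n)) atTop (𝓝 (R y)) ∧
        (∀ ε : ℝ, 0 < ε → ∃ n₀, ∀ m ≥ n₀, ∀ n ≥ n₀, ‖E (u m - u n) (u m - u n)‖ < ε) ∧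
        ∀ z, Tendsto (fun n => E z (u n)) atTop (𝓝 ⟪J z, (h : ℂ)⁻¹ • (y - R y)⟫_ℂ)) ∧
      ∀ (y : X) (C : Set X), IsClosed C →
        (∀ u, ∃ u', J u' ∈ C ∧
          h * (E u' u').re + ‖J u' - y‖ ^ 2 ≤ h * (E u u).re + ‖J u - y‖ ^ 2) → R y ∈ C := by
  let c : PreInnerProductSpace.Core ℂ V :=
    { inner := fun u v => h * E u v + ⟪J u, J v⟫_ℂ
      conj_inner_symm := fun u v => by
        rw [map_add, map_mul, Complex.conj_ofReal, inner_conj_symm,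
          show (starRingEnd ℂ) (E v u) = E u v from hE.herm u v]
      re_inner_nonneg := fun u => by
        have h1 : 0 ≤ (⟪J u, J u⟫_ℂ).re := inner_self_nonneg (𝕜 := ℂ)
        have h2 := mul_nonneg hh.le (hE.nonneg u)
        show 0 ≤ ((h : ℂ) * E u u + ⟪J u, J u⟫_ℂ).re
        rw [Complex.add_re, Complex.re_ofReal_mul]
        exact add_nonneg h2 h1
      add_left := fun u v w => by
        simp only [map_add, LinearMap.add_apply, inner_add_left]; ring
      smul_left := fun u v r => by
        simp only [map_smulₛₗ, LinearMap.smul_apply, inner_smul_left, smul_eq_mul,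
          RingHom.id_apply]; ring }
  let _ : SeminormedAddCommGroup V := InnerProductSpace.Core.toSeminormedAddCommGroup (c := c)
  let _ : InnerProductSpace ℂ V := InnerProductSpace.ofCore c
  have inner_def : ∀ u v : V, ⟪u, v⟫_ℂ = h * E u v + ⟪J u, J v⟫_ℂ := fun u v => rfl
  have norm_def : ∀ u : V, ‖u‖ ^ 2 = h * (E u u).re + ‖J u‖ ^ 2 := by
    intro u
    have h1 : ‖u‖ ^ 2 = (⟪u, u⟫_ℂ).re := norm_sq_eq_re_inner (𝕜 := ℂ) u
    have h2 : ‖J u‖ ^ 2 = (⟪J u, J u⟫_ℂ).re := norm_sq_eq_re_inner (𝕜 := ℂ) (J u)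
    rw [h1, inner_def, Complex.add_re, Complex.re_ofReal_mul, h2]
  have J_le : ∀ u : V, ‖J u‖ ≤ 1 * ‖u‖ := by
    intro u
    rw [one_mul]
    refine le_of_sq_le_sq ?_ (norm_nonneg _)
    rw [norm_def]
    linarith [mul_nonneg hh.le (hE.nonneg u)]
  let W := UniformSpace.Completion V
  let e : V →ₗ[ℂ] W := (UniformSpace.Completion.toComplL (𝕜 := ℂ) (E := V)).toLinearMap
  have he : ∀ v, e v = (v : W) := fun v => rfl
  have hed : DenseRange e := UniformSpace.Completion.denseRange_coe
  have hen : ∀ u, ‖e u‖ = ‖u‖ := fun u => UniformSpace.Completion.norm_coe u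
  have J_le' : ∀ u : V, ‖J u‖ ≤ 1 * ‖e u‖ := fun u => by rw [hen]; exact J_le u
  let Jb : W →L[ℂ] X := J.extendOfNorm e
  have hJb : ∀ u, Jb (e u) = J u := LinearMap.extendOfNorm_eq hed ⟨1, J_le'⟩
  have hJn : ‖Jb‖ ≤ 1 := Jb.opNorm_le_bound zero_le_one
    (fun x => LinearMap.norm_extendOfNorm_apply_le hed 1 J_le' x)
  have einner : ∀ u v : V, ⟪e u, e v⟫_ℂ = h * E u v + ⟪J u, J v⟫_ℂ := fun u v => by
    rw [he, he, UniformSpace.Completion.inner_coe, inner_def]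
  have hξ : ∀ y z, ⟪e z, Jb.adjoint y⟫_ℂ = ⟪J z, y⟫_ℂ := fun y z => by
    rw [ContinuousLinearMap.adjoint_inner_right, hJb]
  refine ⟨Jb ∘L Jb.adjoint, ?_, ?_, ?_, ?_, ?_⟩
  · calc _ ≤ ‖Jb‖ * ‖Jb.adjoint‖ := ContinuousLinearMap.opNorm_comp_le _ _
      _ ≤ 1 * 1 := by
          rw [LinearIsometryEquiv.norm_map]
          gcongr
      _ = 1 := one_mul 1
  · rw [ContinuousLinearMap.isSelfAdjoint_iff', ContinuousLinearMap.adjoint_comp,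
      ContinuousLinearMap.adjoint_adjoint]
  · intro x
    rw [ContinuousLinearMap.comp_apply, ← ContinuousLinearMap.adjoint_inner_left]
    exact inner_self_nonneg (𝕜 := ℂ)
  · intro y
    obtain ⟨v, hv, hlim⟩ := mem_closure_iff_seq_limit.1 (hed (Jb.adjoint y))
    choose u hu using hv
    have hlim' : Tendsto (fun n => e (u n)) atTop (𝓝 (Jb.adjoint y)) := by
      simpa only [hu] using hlim
    have hJlim : Tendsto (fun n => J (u n)) atTop (𝓝 ((Jb ∘L Jb.adjoint) y)) := by
      have := (Jb.continuous.tendsto _).comp hlim'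
      simpa only [Function.comp_def, hJb, ContinuousLinearMap.comp_apply] using this
    refine ⟨u, hJlim, fun ε hε => ?_, fun z => ?_⟩
    · have hc := hlim'.cauchySeq
      rw [Metric.cauchySeq_iff] at hc
      obtain ⟨n₀, hn⟩ := hc (Real.sqrt (h * ε)) (by positivity)
      refine ⟨n₀, fun m hm n hn' => ?_⟩
      have h1 := hn m hm n hn'
      rw [dist_eq_norm, ← map_sub, hen, Real.lt_sqrt (norm_nonneg _), norm_def] at h1
      rw [hE.norm_self]
      have h2 := sq_nonneg ‖J (u m - u n)‖
      exact lt_of_mul_lt_mul_left (by linarith) hh.le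
    · have h1 : Tendsto (fun n => (h : ℂ)⁻¹ * (⟪e z, e (u n)⟫_ℂ - ⟪J z, J (u n)⟫_ℂ)) atTop
          (𝓝 ((h : ℂ)⁻¹ * (⟪e z, Jb.adjoint y⟫_ℂ - ⟪J z, (Jb ∘L Jb.adjoint) y⟫_ℂ))) :=
        ((tendsto_const_nhds.inner hlim').sub (tendsto_const_nhds.inner hJlim)).const_mul _
      rw [hξ, ← inner_sub_right, ← inner_smul_right] at h1
      refine h1.congr fun n => ?_
      rw [einner]
      have : (h : ℂ) ≠ 0 := by exact_mod_cast hh.ne'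
      field_simp
      ring
  · intro y C hC hdec
    have hF : ∀ u, ‖e u - Jb.adjoint y‖ ^ 2 =
        h * (E u u).re + ‖J u - y‖ ^ 2 + (‖Jb.adjoint y‖ ^ 2 - ‖y‖ ^ 2) := by
      intro u
      rw [@norm_sub_sq ℂ, @norm_sub_sq ℂ, hξ, hen, norm_def]
      ring
    obtain ⟨v, hv, hlim⟩ := mem_closure_iff_seq_limit.1 (hed (Jb.adjoint y))
    choose u hu using hv
    choose u' hu'C hu' using fun n => hdec (u n)
    have hlim' : Tendsto (fun n => e (u' n)) atTop (𝓝 (Jb.adjoint y)) := by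
      rw [tendsto_iff_norm_sub_tendsto_zero] at hlim ⊢
      refine squeeze_zero (fun n => norm_nonneg _) (fun n => ?_) hlim
      refine le_of_sq_le_sq ?_ (norm_nonneg _)
      rw [← hu, hF, hF]
      linarith [hu' n]
    have := (Jb.continuous.tendsto _).comp hlim'
    simp only [Function.comp_def, hJb] at this
    exact hC.mem_of_tendsto this (Eventually.of_forall hu'C)

/-- The graph of the operator of a form `E` on a core `V` extended by one null vector; `J` embeds
the extended core. -/
def formGraph (E : V →ₗ⋆[ℂ] V →ₗ[ℂ] ℂ) (J : V × ℂ →ₗ[ℂ] X) : Set (X × X) :=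
  {w | ∃ (u : ℕ → V) (c : ℕ → ℂ),
    Tendsto (fun n => J (u n, c n)) atTop (𝓝 w.1) ∧
    (∀ ε : ℝ, 0 < ε → ∃ n₀, ∀ m ≥ n₀, ∀ n ≥ n₀, ‖E (u m - u n) (u m - u n)‖ < ε) ∧
    ∀ (z : V) (d : ℂ), Tendsto (fun n => E z (u n)) atTop (𝓝 ⟪J (z, d), w.2⟫_ℂ)}

variable {E : V →ₗ⋆[ℂ] V →ₗ[ℂ] ℂ} (hE : IsPosForm E) {J : V × ℂ →ₗ[ℂ] X}
include hE

lemma formGraph_sub {w w' : X × X} (hw : w ∈ formGraph E J) (hw' : w' ∈ formGraph E J) :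
    w - w' ∈ formGraph E J := by
  obtain ⟨u, c, h1, h2, h3⟩ := hw
  obtain ⟨u', c', h1', h2', h3'⟩ := hw'
  refine ⟨fun n => u n - u' n, fun n => c n - c' n, ?_, fun ε hε => ?_, fun z d => ?_⟩
  · refine (h1.sub h1').congr fun n => ?_
    rw [← map_sub]; rfl
  · obtain ⟨n₀, hn⟩ := h2 (ε / 4) (by positivity)
    obtain ⟨n₁, hn'⟩ := h2' (ε / 4) (by positivity)
    refine ⟨max n₀ n₁, fun m hm n hmn => ?_⟩
    have a := hn m ((le_max_left _ _).trans hm) n ((le_max_left _ _).trans hmn)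
    have b := hn' m ((le_max_right _ _).trans hm) n ((le_max_right _ _).trans hmn)
    rw [hE.norm_self] at a b ⊢
    rw [sub_sub_sub_comm]
    linarith [hE.re_sub_le (u m - u n) (u' m - u' n)]
  · rw [Prod.snd_sub, inner_sub_right]
    exact ((h3 z d).sub (h3' z d)).congr fun n => by rw [map_sub]

lemma formGraph_monotone {w : X × X} (hw : w ∈ formGraph E J) : 0 ≤ (⟪w.1, w.2⟫_ℂ).re := by
  obtain ⟨u, c, h1, h2, h3⟩ := hw
  obtain ⟨n₁, hn₁⟩ := h2 1 one_pos
  set B : ℝ := 2 * 1 + 2 * (E (u n₁) (u n₁)).re with hB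
  have hbd : ∀ n ≥ n₁, (E (u n) (u n)).re ≤ B := by
    intro n hn
    have a := hn₁ n hn n₁ le_rfl
    rw [hE.norm_self] at a
    have b := hE.re_sub_le (u n - u n₁) (-u n₁)
    rw [sub_neg_eq_add, sub_add_cancel] at b
    simp only [map_neg, LinearMap.neg_apply, neg_neg] at b
    linarith
  have hB0 : 0 ≤ B := (hE.nonneg _).trans (hbd n₁ le_rfl)
  have lim1 : Tendsto (fun m => (⟪J (u m, c m), w.2⟫_ℂ).re) atTop (𝓝 (⟪w.1, w.2⟫_ℂ).re) :=
    (Complex.continuous_re.tendsto _).comp (h1.inner tendsto_const_nhds)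
  refine le_of_forall_pos_le_add fun ε hε => ?_
  obtain ⟨n₂, hn₂⟩ := h2 ((ε / (1 + Real.sqrt B)) ^ 2) (by positivity)
  refine ge_of_tendsto (lim1.add_const ε) ?_
  filter_upwards [eventually_ge_atTop (max n₁ n₂)] with m hm
  have lim2 : Tendsto (fun n => (E (u m) (u n)).re + ε) atTop
      (𝓝 ((⟪J (u m, c m), w.2⟫_ℂ).re + ε)) :=
    ((Complex.continuous_re.tendsto _).comp (h3 (u m) (c m))).add_const ε
  refine ge_of_tendsto lim2 ?_
  filter_upwards [eventually_ge_atTop (max n₁ n₂)] with n hn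
  have a := hn₂ m ((le_max_right _ _).trans hm) n ((le_max_right _ _).trans hn)
  rw [hE.norm_self] at a
  have b := hE.cauchy_schwarz (u m - u n) (u n)
  have c1 : Real.sqrt (E (u m - u n) (u m - u n)).re ≤ ε / (1 + Real.sqrt B) :=
    Real.sqrt_le_iff.2 ⟨by positivity, a.le⟩
  have c2 : Real.sqrt (E (u n) (u n)).re ≤ Real.sqrt B :=
    Real.sqrt_le_sqrt (hbd n ((le_max_left _ _).trans hn))
  have c3 : ‖E (u m - u n) (u n)‖ ≤ ε := by
    calc _ ≤ ε / (1 + Real.sqrt B) * Real.sqrt B := b.trans (by gcongr)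
      _ = ε * (Real.sqrt B / (1 + Real.sqrt B)) := by ring
      _ ≤ ε * 1 := by
          gcongr
          rw [div_le_one (by positivity)]
          linarith
      _ = ε := mul_one ε
  have c4 := (Complex.abs_re_le_norm _).trans c3
  rw [map_sub, LinearMap.sub_apply, Complex.sub_re, abs_le] at c4
  linarith [hE.nonneg (u n), c4.1]

/-- The resolvent equation `x + h L x = y` has at most one solution. -/
lemma formGraph_resolvent_unique {h : ℝ} (hh : 0 < h) {x x' y : X}
    (hx : (x, (h : ℂ)⁻¹ • (y - x)) ∈ formGraph E J)
    (hx' : (x', (h : ℂ)⁻¹ • (y - x')) ∈ formGraph E J) : x = x' := by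
  have h1 := formGraph_monotone hE (formGraph_sub hE hx hx')
  have h2 : ((x, (h : ℂ)⁻¹ • (y - x)) - (x', (h : ℂ)⁻¹ • (y - x'))).2 =
      (h : ℂ)⁻¹ • (-(x - x')) := by
    rw [Prod.snd_sub, ← smul_sub]; congr 1; abel
  have h4 : (⟪x - x', x - x'⟫_ℂ).re = ‖x - x'‖ ^ 2 := (norm_sq_eq_re_inner (𝕜 := ℂ) _).symm
  rw [h2, Prod.fst_sub, inner_smul_right, inner_neg_right, ← Complex.ofReal_inv,
    Complex.re_ofReal_mul, Complex.neg_re, h4] at h1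
  have h3 : ‖x - x'‖ ^ 2 ≤ 0 := by
    by_contra h5
    push Not at h5
    nlinarith [mul_pos (inv_pos.2 hh) h5]
  rw [← sub_eq_zero, ← norm_eq_zero]
  exact pow_eq_zero_iff two_ne_zero |>.1 (le_antisymm h3 (sq_nonneg _))

end AbstractForm

/-! ### The semigroup as a limit of resolvent powers -/

section EulerLimit
open Filter Topology

lemma choose_two_mul_sq_le_one_add_pow {y : ℝ} (hy : 0 ≤ y) (n : ℕ) :
    n * (n - 1) / 2 * y ^ 2 ≤ (1 + y) ^ n := by
  induction n with
  | zero => simp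
  | succ n ih =>
    have h := one_add_mul_le_pow (show (-2 : ℝ) ≤ y by linarith) n
    have h2 : (1 + n * y) * y ≤ (1 + y) ^ n * y := mul_le_mul_of_nonneg_right h hy
    push_cast
    rw [pow_succ (1 + y) n]
    nlinarith

lemma abs_one_div_one_add_pow_sub_exp_le {y : ℝ} (hy : 0 ≤ y) {n : ℕ} (hn : 2 ≤ n) :
    |(1 / (1 + y)) ^ n - Real.exp (-(n * y))| ≤ 2 / (n - 1) := by
  have hn' : (2 : ℝ) ≤ n := by exact_mod_cast hn
  have hy1 : 0 < 1 + y := by linarith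
  set a : ℝ := 1 / (1 + y) with ha
  have ha0 : 0 < a := by positivity
  have hay : a * (1 + y) = 1 := by rw [ha]; field_simp
  have hexp : Real.exp (-(n * y)) = Real.exp (-y) ^ n := by
    rw [← Real.exp_nat_mul]; ring_nf
  have hba : Real.exp (-y) ≤ a := by
    rw [Real.exp_neg, ha, one_div]
    exact inv_anti₀ hy1 (by linarith [Real.add_one_le_exp y])
  have hb : 1 - y ≤ Real.exp (-y) := by linarith [Real.add_one_le_exp (-y)]
  have hle : Real.exp (-y) ^ n ≤ a ^ n := pow_le_pow_left₀ (Real.exp_pos _).le hba n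
  rw [hexp, abs_of_nonneg (by linarith)]
  set x : ℝ := Real.exp (-y) * (1 + y) - 1 with hx
  have hx1 : -y ^ 2 ≤ x := by rw [hx]; nlinarith
  have hx2 : -1 ≤ x := by
    rw [hx]; linarith [mul_nonneg (Real.exp_pos (-y)).le hy1.le]
  have hbx : Real.exp (-y) = a * (1 + x) := by
    rw [hx, add_sub_cancel, mul_comm, mul_assoc, mul_comm (1 + y), hay, mul_one]
  have hbern := one_add_mul_le_pow (show (-2 : ℝ) ≤ x by linarith) n
  have han : 0 < a ^ n := by positivity
  have key : a ^ n - Real.exp (-y) ^ n ≤ n * y ^ 2 * a ^ n := by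
    rw [hbx, mul_pow]
    have h1 : 1 - (1 + x) ^ n ≤ n * y ^ 2 := by nlinarith
    calc a ^ n - a ^ n * (1 + x) ^ n = a ^ n * (1 - (1 + x) ^ n) := by ring
      _ ≤ a ^ n * (n * y ^ 2) := by gcongr
      _ = _ := by ring
  have h3 := choose_two_mul_sq_le_one_add_pow hy n
  have h4 : a ^ n * (1 + y) ^ n = 1 := by rw [← mul_pow, hay, one_pow]
  have h5 : a ^ n * (n * (n - 1) / 2 * y ^ 2) ≤ 1 := by
    exact (mul_le_mul_of_nonneg_left h3 han.le).trans h4.le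
  refine key.trans ?_
  rw [le_div_iff₀ (by linarith)]
  nlinarith

variable {X : Type*} [NormedAddCommGroup X] [InnerProductSpace ℂ X] [CompleteSpace X]

lemma spectrum_subset_Icc {R : X →L[ℂ] X} (hn : ‖R‖ ≤ 1) (hsa : IsSelfAdjoint R)
    (hpos : ∀ x, 0 ≤ (⟪x, R x⟫_ℂ).re) : spectrum ℝ R ⊆ Set.Icc 0 1 := by
  have hp : R.IsPositive := by
    rw [ContinuousLinearMap.isPositive_def']
    refine ⟨hsa, fun x => ?_⟩
    rw [ContinuousLinearMap.reApplyInnerSelf_apply, inner_re_symm]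
    exact hpos x
  have h0 : 0 ≤ R := (ContinuousLinearMap.nonneg_iff_isPositive R).2 hp
  intro r hr
  refine ⟨spectrum_nonneg_of_nonneg h0 hr, ?_⟩
  have h1 := spectrum.norm_le_norm_mul_of_mem hr
  have h2 : ‖(1 : X →L[ℂ] X)‖ ≤ 1 := ContinuousLinearMap.norm_id_le
  calc r ≤ ‖r‖ := le_abs_self r
    _ ≤ ‖R‖ * ‖(1 : X →L[ℂ] X)‖ := h1
    _ ≤ 1 * 1 := by gcongr
    _ = 1 := one_mul 1

/-- The function `r ↦ (1 + h (1 / r - 1))⁻¹` relating the resolvents at `1` and at `h`. -/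
def resolventFun (h r : ℝ) : ℝ := r / (r + h * (1 - r))

lemma resolventFun_den_pos {h r : ℝ} (hh : 0 < h) (hr : r ∈ Set.Icc (0 : ℝ) 1) :
    0 < r + h * (1 - r) := by
  rcases hr.1.eq_or_lt with h0 | h0
  · rw [← h0]; simpa using hh
  · linarith [mul_nonneg hh.le (sub_nonneg.2 hr.2)]

lemma continuousOn_resolventFun {h : ℝ} (hh : 0 < h) :
    ContinuousOn (resolventFun h) (Set.Icc 0 1) := by
  unfold resolventFun
  exact ContinuousOn.div (by fun_prop) (by fun_prop) fun r hr => (resolventFun_den_pos hh hr).ne'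

lemma abs_resolventFun_pow_sub_le {t r : ℝ} (ht : 0 < t) (hr : r ∈ Set.Icc (0 : ℝ) 1) {n : ℕ}
    (hn : 2 ≤ n) :
    |resolventFun (t / n) r ^ n - (if 0 < r then Real.exp (-(t * (1 / r - 1))) else 0)| ≤
      2 / (n - 1) := by
  have hn' : (2 : ℝ) ≤ n := by exact_mod_cast hn
  rcases hr.1.eq_or_lt with h0 | h0
  · rw [← h0]
    have h1 : (0 : ℝ) ≤ 2 / (n - 1) := div_nonneg zero_le_two (by linarith)
    simpa [resolventFun, (by lia : n ≠ 0)] using h1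
  · have hy : 0 ≤ t / n * (1 / r - 1) := by
      have : 1 ≤ 1 / r := by rw [le_div_iff₀ h0]; linarith [hr.2]
      have := sub_nonneg.2 this
      positivity
    have h1 := abs_one_div_one_add_pow_sub_exp_le hy hn
    rw [if_pos h0]
    convert h1 using 5
    · rw [resolventFun]
      have := (resolventFun_den_pos (h := t / n) (by positivity) hr).ne'
      have h2 : 1 + t / n * (1 / r - 1) = (r + t / n * (1 - r)) / r := by
        field_simp
      rw [h2, one_div_div]
    · field_simp

/-- The semigroup of `K` is the limit of the powers of its resolvents, when these exist and the
resolvent equations have unique solutions. -/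
theorem tendsto_resolvent_pow {K : Set (X × X)} {R : ℝ → X →L[ℂ] X}
    (hn : ∀ h, 0 < h → ‖R h‖ ≤ 1) (hsa : ∀ h, 0 < h → IsSelfAdjoint (R h))
    (hpos : ∀ h, 0 < h → ∀ x, 0 ≤ (⟪x, R h x⟫_ℂ).re)
    (hR : ∀ h, 0 < h → ∀ y, (R h y, (h : ℂ)⁻¹ • (y - R h y)) ∈ K)
    (huniq : ∀ h : ℝ, 0 < h → ∀ x x' y : X, (x, (h : ℂ)⁻¹ • (y - x)) ∈ K →
      (x', (h : ℂ)⁻¹ • (y - x')) ∈ K → x = x') {t : ℝ} (ht : 0 < t) :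
    Tendsto (fun n : ℕ => R (t / n) ^ n) atTop (𝓝 (expNegSemigroup K t)) := by
  have h1K : ∀ y, (R 1 y, y - R 1 y) ∈ K := fun y => by simpa using hR 1 one_pos y
  have hres : resolventOne K = R 1 := by
    have hex : ∃ R : X →L[ℂ] X, ∀ y, (R y, y - R y) ∈ K := ⟨R 1, h1K⟩
    rw [resolventOne, dif_pos hex]
    ext y
    refine huniq 1 one_pos _ _ y ?_ ?_
    · simpa using hex.choose_spec y
    · simpa using h1K y
  have hspec : spectrum ℝ (R 1) ⊆ Set.Icc 0 1 :=
    spectrum_subset_Icc (hn 1 one_pos) (hsa 1 one_pos) (hpos 1 one_pos)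
  have hsa1 : IsSelfAdjoint (R 1) := hsa 1 one_pos
  have hRh : ∀ h, 0 < h → R h = cfc (resolventFun h) (R 1) := by
    intro h hh
    have hden : ∀ r ∈ spectrum ℝ (R 1), r + h * (1 - r) ≠ 0 := fun r hr =>
      (resolventFun_den_pos hh (hspec hr)).ne'
    have e1 : R h * cfc (fun r : ℝ => r + h * (1 - r)) (R 1) = R 1 := by
      have e2 : cfc (fun r : ℝ => r + h * (1 - r)) (R 1) = R 1 + h • (1 - R 1) := by
        rw [cfc_add (R 1) (fun r : ℝ => r) (fun r => h * (1 - r)), cfc_id' ℝ (R 1),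
          cfc_const_mul h (fun r : ℝ => 1 - r) (R 1),
          cfc_sub (fun _ : ℝ => 1) (fun r => r) (R 1), cfc_id' ℝ (R 1), cfc_const_one ℝ (R 1)]
      rw [e2]
      ext y
      refine huniq h hh _ _ _ (hR h hh _) ?_
      have e3 : (h : ℂ)⁻¹ • ((R 1 + h • (1 - R 1)) y - R 1 y) = y - R 1 y := by
        have : (h : ℂ) ≠ 0 := by exact_mod_cast hh.ne'
        simp only [add_apply, smul_apply, sub_apply, one_apply_eq_self, add_sub_cancel_left]
        rw [← Complex.coe_smul, smul_smul, inv_mul_cancel₀ this, one_smul]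
      exact e3.symm ▸ h1K y
    have e4 : cfc (fun r : ℝ => r + h * (1 - r)) (R 1) * cfc (fun r : ℝ => (r + h * (1 - r))⁻¹) (R 1)
        = 1 := by
      rw [← cfc_mul (fun r : ℝ => r + h * (1 - r)) (fun r : ℝ => (r + h * (1 - r))⁻¹) (R 1)
        (by fun_prop) (ContinuousOn.inv₀ (by fun_prop) hden)]
      rw [← cfc_const_one ℝ (R 1)]
      exact cfc_congr fun r hr => mul_inv_cancel₀ (hden r hr)
    calc R h = R h * (cfc (fun r : ℝ => r + h * (1 - r)) (R 1) *
          cfc (fun r : ℝ => (r + h * (1 - r))⁻¹) (R 1)) := by rw [e4, mul_one]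
      _ = cfc (fun r : ℝ => r) (R 1) * cfc (fun r : ℝ => (r + h * (1 - r))⁻¹) (R 1) := by
          rw [← mul_assoc, e1, cfc_id' ℝ (R 1)]
      _ = cfc (resolventFun h) (R 1) := by
          rw [← cfc_mul (fun r : ℝ => r) (fun r : ℝ => (r + h * (1 - r))⁻¹) (R 1)
            (by fun_prop) (ContinuousOn.inv₀ (by fun_prop) hden)]
          rfl
  set g : ℝ → ℝ := fun r => if 0 < r then Real.exp (-(t * (1 / r - 1))) else 0 with hg
  have hpow_cont : ∀ n : ℕ, 2 ≤ n →
      ContinuousOn (fun r => resolventFun (t / n) r ^ n) (Set.Icc 0 1) := by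
    intro n hn2
    have : 0 < (n : ℝ) := by exact_mod_cast (by lia : 0 < n)
    exact (continuousOn_resolventFun (by positivity)).pow n
  have hlim0 : Tendsto (fun n : ℕ => 2 / ((n : ℝ) - 1)) atTop (𝓝 0) :=
    tendsto_const_nhds.div_atTop
      (tendsto_atTop_add_const_right _ _ tendsto_natCast_atTop_atTop)
  have hunif : TendstoUniformlyOn (fun (n : ℕ) r => resolventFun (t / n) r ^ n) g atTop
      (Set.Icc 0 1) := by
    rw [Metric.tendstoUniformlyOn_iff]
    intro ε hε
    filter_upwards [hlim0.eventually_lt_const hε, eventually_ge_atTop 2] with n hn1 hn2 r hr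
    rw [dist_comm, Real.dist_eq]
    exact (abs_resolventFun_pow_sub_le ht hr hn2).trans_lt hn1
  have hgc : ContinuousOn g (Set.Icc 0 1) :=
    hunif.continuousOn (Eventually.frequently
      ((eventually_ge_atTop 2).mono fun n hn2 => hpow_cont n hn2))
  rw [expNegSemigroup, if_neg ht.ne', funcCalc, hres, tendsto_iff_norm_sub_tendsto_zero]
  refine squeeze_zero' (Eventually.of_forall fun n => norm_nonneg _) ?_ hlim0
  filter_upwards [eventually_ge_atTop 2] with n hn2
  have hn0 : 0 < (n : ℝ) := by exact_mod_cast (by lia : 0 < n)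
  rw [hRh (t / n) (by positivity), ← cfc_pow (resolventFun (t / n)) n (R 1)
    ((continuousOn_resolventFun (by positivity)).mono hspec),
    ← cfc_sub _ _ (R 1) ((hpow_cont n hn2).mono hspec) (hgc.mono hspec)]
  have hn1 : (0 : ℝ) ≤ 2 / (n - 1) :=
    div_nonneg zero_le_two (by have : (2 : ℝ) ≤ n := by exact_mod_cast hn2
                               linarith)
  exact norm_cfc_le hn1 fun r hr => abs_resolventFun_pow_sub_le ht (hspec hr) hn2

end EulerLimit

/-! ### Unitary flows, twirls and weighted bounds -/

section Twirl
open Filter Topology MeasureTheory ContinuousLinearMap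

variable {𝓗 : Type*} [NormedAddCommGroup 𝓗] [InnerProductSpace ℂ 𝓗]

/-- A strongly continuous family of unitaries with `U(s)† = U(-s)`. -/
structure UnitaryFlow (𝓗 : Type*) [NormedAddCommGroup 𝓗] [InnerProductSpace ℂ 𝓗] where
  toFun : ℝ → 𝓗 →L[ℂ] 𝓗
  cont : ∀ ψ, Continuous fun s => toFun s ψ
  norm_map : ∀ s ψ, ‖toFun s ψ‖ = ‖ψ‖
  adj : ∀ s φ ψ, ⟪toFun s φ, ψ⟫_ℂ = ⟪φ, toFun (-s) ψ⟫_ℂ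

instance : CoeFun (UnitaryFlow 𝓗) fun _ => ℝ → 𝓗 →L[ℂ] 𝓗 := ⟨UnitaryFlow.toFun⟩

namespace UnitaryFlow
variable (U : UnitaryFlow 𝓗)

lemma continuous_apply {ψ : ℝ → 𝓗} (hψ : Continuous ψ) : Continuous fun s => U s (ψ s) := by
  rw [continuous_iff_continuousAt]
  intro s₀
  have h1 : Tendsto (fun s => ‖ψ s - ψ s₀‖ + ‖U s (ψ s₀) - U s₀ (ψ s₀)‖) (𝓝 s₀) (𝓝 0) := by
    have a := tendsto_iff_norm_sub_tendsto_zero.1 (hψ.tendsto s₀)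
    have b := tendsto_iff_norm_sub_tendsto_zero.1 ((U.cont (ψ s₀)).tendsto s₀)
    simpa using a.add b
  refine tendsto_iff_norm_sub_tendsto_zero.2 (squeeze_zero (fun s => norm_nonneg _) (fun s => ?_) h1)
  calc ‖U s (ψ s) - U s₀ (ψ s₀)‖ = ‖U s (ψ s - ψ s₀) + (U s (ψ s₀) - U s₀ (ψ s₀))‖ := by
        rw [map_sub]; congr 1; abel
    _ ≤ _ := (norm_add_le _ _).trans (by rw [U.norm_map])

/-- The evolved operator `U(s) B U(-s)`. -/
def conj (B : 𝓗 →L[ℂ] 𝓗) (s : ℝ) : 𝓗 →L[ℂ] 𝓗 := U s ∘L B ∘L U (-s)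

lemma conj_apply (B : 𝓗 →L[ℂ] 𝓗) (s : ℝ) (φ : 𝓗) : U.conj B s φ = U s (B (U (-s) φ)) := rfl

lemma continuous_conj (B : 𝓗 →L[ℂ] 𝓗) (φ : 𝓗) : Continuous fun s => U.conj B s φ :=
  U.continuous_apply (B.continuous.comp ((U.cont φ).comp continuous_neg))

lemma norm_conj_apply_le (B : 𝓗 →L[ℂ] 𝓗) (s : ℝ) (φ : 𝓗) : ‖U.conj B s φ‖ ≤ ‖B‖ * ‖φ‖ := by
  rw [conj_apply, U.norm_map]
  exact (B.le_opNorm _).trans (by rw [U.norm_map])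

lemma norm_conj_le (B : 𝓗 →L[ℂ] 𝓗) (s : ℝ) : ‖U.conj B s‖ ≤ ‖B‖ :=
  opNorm_le_bound _ (norm_nonneg _) (U.norm_conj_apply_le B s)

lemma inner_conj [CompleteSpace 𝓗] (B : 𝓗 →L[ℂ] 𝓗) (s : ℝ) (φ ψ : 𝓗) :
    ⟪U.conj B s φ, ψ⟫_ℂ = ⟪φ, U.conj (adjoint B) s ψ⟫_ℂ := by
  rw [conj_apply, U.adj, ← adjoint_inner_right, U.adj, neg_neg, conj_apply]

end UnitaryFlow

variable (U : UnitaryFlow 𝓗)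

lemma integrable_conj {k : ℝ → ℂ} (hk : Integrable k) (B : 𝓗 →L[ℂ] 𝓗) (φ : 𝓗) :
    Integrable fun s => k s • U.conj B s φ :=
  hk.smul_bdd (‖B‖ * ‖φ‖) (U.continuous_conj B φ).aestronglyMeasurable
    (Eventually.of_forall fun s => U.norm_conj_apply_le B s φ)

/-- The weighted time average `∫ k(s) U(s) B U(-s) ds`, in the strong sense. -/
def twirl (k : ℝ → ℂ) (hk : Integrable k) (B : 𝓗 →L[ℂ] 𝓗) : 𝓗 →L[ℂ] 𝓗 :=
  LinearMap.mkContinuous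
    { toFun := fun φ => ∫ s, k s • U.conj B s φ
      map_add' := fun φ ψ => by
        rw [← integral_add (integrable_conj U hk B φ) (integrable_conj U hk B ψ)]
        simp only [map_add, smul_add]
      map_smul' := fun c φ => by
        rw [RingHom.id_apply, ← integral_smul]
        simp only [map_smul, smul_comm c] }
    ((∫ s, ‖k s‖) * ‖B‖) fun φ => by
      rw [mul_assoc, ← integral_mul_const]
      refine norm_integral_le_of_norm_le (hk.norm.mul_const _) (Eventually.of_forall fun s => ?_)
      rw [norm_smul]
      exact mul_le_mul_of_nonneg_left (U.norm_conj_apply_le B s φ) (norm_nonneg _)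

variable {k : ℝ → ℂ} (hk : Integrable k)

lemma twirl_apply (B : 𝓗 →L[ℂ] 𝓗) (φ : 𝓗) : twirl U k hk B φ = ∫ s, k s • U.conj B s φ := rfl

lemma norm_twirl_le (B : 𝓗 →L[ℂ] 𝓗) : ‖twirl U k hk B‖ ≤ (∫ s, ‖k s‖) * ‖B‖ :=
  LinearMap.mkContinuous_norm_le _ (mul_nonneg (integral_nonneg fun _ => norm_nonneg _)
    (norm_nonneg _)) _

lemma twirl_sub (B B' : 𝓗 →L[ℂ] 𝓗) :
    twirl U k hk (B - B') = twirl U k hk B - twirl U k hk B' := by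
  ext φ
  rw [sub_apply, twirl_apply, twirl_apply, twirl_apply,
    ← integral_sub (integrable_conj U hk B φ) (integrable_conj U hk B' φ)]
  simp only [UnitaryFlow.conj_apply, sub_apply, map_sub, smul_sub]

lemma integrable_star {k : ℝ → ℂ} (hk : Integrable k) : Integrable fun s => star (k s) :=
  hk.mono (continuous_star.comp_aestronglyMeasurable hk.1)
    (Eventually.of_forall fun s => (norm_star _).le)

variable [CompleteSpace 𝓗]

lemma inner_twirl (B : 𝓗 →L[ℂ] 𝓗) (χ φ : 𝓗) :
    ⟪χ, twirl U k hk B φ⟫_ℂ = ∫ s, k s * ⟪χ, U.conj B s φ⟫_ℂ := by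
  rw [twirl_apply, ← integral_inner (integrable_conj U hk B φ) χ]
  simp only [inner_smul_right]

lemma adjoint_twirl (B : 𝓗 →L[ℂ] 𝓗) :
    adjoint (twirl U k hk B) =
      twirl U (fun s => star (k s)) (integrable_star hk) (adjoint B) := by
  symm
  rw [eq_adjoint_iff]
  intro φ ψ
  rw [inner_twirl, ← inner_conj_symm, inner_twirl, ← integral_conj]
  congr 1
  ext s
  rw [map_mul, inner_conj_symm, U.inner_conj, adjoint_adjoint]
  simp

/-! #### Vectors in the range of a weight -/

/-- The vector `φ` is `D η` with `‖η‖ ≤ c`. -/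
def Reg (D : 𝓗 →L[ℂ] 𝓗) (φ : 𝓗) (c : ℝ) : Prop := ∃ η, D η = φ ∧ ‖η‖ ≤ c

/-- A self-adjoint contraction with dense range. -/
structure IsWeight (D : 𝓗 →L[ℂ] 𝓗) : Prop where
  selfAdjoint : IsSelfAdjoint D
  dense : DenseRange D
  norm_le : ‖D‖ ≤ 1

variable {D D' D'' : 𝓗 →L[ℂ] 𝓗}

lemma Reg.mono {φ : 𝓗} {c c' : ℝ} (h : Reg D φ c) (hc : c ≤ c') : Reg D φ c' :=
  let ⟨η, h1, h2⟩ := h; ⟨η, h1, h2.trans hc⟩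

lemma Reg.nonneg {φ : 𝓗} {c : ℝ} (h : Reg D φ c) : 0 ≤ c :=
  let ⟨_, _, h2⟩ := h; (norm_nonneg _).trans h2

lemma reg_one {φ : 𝓗} {c : ℝ} : Reg (1 : 𝓗 →L[ℂ] 𝓗) φ c ↔ ‖φ‖ ≤ c :=
  ⟨fun ⟨η, h1, h2⟩ => by rw [← h1]; exact h2, fun h => ⟨φ, rfl, h⟩⟩

lemma Reg.add {φ ψ : 𝓗} {c c' : ℝ} (h : Reg D φ c) (h' : Reg D ψ c') : Reg D (φ + ψ) (c + c') := by
  obtain ⟨η, rfl, h2⟩ := h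
  obtain ⟨η', rfl, h2'⟩ := h'
  exact ⟨η + η', map_add _ _ _, (norm_add_le _ _).trans (add_le_add h2 h2')⟩

lemma isWeight_one : IsWeight (1 : 𝓗 →L[ℂ] 𝓗) :=
  ⟨.one _, Function.Surjective.denseRange fun x => ⟨x, rfl⟩, norm_id_le⟩

lemma IsWeight.norm_apply_le (hD : IsWeight D) (φ : 𝓗) : ‖D φ‖ ≤ ‖φ‖ := by
  simpa using D.le_of_opNorm_le hD.norm_le φ

lemma IsWeight.inner (hD : IsWeight D) (φ ψ : 𝓗) : ⟪D φ, ψ⟫_ℂ = ⟪φ, D ψ⟫_ℂ := by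
  rw [← adjoint_inner_right, hD.selfAdjoint.adjoint_eq]

lemma IsWeight.injective (hD : IsWeight D) : Function.Injective D := by
  rw [injective_iff_map_eq_zero]
  intro φ hφ
  refine hD.dense.eq_zero_of_inner_left ℂ fun ψ => ?_
  rw [← hD.inner, hφ, inner_zero_left]

lemma IsWeight.reg_iff (hD : IsWeight D) {φ : 𝓗} {c : ℝ} (hc : 0 ≤ c) :
    Reg D φ c ↔ ∀ χ, ‖⟪φ, χ⟫_ℂ‖ ≤ c * ‖D χ‖ := by
  constructor
  · rintro ⟨η, rfl, hη⟩ χ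
    rw [hD.inner]
    exact (norm_inner_le_norm _ _).trans (by gcongr)
  · intro h
    set F : 𝓗 →L[ℂ] ℂ := ((innerSL ℂ φ : 𝓗 →L[ℂ] ℂ) : 𝓗 →ₗ[ℂ] ℂ).extendOfNorm (D : 𝓗 →ₗ[ℂ] 𝓗)
      with hF
    have hFD : ∀ χ, F (D χ) = ⟪φ, χ⟫_ℂ := fun χ =>
      LinearMap.extendOfNorm_eq (e := (D : 𝓗 →ₗ[ℂ] 𝓗)) hD.dense ⟨c, h⟩ χ
    refine ⟨(InnerProductSpace.toDual ℂ 𝓗).symm F, ?_, ?_⟩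
    · refine ext_inner_right ℂ fun χ => ?_
      rw [hD.inner, InnerProductSpace.toDual_symm_apply, hFD]
    · rw [LinearIsometryEquiv.norm_map]
      exact F.opNorm_le_bound hc fun x => LinearMap.norm_extendOfNorm_apply_le
        (e := (D : 𝓗 →ₗ[ℂ] 𝓗)) hD.dense c h x

/-- The operator `Y` is bounded by `a` from the range norm of `D` to that of `D'`. -/
def Bdd (D D' Y : 𝓗 →L[ℂ] 𝓗) (a : ℝ) : Prop :=
  ∀ φ c, Reg D φ c → Reg D' (Y φ) (a * c)

lemma Bdd.mono {Y : 𝓗 →L[ℂ] 𝓗} {a a' : ℝ} (h : Bdd D D' Y a) (ha : a ≤ a') : Bdd D D' Y a' :=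
  fun φ c hφ => (h φ c hφ).mono (mul_le_mul_of_nonneg_right ha hφ.nonneg)

lemma Bdd.comp {Y Y' : 𝓗 →L[ℂ] 𝓗} {a a' : ℝ} (h : Bdd D' D'' Y' a') (h' : Bdd D D' Y a) :
    Bdd D D'' (Y' ∘L Y) (a' * a) := fun φ c hφ => by
  rw [mul_assoc]; exact h _ _ (h' _ _ hφ)

lemma Bdd.add {Y Y' : 𝓗 →L[ℂ] 𝓗} {a a' : ℝ} (h : Bdd D D' Y a) (h' : Bdd D D' Y' a') :
    Bdd D D' (Y + Y') (a + a') := fun φ c hφ => by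
  rw [add_mul]; exact (h _ _ hφ).add (h' _ _ hφ)

lemma bdd_zero : Bdd D D' 0 0 := fun _ _ _ => ⟨0, by simp, by simp⟩

lemma Bdd.neg {Y : 𝓗 →L[ℂ] 𝓗} {a : ℝ} (h : Bdd D D' Y a) : Bdd D D' (-Y) a := fun φ c hφ => by
  obtain ⟨η, h1, h2⟩ := h _ _ hφ
  exact ⟨-η, by rw [map_neg, h1]; rfl, by rwa [norm_neg]⟩

lemma bdd_sum {β : Type*} (s : Finset β) {Y : β → 𝓗 →L[ℂ] 𝓗} {a : β → ℝ}
    (h : ∀ i ∈ s, Bdd D D' (Y i) (a i)) : Bdd D D' (∑ i ∈ s, Y i) (∑ i ∈ s, a i) := by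
  classical
  induction s using Finset.induction_on with
  | empty => simpa using bdd_zero
  | insert i s hi ih =>
    rw [Finset.sum_insert hi, Finset.sum_insert hi]
    exact (h i (Finset.mem_insert_self _ _)).add
      (ih fun j hj => h j (Finset.mem_insert_of_mem hj))

lemma bdd_of_forall {Y : 𝓗 →L[ℂ] 𝓗} {a : ℝ} (ha : 0 ≤ a)
    (h : ∀ η, ∃ η', D' η' = Y (D η) ∧ ‖η'‖ ≤ a * ‖η‖) : Bdd D D' Y a := by
  rintro φ c ⟨η, rfl, hη⟩
  obtain ⟨η', h1, h2⟩ := h η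
  exact ⟨η', h1, h2.trans (by gcongr)⟩

lemma Bdd.norm_le {Y : 𝓗 →L[ℂ] 𝓗} {a c : ℝ} (h : Bdd D 1 Y a) {φ : 𝓗} (hφ : Reg D φ c) :
    ‖Y φ‖ ≤ a * c := reg_one.1 (h _ _ hφ)

lemma bdd_one_one {Y : 𝓗 →L[ℂ] 𝓗} {a : ℝ} (h : ‖Y‖ ≤ a) : Bdd 1 1 Y a := fun φ c hφ => by
  rw [reg_one] at hφ ⊢
  exact (Y.le_opNorm φ).trans (by gcongr; exact (norm_nonneg _).trans h)

/-- A twirl preserves weighted bounds. -/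
lemma bdd_twirl (hD' : IsWeight D') {B : 𝓗 →L[ℂ] 𝓗} {w : ℝ → ℝ} (hw : ∀ s, 0 ≤ w s)
    (hkw : Integrable fun s => ‖k s‖ * w s) (h : ∀ s, Bdd D D' (U.conj B s) (w s)) :
    Bdd D D' (twirl U k hk B) (∫ s, ‖k s‖ * w s) := by
  intro φ c hφ
  have hc := hφ.nonneg
  have hI : 0 ≤ ∫ s, ‖k s‖ * w s := integral_nonneg fun s => mul_nonneg (norm_nonneg _) (hw s)
  rw [hD'.reg_iff (mul_nonneg hI hc)]
  intro χ
  rw [norm_inner_symm, inner_twirl, mul_assoc, ← integral_mul_const]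
  refine norm_integral_le_of_norm_le (hkw.mul_const _) (Eventually.of_forall fun s => ?_)
  have h1 := (hD'.reg_iff (mul_nonneg (hw s) hc)).1 (h s φ c hφ) χ
  rw [norm_mul, norm_inner_symm]
  calc ‖k s‖ * ‖⟪U.conj B s φ, χ⟫_ℂ‖ ≤ ‖k s‖ * (w s * c * ‖D' χ‖) := by gcongr
    _ = _ := by ring

end Twirl

/-! ### Comparison of generators on pure states -/

section PureGenerator
open Filter Topology MeasureTheory ContinuousLinearMap

variable {𝒜 𝓗 : Type*} [Fintype 𝒜] [NormedAddCommGroup 𝓗] [InnerProductSpace ℂ 𝓗]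
  [CompleteSpace 𝓗]

/-- The drift `-∑ α, ∫ g(s) U(s) L† L U(-s) ds` for a kernel `g`. -/
def driftOp (U : UnitaryFlow 𝓗) (g : ℝ → ℂ) (hg : Integrable g) (L : 𝒜 → 𝓗 →L[ℂ] 𝓗) :
    𝓗 →L[ℂ] 𝓗 :=
  -∑ α, twirl U g hg (adjoint (L α) ∘L L α)

/-- The Gaussian weight of the transition part. -/
def gaussWeight (σ s : ℝ) : ℝ := Real.exp (-(2 * σ ^ 2 * s ^ 2))

/-- The prefactor of the transition part. -/
def gaussCoeff (σ : ℝ) : ℝ := σ * Real.sqrt (2 / Real.pi)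

lemma gaussWeight_nonneg (σ s : ℝ) : 0 ≤ gaussWeight σ s := (Real.exp_pos _).le

lemma continuous_gaussWeight (σ : ℝ) : Continuous (gaussWeight σ) := by
  unfold gaussWeight; fun_prop

lemma integrable_gaussWeight {σ : ℝ} (hσ : 0 < σ) : Integrable (gaussWeight σ) := by
  have := integrable_exp_neg_mul_sq (b := 2 * σ ^ 2) (by positivity)
  refine this.congr (Eventually.of_forall fun s => ?_)
  simp [gaussWeight]

/-- The expectation of the generated observable in the pure state `φ`: it equals
`Tr (Z 𝓛(|φ⟩⟨φ|))` for the generator `𝓛` with drift `G` and jumps `L`. -/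
def pureGen (σ : ℝ) (U : UnitaryFlow 𝓗) (G : 𝓗 →L[ℂ] 𝓗) (L : 𝒜 → 𝓗 →L[ℂ] 𝓗)
    (Z : 𝓗 →L[ℂ] 𝓗) (φ : 𝓗) : ℂ :=
  ⟪φ, Z (G φ)⟫_ℂ + ⟪G φ, Z φ⟫_ℂ + (gaussCoeff σ : ℂ) *
    ∑ α, ∫ s, (gaussWeight σ s : ℂ) * ⟪U.conj (L α) s φ, Z (U.conj (L α) s φ)⟫_ℂ

lemma norm_inner_map_le (Z : 𝓗 →L[ℂ] 𝓗) (x y : 𝓗) : ‖⟪x, Z y⟫_ℂ‖ ≤ ‖Z‖ * (‖x‖ * ‖y‖) := by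
  calc _ ≤ ‖x‖ * ‖Z y‖ := norm_inner_le_norm _ _
    _ ≤ ‖x‖ * (‖Z‖ * ‖y‖) := by gcongr; exact Z.le_opNorm y
    _ = _ := by ring

lemma norm_inner_map_sub_le (Z : 𝓗 →L[ℂ] 𝓗) (x y : 𝓗) :
    ‖⟪x, Z x⟫_ℂ - ⟪y, Z y⟫_ℂ‖ ≤ ‖Z‖ * (‖x - y‖ * (‖x‖ + ‖y‖)) := by
  have : ⟪x, Z x⟫_ℂ - ⟪y, Z y⟫_ℂ = ⟪x - y, Z x⟫_ℂ + ⟪y, Z (x - y)⟫_ℂ := by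
    rw [map_sub, inner_sub_left, inner_sub_right]; ring
  rw [this]
  calc _ ≤ _ := norm_add_le _ _
    _ ≤ ‖Z‖ * (‖x - y‖ * ‖x‖) + ‖Z‖ * (‖y‖ * ‖x - y‖) :=
        add_le_add (norm_inner_map_le _ _ _) (norm_inner_map_le _ _ _)
    _ = _ := by ring

lemma integrable_gauss_inner {σ : ℝ} (hσ : 0 < σ) (U : UnitaryFlow 𝓗) (L Z : 𝓗 →L[ℂ] 𝓗) (φ ψ : 𝓗) :
    Integrable fun s => (gaussWeight σ s : ℂ) * ⟪U.conj L s φ, Z (U.conj L s ψ)⟫_ℂ := by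
  refine (integrable_gaussWeight hσ).ofReal.mul_bdd (c := ‖Z‖ * ((‖L‖ * ‖φ‖) * (‖L‖ * ‖ψ‖)))
    ?_ (Eventually.of_forall fun s => ?_)
  · exact ((U.continuous_conj L φ).inner
      (Z.continuous.comp (U.continuous_conj L ψ))).aestronglyMeasurable
  · refine (norm_inner_map_le _ _ _).trans ?_
    gcongr <;> exact U.norm_conj_apply_le _ _ _

/-- Two generators with close drifts and close jumps are close on pure states. -/
lemma norm_pureGen_sub_le {σ : ℝ} (hσ : 0 < σ) {U U' : UnitaryFlow 𝓗} {G G' : 𝓗 →L[ℂ] 𝓗}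
    {L L' : 𝒜 → 𝓗 →L[ℂ] 𝓗} {φ : 𝓗} {c d : ℝ} {w : ℝ → ℝ} (hφ : ‖φ‖ ≤ c)
    (hG : ‖G φ - G' φ‖ ≤ d)
    (hw : Integrable fun s => gaussWeight σ s * w s)
    (hL : ∀ α s, ‖U.conj (L α) s φ - U'.conj (L' α) s φ‖ *
      (‖U.conj (L α) s φ‖ + ‖U'.conj (L' α) s φ‖) ≤ w s) (Z : 𝓗 →L[ℂ] 𝓗) :
    ‖pureGen σ U G L Z φ - pureGen σ U' G' L' Z φ‖ ≤
      ‖Z‖ * (2 * c * d + gaussCoeff σ * Fintype.card 𝒜 * ∫ s, gaussWeight σ s * w s) := by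
  have hc : 0 ≤ c := (norm_nonneg _).trans hφ
  have e : pureGen σ U G L Z φ - pureGen σ U' G' L' Z φ =
      ⟪φ, Z (G φ - G' φ)⟫_ℂ + ⟪G φ - G' φ, Z φ⟫_ℂ + (gaussCoeff σ : ℂ) *
        ∑ α, ∫ s, (gaussWeight σ s : ℂ) * (⟪U.conj (L α) s φ, Z (U.conj (L α) s φ)⟫_ℂ -
          ⟪U'.conj (L' α) s φ, Z (U'.conj (L' α) s φ)⟫_ℂ) := by
    simp only [mul_sub]
    simp only [integral_sub (integrable_gauss_inner hσ U (L _) Z φ φ)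
      (integrable_gauss_inner hσ U' (L' _) Z φ φ)]
    rw [Finset.sum_sub_distrib, map_sub, inner_sub_left, inner_sub_right, pureGen, pureGen]
    ring
  have hcoef : 0 ≤ gaussCoeff σ := by unfold gaussCoeff; positivity
  rw [e]
  refine (norm_add₃_le).trans ?_
  have b1 : ‖⟪φ, Z (G φ - G' φ)⟫_ℂ‖ ≤ ‖Z‖ * (c * d) :=
    (norm_inner_map_le _ _ _).trans (by gcongr)
  have b2 : ‖⟪G φ - G' φ, Z φ⟫_ℂ‖ ≤ ‖Z‖ * (d * c) :=
    (norm_inner_map_le _ _ _).trans (by gcongr; exact (norm_nonneg _).trans hG)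
  have b3 : ∀ α, ‖∫ s, (gaussWeight σ s : ℂ) * (⟪U.conj (L α) s φ, Z (U.conj (L α) s φ)⟫_ℂ -
      ⟪U'.conj (L' α) s φ, Z (U'.conj (L' α) s φ)⟫_ℂ)‖ ≤ ‖Z‖ * ∫ s, gaussWeight σ s * w s := by
    intro α
    rw [← integral_const_mul]
    refine norm_integral_le_of_norm_le (hw.const_mul _) (Eventually.of_forall fun s => ?_)
    rw [norm_mul, Complex.norm_real, Real.norm_of_nonneg (gaussWeight_nonneg _ _)]
    calc _ ≤ gaussWeight σ s * (‖Z‖ * w s) := by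
          refine mul_le_mul_of_nonneg_left ?_ (gaussWeight_nonneg _ _)
          refine (norm_inner_map_sub_le _ _ _).trans ?_
          gcongr
          exact hL α s
      _ = _ := by ring
  have b4 : ‖(gaussCoeff σ : ℂ) * ∑ α, ∫ s, (gaussWeight σ s : ℂ) *
      (⟪U.conj (L α) s φ, Z (U.conj (L α) s φ)⟫_ℂ -
        ⟪U'.conj (L' α) s φ, Z (U'.conj (L' α) s φ)⟫_ℂ)‖ ≤
      gaussCoeff σ * (Fintype.card 𝒜 * (‖Z‖ * ∫ s, gaussWeight σ s * w s)) := by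
    rw [norm_mul, Complex.norm_real, Real.norm_of_nonneg hcoef]
    gcongr
    refine (norm_sum_le_of_le _ fun α _ => b3 α).trans ?_
    rw [Finset.sum_const, Finset.card_univ, nsmul_eq_mul]
  calc _ ≤ ‖Z‖ * (c * d) + ‖Z‖ * (d * c) + _ := add_le_add (add_le_add b1 b2) b4
    _ = _ := by ring

/-- A growth function: even and at least `1`. -/
structure IsGrowth (γ : ℝ → ℝ) : Prop where
  one_le : ∀ s, 1 ≤ γ s
  even : ∀ s, γ (-s) = γ s

/-- The weighted integral of a kernel. -/
def kernelWeight (γ : ℝ → ℝ) (k : ℝ → ℂ) : ℝ := ∫ s, ‖k s‖ * ((1 + |s|) * γ s ^ 2)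

/-- A kernel that is integrable against the growth function. -/
structure IsKernel (γ : ℝ → ℝ) (k : ℝ → ℂ) : Prop where
  integrable : Integrable k
  weighted : Integrable fun s => ‖k s‖ * ((1 + |s|) * γ s ^ 2)

lemma IsKernel.star {γ : ℝ → ℝ} {k : ℝ → ℂ} (hk : IsKernel γ k) :
    IsKernel γ fun s => star (k s) :=
  ⟨integrable_star hk.1, by simpa only [norm_star] using hk.2⟩

lemma kernelWeight_star (γ : ℝ → ℝ) (k : ℝ → ℂ) :
    kernelWeight γ (fun s => star (k s)) = kernelWeight γ k := by
  simp only [kernelWeight, norm_star]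

lemma kernelWeight_nonneg (γ : ℝ → ℝ) (k : ℝ → ℂ) : 0 ≤ kernelWeight γ k :=
  integral_nonneg fun s => by positivity

variable {γ : ℝ → ℝ} (hγ : IsGrowth γ) {k : ℝ → ℂ} (hk : IsKernel γ k)
  {D D' : 𝓗 →L[ℂ] 𝓗}

lemma IsGrowth.one_le_weight (hγ : IsGrowth γ) (s : ℝ) : 1 ≤ (1 + |s|) * γ s ^ 2 := by
  nlinarith [hγ.one_le s, abs_nonneg s, sq_nonneg (γ s), mul_nonneg (abs_nonneg s) (sq_nonneg (γ s))]

lemma IsGrowth.sq_le_weight (s : ℝ) : γ s ^ 2 ≤ (1 + |s|) * γ s ^ 2 := by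
  nlinarith [abs_nonneg s, sq_nonneg (γ s), mul_nonneg (abs_nonneg s) (sq_nonneg (γ s))]

include hγ

lemma integral_norm_le_kernelWeight (hk : IsKernel γ k) : ∫ s, ‖k s‖ ≤ kernelWeight γ k :=
  integral_mono_of_nonneg (Eventually.of_forall fun s => norm_nonneg _) hk.2
    (Eventually.of_forall fun s => le_mul_of_one_le_right (norm_nonneg _) (hγ.one_le_weight s))

/-- A flow grows at most by `γ` in the range norm of `D`. -/
def GrowsBy (U : UnitaryFlow 𝓗) (D : 𝓗 →L[ℂ] 𝓗) (γ : ℝ → ℝ) : Prop := ∀ s, Bdd D D (U s) (γ s)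

lemma growsBy_one (U : UnitaryFlow 𝓗) : GrowsBy U 1 γ := fun s φ c hφ => by
  rw [reg_one, U.norm_map]
  exact (reg_one.1 hφ).trans (le_mul_of_one_le_left hφ.nonneg (hγ.one_le s))

lemma bdd_conj {U : UnitaryFlow 𝓗} (hD : GrowsBy U D γ) (hD' : GrowsBy U D' γ) {B : 𝓗 →L[ℂ] 𝓗}
    {a : ℝ} (h : Bdd D D' B a) (s : ℝ) : Bdd D D' (U.conj B s) (a * γ s ^ 2) := by
  have := (hD' s).comp (h.comp (hD (-s)))
  rw [hγ.even] at this
  exact this.mono (le_of_eq (by ring))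

lemma bdd_conj_one {U : UnitaryFlow 𝓗} (hD : GrowsBy U D γ) {B : 𝓗 →L[ℂ] 𝓗}
    {a : ℝ} (h : Bdd D 1 B a) (s : ℝ) : Bdd D 1 (U.conj B s) (a * γ s) := by
  intro φ c hφ
  rw [reg_one, UnitaryFlow.conj_apply, U.norm_map]
  have := h.norm_le (hD (-s) φ c hφ)
  rwa [hγ.even, ← mul_assoc] at this

lemma bdd_twirl_growth {U : UnitaryFlow 𝓗} (hw : IsWeight D') (hD : GrowsBy U D γ)
    (hD' : GrowsBy U D' γ) {B : 𝓗 →L[ℂ] 𝓗} {a : ℝ} (ha : 0 ≤ a) (h : Bdd D D' B a) :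
    Bdd D D' (twirl U k hk.1 B) (kernelWeight γ k * a) := by
  have := bdd_twirl U hk.1 hw (B := B) (D := D) (w := fun s => (1 + |s|) * γ s ^ 2 * a)
    (fun s => by positivity) (by simpa only [mul_assoc] using hk.2.mul_const a)
    (fun s => (bdd_conj hγ hD hD' h s).mono (by
      nlinarith [mul_le_mul_of_nonneg_right (IsGrowth.sq_le_weight (γ := γ) s) ha]))
  rw [kernelWeight, ← integral_mul_const]
  simpa only [mul_assoc] using this

/-- Replacing the jumps while keeping the flow. -/
theorem norm_pureGen_jump_sub_le {σ : ℝ} (hσ : 0 < σ) {U : UnitaryFlow 𝓗} {D₁ D₂ : 𝓗 →L[ℂ] 𝓗}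
    (hw₁ : IsWeight D₁) (h21 : Bdd D₂ D₁ 1 1)
    (hU₁ : GrowsBy U D₁ γ) (hU₂ : GrowsBy U D₂ γ)
    (hN : Integrable fun s => gaussWeight σ s * ((1 + |s|) * γ s ^ 4))
    {f g : ℝ → ℂ} (hf : IsKernel γ f) (hg : IsKernel γ g)
    {B B' : 𝒜 → 𝓗 →L[ℂ] 𝓗} {a e : ℝ} (ha : 0 ≤ a) (he : 0 ≤ e)
    (hB1 : ∀ α, Bdd D₁ 1 (B α) a)
    (hB2 : ∀ α, Bdd D₂ D₁ (B α) a)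
    (hB'1 : ∀ α, Bdd D₁ 1 (B' α) a) (hB'1a : ∀ α, Bdd D₁ 1 (adjoint (B' α)) a)
    (hd1 : ∀ α, Bdd D₁ 1 (B' α - B α) e)
    (hd1a : ∀ α, Bdd D₁ 1 (adjoint (B' α) - adjoint (B α)) e)
    (hd2 : ∀ α, Bdd D₂ D₁ (B' α - B α) e)
    {L L' : 𝒜 → 𝓗 →L[ℂ] 𝓗} (hL : ∀ α, L α = twirl U f hf.1 (B α))
    (hL' : ∀ α, L' α = twirl U f hf.1 (B' α)) :
    Bdd D₂ 1 (driftOp U g hg.1 L' - driftOp U g hg.1 L)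
      (Fintype.card 𝒜 * (2 * kernelWeight γ g * kernelWeight γ f ^ 2 * a * e)) ∧
    (∀ α, Bdd D₁ 1 (L' α - L α) (kernelWeight γ f * e)) ∧
    (∀ α, Bdd D₁ 1 (adjoint (L' α) - adjoint (L α)) (kernelWeight γ f * e)) ∧
    ∀ φ c, Reg D₂ φ c → ∀ Z : 𝓗 →L[ℂ] 𝓗,
      ‖pureGen σ U (driftOp U g hg.1 L') L' Z φ - pureGen σ U (driftOp U g hg.1 L) L Z φ‖ ≤
      ‖Z‖ * (Fintype.card 𝒜 * (4 * kernelWeight γ g * kernelWeight γ f ^ 2 +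
        2 * gaussCoeff σ * kernelWeight γ f ^ 2 *
          ∫ s, gaussWeight σ s * ((1 + |s|) * γ s ^ 4)) * (a * e) * c ^ 2) := by
  have h10 : GrowsBy U 1 γ := growsBy_one hγ U
  set F := kernelWeight γ f with hF
  have hF0 : 0 ≤ F := kernelWeight_nonneg _ _
  have hdL : ∀ α, L' α - L α = twirl U f hf.1 (B' α - B α) := fun α => by
    rw [twirl_sub, hL, hL']
  have hadj : ∀ α, adjoint (L α) = twirl U _ hf.star.1 (adjoint (B α)) := fun α => by
    rw [hL, adjoint_twirl]
  have hadj' : ∀ α, adjoint (L' α) = twirl U _ hf.star.1 (adjoint (B' α)) := fun α => by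
    rw [hL', adjoint_twirl]
  have l1 : ∀ α, Bdd D₁ 1 (L α) (F * a) := fun α => by
    rw [hL]; exact bdd_twirl_growth hγ hf isWeight_one hU₁ h10 ha (hB1 α)
  have l1' : ∀ α, Bdd D₁ 1 (L' α) (F * a) := fun α => by
    rw [hL']; exact bdd_twirl_growth hγ hf isWeight_one hU₁ h10 ha (hB'1 α)
  have l2 : ∀ α, Bdd D₂ D₁ (L α) (F * a) := fun α => by
    rw [hL]; exact bdd_twirl_growth hγ hf hw₁ hU₂ hU₁ ha (hB2 α)
  have d1 : ∀ α, Bdd D₁ 1 (L' α - L α) (F * e) := fun α => by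
    rw [hdL]; exact bdd_twirl_growth hγ hf isWeight_one hU₁ h10 he (hd1 α)
  have d2 : ∀ α, Bdd D₂ D₁ (L' α - L α) (F * e) := fun α => by
    rw [hdL]; exact bdd_twirl_growth hγ hf hw₁ hU₂ hU₁ he (hd2 α)
  have a1' : ∀ α, Bdd D₁ 1 (adjoint (L' α)) (F * a) := fun α => by
    rw [hadj', hF, ← kernelWeight_star]
    exact bdd_twirl_growth hγ hf.star isWeight_one hU₁ h10 ha (hB'1a α)
  have d1a : ∀ α, Bdd D₁ 1 (adjoint (L' α) - adjoint (L α)) (F * e) := fun α => by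
    rw [hadj', hadj, ← twirl_sub, hF, ← kernelWeight_star]
    exact bdd_twirl_growth hγ hf.star isWeight_one hU₁ h10 he (hd1a α)
  have dLL : ∀ α, Bdd D₂ 1 (adjoint (L' α) ∘L L' α - adjoint (L α) ∘L L α)
      (2 * F ^ 2 * a * e) := fun α => by
    have e1 : adjoint (L' α) ∘L L' α - adjoint (L α) ∘L L α =
        adjoint (L' α) ∘L (L' α - L α) + (adjoint (L' α) - adjoint (L α)) ∘L L α := by
      rw [comp_sub, sub_comp]; abel
    rw [e1]
    refine (((a1' α).comp (d2 α)).add ((d1a α).comp (l2 α))).mono (le_of_eq ?_)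
    ring
  have dG : Bdd D₂ 1 (driftOp U g hg.1 L' - driftOp U g hg.1 L)
      (Fintype.card 𝒜 * (2 * kernelWeight γ g * F ^ 2 * a * e)) := by
    have e1 : driftOp U g hg.1 L' - driftOp U g hg.1 L =
        -∑ α, twirl U g hg.1 (adjoint (L' α) ∘L L' α - adjoint (L α) ∘L L α) := by
      simp only [driftOp, twirl_sub, Finset.sum_sub_distrib]
      abel
    rw [e1]
    have := (bdd_sum Finset.univ fun α (_ : α ∈ Finset.univ) =>
      bdd_twirl_growth hγ hg isWeight_one hU₂ h10 (by positivity) (dLL α)).neg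
    refine this.mono (le_of_eq ?_)
    rw [Finset.sum_const, Finset.card_univ, nsmul_eq_mul]
    ring
  refine ⟨dG, d1, d1a, fun φ c hφ Z => ?_⟩
  have hφ1 : Reg D₁ φ c := by simpa using h21 φ c hφ
  have hc : 0 ≤ c := hφ.nonneg
  have hφ0 : ‖φ‖ ≤ c := by
    obtain ⟨η, rfl, hη⟩ := hφ1
    exact (hw₁.norm_apply_le η).trans hη
  refine (norm_pureGen_sub_le hσ hφ0 (dG.norm_le hφ)
    (w := fun s => (2 * F ^ 2 * (a * e) * c ^ 2) * ((1 + |s|) * γ s ^ 4)) ?_ ?_ Z).trans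
    (le_of_eq ?_)
  · refine (hN.const_mul (2 * F ^ 2 * (a * e) * c ^ 2)).congr (Eventually.of_forall fun s => ?_)
    simp only; ring
  · intro α s
    have b1 : ‖U.conj (L' α) s φ - U.conj (L α) s φ‖ ≤ F * e * γ s * c := by
      have := (bdd_conj_one hγ hU₁ (d1 α) s).norm_le hφ1
      rwa [UnitaryFlow.conj_apply, sub_apply, map_sub] at this
    have b2 := (bdd_conj_one hγ hU₁ (l1' α) s).norm_le hφ1
    have b3 := (bdd_conj_one hγ hU₁ (l1 α) s).norm_le hφ1
    have hg1 := hγ.one_le s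
    have hg0 : 0 ≤ γ s := by linarith
    calc _ ≤ (F * e * γ s * c) * (F * a * γ s * c + F * a * γ s * c) := by gcongr
      _ = (2 * F ^ 2 * (a * e) * c ^ 2) * (γ s ^ 2) := by ring
      _ ≤ (2 * F ^ 2 * (a * e) * c ^ 2) * ((1 + |s|) * γ s ^ 4) := by
          gcongr
          have h2 : γ s ^ 2 ≤ γ s ^ 4 := pow_le_pow_right₀ hg1 (by norm_num)
          nlinarith [mul_nonneg (abs_nonneg s) (pow_nonneg hg0 4)]
  · have e2 : (∫ s, gaussWeight σ s * ((2 * F ^ 2 * (a * e) * c ^ 2) * ((1 + |s|) * γ s ^ 4))) =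
        (2 * F ^ 2 * (a * e) * c ^ 2) * ∫ s, gaussWeight σ s * ((1 + |s|) * γ s ^ 4) := by
      rw [← integral_const_mul]
      congr 1
      ext s
      ring
    rw [e2]
    ring

variable {U U' : UnitaryFlow 𝓗} {D₁ : 𝓗 →L[ℂ] 𝓗} {π : ℝ}

lemma bdd_conj_flow_sub (hU : GrowsBy U D₁ γ) (hπ : 0 ≤ π)
    (hcmp : ∀ s, Bdd D₁ 1 (U s - U' s) (|s| * γ s * π)) {B : 𝓗 →L[ℂ] 𝓗} {b : ℝ} (hb : 0 ≤ b)
    (hB0 : ‖B‖ ≤ b) (hB1 : Bdd D₁ D₁ B b) (s : ℝ) :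
    Bdd D₁ 1 (U.conj B s - U'.conj B s) (2 * b * π * (|s| * γ s ^ 2)) := by
  have e : U.conj B s - U'.conj B s =
      (U s - U' s) ∘L (B ∘L U (-s)) + U' s ∘L (B ∘L (U (-s) - U' (-s))) := by
    rw [UnitaryFlow.conj, UnitaryFlow.conj, sub_comp, comp_sub, comp_sub]; abel
  have hU' : Bdd 1 1 (U' s) 1 := bdd_one_one (opNorm_le_bound _ zero_le_one fun φ => by
    rw [U'.norm_map, one_mul])
  have h1 := (hcmp s).comp (hB1.comp (hU (-s)))
  have h2 := hU'.comp ((bdd_one_one hB0).comp (hcmp (-s)))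
  rw [e]
  refine (h1.add h2).mono ?_
  rw [hγ.even, abs_neg]
  have hg1 := hγ.one_le s
  have h3 : γ s ≤ γ s ^ 2 := le_self_pow₀ hg1 two_ne_zero
  have h4 : 0 ≤ b * π * |s| := by positivity
  nlinarith [mul_le_mul_of_nonneg_left h3 h4]

lemma bdd_twirl_flow_sub (hU : GrowsBy U D₁ γ) (hπ : 0 ≤ π)
    (hcmp : ∀ s, Bdd D₁ 1 (U s - U' s) (|s| * γ s * π)) {B : 𝓗 →L[ℂ] 𝓗} {b : ℝ} (hb : 0 ≤ b)
    (hB0 : ‖B‖ ≤ b) (hB1 : Bdd D₁ D₁ B b) :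
    Bdd D₁ 1 (twirl U k hk.1 B - twirl U' k hk.1 B) (2 * b * π * kernelWeight γ k) := by
  intro φ c hφ
  have hc := hφ.nonneg
  rw [reg_one, sub_apply, twirl_apply, twirl_apply,
    ← integral_sub (integrable_conj U hk.1 B φ) (integrable_conj U' hk.1 B φ), kernelWeight,
    mul_right_comm, mul_comm _ (∫ s, ‖k s‖ * ((1 + |s|) * γ s ^ 2)), ← integral_mul_const]
  refine norm_integral_le_of_norm_le (hk.2.mul_const _) (Eventually.of_forall fun s => ?_)
  rw [← smul_sub, norm_smul]
  have h1 := (bdd_conj_flow_sub hγ hU hπ hcmp hb hB0 hB1 s).norm_le hφ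
  rw [sub_apply] at h1
  have h2 : |s| * γ s ^ 2 ≤ (1 + |s|) * γ s ^ 2 := by nlinarith [sq_nonneg (γ s)]
  calc _ ≤ ‖k s‖ * (2 * b * π * (|s| * γ s ^ 2) * c) := by gcongr
    _ ≤ ‖k s‖ * (2 * b * π * ((1 + |s|) * γ s ^ 2) * c) := by gcongr
    _ = _ := by ring

/-- Replacing the flow while keeping the jumps. -/
theorem norm_pureGen_flow_sub_le {σ : ℝ} (hσ : 0 < σ) (hw₁ : IsWeight D₁)
    (hU : GrowsBy U D₁ γ) (hπ : 0 ≤ π)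
    (hcmp : ∀ s, Bdd D₁ 1 (U s - U' s) (|s| * γ s * π))
    (hN : Integrable fun s => gaussWeight σ s * ((1 + |s|) * γ s ^ 4))
    {f g : ℝ → ℂ} (hf : IsKernel γ f) (hg : IsKernel γ g)
    {B : 𝒜 → 𝓗 →L[ℂ] 𝓗} {b : ℝ} (hb : 0 ≤ b)
    (hB0 : ∀ α, ‖B α‖ ≤ b) (hB1 : ∀ α, Bdd D₁ D₁ (B α) b)
    (hB1a : ∀ α, Bdd D₁ D₁ (adjoint (B α)) b)
    {L L' : 𝒜 → 𝓗 →L[ℂ] 𝓗} (hL : ∀ α, L α = twirl U f hf.1 (B α))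
    (hL' : ∀ α, L' α = twirl U' f hf.1 (B α)) {φ : 𝓗} {c : ℝ} (hφ : Reg D₁ φ c)
    (Z : 𝓗 →L[ℂ] 𝓗) :
    ‖pureGen σ U (driftOp U g hg.1 L) L Z φ - pureGen σ U' (driftOp U' g hg.1 L') L' Z φ‖ ≤
      ‖Z‖ * (Fintype.card 𝒜 * (12 * kernelWeight γ g * kernelWeight γ f ^ 2 +
        8 * gaussCoeff σ * kernelWeight γ f ^ 2 *
          ∫ s, gaussWeight σ s * ((1 + |s|) * γ s ^ 4)) * (b ^ 2 * π) * c ^ 2) := by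
  have h10 : GrowsBy U 1 γ := growsBy_one hγ U
  have hc : 0 ≤ c := hφ.nonneg
  have hφ0 : ‖φ‖ ≤ c := by
    obtain ⟨η, rfl, hη⟩ := hφ
    exact (hw₁.norm_apply_le η).trans hη
  set F := kernelWeight γ f with hF
  have hF0 : 0 ≤ F := kernelWeight_nonneg _ _
  have hfF := integral_norm_le_kernelWeight hγ hf
  have nL : ∀ α, ‖L α‖ ≤ F * b := fun α => by
    rw [hL]
    exact (norm_twirl_le U hf.1 (B α)).trans (mul_le_mul hfF (hB0 α) (norm_nonneg _) hF0)
  have nL' : ∀ α, ‖L' α‖ ≤ F * b := fun α => by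
    rw [hL']
    exact (norm_twirl_le U' hf.1 (B α)).trans (mul_le_mul hfF (hB0 α) (norm_nonneg _) hF0)
  have nadj : ∀ A : 𝓗 →L[ℂ] 𝓗, ‖adjoint A‖ = ‖A‖ := fun A => LinearIsometryEquiv.norm_map _ A
  have l1 : ∀ α, Bdd D₁ D₁ (L α) (F * b) := fun α => by
    rw [hL]; exact bdd_twirl_growth hγ hf hw₁ hU hU hb (hB1 α)
  have l1a : ∀ α, Bdd D₁ D₁ (adjoint (L α)) (F * b) := fun α => by
    rw [hL, adjoint_twirl, hF, ← kernelWeight_star]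
    exact bdd_twirl_growth hγ hf.star hw₁ hU hU hb (hB1a α)
  have d1 : ∀ α, Bdd D₁ 1 (L α - L' α) (2 * b * π * F) := fun α => by
    rw [hL, hL']; exact bdd_twirl_flow_sub hγ hf hU hπ hcmp hb (hB0 α) (hB1 α)
  have d1a : ∀ α, Bdd D₁ 1 (adjoint (L α) - adjoint (L' α)) (2 * b * π * F) := fun α => by
    rw [hL, hL', adjoint_twirl, adjoint_twirl, hF, ← kernelWeight_star]
    exact bdd_twirl_flow_sub hγ hf.star hU hπ hcmp hb ((nadj _).trans_le (hB0 α)) (hB1a α)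
  have nLL : ∀ α, ‖adjoint (L α) ∘L L α‖ ≤ (F * b) ^ 2 := fun α => by
    rw [sq]
    exact (opNorm_comp_le _ _).trans (mul_le_mul ((nadj _).trans_le (nL α)) (nL α)
      (norm_nonneg _) (by positivity))
  have nLL' : ∀ α, ‖adjoint (L' α) ∘L L' α‖ ≤ (F * b) ^ 2 := fun α => by
    rw [sq]
    exact (opNorm_comp_le _ _).trans (mul_le_mul ((nadj _).trans_le (nL' α)) (nL' α)
      (norm_nonneg _) (by positivity))
  have bLL : ∀ α, Bdd D₁ D₁ (adjoint (L α) ∘L L α) ((F * b) ^ 2) := fun α => by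
    rw [sq]; exact (l1a α).comp (l1 α)
  have dLL : ∀ α, Bdd D₁ 1 (adjoint (L α) ∘L L α - adjoint (L' α) ∘L L' α)
      (4 * b ^ 2 * π * F ^ 2) := fun α => by
    have e1 : adjoint (L α) ∘L L α - adjoint (L' α) ∘L L' α =
        adjoint (L' α) ∘L (L α - L' α) + (adjoint (L α) - adjoint (L' α)) ∘L L α := by
      rw [comp_sub, sub_comp]; abel
    rw [e1]
    refine (((bdd_one_one ((nadj _).trans_le (nL' α))).comp (d1 α)).add
      ((d1a α).comp (l1 α))).mono (le_of_eq ?_)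
    ring
  have hU'sub : ∀ s, ‖U' s φ - U s φ‖ ≤ |s| * γ s * π * c := fun s => by
    rw [norm_sub_rev]
    simpa using (hcmp s).norm_le hφ
  have dT : ∀ α, Bdd D₁ 1 (twirl U g hg.1 (adjoint (L α) ∘L L α) -
      twirl U' g hg.1 (adjoint (L' α) ∘L L' α)) (6 * b ^ 2 * π * F ^ 2 * kernelWeight γ g) := by
    intro α
    have p1 := bdd_twirl_flow_sub hγ hg hU hπ hcmp (by positivity) (nLL α) (bLL α)
    have p2 : Bdd D₁ 1 (twirl U' g hg.1 (adjoint (L α) ∘L L α - adjoint (L' α) ∘L L' α))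
        (kernelWeight γ g * (4 * b ^ 2 * π * F ^ 2)) := by
      intro ψ d hψ
      have hd := hψ.nonneg
      rw [reg_one, twirl_apply, kernelWeight, mul_assoc, ← integral_mul_const]
      refine norm_integral_le_of_norm_le (hg.2.mul_const _) (Eventually.of_forall fun s => ?_)
      rw [norm_smul, UnitaryFlow.conj_apply, U'.norm_map]
      set X := adjoint (L α) ∘L L α - adjoint (L' α) ∘L L' α with hX
      have q1 : ‖X (U (-s) ψ)‖ ≤ 4 * b ^ 2 * π * F ^ 2 * (γ s * d) := by
        have := (dLL α).norm_le (hU (-s) ψ d hψ)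
        rwa [hγ.even] at this
      have q2 : ‖X (U' (-s) ψ - U (-s) ψ)‖ ≤ (2 * (F * b) ^ 2) * (|s| * γ s * π * d) := by
        have hXn : ‖X‖ ≤ 2 * (F * b) ^ 2 := by
          rw [two_mul]; exact (norm_sub_le _ _).trans (add_le_add (nLL α) (nLL' α))
        have := (hcmp (-s)).norm_le hψ
        rw [sub_apply, norm_sub_rev, hγ.even, abs_neg] at this
        exact (X.le_opNorm _).trans (mul_le_mul hXn this (norm_nonneg _) (by positivity))
      have q3 : X (U' (-s) ψ) = X (U (-s) ψ) + X (U' (-s) ψ - U (-s) ψ) := by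
        rw [map_sub]; abel
      have hg1 := hγ.one_le s
      have h3 : γ s ≤ γ s ^ 2 := le_self_pow₀ hg1 two_ne_zero
      have h4 : (1 + |s|) * γ s ≤ (1 + |s|) * γ s ^ 2 := by gcongr
      have hγ0 : 0 ≤ γ s := by linarith
      have q4 : ‖X (U' (-s) ψ)‖ ≤ ((1 + |s|) * γ s ^ 2) * (4 * b ^ 2 * π * F ^ 2 * d) := by
        rw [q3]
        refine (norm_add_le _ _).trans ((add_le_add q1 q2).trans ?_)
        have h5 : 0 ≤ b ^ 2 * π * F ^ 2 * d := by positivity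
        have h6 : 0 ≤ |s| * γ s := by positivity
        nlinarith [mul_le_mul_of_nonneg_left h4 h5, mul_nonneg h5 h6]
      calc _ ≤ ‖g s‖ * (((1 + |s|) * γ s ^ 2) * (4 * b ^ 2 * π * F ^ 2 * d)) := by gcongr
        _ = _ := by ring
    have e1 : twirl U g hg.1 (adjoint (L α) ∘L L α) - twirl U' g hg.1 (adjoint (L' α) ∘L L' α) =
        (twirl U g hg.1 (adjoint (L α) ∘L L α) - twirl U' g hg.1 (adjoint (L α) ∘L L α)) +
        twirl U' g hg.1 (adjoint (L α) ∘L L α - adjoint (L' α) ∘L L' α) := by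
      rw [twirl_sub]; abel
    rw [e1]
    refine (p1.add p2).mono (le_of_eq ?_)
    ring
  have dG : Bdd D₁ 1 (driftOp U g hg.1 L - driftOp U' g hg.1 L')
      (Fintype.card 𝒜 * (6 * b ^ 2 * π * F ^ 2 * kernelWeight γ g)) := by
    have e1 : driftOp U g hg.1 L - driftOp U' g hg.1 L' =
        -∑ α, (twirl U g hg.1 (adjoint (L α) ∘L L α) -
          twirl U' g hg.1 (adjoint (L' α) ∘L L' α)) := by
      simp only [driftOp, Finset.sum_sub_distrib]
      abel
    rw [e1]
    refine (bdd_sum Finset.univ fun α (_ : α ∈ Finset.univ) => dT α).neg.mono (le_of_eq ?_)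
    rw [Finset.sum_const, Finset.card_univ, nsmul_eq_mul]
  refine (norm_pureGen_sub_le hσ hφ0 (dG.norm_le hφ)
    (w := fun s => (8 * F ^ 2 * (b ^ 2 * π) * c ^ 2) * ((1 + |s|) * γ s ^ 4)) ?_ ?_ Z).trans
    (le_of_eq ?_)
  · refine (hN.const_mul (8 * F ^ 2 * (b ^ 2 * π) * c ^ 2)).congr (Eventually.of_forall fun s => ?_)
    simp only; ring
  · intro α s
    have hg1 := hγ.one_le s
    have hγ0 : 0 ≤ γ s := by linarith
    have c1 : ‖U.conj (L α) s φ - U'.conj (L α) s φ‖ ≤ 2 * (F * b) * π * (|s| * γ s ^ 2) * c := by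
      simpa using (bdd_conj_flow_sub hγ hU hπ hcmp (by positivity) (nL α) (l1 α) s).norm_le hφ
    have c2 : ‖(L α - L' α) (U (-s) φ)‖ ≤ 2 * b * π * F * (γ s * c) := by
      have := (d1 α).norm_le (hU (-s) φ c hφ)
      rwa [hγ.even] at this
    have c3 : ‖(L α - L' α) (U' (-s) φ - U (-s) φ)‖ ≤ (2 * (F * b)) * (|s| * γ s * π * c) := by
      have hXn : ‖L α - L' α‖ ≤ 2 * (F * b) := by
        rw [two_mul]; exact (norm_sub_le _ _).trans (add_le_add (nL α) (nL' α))
      have := hU'sub (-s)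
      rw [hγ.even, abs_neg] at this
      exact (le_opNorm _ _).trans (mul_le_mul hXn this (norm_nonneg _) (by positivity))
    have e1 : U.conj (L α) s φ - U'.conj (L' α) s φ = (U.conj (L α) s φ - U'.conj (L α) s φ) +
        U' s ((L α - L' α) (U (-s) φ) + (L α - L' α) (U' (-s) φ - U (-s) φ)) := by
      rw [← map_add, add_sub_cancel, sub_apply, map_sub]
      simp only [UnitaryFlow.conj_apply]
      abel
    have c4 : ‖U.conj (L α) s φ - U'.conj (L' α) s φ‖ ≤ 4 * F * b * π * ((1 + |s|) * γ s ^ 2) * c := by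
      rw [e1]
      refine (norm_add_le _ _).trans ?_
      rw [U'.norm_map]
      refine (add_le_add c1 ((norm_add_le _ _).trans (add_le_add c2 c3))).trans ?_
      have h3 : γ s ≤ γ s ^ 2 := le_self_pow₀ hg1 two_ne_zero
      have h4 : (1 + |s|) * γ s ≤ (1 + |s|) * γ s ^ 2 := by gcongr
      have h5 : 0 ≤ F * b * π * c := by positivity
      nlinarith [mul_le_mul_of_nonneg_left h4 h5, mul_nonneg h5 (sq_nonneg (γ s))]
    have c5 : ‖U.conj (L α) s φ‖ ≤ F * b * c :=
      (U.norm_conj_apply_le _ _ _).trans (mul_le_mul (nL α) hφ0 (norm_nonneg _) (by positivity))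
    have c6 : ‖U'.conj (L' α) s φ‖ ≤ F * b * c :=
      (U'.norm_conj_apply_le _ _ _).trans (mul_le_mul (nL' α) hφ0 (norm_nonneg _) (by positivity))
    calc _ ≤ (4 * F * b * π * ((1 + |s|) * γ s ^ 2) * c) * (F * b * c + F * b * c) := by gcongr
      _ = (8 * F ^ 2 * (b ^ 2 * π) * c ^ 2) * ((1 + |s|) * γ s ^ 2) := by ring
      _ ≤ (8 * F ^ 2 * (b ^ 2 * π) * c ^ 2) * ((1 + |s|) * γ s ^ 4) := by
          gcongr
          norm_num
  · have e2 : (∫ s, gaussWeight σ s * ((8 * F ^ 2 * (b ^ 2 * π) * c ^ 2) * ((1 + |s|) * γ s ^ 4))) =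
        (8 * F ^ 2 * (b ^ 2 * π) * c ^ 2) * ∫ s, gaussWeight σ s * ((1 + |s|) * γ s ^ 4) := by
      rw [← integral_const_mul]
      congr 1
      ext s
      ring
    rw [e2]
    ring

end PureGenerator

/-! ### The truncated dynamics and its dual -/

section DualGenerator
open Filter Topology MeasureTheory ContinuousLinearMap

variable {𝒜 𝓗 : Type*} [Fintype 𝒜] [NormedAddCommGroup 𝓗] [InnerProductSpace ℂ 𝓗]
  [CompleteSpace 𝓗]

lemma gaussCoeff_nonneg {σ : ℝ} (hσ : 0 < σ) : 0 ≤ gaussCoeff σ := by unfold gaussCoeff; positivity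

lemma continuous_exp_clm {X : Type*} [NormedAddCommGroup X] [NormedSpace ℂ X] [CompleteSpace X] :
    Continuous (NormedSpace.exp : (X →L[ℂ] X) → X →L[ℂ] X) :=
  let _ : NormedAlgebra ℚ (X →L[ℂ] X) := NormedAlgebra.restrictScalars ℚ ℂ _
  NormedSpace.exp_continuous

lemma exp_smul_mul_exp_smul {X : Type*} [NormedAddCommGroup X] [NormedSpace ℂ X] [CompleteSpace X]
    (H : X →L[ℂ] X) (a b : ℂ) :
    NormedSpace.exp (a • H) * NormedSpace.exp (b • H) = NormedSpace.exp ((a + b) • H) := by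
  let _ : NormedAlgebra ℚ (X →L[ℂ] X) := NormedAlgebra.restrictScalars ℚ ℂ _
  rw [add_smul, ← NormedSpace.exp_add_of_commute ((Commute.refl H).smul_left _ |>.smul_right _)]

/-- The unitary group of a bounded self-adjoint operator. -/
def expFlow {H : 𝓗 →L[ℂ] 𝓗} (hH : IsSelfAdjoint H) : UnitaryFlow 𝓗 :=
  have hadj : ∀ s : ℝ, adjoint (NormedSpace.exp ((Complex.I * s) • H)) =
      NormedSpace.exp ((Complex.I * (-s : ℝ)) • H) := fun s => by
    rw [← star_eq_adjoint, NormedSpace.star_exp, star_smul, hH.star_eq]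
    congr 2
    simp
  have hinv : ∀ s : ℝ, NormedSpace.exp ((Complex.I * (-s : ℝ)) • H) *
      NormedSpace.exp ((Complex.I * s) • H) = 1 := fun s => by
    rw [exp_smul_mul_exp_smul]
    simp [NormedSpace.exp_zero]
  { toFun := fun s => NormedSpace.exp ((Complex.I * s) • H)
    cont := fun ψ => by
      have h : Continuous fun s : ℝ => NormedSpace.exp ((Complex.I * s) • H) :=
        continuous_exp_clm.comp (by fun_prop)
      exact h.clm_apply continuous_const
    norm_map := fun s ψ => by
      have h : ⟪NormedSpace.exp ((Complex.I * s) • H) ψ, NormedSpace.exp ((Complex.I * s) • H) ψ⟫_ℂ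
          = ⟪ψ, ψ⟫_ℂ := by
        rw [← adjoint_inner_right, hadj, ← comp_apply, ← mul_def, hinv]; rfl
      rw [inner_self_eq_norm_sq_to_K, inner_self_eq_norm_sq_to_K] at h
      exact (sq_eq_sq₀ (norm_nonneg _) (norm_nonneg _)).1 (by exact_mod_cast h)
    adj := fun s φ ψ => by rw [← adjoint_inner_right, hadj] }

lemma expFlow_apply {H : 𝓗 →L[ℂ] 𝓗} (hH : IsSelfAdjoint H) (s : ℝ) :
    expFlow hH s = NormedSpace.exp ((Complex.I * s) • H) := rfl

lemma continuous_expFlow {H : 𝓗 →L[ℂ] 𝓗} (hH : IsSelfAdjoint H) :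
    Continuous fun s => expFlow hH s :=
  continuous_exp_clm.comp (by fun_prop)

lemma heis_eq_conj {H : 𝓗 →L[ℂ] 𝓗} (hH : IsSelfAdjoint H) (B : 𝓗 →L[ℂ] 𝓗) (s : ℝ) :
    heis H B s = (expFlow hH).conj B s := by
  rw [heis, UnitaryFlow.conj, expFlow_apply, expFlow_apply, mul_assoc]
  congr 3
  simp

variable {U : UnitaryFlow 𝓗}

lemma continuous_conj_of_norm (hU : Continuous fun s => U s) (B : 𝓗 →L[ℂ] 𝓗) :
    Continuous fun s => U.conj B s :=
  hU.clm_comp (continuous_const.clm_comp (hU.comp continuous_neg))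

lemma integrable_conj_of_norm (hU : Continuous fun s => U s) {k : ℝ → ℂ} (hk : Integrable k)
    (B : 𝓗 →L[ℂ] 𝓗) : Integrable fun s => k s • U.conj B s :=
  hk.smul_bdd (f := fun s => U.conj B s) ‖B‖ (continuous_conj_of_norm hU B).aestronglyMeasurable
    (Eventually.of_forall fun s => U.norm_conj_le B s)

lemma integral_conj_eq_twirl (hU : Continuous fun s => U s) {k : ℝ → ℂ} (hk : Integrable k)
    (B : 𝓗 →L[ℂ] 𝓗) : ∫ s, k s • U.conj B s = twirl U k hk B := by
  ext φ
  rw [integral_apply (integrable_conj_of_norm hU hk B), twirl_apply]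
  rfl

/-- The generator of the Heisenberg picture. -/
def dualGen (σ : ℝ) (U : UnitaryFlow 𝓗) (G : 𝓗 →L[ℂ] 𝓗) (L : 𝒜 → 𝓗 →L[ℂ] 𝓗) :
    (𝓗 →L[ℂ] 𝓗) →L[ℂ] (𝓗 →L[ℂ] 𝓗) :=
  mulLeftRight ℂ (𝓗 →L[ℂ] 𝓗) 1 G + mulLeftRight ℂ (𝓗 →L[ℂ] 𝓗) (star G) 1 +
  ∑ α, (gaussCoeff σ : ℂ) • ∫ s : ℝ, (gaussWeight σ s : ℂ) •
    mulLeftRight ℂ (𝓗 →L[ℂ] 𝓗) (star (U.conj (L α) s)) (U.conj (L α) s)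

/-- The generator of the Schrödinger picture. -/
def lindGen (σ : ℝ) (U : UnitaryFlow 𝓗) (G : 𝓗 →L[ℂ] 𝓗) (L : 𝒜 → 𝓗 →L[ℂ] 𝓗) :
    (𝓗 →L[ℂ] 𝓗) →L[ℂ] (𝓗 →L[ℂ] 𝓗) :=
  mulLeftRight ℂ (𝓗 →L[ℂ] 𝓗) G 1 + mulLeftRight ℂ (𝓗 →L[ℂ] 𝓗) 1 (star G) +
  ∑ α, (gaussCoeff σ : ℂ) • ∫ s : ℝ, (gaussWeight σ s : ℂ) •
    mulLeftRight ℂ (𝓗 →L[ℂ] 𝓗) (U.conj (L α) s) (star (U.conj (L α) s))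

lemma intJump_eq_twirl {f : 𝓢(ℝ, ℂ)} (hf : Integrable f) {H : 𝓗 →L[ℂ] 𝓗} (hH : IsSelfAdjoint H)
    (B : 𝓗 →L[ℂ] 𝓗) : intJump f H B = twirl (expFlow hH) f hf B := by
  rw [← integral_conj_eq_twirl (continuous_expFlow hH)]
  simp only [intJump, heis_eq_conj hH]

lemma lindbladian_eq_lindGen {β σ : ℝ} {f : 𝓢(ℝ, ℂ)} (hf : Integrable f)
    (hg : Integrable (driftKernel β σ)) {H : 𝓗 →L[ℂ] 𝓗} (hH : IsSelfAdjoint H)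
    (B : 𝒜 → 𝓗 →L[ℂ] 𝓗) :
    lindbladian β σ f H B = lindGen σ (expFlow hH)
      (driftOp (expFlow hH) (driftKernel β σ) hg fun α => twirl (expFlow hH) f hf (B α))
      fun α => twirl (expFlow hH) f hf (B α) := by
  have hd : drift β σ f H B = driftOp (expFlow hH) (driftKernel β σ) hg
      fun α => twirl (expFlow hH) f hf (B α) := by
    simp only [drift, driftOp, ← integral_conj_eq_twirl (continuous_expFlow hH), intJump,
      heis_eq_conj hH]
    rfl
  rw [lindbladian, lindGen, hd]
  simp only [intJump_eq_twirl hf hH, heis_eq_conj hH]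
  rfl

section norm_continuous
variable (hU : Continuous fun s => U s) {σ : ℝ} (hσ : 0 < σ)
include hU hσ

lemma integrable_gauss_mulLeftRight {X Y : ℝ → 𝓗 →L[ℂ] 𝓗} (hX : Continuous X) (hY : Continuous Y)
    {C : ℝ} (hC : ∀ s, ‖X s‖ ≤ C) (hC' : ∀ s, ‖Y s‖ ≤ C) :
    Integrable fun s => (gaussWeight σ s : ℂ) • mulLeftRight ℂ (𝓗 →L[ℂ] 𝓗) (X s) (Y s) := by
  have hC0 : 0 ≤ C := (norm_nonneg _).trans (hC 0)
  refine ((integrable_gaussWeight hσ).ofReal (𝕜 := ℂ)).smul_bdd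
    (f := fun s => mulLeftRight ℂ (𝓗 →L[ℂ] 𝓗) (X s) (Y s)) (C * C) ?_ (Eventually.of_forall fun s => ?_)
  · have := secondCountableTopologyEither_of_left ℝ ((𝓗 →L[ℂ] 𝓗) →L[ℂ] 𝓗 →L[ℂ] 𝓗)
    refine Continuous.aestronglyMeasurable ?_
    exact ((mulLeftRight ℂ (𝓗 →L[ℂ] 𝓗)).continuous.comp hX).clm_apply hY
  · refine (opNorm_mulLeftRight_apply_apply_le ℂ _ _ _).trans ?_
    exact mul_le_mul (hC s) (hC' s) (norm_nonneg _) hC0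

lemma integrable_dualGen (L : 𝓗 →L[ℂ] 𝓗) : Integrable fun s => (gaussWeight σ s : ℂ) •
    mulLeftRight ℂ (𝓗 →L[ℂ] 𝓗) (star (U.conj L s)) (U.conj L s) :=
  integrable_gauss_mulLeftRight hU hσ (continuous_star.comp (continuous_conj_of_norm hU L))
    (continuous_conj_of_norm hU L) (C := ‖L‖) (fun s => (norm_star _).trans_le (U.norm_conj_le L s))
    (fun s => U.norm_conj_le L s)

lemma integrable_lindGen (L : 𝓗 →L[ℂ] 𝓗) : Integrable fun s => (gaussWeight σ s : ℂ) •
    mulLeftRight ℂ (𝓗 →L[ℂ] 𝓗) (U.conj L s) (star (U.conj L s)) :=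
  integrable_gauss_mulLeftRight hU hσ (continuous_conj_of_norm hU L)
    (continuous_star.comp (continuous_conj_of_norm hU L)) (C := ‖L‖) (fun s => U.norm_conj_le L s)
    (fun s => (norm_star _).trans_le (U.norm_conj_le L s))

lemma dualGen_apply (G : 𝓗 →L[ℂ] 𝓗) (L : 𝒜 → 𝓗 →L[ℂ] 𝓗) (Z : 𝓗 →L[ℂ] 𝓗) :
    dualGen σ U G L Z = Z * G + star G * Z + ∑ α, (gaussCoeff σ : ℂ) •
      ∫ s : ℝ, (gaussWeight σ s : ℂ) • (star (U.conj (L α) s) * Z * U.conj (L α) s) := by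
  simp only [dualGen, add_apply, sum_apply, smul_apply, mulLeftRight_apply, one_mul, mul_one,
    integral_apply (integrable_dualGen hU hσ _)]

lemma inner_dualGen (G : 𝓗 →L[ℂ] 𝓗) (L : 𝒜 → 𝓗 →L[ℂ] 𝓗) (Z : 𝓗 →L[ℂ] 𝓗) (a b : 𝓗) :
    ⟪a, dualGen σ U G L Z b⟫_ℂ = ⟪a, Z (G b)⟫_ℂ + ⟪G a, Z b⟫_ℂ + (gaussCoeff σ : ℂ) *
    ∑ α, ∫ s, (gaussWeight σ s : ℂ) * ⟪U.conj (L α) s a, Z (U.conj (L α) s b)⟫_ℂ := by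
  have hi : ∀ α, Integrable fun s => (gaussWeight σ s : ℂ) •
      (star (U.conj (L α) s) * Z * U.conj (L α) s) := fun α => by
    simpa only [smul_apply, mulLeftRight_apply] using
      (integrable_dualGen hU hσ (L α)).apply_continuousLinearMap Z
  have hi' : ∀ α, Integrable fun s => (gaussWeight σ s : ℂ) •
      (star (U.conj (L α) s) * Z * U.conj (L α) s) b := fun α => by
    simpa only [smul_apply] using (hi α).apply_continuousLinearMap b
  have e : ∀ α, ⟪a, (∫ s, (gaussWeight σ s : ℂ) •
      (star (U.conj (L α) s) * Z * U.conj (L α) s)) b⟫_ℂ =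
      ∫ s, (gaussWeight σ s : ℂ) * ⟪U.conj (L α) s a, Z (U.conj (L α) s b)⟫_ℂ := fun α => by
    rw [integral_apply (hi α)]
    simp only [smul_apply]
    rw [← integral_inner (hi' α) a]
    simp only [inner_smul_right, mul_apply_eq_comp, star_eq_adjoint, adjoint_inner_right]
  rw [dualGen_apply hU hσ]
  simp only [star_eq_adjoint] at e
  simp only [add_apply, sum_apply, smul_apply, inner_add_right, inner_sum, inner_smul_right, e,
    Finset.mul_sum, mul_apply_eq_comp, star_eq_adjoint, adjoint_inner_right]

lemma pureGen_eq_inner_dualGen (G : 𝓗 →L[ℂ] 𝓗) (L : 𝒜 → 𝓗 →L[ℂ] 𝓗) (Z : 𝓗 →L[ℂ] 𝓗) (φ : 𝓗) :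
    pureGen σ U G L Z φ = ⟪φ, dualGen σ U G L Z φ⟫_ℂ :=
  (inner_dualGen hU hσ G L Z φ φ).symm

end norm_continuous

/-- The operator `T` is represented by the functional `ω`, that is, `ω(Z) = Tr(T Z)` for rank-one
operators `Z`. -/
def Represents (ω : (𝓗 →L[ℂ] 𝓗) →L[ℂ] ℂ) (T : 𝓗 →L[ℂ] 𝓗) : Prop :=
  ∀ a b : 𝓗, ⟪a, T b⟫_ℂ = ω (InnerProductSpace.rankOne ℂ b a)

/-- The map `𝓓` on observables is dual to the map `𝓛` on states. -/
def IsDual (𝓓 𝓛 : (𝓗 →L[ℂ] 𝓗) →L[ℂ] (𝓗 →L[ℂ] 𝓗)) : Prop :=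
  ∀ ω T, Represents ω T → Represents (ω ∘L 𝓓) (𝓛 T)

lemma IsDual.add {𝓓 𝓛 𝓓' 𝓛' : (𝓗 →L[ℂ] 𝓗) →L[ℂ] (𝓗 →L[ℂ] 𝓗)} (h : IsDual 𝓓 𝓛)
    (h' : IsDual 𝓓' 𝓛') : IsDual (𝓓 + 𝓓') (𝓛 + 𝓛') := fun ω T hω a b => by
  simp only [add_apply, inner_add_right, comp_apply, map_add, h ω T hω a b, h' ω T hω a b]

lemma IsDual.smul {𝓓 𝓛 : (𝓗 →L[ℂ] 𝓗) →L[ℂ] (𝓗 →L[ℂ] 𝓗)} (h : IsDual 𝓓 𝓛) (c : ℂ) :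
    IsDual (c • 𝓓) (c • 𝓛) := fun ω T hω a b => by
  simp only [smul_apply, inner_smul_right, comp_apply, map_smul, h ω T hω a b, smul_eq_mul]

lemma isDual_sum {J : Type*} (s : Finset J) {𝓓 𝓛 : J → (𝓗 →L[ℂ] 𝓗) →L[ℂ] (𝓗 →L[ℂ] 𝓗)}
    (h : ∀ i ∈ s, IsDual (𝓓 i) (𝓛 i)) : IsDual (∑ i ∈ s, 𝓓 i) (∑ i ∈ s, 𝓛 i) :=
  fun ω T hω a b => by
  simp only [sum_apply, inner_sum, comp_apply, map_sum]
  exact Finset.sum_congr rfl fun i hi => h i hi ω T hω a b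

lemma isDual_mulLeftRight (A B : 𝓗 →L[ℂ] 𝓗) :
    IsDual (mulLeftRight ℂ (𝓗 →L[ℂ] 𝓗) B A) (mulLeftRight ℂ (𝓗 →L[ℂ] 𝓗) A B) :=
  fun ω T hω a b => by
  rw [comp_apply, mulLeftRight_apply, mulLeftRight_apply, mul_def, mul_def, mul_def, mul_def,
    InnerProductSpace.comp_rankOne, InnerProductSpace.rankOne_comp, ← hω]
  simp only [comp_apply, adjoint_inner_left]

lemma isDual_integral {𝓓 𝓛 : ℝ → (𝓗 →L[ℂ] 𝓗) →L[ℂ] (𝓗 →L[ℂ] 𝓗)} (h𝓓 : Integrable 𝓓)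
    (h𝓛 : Integrable 𝓛) (h : ∀ s, IsDual (𝓓 s) (𝓛 s)) : IsDual (∫ s, 𝓓 s) (∫ s, 𝓛 s) :=
  fun ω T hω a b => by
  rw [comp_apply, integral_apply h𝓓, integral_apply h𝓛,
    integral_apply (h𝓛.apply_continuousLinearMap T),
    ← integral_inner ((h𝓛.apply_continuousLinearMap T).apply_continuousLinearMap b) a,
    ← ω.integral_comp_comm (h𝓓.apply_continuousLinearMap _)]
  exact integral_congr_ae (Eventually.of_forall fun s => h s ω T hω a b)

lemma IsDual.pow {𝓓 𝓛 : (𝓗 →L[ℂ] 𝓗) →L[ℂ] (𝓗 →L[ℂ] 𝓗)} (h : IsDual 𝓓 𝓛) (n : ℕ) :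
    IsDual (𝓓 ^ n) (𝓛 ^ n) := by
  induction n with
  | zero => exact fun ω T hω => hω
  | succ n ih =>
    intro ω T hω
    rw [pow_succ, pow_succ']
    exact h _ _ (ih ω T hω)

lemma IsDual.exp {𝓓 𝓛 : (𝓗 →L[ℂ] 𝓗) →L[ℂ] (𝓗 →L[ℂ] 𝓗)} (h : IsDual 𝓓 𝓛) :
    IsDual (NormedSpace.exp 𝓓) (NormedSpace.exp 𝓛) := by
  intro ω T hω a b
  have h1 := NormedSpace.exp_series_hasSum_exp' (𝕂 := ℂ) 𝓓
  have h2 := NormedSpace.exp_series_hasSum_exp' (𝕂 := ℂ) 𝓛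
  have h3 := (h2.mapL (ContinuousLinearMap.apply ℂ (𝓗 →L[ℂ] 𝓗) T)).mapL
    (ContinuousLinearMap.apply ℂ 𝓗 b) |>.mapL (innerSL ℂ a)
  have h4 := (h1.mapL (ContinuousLinearMap.apply ℂ (𝓗 →L[ℂ] 𝓗)
    (InnerProductSpace.rankOne ℂ b a))).mapL ω
  refine h3.unique (h4.congr_fun ?_)
  intro n
  have h5 := ((h.pow n).smul ((n.factorial : ℂ)⁻¹) ω T hω a b)
  rw [comp_apply] at h5
  simpa only [apply_apply, innerSL_apply_apply] using h5

lemma isDual_lindGen (hU : Continuous fun s => U s) {σ : ℝ} (hσ : 0 < σ) (G : 𝓗 →L[ℂ] 𝓗)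
    (L : 𝒜 → 𝓗 →L[ℂ] 𝓗) : IsDual (dualGen σ U G L) (lindGen σ U G L) :=
  ((isDual_mulLeftRight _ _).add (isDual_mulLeftRight _ _)).add (isDual_sum _ fun α _ =>
    (isDual_integral (integrable_dualGen hU hσ (L α)) (integrable_lindGen hU hσ (L α)) fun _ =>
      (isDual_mulLeftRight _ _).smul _).smul _)

end DualGenerator

/-! ### Contractivity of the dual semigroup -/

section Contraction
open Filter Topology MeasureTheory ContinuousLinearMap

lemma norm_exp_smul_le_one {X : Type*} [NormedAddCommGroup X] [NormedSpace ℂ X] [CompleteSpace X]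
    {D : X →L[ℂ] X} {C : ℝ}
    (hD : ∀ h : ℝ, 0 ≤ h → ‖1 + (h : ℂ) • D‖ ≤ 1 + C * h ^ 2) {t : ℝ} (ht : 0 ≤ t) :
    ‖NormedSpace.exp ((t : ℂ) • D)‖ ≤ 1 := by
  have hder : HasDerivAt (fun u : ℂ => NormedSpace.exp (u • D)) D 0 := by
    simpa [NormedSpace.exp_zero] using hasDerivAt_exp_smul_const (𝕂 := ℂ) D 0
  have key : ∀ ε : ℝ, 0 < ε → ‖NormedSpace.exp ((t : ℂ) • D)‖ ≤ Real.exp (t * (2 * ε)) := by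
    intro ε hε
    have h1 := hder.isLittleO.def hε
    simp only [zero_smul, NormedSpace.exp_zero, sub_zero] at h1
    have htend : Tendsto (fun n : ℕ => ((t / n : ℝ) : ℂ)) atTop (𝓝 0) := by
      rw [← Complex.ofReal_zero]
      exact (Complex.continuous_ofReal.tendsto _).comp (tendsto_const_div_atTop_nhds_zero_nat t)
    have htend' : Tendsto (fun n : ℕ => C * (t / n)) atTop (𝓝 (C * 0)) :=
      (tendsto_const_div_atTop_nhds_zero_nat t).const_mul C
    rw [mul_zero] at htend'
    obtain ⟨n, hn1, hn2, hn3⟩ := ((htend.eventually h1).and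
      ((htend'.eventually_le_const hε).and (eventually_ge_atTop 1))).exists
    have hn0 : (0 : ℝ) < n := by exact_mod_cast hn3
    set h : ℝ := t / n with hh
    have hh0 : 0 ≤ h := by positivity
    have h2 : ‖NormedSpace.exp ((h : ℂ) • D)‖ ≤ Real.exp (h * (2 * ε)) := by
      have e : NormedSpace.exp ((h : ℂ) • D) = (1 + (h : ℂ) • D) +
          (NormedSpace.exp ((h : ℂ) • D) - 1 - (h : ℂ) • D) := by abel
      rw [Complex.norm_real, Real.norm_of_nonneg hh0] at hn1
      rw [e]
      refine (norm_add_le _ _).trans ((add_le_add (hD h hh0) hn1).trans ?_)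
      refine le_trans ?_ (Real.add_one_le_exp _)
      nlinarith [mul_le_mul_of_nonneg_right hn2 hh0]
    have h3 : NormedSpace.exp ((t : ℂ) • D) = NormedSpace.exp ((h : ℂ) • D) ^ n := by
      let _ : NormedAlgebra ℚ (X →L[ℂ] X) := NormedAlgebra.restrictScalars ℚ ℂ _
      rw [← NormedSpace.exp_nsmul, ← Nat.cast_smul_eq_nsmul ℂ, smul_smul, hh]
      have hn0' : (n : ℂ) ≠ 0 := by exact_mod_cast hn0.ne'
      congr 2
      push_cast
      rw [mul_div_cancel₀ _ hn0']
    rw [h3]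
    refine (norm_pow_le' _ hn3).trans ((pow_le_pow_left₀ (norm_nonneg _) h2 n).trans ?_)
    rw [← Real.exp_nat_mul]
    refine le_of_eq ?_
    congr 1
    rw [hh]
    field_simp
  have hlim : Tendsto (fun ε : ℝ => Real.exp (t * (2 * ε))) (𝓝[>] 0) (𝓝 (Real.exp (t * (2 * 0)))) :=
    (Continuous.tendsto (by fun_prop) _).mono_left nhdsWithin_le_nhds
  rw [mul_zero, mul_zero, Real.exp_zero] at hlim
  exact ge_of_tendsto hlim (eventually_mem_nhdsWithin.mono key)

variable {𝒜 𝓗 : Type*} [Fintype 𝒜] [NormedAddCommGroup 𝓗] [InnerProductSpace ℂ 𝓗]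
  [CompleteSpace 𝓗]

lemma opNorm_le_of_norm_inner_le {T : 𝓗 →L[ℂ] 𝓗} {C : ℝ} (hC : 0 ≤ C)
    (h : ∀ a b, ‖⟪a, T b⟫_ℂ‖ ≤ C * ((‖a‖ ^ 2 + ‖b‖ ^ 2) / 2)) : ‖T‖ ≤ C := by
  refine T.opNorm_le_bound hC fun b => ?_
  rcases eq_or_ne (T b) 0 with h0 | h0
  · rw [h0, norm_zero]; positivity
  have hT : 0 < ‖T b‖ := norm_pos_iff.2 h0
  have hb : 0 < ‖b‖ := norm_pos_iff.2 fun hb => h0 (by rw [hb, map_zero])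
  have h1 := h (((‖b‖ / ‖T b‖ : ℝ) : ℂ) • T b) b
  rw [norm_smul, inner_smul_left, norm_mul, inner_self_eq_norm_sq_to_K, Complex.conj_ofReal,
    Complex.norm_real, Real.norm_of_nonneg (by positivity), norm_pow, RCLike.norm_ofReal, abs_norm,
    div_mul_cancel₀ _ hT.ne'] at h1
  have h2 : ‖b‖ / ‖T b‖ * ‖T b‖ ^ 2 = ‖b‖ * ‖T b‖ := by field_simp
  rw [h2] at h1
  exact le_of_mul_le_mul_left (h1.trans (le_of_eq (by ring))) hb

/-- The drift balances the jumps, so that the trace is preserved. -/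
lemma two_mul_re_inner_driftOp {σ : ℝ} (U : UnitaryFlow 𝓗) {g : ℝ → ℂ}
    (hg : Integrable g) (hgs : ∀ s, g s + star (g s) = (gaussCoeff σ * gaussWeight σ s : ℝ))
    (L : 𝒜 → 𝓗 →L[ℂ] 𝓗) (a : 𝓗) :
    2 * (⟪a, driftOp U g hg L a⟫_ℂ).re =
      -(gaussCoeff σ * ∑ α, ∫ s, gaussWeight σ s * ‖U.conj (L α) s a‖ ^ 2) := by
  have h1 : ∀ α s, ⟪a, U.conj (adjoint (L α) ∘L L α) s a⟫_ℂ = ((‖U.conj (L α) s a‖ ^ 2 : ℝ) : ℂ) := by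
    intro α s
    rw [UnitaryFlow.conj_apply, UnitaryFlow.conj_apply, U.norm_map]
    have := U.adj (-s) a (adjoint (L α) (L α (U (-s) a)))
    rw [neg_neg] at this
    rw [comp_apply, ← this, adjoint_inner_right, inner_self_eq_norm_sq_to_K]
    push_cast
    rfl
  have h2 : ∀ α, 2 * (⟪a, twirl U g hg (adjoint (L α) ∘L L α) a⟫_ℂ).re =
      gaussCoeff σ * ∫ s, gaussWeight σ s * ‖U.conj (L α) s a‖ ^ 2 := by
    intro α
    have hi : Integrable fun s => g s * ((‖U.conj (L α) s a‖ ^ 2 : ℝ) : ℂ) := by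
      refine hg.mul_bdd (c := (‖L α‖ * ‖a‖) ^ 2) ?_ (Eventually.of_forall fun s => ?_)
      · have := U.continuous_conj (L α) a
        exact Continuous.aestronglyMeasurable (by fun_prop)
      · rw [Complex.norm_real, Real.norm_of_nonneg (by positivity)]
        gcongr
        exact U.norm_conj_apply_le _ _ _
    rw [inner_twirl]
    simp only [h1]
    rw [show (∫ s, g s * ((‖U.conj (L α) s a‖ ^ 2 : ℝ) : ℂ)).re =
      ∫ s, (g s * ((‖U.conj (L α) s a‖ ^ 2 : ℝ) : ℂ)).re from (integral_re hi).symm,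
      ← integral_const_mul, ← integral_const_mul]
    refine integral_congr_ae (Eventually.of_forall fun s => ?_)
    have h3 := congrArg Complex.re (hgs s)
    simp only [Complex.add_re, Complex.star_def, Complex.conj_re, Complex.ofReal_re] at h3
    simp only [Complex.re_mul_ofReal]
    linear_combination ‖U.conj (L α) s a‖ ^ 2 * h3
  rw [driftOp, neg_apply, sum_apply, inner_neg_right, inner_sum, Complex.neg_re, Complex.re_sum,
    mul_neg, Finset.mul_sum, Finset.mul_sum]
  simp only [h2]

section
variable {U : UnitaryFlow 𝓗} (hU : Continuous fun s => U s) {σ : ℝ} (hσ : 0 < σ)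
  {g : ℝ → ℂ} (hg : Integrable g)
  (hgs : ∀ s, g s + star (g s) = (gaussCoeff σ * gaussWeight σ s : ℝ)) (L : 𝒜 → 𝓗 →L[ℂ] 𝓗)
include hU hσ hgs

lemma norm_one_add_smul_dualGen_le {h : ℝ} (hh : 0 ≤ h) :
    ‖1 + (h : ℂ) • dualGen σ U (driftOp U g hg L) L‖ ≤
      1 + 2 * ‖driftOp U g hg L‖ ^ 2 * h ^ 2 := by
  set G := driftOp U g hg L with hG
  have hc := gaussCoeff_nonneg hσ
  refine opNorm_le_bound _ (by positivity) fun Z => ?_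
  rw [mul_comm _ ‖Z‖]
  refine opNorm_le_of_norm_inner_le (by positivity) fun a b => ?_
  set N : 𝓗 → ℝ := fun a => ∑ α, ∫ s, gaussWeight σ s * ‖U.conj (L α) s a‖ ^ 2 with hN
  have hint : ∀ α (a : 𝓗), Integrable fun s => gaussWeight σ s * ‖U.conj (L α) s a‖ ^ 2 := by
    intro α a
    refine (integrable_gaussWeight hσ).mul_bdd (c := (‖L α‖ * ‖a‖) ^ 2) ?_
      (Eventually.of_forall fun s => ?_)
    · have := U.continuous_conj (L α) a
      exact Continuous.aestronglyMeasurable (by fun_prop)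
    · rw [Real.norm_of_nonneg (by positivity)]
      gcongr
      exact U.norm_conj_apply_le _ _ _
  have hQ : ∀ a : 𝓗, ‖a + (h : ℂ) • G a‖ ^ 2 + h ^ 2 * ‖G a‖ ^ 2 + h * gaussCoeff σ * N a ≤
      (1 + 2 * ‖G‖ ^ 2 * h ^ 2) * ‖a‖ ^ 2 := by
    intro a
    have h1 := two_mul_re_inner_driftOp U hg hgs L a
    have h2 : ‖G a‖ ^ 2 ≤ ‖G‖ ^ 2 * ‖a‖ ^ 2 := by
      rw [← mul_pow]; gcongr; exact G.le_opNorm a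
    rw [@norm_add_sq ℂ, inner_smul_right, norm_smul, mul_pow]
    have h3 : RCLike.re ((h : ℂ) * ⟪a, G a⟫_ℂ) = h * (⟪a, G a⟫_ℂ).re := Complex.re_ofReal_mul _ _
    rw [h3, Complex.norm_real, Real.norm_of_nonneg hh]
    have h4 : 2 * (h * (⟪a, G a⟫_ℂ).re) = -(h * gaussCoeff σ * N a) := by
      rw [mul_left_comm, h1]; ring
    nlinarith [mul_le_mul_of_nonneg_left h2 (sq_nonneg h)]
  have e : ⟪a, (1 + (h : ℂ) • dualGen σ U G L) Z b⟫_ℂ =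
      ⟪a + (h : ℂ) • G a, Z (b + (h : ℂ) • G b)⟫_ℂ - ((h ^ 2 : ℝ) : ℂ) * ⟪G a, Z (G b)⟫_ℂ +
      ((h * gaussCoeff σ : ℝ) : ℂ) *
        ∑ α, ∫ s, (gaussWeight σ s : ℂ) * ⟪U.conj (L α) s a, Z (U.conj (L α) s b)⟫_ℂ := by
    rw [add_apply, add_apply, smul_apply, smul_apply, one_apply_eq_self, inner_add_right,
      inner_smul_right, inner_dualGen hU hσ]
    simp only [map_add, map_smul, inner_add_left, inner_add_right, inner_smul_left,
      inner_smul_right, Complex.conj_ofReal]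
    push_cast
    ring
  have b1 : ‖⟪a + (h : ℂ) • G a, Z (b + (h : ℂ) • G b)⟫_ℂ‖ ≤
      ‖Z‖ * ((‖a + (h : ℂ) • G a‖ ^ 2 + ‖b + (h : ℂ) • G b‖ ^ 2) / 2) := by
    refine (norm_inner_map_le Z _ _).trans ?_
    gcongr
    linarith [two_mul_le_add_sq ‖a + (h : ℂ) • G a‖ ‖b + (h : ℂ) • G b‖]
  have b2 : ‖((h ^ 2 : ℝ) : ℂ) * ⟪G a, Z (G b)⟫_ℂ‖ ≤
      ‖Z‖ * ((h ^ 2 * ‖G a‖ ^ 2 + h ^ 2 * ‖G b‖ ^ 2) / 2) := by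
    rw [norm_mul, Complex.norm_real, Real.norm_of_nonneg (sq_nonneg h)]
    have := mul_le_mul_of_nonneg_left (two_mul_le_add_sq ‖G a‖ ‖G b‖) (norm_nonneg Z)
    nlinarith [mul_le_mul_of_nonneg_left (norm_inner_map_le Z (G a) (G b)) (sq_nonneg h),
      mul_le_mul_of_nonneg_left this (sq_nonneg h)]
  have b3 : ‖((h * gaussCoeff σ : ℝ) : ℂ) *
        ∑ α, ∫ s, (gaussWeight σ s : ℂ) * ⟪U.conj (L α) s a, Z (U.conj (L α) s b)⟫_ℂ‖ ≤
      ‖Z‖ * ((h * gaussCoeff σ * N a + h * gaussCoeff σ * N b) / 2) := by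
    rw [norm_mul, Complex.norm_real, Real.norm_of_nonneg (by positivity)]
    have : ‖∑ α, ∫ s, (gaussWeight σ s : ℂ) * ⟪U.conj (L α) s a, Z (U.conj (L α) s b)⟫_ℂ‖ ≤
        ‖Z‖ * ((N a + N b) / 2) := by
      have e2 : ‖Z‖ * ((N a + N b) / 2) = ∑ α, ∫ s, ‖Z‖ / 2 *
          (gaussWeight σ s * ‖U.conj (L α) s a‖ ^ 2 + gaussWeight σ s * ‖U.conj (L α) s b‖ ^ 2) := by
        simp only [integral_const_mul, integral_add (hint _ a) (hint _ b), hN,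
          ← Finset.sum_add_distrib, ← Finset.mul_sum]
        ring
      rw [e2]
      refine norm_sum_le_of_le _ fun α _ => ?_
      refine norm_integral_le_of_norm_le (((hint α a).add (hint α b)).const_mul _)
        (Eventually.of_forall fun s => ?_)
      rw [norm_mul, Complex.norm_real, Real.norm_of_nonneg (gaussWeight_nonneg _ _)]
      have h5 := mul_le_mul_of_nonneg_left
        (two_mul_le_add_sq ‖U.conj (L α) s a‖ ‖U.conj (L α) s b‖) (norm_nonneg Z)
      nlinarith [mul_le_mul_of_nonneg_left (norm_inner_map_le Z (U.conj (L α) s a)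
        (U.conj (L α) s b)) (gaussWeight_nonneg σ s),
        mul_le_mul_of_nonneg_left h5 (gaussWeight_nonneg σ s)]
    calc _ ≤ h * gaussCoeff σ * (‖Z‖ * ((N a + N b) / 2)) := by gcongr
      _ = _ := by ring
  rw [e]
  refine (norm_add_le _ _).trans ((add_le_add ((norm_sub_le _ _).trans (add_le_add b1 b2)) b3).trans
    ?_)
  have := mul_le_mul_of_nonneg_left (add_le_add (hQ a) (hQ b)) (norm_nonneg Z)
  nlinarith

/-- The dual semigroup is contractive. -/
lemma norm_exp_dualGen_le_one {t : ℝ} (ht : 0 ≤ t) :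
    ‖NormedSpace.exp ((t : ℂ) • dualGen σ U (driftOp U g hg L) L)‖ ≤ 1 :=
  norm_exp_smul_le_one
    (fun _ hh => norm_one_add_smul_dualGen_le hU hσ hg hgs L hh) ht

end

/-! #### The closed span of the matrix units -/

variable {ι : Type*} (b : HilbertBasis ι ℂ 𝓗)

/-- The closed span of the matrix units of a basis. -/
def unitSpan : Submodule ℂ (𝓗 →L[ℂ] 𝓗) :=
  (Submodule.span ℂ (Set.range fun p : ι × ι =>
    InnerProductSpace.rankOne ℂ (b p.1) (b p.2))).topologicalClosure

lemma isClosed_unitSpan : IsClosed (unitSpan b : Set (𝓗 →L[ℂ] 𝓗)) :=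
  Submodule.isClosed_topologicalClosure _

lemma mem_of_basis_mem {W : Submodule ℂ 𝓗} (hW : IsClosed (W : Set 𝓗)) (h : ∀ i, b i ∈ W)
    (x : 𝓗) : x ∈ W := by
  have h1 : Submodule.span ℂ (Set.range b) ≤ W := Submodule.span_le.2 (by rintro _ ⟨i, rfl⟩; exact h i)
  have h2 := Submodule.topologicalClosure_minimal _ h1 hW
  rw [b.dense_span] at h2
  exact h2 trivial

lemma rankOne_mem_unitSpan (x y : 𝓗) : InnerProductSpace.rankOne ℂ x y ∈ unitSpan b := by
  have h1 : ∀ j x, InnerProductSpace.rankOne ℂ x (b j) ∈ unitSpan b := by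
    intro j x
    refine mem_of_basis_mem b (W := (unitSpan b).comap
      ((InnerProductSpace.rankOne ℂ (E := 𝓗) (F := 𝓗)).flip (b j)).toLinearMap)
      ((isClosed_unitSpan b).preimage (ContinuousLinearMap.continuous _)) (fun i => ?_) x
    exact Submodule.le_topologicalClosure _ (Submodule.subset_span ⟨(i, j), rfl⟩)
  refine mem_of_basis_mem b (W := (unitSpan b).comap
    (InnerProductSpace.rankOne ℂ (E := 𝓗) (F := 𝓗) x).toLinearMap)
    ((isClosed_unitSpan b).preimage (ContinuousLinearMap.continuous _)) (fun j => h1 j x) y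

lemma unitSpan_induction {W : Submodule ℂ (𝓗 →L[ℂ] 𝓗)} (hW : IsClosed (W : Set (𝓗 →L[ℂ] 𝓗)))
    (h : ∀ i j, InnerProductSpace.rankOne ℂ (b i) (b j) ∈ W) : unitSpan b ≤ W :=
  Submodule.topologicalClosure_minimal _
    (Submodule.span_le.2 (by rintro _ ⟨p, rfl⟩; exact h p.1 p.2)) hW

lemma mulLeftRight_mem_unitSpan (A B : 𝓗 →L[ℂ] 𝓗) {Z : 𝓗 →L[ℂ] 𝓗} (hZ : Z ∈ unitSpan b) :
    mulLeftRight ℂ (𝓗 →L[ℂ] 𝓗) A B Z ∈ unitSpan b := by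
  refine unitSpan_induction b (W := (unitSpan b).comap
    (mulLeftRight ℂ (𝓗 →L[ℂ] 𝓗) A B).toLinearMap)
    ((isClosed_unitSpan b).preimage (ContinuousLinearMap.continuous _)) (fun i j => ?_) hZ
  rw [Submodule.mem_comap, coe_coe, mulLeftRight_apply, mul_def, mul_def,
    InnerProductSpace.comp_rankOne, InnerProductSpace.rankOne_comp]
  exact rankOne_mem_unitSpan b _ _

lemma integral_mem_of_isClosed {X : Type*} [NormedAddCommGroup X] [NormedSpace ℂ X]
    [CompleteSpace X] {W : Submodule ℂ X} (hW : IsClosed (W : Set X)) {F : ℝ → X}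
    (hF : Continuous F) (hFi : Integrable F) (h : ∀ s, F s ∈ W) : ∫ s, F s ∈ W := by
  have : CompleteSpace W := hW.completeSpace_coe
  have hc : Continuous fun s => (⟨F s, h s⟩ : W) := hF.subtype_mk h
  have hi : Integrable fun s => (⟨F s, h s⟩ : W) :=
    hFi.mono hc.aestronglyMeasurable (Eventually.of_forall fun s => le_rfl)
  have := W.subtypeL.integral_comp_comm hi
  simp only [Submodule.subtypeL_apply] at this
  rw [this]
  exact Subtype.coe_prop _

lemma dualGen_mem_unitSpan {U : UnitaryFlow 𝓗} (hU : Continuous fun s => U s) {σ : ℝ}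
    (hσ : 0 < σ) (G : 𝓗 →L[ℂ] 𝓗) (L : 𝒜 → 𝓗 →L[ℂ] 𝓗) {Z : 𝓗 →L[ℂ] 𝓗} (hZ : Z ∈ unitSpan b) :
    dualGen σ U G L Z ∈ unitSpan b := by
  rw [dualGen_apply hU hσ]
  refine add_mem (add_mem ?_ ?_) (sum_mem fun α _ => Submodule.smul_mem _ _ ?_)
  · simpa using mulLeftRight_mem_unitSpan b 1 G hZ
  · simpa using mulLeftRight_mem_unitSpan b (star G) 1 hZ
  · refine integral_mem_of_isClosed (isClosed_unitSpan b) ?_ ?_ fun s => ?_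
    · have h1 := continuous_conj_of_norm hU (L α)
      have h2 := continuous_gaussWeight σ
      have h3 : Continuous fun s => star (U.conj (L α) s) := continuous_star.comp h1
      exact (Complex.continuous_ofReal.comp h2).smul ((h3.mul continuous_const).mul h1)
    · simpa only [smul_apply, mulLeftRight_apply] using
        (integrable_dualGen hU hσ (L α)).apply_continuousLinearMap Z
    · have h1 := mulLeftRight_mem_unitSpan b (star (U.conj (L α) s)) (U.conj (L α) s) hZ
      rw [mulLeftRight_apply] at h1
      exact Submodule.smul_mem _ _ h1

lemma exp_mem_of_isClosed {X : Type*} [NormedAddCommGroup X] [NormedSpace ℂ X]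
    [CompleteSpace X] {W : Submodule ℂ X} (hW : IsClosed (W : Set X)) {D : X →L[ℂ] X}
    (hD : ∀ x ∈ W, D x ∈ W) {x : X} (hx : x ∈ W) : NormedSpace.exp D x ∈ W := by
  have h1 := (NormedSpace.exp_series_hasSum_exp' (𝕂 := ℂ) D).mapL (ContinuousLinearMap.apply ℂ X x)
  refine hW.mem_of_tendsto h1 (Eventually.of_forall fun s => sum_mem fun n hn => ?_)
  clear hn
  rw [apply_apply, smul_apply]
  refine Submodule.smul_mem _ _ ?_
  induction n with
  | zero => simpa using hx
  | succ n ih => rw [pow_succ']; exact hD _ ih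

/-- Error accumulation for an implicit Euler scheme against a contraction semigroup, tested on an
invariant subspace. -/
lemma norm_euler_sub_le {X : Type*} [NormedAddCommGroup X] [NormedSpace ℂ X]
    {D E : X →L[ℂ] X} {W : Submodule ℂ X} (hE : ‖E‖ ≤ 1) (hEW : ∀ x ∈ W, E x ∈ W)
    {h δ c : ℝ} (hδ : 0 ≤ δ) {Ω : ℕ → X →L[ℂ] ℂ} {n : ℕ} (hΩ : ∀ k, ‖Ω k‖ ≤ c)
    (hstep : ∀ k < n, ∀ Z ∈ W,
      ‖Ω (k + 1) Z - Ω k Z - (h : ℂ) * Ω (k + 1) (D Z)‖ ≤ δ * ‖Z‖) {Z : X} (hZ : Z ∈ W) :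
    ‖Ω n Z - Ω 0 ((E ^ n) Z)‖ ≤ n * (δ + c * ‖1 - (1 - (h : ℂ) • D) * E‖) * ‖Z‖ := by
  have hc : 0 ≤ c := (norm_nonneg _).trans (hΩ 0)
  set η := δ + c * ‖1 - (1 - (h : ℂ) • D) * E‖ with hη
  have hη0 : 0 ≤ η := by positivity
  have hone : ∀ k < n, ∀ Z ∈ W, ‖Ω (k + 1) Z - Ω k (E Z)‖ ≤ η * ‖Z‖ := by
    intro k hk Z hZ
    have e : Ω (k + 1) Z - Ω k (E Z) = (Ω (k + 1) (E Z) - Ω k (E Z) - (h : ℂ) * Ω (k + 1) (D (E Z))) +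
        Ω (k + 1) ((1 - (1 - (h : ℂ) • D) * E) Z) := by
      simp only [sub_apply, one_apply_eq_self, mul_apply_eq_comp, smul_apply, map_sub, map_smul,
        smul_eq_mul]
      ring
    have hEZ : ‖E Z‖ ≤ ‖Z‖ := by simpa using E.le_of_opNorm_le hE Z
    rw [e]
    refine (norm_add_le _ _).trans ?_
    have h1 := hstep k hk (E Z) (hEW Z hZ)
    have h2 := (Ω (k + 1)).le_of_opNorm_le (hΩ (k + 1)) ((1 - (1 - (h : ℂ) • D) * E) Z)
    have h3 := (1 - (1 - (h : ℂ) • D) * E).le_opNorm Z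
    calc _ ≤ δ * ‖Z‖ + c * (‖1 - (1 - (h : ℂ) • D) * E‖ * ‖Z‖) :=
          add_le_add (h1.trans (by gcongr)) (h2.trans (by gcongr))
      _ = η * ‖Z‖ := by rw [hη]; ring
  have main : ∀ k ≤ n, ∀ Z ∈ W, ‖Ω k Z - Ω 0 ((E ^ k) Z)‖ ≤ k * η * ‖Z‖ := by
    intro k
    induction k with
    | zero => intro _ Z _; simp
    | succ k ih =>
      intro hk Z hZ
      have hEZ : ‖E Z‖ ≤ ‖Z‖ := by simpa using E.le_of_opNorm_le hE Z
      have e : Ω (k + 1) Z - Ω 0 ((E ^ (k + 1)) Z) =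
          (Ω (k + 1) Z - Ω k (E Z)) + (Ω k (E Z) - Ω 0 ((E ^ k) (E Z))) := by
        rw [pow_succ, mul_apply_eq_comp]; ring
      rw [e]
      refine (norm_add_le _ _).trans ((add_le_add (hone k hk Z hZ)
        (ih (by lia) (E Z) (hEW Z hZ))).trans ?_)
      push_cast
      nlinarith [mul_le_mul_of_nonneg_left hEZ (mul_nonneg (Nat.cast_nonneg (α := ℝ) k) hη0)]
  exact main n le_rfl Z hZ

/-! #### The trace norm -/

lemma norm_sum_smul_rankOne_le_one {n : ℕ} {e f : Fin n → 𝓗} (he : Orthonormal ℂ e)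
    (hf : Orthonormal ℂ f) {u : Fin n → ℂ} (hu : ∀ i, ‖u i‖ ≤ 1) :
    ‖∑ i, u i • InnerProductSpace.rankOne ℂ (f i) (e i)‖ ≤ 1 := by
  refine opNorm_le_bound _ zero_le_one fun x => ?_
  have h1 : (∑ i, u i • InnerProductSpace.rankOne ℂ (f i) (e i)) x =
      ∑ i, (u i * ⟪e i, x⟫_ℂ) • f i := by
    simp only [sum_apply, smul_apply, InnerProductSpace.rankOne_apply, smul_smul]
  rw [h1, one_mul]
  refine le_of_sq_le_sq ?_ (norm_nonneg _)
  have h2 : ‖∑ i, (u i * ⟪e i, x⟫_ℂ) • f i‖ ^ 2 = ∑ i, ‖u i * ⟪e i, x⟫_ℂ‖ ^ 2 := by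
    have h3 := hf.inner_sum (fun i => u i * ⟪e i, x⟫_ℂ) (fun i => u i * ⟪e i, x⟫_ℂ) Finset.univ
    have h4 : ((‖∑ i, (u i * ⟪e i, x⟫_ℂ) • f i‖ ^ 2 : ℝ) : ℂ) =
        ((∑ i, ‖u i * ⟪e i, x⟫_ℂ‖ ^ 2 : ℝ) : ℂ) := by
      rw [inner_self_eq_norm_sq_to_K] at h3
      push_cast
      refine Eq.trans h3 (Finset.sum_congr rfl fun i _ => ?_)
      rw [RCLike.conj_mul]
      rfl
    exact_mod_cast h4
  rw [h2]
  refine le_trans (Finset.sum_le_sum fun i _ => ?_) (he.sum_inner_products_le x (s := Finset.univ))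
  rw [norm_mul]
  gcongr
  exact mul_le_of_le_one_left (norm_nonneg _) (hu i)

lemma traceNorm_le_of_forall {T : 𝓗 →L[ℂ] 𝓗} {c : ℝ}
    (h : ∀ (n : ℕ) (e f : Fin n → 𝓗) (u : Fin n → ℂ),
      ‖∑ i, u i • InnerProductSpace.rankOne ℂ (f i) (e i)‖ ≤ 1 →
      ‖∑ i, u i * ⟪e i, T (f i)⟫_ℂ‖ ≤ c) : traceNorm T ≤ ENNReal.ofReal c := by
  refine iSup_le fun n => iSup_le fun e => iSup_le fun f => iSup_le fun he => iSup_le fun hf => ?_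
  have hex : ∀ z : ℂ, ∃ u : ℂ, ‖u‖ ≤ 1 ∧ u * z = (‖z‖ : ℂ) := fun z => by
    rcases eq_or_ne z 0 with rfl | hz
    · exact ⟨0, by simp, by simp⟩
    · have hz' : (‖z‖ : ℂ) ≠ 0 := by exact_mod_cast norm_ne_zero_iff.2 hz
      refine ⟨(‖z‖ : ℂ) / z, ?_, div_mul_cancel₀ _ hz⟩
      rw [norm_div, Complex.norm_real, norm_norm, div_self (norm_ne_zero_iff.2 hz)]
  choose u hu1 hu2 using fun i => hex ⟪e i, T (f i)⟫_ℂ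
  have := h n e f u (norm_sum_smul_rankOne_le_one he hf hu1)
  simp only [hu2] at this
  rw [← ENNReal.ofReal_sum_of_nonneg fun i _ => norm_nonneg _]
  refine ENNReal.ofReal_le_ofReal (le_trans (le_of_eq ?_) this)
  rw [← Complex.ofReal_sum, Complex.norm_real, Real.norm_of_nonneg
    (Finset.sum_nonneg fun i _ => norm_nonneg _)]

lemma Represents.sum_inner {ω : (𝓗 →L[ℂ] 𝓗) →L[ℂ] ℂ} {T : 𝓗 →L[ℂ] 𝓗} (h : Represents ω T) {n : ℕ}
    (e f : Fin n → 𝓗) (u : Fin n → ℂ) :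
    ∑ i, u i * ⟪e i, T (f i)⟫_ℂ = ω (∑ i, u i • InnerProductSpace.rankOne ℂ (f i) (e i)) := by
  simp only [map_sum, map_smul, smul_eq_mul, h _ _]

end Contraction

/-! ### The exact flow and the jumps in the energy basis -/

section ExactFlow
open Filter Topology MeasureTheory ContinuousLinearMap

variable {ι 𝒜 𝓗 : Type*} [NormedAddCommGroup 𝓗] [InnerProductSpace ℂ 𝓗]
  [CompleteSpace 𝓗]

lemma memℓp_two_iff {J : Type*} (x : J → ℂ) : Memℓp x 2 ↔ Summable fun i => ‖x i‖ ^ 2 := by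
  rw [memℓp_gen_iff (by norm_num)]
  simp

lemma hasSum_norm_sq_lp {J : Type*} (x : lp (fun _ : J => ℂ) 2) :
    HasSum (fun i => ‖x i‖ ^ 2) (‖x‖ ^ 2) := by
  have := lp.hasSum_norm (p := 2) (by norm_num) x
  simpa using this

namespace System
variable (S : System ι 𝒜 𝓗)

/-- The eigenvalue `e^{itE}` of the time evolution. -/
def phase (t : ℝ) (i : ι) : ℂ := Complex.exp (Complex.I * t * S.energy i)

lemma norm_phase (t : ℝ) (i : ι) : ‖S.phase t i‖ = 1 := by
  rw [phase, mul_assoc, ← Complex.ofReal_mul, mul_comm, Complex.norm_exp_ofReal_mul_I]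

lemma star_phase (t : ℝ) (i : ι) : star (S.phase t i) = S.phase (-t) i := by
  rw [phase, phase, Complex.star_def, ← Complex.exp_conj]
  simp

lemma continuous_phase (i : ι) : Continuous fun t => S.phase t i := by unfold phase; fun_prop

/-- The unitary time evolution `e^{itH}`. -/
def flow : UnitaryFlow 𝓗 :=
  have hmem : ∀ (t : ℝ) (x : lp (fun _ : ι => ℂ) 2), Memℓp (fun i => S.phase t i * x i) 2 :=
    fun t x => by
      rw [memℓp_two_iff]
      simpa only [norm_mul, S.norm_phase, one_mul] using (memℓp_two_iff _).1 (lp.memℓp x)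
  let D : ℝ → lp (fun _ : ι => ℂ) 2 →L[ℂ] lp (fun _ : ι => ℂ) 2 := fun t =>
    LinearMap.mkContinuous
      { toFun := fun x => ⟨fun i => S.phase t i * x i, hmem t x⟩
        map_add' := fun x y => by ext i; exact mul_add _ _ _
        map_smul' := fun c x => by ext i; exact mul_left_comm _ _ _ } 1 fun x => by
      rw [one_mul]
      refine le_of_sq_le_sq (le_of_eq ?_) (norm_nonneg _)
      refine (hasSum_norm_sq_lp _).unique ((hasSum_norm_sq_lp x).congr_fun fun i => ?_)
      show ‖S.phase t i * x i‖ ^ 2 = _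
      rw [norm_mul, S.norm_phase, one_mul]
  let U : ℝ → 𝓗 →L[ℂ] 𝓗 := fun t =>
    (S.basis.repr.symm : lp (fun _ : ι => ℂ) 2 →L[ℂ] 𝓗) ∘L D t ∘L (S.basis.repr : 𝓗 →L[ℂ] lp (fun _ : ι => ℂ) 2)
  have hU : ∀ t ψ i, S.basis.repr (U t ψ) i = S.phase t i * S.basis.repr ψ i := fun t ψ i => by
    show S.basis.repr (S.basis.repr.symm (D t (S.basis.repr ψ))) i = _
    rw [LinearIsometryEquiv.apply_symm_apply]
    rfl
  have hnorm : ∀ t ψ, ‖U t ψ‖ = ‖ψ‖ := fun t ψ => by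
    rw [← S.basis.repr.norm_map, ← S.basis.repr.norm_map ψ]
    refine (sq_eq_sq₀ (norm_nonneg _) (norm_nonneg _)).1 ?_
    refine (hasSum_norm_sq_lp _).unique ((hasSum_norm_sq_lp _).congr_fun fun i => ?_)
    rw [hU, norm_mul, S.norm_phase, one_mul]
  { toFun := U
    norm_map := hnorm
    cont := fun ψ => by
      let W : Submodule ℂ 𝓗 :=
        { carrier := {ψ | Continuous fun t => U t ψ}
          add_mem' := fun {a b} ha hb => by
            simp only [Set.mem_ofPred_eq, map_add] at *
            exact ha.add hb
          zero_mem' := by simp only [Set.mem_ofPred_eq, map_zero]; exact continuous_const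
          smul_mem' := fun c x hx => by
            simp only [Set.mem_ofPred_eq, map_smul] at *
            exact hx.const_smul c }
      have hW : IsClosed (W : Set 𝓗) := by
        refine isClosed_of_closure_subset fun ψ hψ => ?_
        refine continuous_of_uniform_approx_of_continuous fun u hu => ?_
        obtain ⟨ε, hε, hεu⟩ := Metric.mem_uniformity_dist.1 hu
        obtain ⟨φ, hφ, hd⟩ := Metric.mem_closure_iff.1 hψ ε hε
        refine ⟨fun t => U t φ, hφ, fun t => hεu ?_⟩
        rw [dist_eq_norm, ← map_sub, hnorm, ← dist_eq_norm]
        exact hd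
      refine mem_of_basis_mem S.basis hW (fun i => ?_) ψ
      have : ∀ t, U t (S.basis i) = S.phase t i • S.basis i := fun t => by
        apply S.basis.repr.injective
        ext j
        rw [hU, map_smul]
        show _ = S.phase t i * S.basis.repr (S.basis i) j
        classical
        rw [S.basis.repr_self]
        by_cases hj : j = i
        · rw [hj]
        · simp [lp.single_apply, hj]
      show Continuous fun t => U t (S.basis i)
      simp only [this]
      exact (S.continuous_phase i).smul continuous_const
    adj := fun s φ ψ => by
      rw [← S.basis.repr.inner_map_map, ← S.basis.repr.inner_map_map φ]
      refine (lp.hasSum_inner _ _).unique ((lp.hasSum_inner _ _).congr_fun fun i => ?_)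
      rw [hU, hU, ← S.star_phase]
      simp only [RCLike.inner_apply, map_mul, Complex.star_def]
      ring }

lemma inner_basis_flow (t : ℝ) (ψ : 𝓗) (i : ι) :
    ⟪S.basis i, S.flow t ψ⟫_ℂ = S.phase t i * ⟪S.basis i, ψ⟫_ℂ := by
  rw [← S.basis.repr_apply_apply, ← S.basis.repr_apply_apply]
  show S.basis.repr (S.basis.repr.symm _) i = _
  rw [LinearIsometryEquiv.apply_symm_apply]
  rfl

lemma ext_basis {φ ψ : 𝓗} (h : ∀ i, ⟪S.basis i, φ⟫_ℂ = ⟪S.basis i, ψ⟫_ℂ) : φ = ψ := by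
  apply S.basis.repr.injective
  ext i
  rw [S.basis.repr_apply_apply, S.basis.repr_apply_apply, h]

lemma inner_basis_eq (i j : ι) [Decidable (i = j)] :
    ⟪S.basis i, S.basis j⟫_ℂ = if i = j then 1 else 0 := by
  classical
  rw [orthonormal_iff_ite.1 S.basis.orthonormal]
  congr

lemma flow_basis (t : ℝ) (i : ι) : S.flow t (S.basis i) = S.phase t i • S.basis i := by
  classical
  refine S.ext_basis fun j => ?_
  rw [inner_basis_flow, inner_smul_right, inner_basis_eq]
  split_ifs with h
  · rw [h]
  · simp

lemma hasSum_fun_H {φ : ℝ → ℂ} {ψ η : 𝓗}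
    (h : ∀ i, ⟪S.basis i, η⟫_ℂ = φ (S.energy i) * ⟪S.basis i, ψ⟫_ℂ) : S.fun_H φ ψ = η := by
  have := S.basis.hasSum_repr η
  simp only [S.basis.repr_apply_apply, h] at this
  exact this.tsum_eq

lemma evolve_eq (t : ℝ) (ψ : 𝓗) : S.evolve t ψ = S.flow t ψ :=
  S.hasSum_fun_H fun i => S.inner_basis_flow t ψ i

/-- The vector `A^α |E k⟩`. -/
def jumpVec (α : 𝒜) (k : ι) : 𝓗 := applyAt (S.A α) (S.basis k)

/-- The matrix of the jump `A^α`. -/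
def entry (α : 𝒜) (k l : ι) : ℂ := ⟪S.basis k, S.jumpVec α l⟫_ℂ

/-- The time average `∫ f(s) e^{-isE k} e^{isH} ψ ds`. -/
def average (f : 𝓢(ℝ, ℂ)) (k : ι) (ψ : 𝓗) : 𝓗 := ∫ s, (f s * S.phase (-s) k) • S.flow s ψ

/-- The vector `L^α |E k⟩` for the integrated jump `L^α`. -/
def lindVec (f : 𝓢(ℝ, ℂ)) (α : 𝒜) (k : ι) : 𝓗 := S.average f k (S.jumpVec α k)

section average
variable {f : 𝓢(ℝ, ℂ)} (hf : Integrable f)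
include hf

lemma integrable_average (k : ι) (ψ : 𝓗) :
    Integrable fun s => (f s * S.phase (-s) k) • S.flow s ψ := by
  refine (hf.mul_bdd (c := 1) ((S.continuous_phase k).comp continuous_neg).aestronglyMeasurable
    (Eventually.of_forall fun s => (S.norm_phase _ _).le)).smul_bdd
    (f := fun s => S.flow s ψ) ‖ψ‖ (S.flow.cont ψ).aestronglyMeasurable
    (Eventually.of_forall fun s => (S.flow.norm_map s ψ).le)

lemma norm_average_le (k : ι) (ψ : 𝓗) : ‖S.average f k ψ‖ ≤ (∫ s, ‖f s‖) * ‖ψ‖ := by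
  rw [average, ← integral_mul_const]
  refine norm_integral_le_of_norm_le (hf.norm.mul_const _) (Eventually.of_forall fun s => ?_)
  rw [norm_smul, norm_mul, S.norm_phase, mul_one, S.flow.norm_map]

lemma average_sub (k : ι) (φ ψ : 𝓗) :
    S.average f k (φ - ψ) = S.average f k φ - S.average f k ψ := by
  rw [average, average, average, ← integral_sub (S.integrable_average hf k φ)
    (S.integrable_average hf k ψ)]
  simp only [map_sub, smul_sub]

lemma inner_basis_average (k m : ι) (ψ : 𝓗) : ⟪S.basis m, S.average f k ψ⟫_ℂ =
    hat f (S.energy m - S.energy k) * ⟪S.basis m, ψ⟫_ℂ := by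
  rw [average, ← integral_inner (S.integrable_average hf k ψ), hat, ← integral_mul_const]
  refine integral_congr_ae (Eventually.of_forall fun s => ?_)
  simp only [inner_smul_right, inner_basis_flow, phase]
  have e : Complex.exp (Complex.I * ((-s : ℝ) : ℂ) * S.energy k) * Complex.exp
      (Complex.I * s * S.energy m) = Complex.exp (Complex.I * s * ((S.energy m - S.energy k : ℝ) : ℂ)) := by
    rw [← Complex.exp_add]
    congr 1
    push_cast
    ring
  rw [← e]
  ring

lemma inner_basis_lindVec (α : 𝒜) (k m : ι) : ⟪S.basis m, S.lindVec f α k⟫_ℂ =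
    hat f (S.energy m - S.energy k) * S.entry α m k :=
  S.inner_basis_average hf k m _

lemma twirl_flow_basis (B : 𝓗 →L[ℂ] 𝓗) (k : ι) :
    twirl S.flow f hf B (S.basis k) = S.average f k (B (S.basis k)) := by
  rw [twirl_apply, average]
  refine integral_congr_ae (Eventually.of_forall fun s => ?_)
  simp only [UnitaryFlow.conj_apply, flow_basis, map_smul, smul_smul]

end average

end System
end ExactFlow

/-! ### The Dirichlet form on matrix units -/

section FormAlgebra
open Filter Topology MeasureTheory

/-- The Gaussian in the frequency domain. -/
def freqGauss (σ ω : ℝ) : ℝ := Real.exp (-(ω ^ 2 / (8 * σ ^ 2)))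

lemma freqGauss_neg (σ ω : ℝ) : freqGauss σ (-ω) = freqGauss σ ω := by simp [freqGauss]

lemma tendsto_prod_self_atTop {J : Type*} :
    Tendsto (fun s : Finset J => s ×ˢ s) atTop atTop := by
  classical
  refine tendsto_atTop.2 fun B => ?_
  filter_upwards [eventually_ge_atTop (B.image Prod.fst ∪ B.image Prod.snd)] with s hs
  intro z hz
  exact Finset.mem_product.2 ⟨hs (Finset.mem_union_left _ (Finset.mem_image_of_mem _ hz)),
    hs (Finset.mem_union_right _ (Finset.mem_image_of_mem _ hz))⟩

/-! #### Positivity of the coefficients -/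

section kernels
variable {J : Type*} (s : Finset J) (ν : J → ℝ)

/-- The Gaussian is a positive definite function. -/
lemma re_sum_freqGauss_nonneg {σ : ℝ} (hσ : 0 < σ) (z : J → ℂ) :
    0 ≤ (∑ a ∈ s, ∑ b ∈ s, (freqGauss σ (ν a - ν b) : ℂ) * (star (z a) * z b)).re := by
  have hc : 0 < Real.sqrt (Real.pi / (2 * σ ^ 2)) := by positivity
  have hi : ∀ ω : ℝ, Integrable fun t : ℝ =>
      (Real.exp (-(2 * σ ^ 2 * t ^ 2)) : ℂ) * Complex.exp (Complex.I * t * ω) := fun ω => by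
    refine (integrable_gaussWeight hσ).ofReal.mul_bdd (c := 1) (by fun_prop)
      (Eventually.of_forall fun t => ?_)
    rw [mul_assoc, ← Complex.ofReal_mul, mul_comm, Complex.norm_exp_ofReal_mul_I]
  have e : (Real.sqrt (Real.pi / (2 * σ ^ 2)) : ℂ) *
      ∑ a ∈ s, ∑ b ∈ s, (freqGauss σ (ν a - ν b) : ℂ) * (star (z a) * z b) =
      ((∫ t : ℝ, gaussWeight σ t *
        ‖∑ a ∈ s, Complex.exp (-(Complex.I * t * ν a)) * z a‖ ^ 2 : ℝ) : ℂ) := by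
    have e1 : ∀ t : ℝ, ((gaussWeight σ t *
        ‖∑ a ∈ s, Complex.exp (-(Complex.I * t * ν a)) * z a‖ ^ 2 : ℝ) : ℂ) =
        ∑ a ∈ s, ∑ b ∈ s, (Real.exp (-(2 * σ ^ 2 * t ^ 2)) : ℂ) *
          Complex.exp (Complex.I * t * ((ν a - ν b : ℝ) : ℂ)) * (star (z a) * z b) := by
      intro t
      rw [Complex.ofReal_mul, Complex.ofReal_pow, ← Complex.conj_mul', map_sum, Finset.sum_mul_sum,
        Finset.mul_sum]
      refine Finset.sum_congr rfl fun a _ => ?_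
      rw [Finset.mul_sum]
      refine Finset.sum_congr rfl fun b _ => ?_
      have : Complex.exp (Complex.I * t * ((ν a - ν b : ℝ) : ℂ)) =
          (starRingEnd ℂ) (Complex.exp (-(Complex.I * t * ν a))) *
            Complex.exp (-(Complex.I * t * ν b)) := by
        rw [← Complex.exp_conj, ← Complex.exp_add]
        congr 1
        simp only [map_neg, map_mul, Complex.conj_I, Complex.conj_ofReal]
        push_cast
        ring
      rw [this, map_mul, Complex.star_def, gaussWeight]
      ring
    rw [← integral_complex_ofReal]
    simp only [e1]
    rw [integral_finsetSum _ fun a _ => integrable_finsetSum _ fun b _ => (hi _).mul_const _,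
      Finset.mul_sum]
    refine Finset.sum_congr rfl fun a _ => ?_
    rw [integral_finsetSum _ fun b _ => (hi _).mul_const _, Finset.mul_sum]
    refine Finset.sum_congr rfl fun b _ => ?_
    rw [integral_mul_const, gaussian_integral_exp hσ, freqGauss]
    push_cast
    ring
  have h := congrArg Complex.re e
  rw [Complex.re_ofReal_mul, Complex.ofReal_re] at h
  have h2 : 0 ≤ ∫ t : ℝ, gaussWeight σ t *
      ‖∑ a ∈ s, Complex.exp (-(Complex.I * t * ν a)) * z a‖ ^ 2 :=
    integral_nonneg fun t => mul_nonneg (gaussWeight_nonneg _ _) (sq_nonneg _)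
  rw [← h] at h2
  exact nonneg_of_mul_nonneg_right h2 hc

/-- The product of the Gaussian and a Cauchy kernel is positive definite. -/
lemma re_sum_cauchy_nonneg {σ : ℝ} (hσ : 0 < σ) {p : J → ℝ} (hp : ∀ a, 0 < p a) (z : J → ℂ) :
    0 ≤ (∑ a ∈ s, ∑ b ∈ s,
      ((freqGauss σ (ν a - ν b) / (p a + p b) : ℝ) : ℂ) * (star (z a) * z b)).re := by
  have hi : ∀ a b, IntegrableOn (fun u : ℝ => Real.exp (-(p a + p b) * u)) (Set.Ioi 0) := fun a b =>
    integrableOn_exp_mul_Ioi (by linarith [hp a, hp b]) 0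
  have hI : ∀ a b, ∫ u in Set.Ioi (0 : ℝ), Real.exp (-(p a + p b) * u) = 1 / (p a + p b) := by
    intro a b
    rw [integral_exp_mul_Ioi (by linarith [hp a, hp b])]
    rw [mul_zero, Real.exp_zero, neg_div_neg_eq]
  have e : (∑ a ∈ s, ∑ b ∈ s,
      ((freqGauss σ (ν a - ν b) / (p a + p b) : ℝ) : ℂ) * (star (z a) * z b)).re =
      ∫ u in Set.Ioi (0 : ℝ), (∑ a ∈ s, ∑ b ∈ s, (freqGauss σ (ν a - ν b) : ℂ) *
        (star ((Real.exp (-(p a * u)) : ℂ) * z a) * ((Real.exp (-(p b * u)) : ℂ) * z b))).re := by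
    have e1 : ∀ u : ℝ, (∑ a ∈ s, ∑ b ∈ s, (freqGauss σ (ν a - ν b) : ℂ) *
        (star ((Real.exp (-(p a * u)) : ℂ) * z a) * ((Real.exp (-(p b * u)) : ℂ) * z b))).re =
        ∑ a ∈ s, ∑ b ∈ s, (freqGauss σ (ν a - ν b) * (star (z a) * z b).re) *
          Real.exp (-(p a + p b) * u) := by
      intro u
      rw [Complex.re_sum]
      refine Finset.sum_congr rfl fun a _ => ?_
      rw [Complex.re_sum]
      refine Finset.sum_congr rfl fun b _ => ?_
      have : Real.exp (-(p a + p b) * u) = Real.exp (-(p a * u)) * Real.exp (-(p b * u)) := by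
        rw [← Real.exp_add]; congr 1; ring
      rw [this, star_mul', Complex.star_def, Complex.conj_ofReal,
        show (freqGauss σ (ν a - ν b) : ℂ) * ((Real.exp (-(p a * u)) : ℂ) * (starRingEnd ℂ) (z a) *
          ((Real.exp (-(p b * u)) : ℂ) * z b)) =
          ((freqGauss σ (ν a - ν b) * Real.exp (-(p a * u)) * Real.exp (-(p b * u)) : ℝ) : ℂ) *
            ((starRingEnd ℂ) (z a) * z b) by push_cast; ring, Complex.re_ofReal_mul]
      ring
    simp only [e1]
    rw [integral_finsetSum _ fun a _ => integrable_finsetSum _ fun b _ => (hi a b).const_mul _,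
      Complex.re_sum]
    refine Finset.sum_congr rfl fun a _ => ?_
    rw [integral_finsetSum _ fun b _ => (hi a b).const_mul _, Complex.re_sum]
    refine Finset.sum_congr rfl fun b _ => ?_
    rw [integral_const_mul, hI, Complex.re_ofReal_mul]
    ring
  rw [e]
  exact integral_nonneg fun u => re_sum_freqGauss_nonneg s ν hσ _

end kernels

namespace System

lemma formCoeff_eq (β σ : ℝ) (f : 𝓢(ℝ, ℂ)) (ν₁ ν₂ : ℝ) :
    formCoeff β σ f ν₁ ν₂ = ((freqGauss σ (ν₁ - ν₂) /
      ((Real.exp (β * ν₁ / 4))⁻¹ ^ 2 + (Real.exp (β * ν₂ / 4))⁻¹ ^ 2) : ℝ) : ℂ) *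
      star (hat f ν₁) * hat f ν₂ := by
  have h1 : Real.exp (β * (ν₁ + ν₂) / 4) = Real.exp (β * ν₁ / 4) * Real.exp (β * ν₂ / 4) := by
    rw [← Real.exp_add]; congr 1; ring
  have h2 : 2 * Real.cosh ((ν₁ - ν₂) * β / 4) =
      Real.exp (β * ν₁ / 4) * (Real.exp (β * ν₂ / 4))⁻¹ +
        (Real.exp (β * ν₁ / 4))⁻¹ * Real.exp (β * ν₂ / 4) := by
    rw [Real.cosh_eq, ← Real.exp_neg, ← Real.exp_neg, ← Real.exp_add, ← Real.exp_add]
    ring_nf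
  rw [formCoeff, freqGauss, h1, h2]
  congr 3
  have hx := Real.exp_pos (β * ν₁ / 4)
  have hy := Real.exp_pos (β * ν₂ / 4)
  field_simp
  ring

lemma star_formCoeff (β σ : ℝ) (f : 𝓢(ℝ, ℂ)) (ν₁ ν₂ : ℝ) :
    star (formCoeff β σ f ν₁ ν₂) = formCoeff β σ f ν₂ ν₁ := by
  rw [formCoeff_eq, formCoeff_eq, star_mul', star_mul', star_star, Complex.star_def,
    Complex.conj_ofReal, ← neg_sub ν₂ ν₁, freqGauss_neg, add_comm]
  ring

lemma re_sum_formCoeff_nonneg {J : Type*} (s : Finset J) (ν : J → ℝ) (β : ℝ) {σ : ℝ} (hσ : 0 < σ)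
    (f : 𝓢(ℝ, ℂ)) (z : J → ℂ) :
    0 ≤ (∑ a ∈ s, ∑ b ∈ s, formCoeff β σ f (ν a) (ν b) * (star (z a) * z b)).re := by
  have := re_sum_cauchy_nonneg s ν hσ (p := fun a => (Real.exp (β * ν a / 4))⁻¹ ^ 2)
    (fun a => by positivity) (fun a => hat f (ν a) * z a)
  refine this.trans (le_of_eq ?_)
  congr 1
  refine Finset.sum_congr rfl fun a _ => Finset.sum_congr rfl fun b _ => ?_
  rw [formCoeff_eq, star_mul']
  ring

variable {ι 𝒜 𝓗 : Type*} [NormedAddCommGroup 𝓗] [InnerProductSpace ℂ 𝓗] [CompleteSpace 𝓗]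
  (S : System ι 𝒜 𝓗)

lemma jumpEntry_eq (α : 𝒜) (ν : ℝ) (k l : ι) [Decidable (S.energy k = S.energy l + ν)] :
    S.jumpEntry α ν k l = if S.energy k = S.energy l + ν then S.entry α k l else 0 := by
  unfold jumpEntry entry jumpVec
  congr

lemma jumpEntry_self (α : 𝒜) (k l : ι) :
    S.jumpEntry α (S.energy k - S.energy l) k l = S.entry α k l := by
  classical
  rw [jumpEntry_eq, if_pos (by ring)]

lemma jumpEntry_ne {α : 𝒜} {ν : ℝ} {k l : ι} (h : ν ≠ S.energy k - S.energy l) :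
    S.jumpEntry α ν k l = 0 := by
  classical
  rw [jumpEntry_eq, if_neg fun h' => h (by linarith)]

open Classical in
/-- The first part of `δ^α_ν` of the matrix unit with index `q`. -/
def deltaLeft (β : ℝ) (α : 𝒜) (ν : ℝ) (q p : ι × ι) : ℂ :=
  if p.2 = q.2 then (Real.exp (-(β * ν / 4)) : ℂ) * S.jumpEntry α ν p.1 q.1 else 0

open Classical in
/-- The second part of `δ^α_ν` of the matrix unit with index `q`. -/
def deltaRight (β : ℝ) (α : 𝒜) (ν : ℝ) (q p : ι × ι) : ℂ :=
  if p.1 = q.1 then (Real.exp (β * ν / 4) : ℂ) * S.jumpEntry α ν q.2 p.2 else 0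

lemma delta_eq_sum (β : ℝ) (α : 𝒜) (ν : ℝ) (x : ι × ι →₀ ℂ) (p : ι × ι) :
    S.delta β α ν x p =
      ∑ q ∈ x.support, x q * (S.deltaLeft β α ν q p - S.deltaRight β α ν q p) := by
  classical
  have h1 : ∑' m, S.jumpEntry α ν p.1 m * x (m, p.2) =
      ∑ q ∈ x.support, x q * (if p.2 = q.2 then S.jumpEntry α ν p.1 q.1 else 0) := by
    rw [← tsum_eq_sum (L := SummationFilter.unconditional _) (f := fun q : ι × ι =>
      x q * (if p.2 = q.2 then S.jumpEntry α ν p.1 q.1 else 0)) (s := x.support)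
      fun q hq => by rw [Finsupp.notMem_support_iff.1 hq, zero_mul]]
    have hinj : Function.Injective fun m : ι => (m, p.2) := fun a b h => (Prod.ext_iff.1 h).1
    rw [← hinj.tsum_eq]
    · refine tsum_congr fun m => ?_
      rw [if_pos rfl, mul_comm]
    · intro q hq
      refine ⟨q.1, ?_⟩
      by_contra hne
      have : p.2 ≠ q.2 := fun h => hne (Prod.ext rfl h)
      exact hq (by simp [this])
  have h2 : ∑' m, x (p.1, m) * S.jumpEntry α ν m p.2 =
      ∑ q ∈ x.support, x q * (if p.1 = q.1 then S.jumpEntry α ν q.2 p.2 else 0) := by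
    rw [← tsum_eq_sum (L := SummationFilter.unconditional _) (f := fun q : ι × ι =>
      x q * (if p.1 = q.1 then S.jumpEntry α ν q.2 p.2 else 0)) (s := x.support)
      fun q hq => by rw [Finsupp.notMem_support_iff.1 hq, zero_mul]]
    have hinj : Function.Injective fun m : ι => (p.1, m) := fun a b h => (Prod.ext_iff.1 h).2
    rw [← hinj.tsum_eq]
    · refine tsum_congr fun m => ?_
      rw [if_pos rfl]
    · intro q hq
      refine ⟨q.2, ?_⟩
      by_contra hne
      have : p.1 ≠ q.1 := fun h => hne (Prod.ext h rfl)
      exact hq (by simp [this])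
  rw [delta, h1, h2, Finset.mul_sum, Finset.mul_sum, ← Finset.sum_sub_distrib]
  refine Finset.sum_congr rfl fun q _ => ?_
  unfold deltaLeft deltaRight
  split_ifs <;> ring

/-- The Bohr frequency of a pair of levels. -/
def bohr (i j : ι) : S.Bohr := ⟨S.energy i - S.energy j, i, j, rfl⟩

variable {S} {f : 𝓢(ℝ, ℂ)} (hf : Integrable f) {β σ : ℝ}

/-- The weight `1 / (2 cosh (β ν / 4))` times the Gaussian. -/
def loopWeight (β σ ν : ℝ) : ℝ :=
  freqGauss σ ν / (Real.exp (β * ν / 4) + Real.exp (-(β * ν / 4)))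

lemma formCoeff_left (ν₁ ν₂ : ℝ) : formCoeff β σ f ν₁ ν₂ *
    ((Real.exp (-(β * ν₁ / 4)) : ℂ) * (Real.exp (-(β * ν₂ / 4)) : ℂ)) =
      (loopWeight β σ (ν₁ - ν₂) : ℂ) * (star (hat f ν₁) * hat f ν₂) := by
  have h1 : Real.exp (β * (ν₁ - ν₂) / 4) = Real.exp (β * ν₁ / 4) * (Real.exp (β * ν₂ / 4))⁻¹ := by
    rw [← Real.exp_neg, ← Real.exp_add]; congr 1; ring
  have h2 : Real.exp (-(β * (ν₁ - ν₂) / 4)) =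
      (Real.exp (β * ν₁ / 4))⁻¹ * Real.exp (β * ν₂ / 4) := by
    rw [← Real.exp_neg, ← Real.exp_add]; congr 1; ring
  have h3 : freqGauss σ (ν₁ - ν₂) /
      ((Real.exp (β * ν₁ / 4))⁻¹ ^ 2 + (Real.exp (β * ν₂ / 4))⁻¹ ^ 2) *
      ((Real.exp (β * ν₁ / 4))⁻¹ * (Real.exp (β * ν₂ / 4))⁻¹) = loopWeight β σ (ν₁ - ν₂) := by
    rw [loopWeight, h1, h2]
    have hx := Real.exp_pos (β * ν₁ / 4)
    have hy := Real.exp_pos (β * ν₂ / 4)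
    field_simp
    ring
  rw [formCoeff_eq, ← h3, Real.exp_neg, Real.exp_neg]
  push_cast
  ring

lemma formCoeff_right (hkms : IsKMSFilter β f) (ν₁ ν₂ : ℝ) : formCoeff β σ f ν₁ ν₂ *
    ((Real.exp (β * ν₁ / 4) : ℂ) * (Real.exp (β * ν₂ / 4) : ℂ)) =
      (loopWeight β σ (ν₁ - ν₂) : ℂ) * (hat f (-ν₁) * star (hat f (-ν₂))) := by
  have e : ∀ ν, (Real.exp (β * ν / 2) : ℂ) = (Real.exp (β * ν / 4) : ℂ) ^ 2 := fun ν => by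
    rw [← Complex.ofReal_pow, ← Real.exp_nat_mul]; congr 2; push_cast; ring
  have h1 : hat f (-ν₁) = star (hat f ν₁) * (Real.exp (β * ν₁ / 4) : ℂ) ^ 2 := by
    rw [hkms.symm, mul_assoc, ← e, ← Complex.ofReal_mul, ← Real.exp_add, neg_add_cancel,
      Real.exp_zero, Complex.ofReal_one, mul_one]
  have h2 : star (hat f (-ν₂)) = hat f ν₂ * (Real.exp (β * ν₂ / 4) : ℂ) ^ 2 := by
    rw [hkms.symm, neg_neg, ← e]; congr 4; ring
  have h3 := formCoeff_left (β := β) (σ := σ) (f := f) ν₁ ν₂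
  have hx : (Real.exp (β * ν₁ / 4) : ℂ) ≠ 0 := by exact_mod_cast (Real.exp_pos _).ne'
  have hy : (Real.exp (β * ν₂ / 4) : ℂ) ≠ 0 := by exact_mod_cast (Real.exp_pos _).ne'
  rw [Real.exp_neg, Real.exp_neg, Complex.ofReal_inv, Complex.ofReal_inv] at h3
  rw [h1, h2]
  field_simp at h3
  linear_combination (Real.exp (β * ν₁ / 4) : ℂ) * (Real.exp (β * ν₂ / 4) : ℂ) * h3

/-- The two mixed terms of the form combine to the transition part. -/
lemma formCoeff_mixed (hkms : IsKMSFilter β f) (ν₁ ν₂ : ℝ) :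
    formCoeff β σ f ν₁ ν₂ * ((Real.exp (-(β * ν₁ / 4)) : ℂ) * (Real.exp (β * ν₂ / 4) : ℂ)) +
    formCoeff β σ f (-ν₂) (-ν₁) *
      ((Real.exp (β * (-ν₂) / 4) : ℂ) * (Real.exp (-(β * (-ν₁) / 4)) : ℂ)) =
    (Real.exp (-(β * (ν₁ + ν₂) / 4)) : ℂ) *
      ((freqGauss σ (ν₁ - ν₂) : ℂ) * (hat f (-ν₁) * star (hat f (-ν₂)))) := by
  have e : ∀ ν, (Real.exp (β * ν / 2) : ℂ) = (Real.exp (β * ν / 4) : ℂ) ^ 2 := fun ν => by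
    rw [← Complex.ofReal_pow, ← Real.exp_nat_mul]; congr 2; push_cast; ring
  have h1 : hat f (-ν₁) = star (hat f ν₁) * (Real.exp (β * ν₁ / 4) : ℂ) ^ 2 := by
    rw [hkms.symm, mul_assoc, ← e, ← Complex.ofReal_mul, ← Real.exp_add, neg_add_cancel,
      Real.exp_zero, Complex.ofReal_one, mul_one]
  have h2 : star (hat f (-ν₂)) = hat f ν₂ * (Real.exp (β * ν₂ / 4) : ℂ) ^ 2 := by
    rw [hkms.symm, neg_neg, ← e]; congr 4; ring
  have h3 : Real.exp (-(β * (ν₁ + ν₂) / 4)) =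
      (Real.exp (β * ν₁ / 4))⁻¹ * (Real.exp (β * ν₂ / 4))⁻¹ := by
    rw [← Real.exp_neg, ← Real.exp_neg, ← Real.exp_add]; congr 1; ring
  have h4 : ∀ ν, Real.exp (β * (-ν) / 4) = (Real.exp (β * ν / 4))⁻¹ := fun ν => by
    rw [← Real.exp_neg]; congr 1; ring
  have h5 : ∀ ν, Real.exp (-(β * ν / 4)) = (Real.exp (β * ν / 4))⁻¹ := fun ν => Real.exp_neg _
  rw [formCoeff_eq, formCoeff_eq, h2, h1, h3, h5 (-ν₁), h5 ν₁, h4, h4,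
    show -ν₂ - -ν₁ = ν₁ - ν₂ by ring]
  set x := Real.exp (β * ν₁ / 4) with hx
  set y := Real.exp (β * ν₂ / 4) with hy
  have hx0 : (x : ℂ) ≠ 0 := by exact_mod_cast (Real.exp_pos _).ne'
  have hy0 : (y : ℂ) ≠ 0 := by exact_mod_cast (Real.exp_pos _).ne'
  have hxy : (x : ℂ) ^ 2 + (y : ℂ) ^ 2 ≠ 0 := by
    have : 0 < x ^ 2 + y ^ 2 := by positivity
    exact_mod_cast this.ne'
  push_cast
  simp only [inv_inv]
  have hxy' : (y : ℂ) ^ 2 + (x : ℂ) ^ 2 ≠ 0 := by rwa [add_comm]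
  field_simp

section units
variable (α : 𝒜) (p q : ι × ι)

include hf in
lemma hasSum_left_left : HasSum (fun z : (S.Bohr × S.Bohr) × (ι × ι) =>
    formCoeff β σ f z.1.1 z.1.2 *
      (star (S.deltaLeft β α z.1.1 p z.2) * S.deltaLeft β α z.1.2 q z.2))
    (open Classical in if p.2 = q.2 then (loopWeight β σ (S.energy q.1 - S.energy p.1) : ℂ) *
      ⟪S.lindVec f α p.1, S.lindVec f α q.1⟫_ℂ else 0) := by
  classical
  split_ifs with h
  · let φ : ι → (S.Bohr × S.Bohr) × (ι × ι) := fun m => ((S.bohr m p.1, S.bohr m q.1), (m, p.2))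
    have hinj : Function.Injective φ := fun a b hab =>
      (Prod.ext_iff.1 (Prod.ext_iff.1 hab).2).1
    rw [← hinj.hasSum_iff]
    · have := (S.basis.hasSum_inner_mul_inner (S.lindVec f α p.1) (S.lindVec f α q.1)).mul_left
        (loopWeight β σ (S.energy q.1 - S.energy p.1) : ℂ)
      refine this.congr_fun fun m => ?_
      have h1 := formCoeff_left (β := β) (σ := σ) (f := f) (S.energy m - S.energy p.1)
        (S.energy m - S.energy q.1)
      rw [sub_sub_sub_cancel_left] at h1
      rw [← inner_conj_symm, S.inner_basis_lindVec hf, S.inner_basis_lindVec hf]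
      simp only [Function.comp_apply, φ, bohr, deltaLeft, if_true, if_pos h, jumpEntry_self,
        map_mul, Complex.star_def, Complex.conj_ofReal] at h1 ⊢
      linear_combination (starRingEnd ℂ) (S.entry α m p.1) * S.entry α m q.1 * h1
    · rintro ⟨⟨ν₁, ν₂⟩, k, l⟩ hz
      by_contra hne
      simp only [deltaLeft] at hne
      by_cases hl : l = p.2
      · by_cases h1 : (ν₁ : ℝ) = S.energy k - S.energy p.1
        · by_cases h2 : (ν₂ : ℝ) = S.energy k - S.energy q.1
          · exact hz ⟨k, Prod.ext (Prod.ext (Subtype.ext h1.symm) (Subtype.ext h2.symm))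
              (Prod.ext rfl hl.symm)⟩
          · simp [S.jumpEntry_ne h2] at hne
        · simp [S.jumpEntry_ne h1] at hne
      · simp [hl] at hne
  · convert hasSum_zero with z
    unfold deltaLeft
    by_cases h1 : z.2.2 = p.2
    · rw [if_neg fun h2 => h (h1.symm.trans h2), mul_zero, mul_zero]
    · rw [if_neg h1, star_zero, zero_mul, mul_zero]

include hf in
lemma hasSum_right_right (hkms : IsKMSFilter β f) {α' : 𝒜}
    (hα' : ∀ k l, S.entry α' k l = star (S.entry α l k)) :
    HasSum (fun z : (S.Bohr × S.Bohr) × (ι × ι) => formCoeff β σ f z.1.1 z.1.2 *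
      (star (S.deltaRight β α z.1.1 p z.2) * S.deltaRight β α z.1.2 q z.2))
    (open Classical in if p.1 = q.1 then (loopWeight β σ (S.energy p.2 - S.energy q.2) : ℂ) *
      ⟪S.lindVec f α' q.2, S.lindVec f α' p.2⟫_ℂ else 0) := by
  classical
  split_ifs with h
  · let φ : ι → (S.Bohr × S.Bohr) × (ι × ι) := fun m => ((S.bohr p.2 m, S.bohr q.2 m), (p.1, m))
    have hinj : Function.Injective φ := fun a b hab =>
      (Prod.ext_iff.1 (Prod.ext_iff.1 hab).2).2
    rw [← hinj.hasSum_iff]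
    · have := (S.basis.hasSum_inner_mul_inner (S.lindVec f α' q.2) (S.lindVec f α' p.2)).mul_left
        (loopWeight β σ (S.energy p.2 - S.energy q.2) : ℂ)
      refine this.congr_fun fun m => ?_
      have h1 := formCoeff_right (σ := σ) hkms (S.energy p.2 - S.energy m)
        (S.energy q.2 - S.energy m)
      rw [sub_sub_sub_cancel_right, neg_sub, neg_sub] at h1
      rw [← inner_conj_symm, S.inner_basis_lindVec hf, S.inner_basis_lindVec hf, hα', hα']
      simp only [Function.comp_apply, φ, bohr, deltaRight, if_true, if_pos h, jumpEntry_self,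
        map_mul, Complex.star_def, Complex.conj_ofReal, Complex.conj_conj] at h1 ⊢
      linear_combination (starRingEnd ℂ) (S.entry α p.2 m) * S.entry α q.2 m * h1
    · rintro ⟨⟨ν₁, ν₂⟩, k, l⟩ hz
      by_contra hne
      simp only [deltaRight] at hne
      by_cases hl : k = p.1
      · by_cases h1 : (ν₁ : ℝ) = S.energy p.2 - S.energy l
        · by_cases h2 : (ν₂ : ℝ) = S.energy q.2 - S.energy l
          · exact hz ⟨l, Prod.ext (Prod.ext (Subtype.ext h1.symm) (Subtype.ext h2.symm))
              (Prod.ext hl.symm rfl)⟩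
          · simp [S.jumpEntry_ne h2] at hne
        · simp [S.jumpEntry_ne h1] at hne
      · simp [hl] at hne
  · convert hasSum_zero with z
    unfold deltaRight
    by_cases h1 : z.2.1 = p.1
    · rw [if_neg fun h2 => h (h1.symm.trans h2), mul_zero, mul_zero]
    · rw [if_neg h1, star_zero, zero_mul, mul_zero]

lemma hasSum_left_right : HasSum (fun z : (S.Bohr × S.Bohr) × (ι × ι) =>
    formCoeff β σ f z.1.1 z.1.2 *
      (star (S.deltaLeft β α z.1.1 p z.2) * S.deltaRight β α z.1.2 q z.2))
    (formCoeff β σ f (S.energy q.1 - S.energy p.1) (S.energy q.2 - S.energy p.2) *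
      ((Real.exp (-(β * (S.energy q.1 - S.energy p.1) / 4)) : ℂ) *
        (Real.exp (β * (S.energy q.2 - S.energy p.2) / 4) : ℂ)) *
      (star (S.entry α q.1 p.1) * S.entry α q.2 p.2)) := by
  classical
  convert hasSum_single (((S.bohr q.1 p.1, S.bohr q.2 p.2), (q.1, p.2)) :
    (S.Bohr × S.Bohr) × (ι × ι)) ?_ using 1
  · simp only [bohr, deltaLeft, deltaRight, if_true, jumpEntry_self, star_mul', Complex.star_def,
      Complex.conj_ofReal]
    ring
  · rintro ⟨⟨ν₁, ν₂⟩, k, l⟩ hz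
    by_contra hne
    simp only [deltaLeft, deltaRight] at hne
    by_cases hl : l = p.2
    · by_cases hk : k = q.1
      · subst hl hk
        by_cases h1 : (ν₁ : ℝ) = S.energy q.1 - S.energy p.1
        · by_cases h2 : (ν₂ : ℝ) = S.energy q.2 - S.energy p.2
          · exact hz (Prod.ext (Prod.ext (Subtype.ext h1) (Subtype.ext h2)) rfl)
          · simp [S.jumpEntry_ne h2] at hne
        · simp [S.jumpEntry_ne h1] at hne
      · simp [hk] at hne
    · simp [hl] at hne

lemma hasSum_right_left : HasSum (fun z : (S.Bohr × S.Bohr) × (ι × ι) =>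
    formCoeff β σ f z.1.1 z.1.2 *
      (star (S.deltaRight β α z.1.1 p z.2) * S.deltaLeft β α z.1.2 q z.2))
    (formCoeff β σ f (S.energy p.2 - S.energy q.2) (S.energy p.1 - S.energy q.1) *
      ((Real.exp (β * (S.energy p.2 - S.energy q.2) / 4) : ℂ) *
        (Real.exp (-(β * (S.energy p.1 - S.energy q.1) / 4)) : ℂ)) *
      (star (S.entry α p.2 q.2) * S.entry α p.1 q.1)) := by
  classical
  convert hasSum_single (((S.bohr p.2 q.2, S.bohr p.1 q.1), (p.1, q.2)) :
    (S.Bohr × S.Bohr) × (ι × ι)) ?_ using 1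
  · simp only [bohr, deltaLeft, deltaRight, if_true, jumpEntry_self, star_mul', Complex.star_def,
      Complex.conj_ofReal]
    ring
  · rintro ⟨⟨ν₁, ν₂⟩, k, l⟩ hz
    by_contra hne
    simp only [deltaLeft, deltaRight] at hne
    by_cases hl : l = q.2
    · by_cases hk : k = p.1
      · subst hl hk
        by_cases h1 : (ν₁ : ℝ) = S.energy p.2 - S.energy q.2
        · by_cases h2 : (ν₂ : ℝ) = S.energy p.1 - S.energy q.1
          · exact hz (Prod.ext (Prod.ext (Subtype.ext h1) (Subtype.ext h2)) rfl)
          · simp [S.jumpEntry_ne h2] at hne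
        · simp [S.jumpEntry_ne h1] at hne
      · simp [hk] at hne
    · simp [hl] at hne

end units

lemma loopWeight_eq (ν : ℝ) : loopWeight β σ ν = Real.exp (β * ν / 4) * driftWeight β σ ν := by
  have h1 : Real.exp (β * ν / 2) = Real.exp (β * ν / 4) ^ 2 := by
    rw [← Real.exp_nat_mul]; congr 1; push_cast; ring
  rw [loopWeight, driftWeight, freqGauss, h1, Real.exp_neg (β * ν / 4)]
  have hx := Real.exp_pos (β * ν / 4)
  field_simp
  ring

lemma loopWeight_neg (ν : ℝ) : loopWeight β σ (-ν) = loopWeight β σ ν := by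
  rw [loopWeight, loopWeight, freqGauss_neg, add_comm, mul_neg, neg_div, neg_neg]

open Classical in
/-- The matrix element of the exact generator of the jump `A^α` between the matrix units `q` and
`p`. -/
def genEntry (S : System ι 𝒜 𝓗) (β σ : ℝ) (f : 𝓢(ℝ, ℂ)) (α : 𝒜) (p q : ι × ι) : ℂ :=
  (freqGauss σ (S.energy p.1 - S.energy q.1 - (S.energy p.2 - S.energy q.2)) : ℂ) *
    (⟪S.basis p.1, S.lindVec f α q.1⟫_ℂ * star ⟪S.basis p.2, S.lindVec f α q.2⟫_ℂ) -
  (if p.2 = q.2 then (driftWeight β σ (S.energy p.1 - S.energy q.1) : ℂ) *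
    ⟪S.lindVec f α p.1, S.lindVec f α q.1⟫_ℂ else 0) -
  (if p.1 = q.1 then (driftWeight β σ (S.energy p.2 - S.energy q.2) : ℂ) *
    ⟪S.lindVec f α q.2, S.lindVec f α p.2⟫_ℂ else 0)

/-- The matrix of the Dirichlet form on the matrix units. -/
def formEntry [Fintype 𝒜] (S : System ι 𝒜 𝓗) (β σ : ℝ) (f : 𝓢(ℝ, ℂ)) (p q : ι × ι) : ℂ :=
  -((Real.exp (-(β * (S.energy q.1 + S.energy q.2 - S.energy p.1 - S.energy p.2) / 4)) : ℂ) *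
    ∑ α, S.genEntry β σ f α p q)

include hf in
/-- The form of a pair of matrix units, as an unconditional sum over frequencies and entries. -/
lemma hasSum_unit_form [Fintype 𝒜] (hkms : IsKMSFilter β f) {τ : Equiv.Perm 𝒜}
    (hτ : ∀ α k l, S.entry (τ α) k l = star (S.entry α l k)) : ∃ T : 𝒜 → ι × ι → ι × ι → ℂ,
    (∀ α p q, HasSum (fun z : (S.Bohr × S.Bohr) × (ι × ι) => formCoeff β σ f z.1.1 z.1.2 *
      (star (S.deltaLeft β α z.1.1 p z.2 - S.deltaRight β α z.1.1 p z.2) *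
        (S.deltaLeft β α z.1.2 q z.2 - S.deltaRight β α z.1.2 q z.2))) (T α p q)) ∧
    ∀ p q, ∑ α, T α p q = S.formEntry β σ f p q := by
  have hT := fun (α : 𝒜) (p q : ι × ι) =>
    (((hasSum_left_left hf (S := S) (β := β) (σ := σ) α p q).add
      (hasSum_right_right hf (σ := σ) α p q hkms (hτ α))).sub
      (hasSum_left_right (f := f) (β := β) (σ := σ) α p q)).sub
      (hasSum_right_left (f := f) (β := β) (σ := σ) α p q)
  refine ⟨_, fun α p q => (hT α p q).congr_fun fun z => ?_, ?_⟩
  · rw [star_sub]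
    ring
  · intro p q
    classical
    set w : ℂ := (Real.exp (-(β * (S.energy q.1 + S.energy q.2 - S.energy p.1 - S.energy p.2) / 4)) : ℂ)
      with hw
    have hLL : ∀ α, (if p.2 = q.2 then (loopWeight β σ (S.energy q.1 - S.energy p.1) : ℂ) *
        ⟪S.lindVec f α p.1, S.lindVec f α q.1⟫_ℂ else 0) =
        w * (if p.2 = q.2 then (driftWeight β σ (S.energy p.1 - S.energy q.1) : ℂ) *
          ⟪S.lindVec f α p.1, S.lindVec f α q.1⟫_ℂ else 0) := by
      intro α
      split_ifs with h
      · rw [← neg_sub (S.energy p.1), loopWeight_neg, loopWeight_eq, hw, h]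
        push_cast
        rw [mul_assoc]
        congr 2
        ring_nf
      · simp
    have hRR : ∀ α, (if p.1 = q.1 then (loopWeight β σ (S.energy p.2 - S.energy q.2) : ℂ) *
        ⟪S.lindVec f α q.2, S.lindVec f α p.2⟫_ℂ else 0) =
        w * (if p.1 = q.1 then (driftWeight β σ (S.energy p.2 - S.energy q.2) : ℂ) *
          ⟪S.lindVec f α q.2, S.lindVec f α p.2⟫_ℂ else 0) := by
      intro α
      split_ifs with h
      · rw [loopWeight_eq, hw, h]
        push_cast
        rw [mul_assoc]
        congr 2
        ring_nf
      · simp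
    have hmix : ∀ α,
        formCoeff β σ f (S.energy q.1 - S.energy p.1) (S.energy q.2 - S.energy p.2) *
          ((Real.exp (-(β * (S.energy q.1 - S.energy p.1) / 4)) : ℂ) *
            (Real.exp (β * (S.energy q.2 - S.energy p.2) / 4) : ℂ)) *
          (S.entry α p.1 q.1 * star (S.entry α p.2 q.2)) +
        formCoeff β σ f (S.energy p.2 - S.energy q.2) (S.energy p.1 - S.energy q.1) *
          ((Real.exp (β * (S.energy p.2 - S.energy q.2) / 4) : ℂ) *
            (Real.exp (-(β * (S.energy p.1 - S.energy q.1) / 4)) : ℂ)) *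
          (star (S.entry α p.2 q.2) * S.entry α p.1 q.1) =
        w * ((freqGauss σ (S.energy p.1 - S.energy q.1 - (S.energy p.2 - S.energy q.2)) : ℂ) *
          (⟪S.basis p.1, S.lindVec f α q.1⟫_ℂ * star ⟪S.basis p.2, S.lindVec f α q.2⟫_ℂ)) := by
      intro α
      have h1 := formCoeff_mixed (σ := σ) hkms (S.energy q.1 - S.energy p.1)
        (S.energy q.2 - S.energy p.2)
      simp only [neg_sub] at h1
      have h2 : freqGauss σ (S.energy p.1 - S.energy q.1 - (S.energy p.2 - S.energy q.2)) =
          freqGauss σ (S.energy q.1 - S.energy p.1 - (S.energy q.2 - S.energy p.2)) := by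
        rw [← freqGauss_neg]; congr 1; ring
      have h3 : w = (Real.exp (-(β * (S.energy q.1 - S.energy p.1 +
          (S.energy q.2 - S.energy p.2)) / 4)) : ℂ) := by
        rw [hw]; congr 5; ring
      rw [S.inner_basis_lindVec hf, S.inner_basis_lindVec hf, h2, h3, star_mul']
      linear_combination S.entry α p.1 q.1 * star (S.entry α p.2 q.2) * h1
    have e1 : ∑ α, (if p.1 = q.1 then (loopWeight β σ (S.energy p.2 - S.energy q.2) : ℂ) *
        ⟪S.lindVec f (τ α) q.2, S.lindVec f (τ α) p.2⟫_ℂ else 0) =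
        ∑ α, (if p.1 = q.1 then (loopWeight β σ (S.energy p.2 - S.energy q.2) : ℂ) *
        ⟪S.lindVec f α q.2, S.lindVec f α p.2⟫_ℂ else 0) :=
      Equiv.sum_comp τ fun α => (if p.1 = q.1 then
        (loopWeight β σ (S.energy p.2 - S.energy q.2) : ℂ) *
        ⟪S.lindVec f α q.2, S.lindVec f α p.2⟫_ℂ else 0)
    have e2 : ∑ α, formCoeff β σ f (S.energy q.1 - S.energy p.1) (S.energy q.2 - S.energy p.2) *
        ((Real.exp (-(β * (S.energy q.1 - S.energy p.1) / 4)) : ℂ) *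
          (Real.exp (β * (S.energy q.2 - S.energy p.2) / 4) : ℂ)) *
        (star (S.entry α q.1 p.1) * S.entry α q.2 p.2) =
        ∑ α, formCoeff β σ f (S.energy q.1 - S.energy p.1) (S.energy q.2 - S.energy p.2) *
        ((Real.exp (-(β * (S.energy q.1 - S.energy p.1) / 4)) : ℂ) *
          (Real.exp (β * (S.energy q.2 - S.energy p.2) / 4) : ℂ)) *
        (S.entry α p.1 q.1 * star (S.entry α p.2 q.2)) := by
      rw [← Equiv.sum_comp τ fun α =>
        formCoeff β σ f (S.energy q.1 - S.energy p.1) (S.energy q.2 - S.energy p.2) *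
        ((Real.exp (-(β * (S.energy q.1 - S.energy p.1) / 4)) : ℂ) *
          (Real.exp (β * (S.energy q.2 - S.energy p.2) / 4) : ℂ)) *
        (S.entry α p.1 q.1 * star (S.entry α p.2 q.2))]
      simp only [hτ, star_star]
    rw [Finset.sum_sub_distrib, Finset.sum_sub_distrib, Finset.sum_add_distrib, e1, e2,
      ← Finset.sum_add_distrib, ← Finset.sum_sub_distrib, ← Finset.sum_sub_distrib, formEntry,
      ← hw, Finset.mul_sum, ← Finset.sum_neg_distrib]
    refine Finset.sum_congr rfl fun α _ => ?_
    have h := hmix α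
    have hl := hLL α
    have hr := hRR α
    rw [genEntry]
    linear_combination hl + hr - h

include hf in
/-- The Dirichlet form as an unconditional sum, and its matrix. -/
lemma exists_hasSum_form [Fintype 𝒜] (hkms : IsKMSFilter β f) {τ : Equiv.Perm 𝒜}
    (hτ : ∀ α k l, S.entry (τ α) k l = star (S.entry α l k)) (x y : ι × ι →₀ ℂ) :
    ∃ F : 𝒜 → ℂ, (∀ α, HasSum (fun z : (S.Bohr × S.Bohr) × (ι × ι) =>
      formCoeff β σ f z.1.1 z.1.2 *
        (star (S.delta β α z.1.1 x z.2) * S.delta β α z.1.2 y z.2)) (F α)) ∧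
    S.form β σ f x y = ∑ α, F α ∧
    ∑ α, F α = ∑ p ∈ x.support, ∑ q ∈ y.support, star (x p) * y q * S.formEntry β σ f p q := by
  obtain ⟨T, hT, hTs⟩ := hasSum_unit_form hf (σ := σ) hkms hτ
  have hF : ∀ α, HasSum (fun z : (S.Bohr × S.Bohr) × (ι × ι) => formCoeff β σ f z.1.1 z.1.2 *
      (star (S.delta β α z.1.1 x z.2) * S.delta β α z.1.2 y z.2))
      (∑ p ∈ x.support, ∑ q ∈ y.support, star (x p) * y q * T α p q) := by
    intro α
    refine (hasSum_sum fun p _ => hasSum_sum fun q _ =>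
      (hT α p q).mul_left (star (x p) * y q)).congr_fun fun z => ?_
    rw [delta_eq_sum, delta_eq_sum, star_sum, Finset.sum_mul_sum, Finset.mul_sum]
    refine Finset.sum_congr rfl fun p _ => ?_
    rw [Finset.mul_sum]
    refine Finset.sum_congr rfl fun q _ => ?_
    rw [star_mul']
    ring
  refine ⟨_, hF, ?_, ?_⟩
  · rw [form]
    refine Finset.sum_congr rfl fun α _ => ?_
    have h1 := (hF α).prod_fiberwise fun ν => ((hF α).summable.prod_factor ν).hasSum
    rw [← h1.tsum_eq]
    refine tsum_congr fun ν => ?_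
    rw [← tsum_mul_left]
  · rw [Finset.sum_comm]
    refine Finset.sum_congr rfl fun p _ => ?_
    rw [Finset.sum_comm]
    refine Finset.sum_congr rfl fun q _ => ?_
    rw [← hTs, Finset.mul_sum]

lemma star_form [Fintype 𝒜] (x y : ι × ι →₀ ℂ) : star (S.form β σ f y x) = S.form β σ f x y := by
  rw [form, form, star_sum]
  refine Finset.sum_congr rfl fun α _ => ?_
  rw [tsum_star, ← (Equiv.prodComm S.Bohr S.Bohr).tsum_eq]
  refine tsum_congr fun ν => ?_
  rw [star_mul', star_formCoeff, tsum_star, Equiv.prodComm_apply, Prod.fst_swap, Prod.snd_swap]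
  congr 1
  refine tsum_congr fun p => ?_
  rw [star_mul', star_star, mul_comm]

include hf in
lemma re_form_nonneg [Fintype 𝒜] (hσ : 0 < σ) (hkms : IsKMSFilter β f) {τ : Equiv.Perm 𝒜}
    (hτ : ∀ α k l, S.entry (τ α) k l = star (S.entry α l k)) (x : ι × ι →₀ ℂ) :
    0 ≤ (S.form β σ f x x).re := by
  obtain ⟨F, hF, e, -⟩ := exists_hasSum_form hf (σ := σ) hkms hτ x x
  rw [e, Complex.re_sum]
  refine Finset.sum_nonneg fun α _ => ?_
  have h1 := (Equiv.prodComm (ι × ι) (S.Bohr × S.Bohr)).hasSum_iff.2 (hF α)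
  have h2 := h1.prod_fiberwise fun p => (h1.summable.prod_factor p).hasSum
  have h3 := Complex.reCLM.hasSum h2
  refine h3.nonneg fun p => ?_
  have h4 := (Complex.continuous_re.tendsto _).comp
    ((h1.summable.prod_factor p).hasSum.comp tendsto_prod_self_atTop)
  refine ge_of_tendsto h4 (Eventually.of_forall fun s => ?_)
  simp only [Function.comp_apply, Equiv.prodComm_apply, Prod.swap_prod_mk, Finset.sum_product]
  exact re_sum_formCoeff_nonneg s (fun ν : S.Bohr => (ν : ℝ)) β hσ f fun ν => S.delta β α ν x p

variable [Fintype 𝒜]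

/-- The Dirichlet form as a sesquilinear form. -/
def formMap (S : System ι 𝒜 𝓗) (β σ : ℝ) (f : 𝓢(ℝ, ℂ)) :
    (ι × ι →₀ ℂ) →ₗ⋆[ℂ] (ι × ι →₀ ℂ) →ₗ[ℂ] ℂ :=
  LinearMap.mk₂'ₛₗ (starRingEnd ℂ) (RingHom.id ℂ)
    (fun x y => x.sum fun p c => y.sum fun q d => star c * d * S.formEntry β σ f p q)
    (fun x x' y => by
      classical
      refine Finsupp.sum_add_index' (fun p => by simp) fun p c c' => ?_
      simp only [Finsupp.sum, ← Finset.sum_add_distrib]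
      exact Finset.sum_congr rfl fun q _ => by rw [star_add]; ring)
    (fun c x y => by
      rw [Finsupp.sum_smul_index' fun p => by simp, Finsupp.smul_sum]
      refine Finsupp.sum_congr fun p _ => ?_
      rw [Finsupp.smul_sum]
      refine Finsupp.sum_congr fun q _ => ?_
      simp only [smul_eq_mul, star_mul', Complex.star_def]
      ring)
    (fun x y y' => by
      classical
      rw [← Finsupp.sum_add]
      refine Finsupp.sum_congr fun p _ => ?_
      exact Finsupp.sum_add_index' (fun q => by simp) fun q d d' => by ring)
    (fun c x y => by
      rw [Finsupp.smul_sum]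
      refine Finsupp.sum_congr fun p _ => ?_
      rw [Finsupp.sum_smul_index' fun q => by simp, Finsupp.smul_sum]
      refine Finsupp.sum_congr fun q _ => ?_
      simp only [smul_eq_mul, RingHom.id_apply]
      ring)

lemma formMap_apply (x y : ι × ι →₀ ℂ) : S.formMap β σ f x y =
    x.sum fun p c => y.sum fun q d => star c * d * S.formEntry β σ f p q := rfl

include hf in
lemma form_eq_formMap (hkms : IsKMSFilter β f) {τ : Equiv.Perm 𝒜}
    (hτ : ∀ α k l, S.entry (τ α) k l = star (S.entry α l k)) (x y : ι × ι →₀ ℂ) :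
    S.form β σ f x y = S.formMap β σ f x y := by
  obtain ⟨F, -, e, e'⟩ := exists_hasSum_form hf (σ := σ) hkms hτ x y
  rw [e, e']
  rfl

include hf in
lemma isPosForm_formMap (hσ : 0 < σ) (hkms : IsKMSFilter β f) {τ : Equiv.Perm 𝒜}
    (hτ : ∀ α k l, S.entry (τ α) k l = star (S.entry α l k)) : IsPosForm (S.formMap β σ f) where
  herm x y := by
    rw [← form_eq_formMap hf hkms hτ, ← form_eq_formMap hf hkms hτ, star_form]
  nonneg x := by
    rw [← form_eq_formMap hf hkms hτ]
    exact re_form_nonneg hf hσ hkms hτ x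

end System
end FormAlgebra

/-! ### Positivity of the Dirichlet form -/

section Markov
open Filter Topology MeasureTheory

variable {ι 𝒜 𝓗 : Type*} [NormedAddCommGroup 𝓗] [InnerProductSpace ℂ 𝓗] [CompleteSpace 𝓗]

/-- The rank-one matrix `v v†`. -/
def outer (v : ι →₀ ℂ) : ι × ι →₀ ℂ :=
  Finsupp.onFinset (v.support ×ˢ v.support) (fun p => v p.1 * star (v p.2)) fun p hp => by
    rw [Finset.mem_product, Finsupp.mem_support_iff, Finsupp.mem_support_iff]
    exact ⟨fun h => hp (by rw [h, zero_mul]), fun h => hp (by rw [h, star_zero, mul_zero])⟩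

lemma outer_apply (v : ι →₀ ℂ) (p : ι × ι) : outer v p = v p.1 * star (v p.2) := rfl

lemma outer_sum {v : ι →₀ ℂ} {s : Finset ι} (hs : v.support ⊆ s) {F : ι × ι → ℂ → ℂ}
    (hF : ∀ p, F p 0 = 0) :
    (outer v).sum F = ∑ i ∈ s, ∑ j ∈ s, F (i, j) (v i * star (v j)) := by
  rw [← Finset.sum_product', Finsupp.sum_of_support_subset (s := s ×ˢ s) _ _ _ fun p _ => hF p]
  · rfl
  · intro p hp
    have := Finsupp.support_onFinset_subset hp
    rw [Finset.mem_product] at this ⊢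
    exact ⟨hs this.1, hs this.2⟩

/-- The scalar product of two finitely supported vectors. -/
def dot (v w : ι →₀ ℂ) : ℂ := v.sum fun i c => star c * w i

lemma dot_eq {v : ι →₀ ℂ} {s : Finset ι} (hs : v.support ⊆ s) (w : ι →₀ ℂ) :
    dot v w = ∑ i ∈ s, star (v i) * w i :=
  Finsupp.sum_of_support_subset _ hs _ fun i _ => by simp

namespace System
variable [Fintype 𝒜] {S : System ι 𝒜 𝓗} {f : 𝓢(ℝ, ℂ)} {β σ : ℝ}

/-- Orthogonal rank-one matrices have a nonpositive form: the drift does not contribute, and the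
transition part is completely positive. -/
lemma re_formMap_outer_nonpos (hσ : 0 < σ) {z y : ι →₀ ℂ} (h : dot z y = 0) :
    (S.formMap β σ f (outer z) (outer y)).re ≤ 0 := by
  classical
  set s := z.support ∪ y.support with hs
  have hz : z.support ⊆ s := Finset.subset_union_left
  have hy : y.support ⊆ s := Finset.subset_union_right
  rw [dot_eq hz] at h
  have h' : ∑ i ∈ s, z i * star (y i) = 0 := by
    have := congrArg star h
    rw [star_sum, star_zero] at this
    refine Eq.trans (Finset.sum_congr rfl fun i _ => ?_) this
    rw [star_mul', star_star]
  have e1 : S.formMap β σ f (outer z) (outer y) = ∑ i ∈ s, ∑ j ∈ s, ∑ k ∈ s, ∑ l ∈ s,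
      star (z i * star (z j)) * (y k * star (y l)) * S.formEntry β σ f (i, j) (k, l) := by
    rw [formMap_apply, outer_sum hz fun p => by simp]
    refine Finset.sum_congr rfl fun i _ => Finset.sum_congr rfl fun j _ => ?_
    rw [outer_sum hy fun p => by simp]
  set t : ι → ℂ := fun i => (Real.exp (β * S.energy i / 4) : ℂ) with ht
  have ht0 : ∀ i, t i ≠ 0 := fun i => by
    simp only [ht]; exact_mod_cast (Real.exp_pos _).ne'
  have hw : ∀ i j k l, (Real.exp (-(β * (S.energy k + S.energy l - S.energy i - S.energy j) / 4)) : ℂ)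
      = t i * t j * ((t k)⁻¹ * (t l)⁻¹) := by
    intro i j k l
    simp only [ht]
    rw [← Complex.ofReal_inv, ← Complex.ofReal_inv, ← Complex.ofReal_mul, ← Complex.ofReal_mul,
      ← Complex.ofReal_mul, ← Real.exp_neg, ← Real.exp_neg, ← Real.exp_add, ← Real.exp_add,
      ← Real.exp_add]
    congr 2
    ring
  have hD1 : ∀ c : ι → ι → ℂ, ∑ i ∈ s, ∑ j ∈ s, ∑ k ∈ s, ∑ l ∈ s,
      star (z i * star (z j)) * (y k * star (y l)) * (t i * t j * ((t k)⁻¹ * (t l)⁻¹)) *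
        (if j = l then c i k else 0) = 0 := by
    intro c
    have e : ∀ i ∈ s, ∑ j ∈ s, ∑ k ∈ s, ∑ l ∈ s,
        star (z i * star (z j)) * (y k * star (y l)) * (t i * t j * ((t k)⁻¹ * (t l)⁻¹)) *
        (if j = l then c i k else 0) =
        (∑ k ∈ s, star (z i) * y k * t i * (t k)⁻¹ * c i k) * ∑ j ∈ s, z j * star (y j) := by
      intro i _
      rw [Finset.sum_comm, Finset.sum_mul_sum]
      refine Finset.sum_congr rfl fun k _ => Finset.sum_congr rfl fun j hj => ?_
      simp only [mul_ite, mul_zero, Finset.sum_ite_eq, hj, if_true, star_mul', star_star]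
      field_simp [ht0 j]
    rw [Finset.sum_congr rfl e]
    simp only [h', mul_zero, Finset.sum_const_zero]
  have hD2 : ∀ c : ι → ι → ℂ, ∑ i ∈ s, ∑ j ∈ s, ∑ k ∈ s, ∑ l ∈ s,
      star (z i * star (z j)) * (y k * star (y l)) * (t i * t j * ((t k)⁻¹ * (t l)⁻¹)) *
        (if i = k then c j l else 0) = 0 := by
    intro c
    rw [Finset.sum_comm]
    have e : ∀ j ∈ s, ∑ i ∈ s, ∑ k ∈ s, ∑ l ∈ s,
        star (z i * star (z j)) * (y k * star (y l)) * (t i * t j * ((t k)⁻¹ * (t l)⁻¹)) *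
        (if i = k then c j l else 0) =
        (∑ i ∈ s, star (z i) * y i) * ∑ l ∈ s, z j * star (y l) * t j * (t l)⁻¹ * c j l := by
      intro j _
      rw [Finset.sum_mul_sum]
      refine Finset.sum_congr rfl fun i hi => ?_
      rw [Finset.sum_comm]
      refine Finset.sum_congr rfl fun l _ => ?_
      simp only [mul_ite, mul_zero, Finset.sum_ite_eq, hi, if_true, star_mul', star_star]
      field_simp [ht0 i]
    rw [Finset.sum_congr rfl e]
    simp only [h, zero_mul, Finset.sum_const_zero]
  have e2 : S.formMap β σ f (outer z) (outer y) = -∑ α, ∑ a ∈ s ×ˢ s, ∑ b ∈ s ×ˢ s,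
      (freqGauss σ ((S.energy a.1 - S.energy a.2) - (S.energy b.1 - S.energy b.2)) : ℂ) *
      (star (star (star (z a.1) * y a.2 * (t a.1 * (t a.2)⁻¹) *
        ⟪S.basis a.1, S.lindVec f α a.2⟫_ℂ)) *
        star (star (z b.1) * y b.2 * (t b.1 * (t b.2)⁻¹) *
        ⟪S.basis b.1, S.lindVec f α b.2⟫_ℂ)) := by
    have e3 : S.formMap β σ f (outer z) (outer y) =
        -∑ α, ((∑ i ∈ s, ∑ j ∈ s, ∑ k ∈ s, ∑ l ∈ s,
          star (z i * star (z j)) * (y k * star (y l)) * (t i * t j * ((t k)⁻¹ * (t l)⁻¹)) *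
          ((freqGauss σ (S.energy i - S.energy k - (S.energy j - S.energy l)) : ℂ) *
            (⟪S.basis i, S.lindVec f α k⟫_ℂ * star ⟪S.basis j, S.lindVec f α l⟫_ℂ))) -
          (∑ i ∈ s, ∑ j ∈ s, ∑ k ∈ s, ∑ l ∈ s,
          star (z i * star (z j)) * (y k * star (y l)) * (t i * t j * ((t k)⁻¹ * (t l)⁻¹)) *
          (if j = l then (driftWeight β σ (S.energy i - S.energy k) : ℂ) *
            ⟪S.lindVec f α i, S.lindVec f α k⟫_ℂ else 0)) -
          (∑ i ∈ s, ∑ j ∈ s, ∑ k ∈ s, ∑ l ∈ s,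
          star (z i * star (z j)) * (y k * star (y l)) * (t i * t j * ((t k)⁻¹ * (t l)⁻¹)) *
          (if i = k then (driftWeight β σ (S.energy j - S.energy l) : ℂ) *
            ⟪S.lindVec f α l, S.lindVec f α j⟫_ℂ else 0))) := by
      rw [e1]
      simp only [← Finset.sum_sub_distrib, ← mul_sub]
      simp only [← Finset.sum_neg_distrib]
      conv_rhs => rw [Finset.sum_comm]
      refine Finset.sum_congr rfl fun i _ => ?_
      conv_rhs => rw [Finset.sum_comm]
      refine Finset.sum_congr rfl fun j _ => ?_
      conv_rhs => rw [Finset.sum_comm]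
      refine Finset.sum_congr rfl fun k _ => ?_
      conv_rhs => rw [Finset.sum_comm]
      refine Finset.sum_congr rfl fun l _ => ?_
      rw [formEntry, hw, Finset.mul_sum, mul_neg, Finset.mul_sum, ← Finset.sum_neg_distrib]
      refine Finset.sum_congr rfl fun α _ => ?_
      rw [genEntry]
      congr 1
      rw [← mul_assoc]
    rw [e3]
    congr 1
    refine Finset.sum_congr rfl fun α _ => ?_
    rw [hD1 fun i k => (driftWeight β σ (S.energy i - S.energy k) : ℂ) *
      ⟪S.lindVec f α i, S.lindVec f α k⟫_ℂ, hD2 fun j l =>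
      (driftWeight β σ (S.energy j - S.energy l) : ℂ) * ⟪S.lindVec f α l, S.lindVec f α j⟫_ℂ,
      sub_zero, sub_zero, Finset.sum_product]
    refine Finset.sum_congr rfl fun i _ => ?_
    rw [Finset.sum_comm]
    refine Finset.sum_congr rfl fun k _ => ?_
    rw [Finset.sum_product]
    refine Finset.sum_congr rfl fun j _ => Finset.sum_congr rfl fun l _ => ?_
    have htr : ∀ i, star (t i) = t i := fun i => Complex.conj_ofReal _
    simp only [star_mul', star_star, star_inv₀, htr]
    ring
  rw [e2, Complex.neg_re, neg_nonpos, Complex.re_sum]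
  exact Finset.sum_nonneg fun α _ => re_sum_freqGauss_nonneg (s ×ˢ s)
    (fun a => S.energy a.1 - S.energy a.2) hσ _

end System

/-- The adjoint of a finitely supported matrix. -/
def adj (u : ι × ι →₀ ℂ) : ι × ι →₀ ℂ :=
  Finsupp.onFinset (u.support.map (Equiv.prodComm ι ι).toEmbedding) (fun p => star (u p.swap))
    fun p hp => by
      rw [Finset.mem_map_equiv, Finsupp.mem_support_iff]
      exact fun h => hp (by rw [show u p.swap = 0 from h, star_zero])

lemma adj_apply (u : ι × ι →₀ ℂ) (p : ι × ι) : adj u p = star (u p.swap) := rfl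

lemma adj_sum (u : ι × ι →₀ ℂ) {F : ι × ι → ℂ → ℂ} (hF : ∀ p, F p 0 = 0) :
    (adj u).sum F = u.sum fun p c => F p.swap (star c) := by
  rw [adj, Finsupp.onFinset_sum _ hF, Finset.sum_map]
  rfl

namespace System
variable [Fintype 𝒜] {S : System ι 𝒜 𝓗} {f : 𝓢(ℝ, ℂ)} {β σ : ℝ}

lemma formEntry_swap (p q : ι × ι) :
    S.formEntry β σ f p.swap q.swap = star (S.formEntry β σ f p q) := by
  classical
  rw [formEntry, formEntry, star_neg, star_mul', star_sum, Complex.star_def, Complex.conj_ofReal]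
  simp only [Prod.fst_swap, Prod.snd_swap]
  congr 2
  · congr 5; ring
  · refine Finset.sum_congr rfl fun α _ => ?_
    rw [genEntry, genEntry]
    simp only [Prod.fst_swap, Prod.snd_swap, map_sub, map_mul, Complex.conj_ofReal,
      apply_ite (starRingEnd ℂ), map_zero, inner_conj_symm, Complex.star_def]
    rw [← freqGauss_neg, neg_sub]
    ring

lemma formMap_adj (u v : ι × ι →₀ ℂ) :
    S.formMap β σ f (adj u) (adj v) = star (S.formMap β σ f u v) := by
  rw [formMap_apply, formMap_apply, adj_sum _ fun p => by simp, Finsupp.sum, Finsupp.sum, star_sum]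
  refine Finset.sum_congr rfl fun p _ => ?_
  rw [adj_sum _ fun q => by simp, Finsupp.sum, Finsupp.sum, star_sum]
  refine Finset.sum_congr rfl fun q _ => ?_
  rw [formEntry_swap, star_mul', star_mul']

end System

/-- The spectral decomposition of a finitely supported hermitian matrix. -/
lemma exists_spectral {u : ι × ι →₀ ℂ} (hu : adj u = u) :
    ∃ (s : Finset ι) (c : s → ℝ) (v : s → ι →₀ ℂ), u = ∑ r, (c r : ℂ) • outer (v r) ∧
      ∀ r r', r ≠ r' → dot (v r) (v r') = 0 := by
  classical
  set s : Finset ι := u.support.image Prod.fst ∪ u.support.image Prod.snd with hs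
  have hsu : ∀ p, u p ≠ 0 → p.1 ∈ s ∧ p.2 ∈ s := fun p hp =>
    ⟨Finset.mem_union_left _ (Finset.mem_image_of_mem _ (Finsupp.mem_support_iff.2 hp)),
      Finset.mem_union_right _ (Finset.mem_image_of_mem _ (Finsupp.mem_support_iff.2 hp))⟩
  let A : Matrix s s ℂ := fun i j => u (i, j)
  have hA : A.IsHermitian := by
    ext i j
    have := DFunLike.congr_fun hu ((i : ι), (j : ι))
    exact this
  let v : s → ι →₀ ℂ := fun r => Finsupp.onFinset s
    (fun i => if h : i ∈ s then (hA.eigenvectorUnitary : Matrix s s ℂ) ⟨i, h⟩ r else 0)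
    fun i hi => by by_contra h; exact hi (dif_neg h)
  have hv : ∀ r (i : s), v r i = (hA.eigenvectorUnitary : Matrix s s ℂ) i r := fun r i =>
    dif_pos i.2
  have hv0 : ∀ r i, i ∉ s → v r i = 0 := fun r i hi => dif_neg hi
  refine ⟨s, hA.eigenvalues, v, ?_, ?_⟩
  · ext p
    simp only [Finsupp.finsetSum_apply, Finsupp.smul_apply, outer_apply, smul_eq_mul]
    by_cases hp : p.1 ∈ s ∧ p.2 ∈ s
    · have h1 := congrFun (congrFun hA.spectral_theorem ⟨p.1, hp.1⟩) ⟨p.2, hp.2⟩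
      refine Eq.trans h1 ?_
      rw [Unitary.conjStarAlgAut_apply, Matrix.mul_apply]
      refine Finset.sum_congr rfl fun r _ => ?_
      rw [Matrix.mul_diagonal, hv r ⟨p.1, hp.1⟩, hv r ⟨p.2, hp.2⟩]
      simp only [Function.comp_apply, Matrix.star_apply]
      rw [mul_comm _ (RCLike.ofReal _), mul_assoc]
      rfl
    · have h0 : u p = 0 := by by_contra h; exact hp (hsu p h)
      rw [h0, eq_comm]
      refine Finset.sum_eq_zero fun r _ => ?_
      rcases not_and_or.1 hp with h | h
      · rw [hv0 r _ h]; simp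
      · rw [hv0 r _ h]; simp
  · intro r r' hrr
    rw [dot_eq (s := s) Finsupp.support_onFinset_subset, ← Finset.sum_coe_sort]
    have h1 := (Matrix.mem_unitaryGroup_iff'.1 hA.eigenvectorUnitary.2)
    have h2 := congrFun (congrFun h1 r) r'
    rw [Matrix.one_apply_ne hrr, Matrix.mul_apply] at h2
    refine Eq.trans (Finset.sum_congr rfl fun i _ => ?_) h2
    rw [hv, hv, Matrix.star_apply]

end Markov

section Core
open Filter Topology MeasureTheory

variable {ι 𝒜 𝓗 : Type*} [NormedAddCommGroup 𝓗] [InnerProductSpace ℂ 𝓗] [CompleteSpace 𝓗]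

lemma toHS_apply {x : ι × ι → ℂ} (hx : Memℓp x 2) (p : ι × ι) : System.toHS x p = x p := by
  rw [System.toHS, dif_pos hx]

lemma memℓp_finsupp (u : ι × ι →₀ ℂ) : Memℓp (u : ι × ι → ℂ) 2 := by
  rw [memℓp_two_iff]
  refine summable_of_ne_finset_zero (s := u.support) fun p hp => ?_
  rw [Finsupp.notMem_support_iff.1 hp]; simp

/-- The Hilbert-Schmidt operator with a finitely supported matrix. -/
def coreMap : (ι × ι →₀ ℂ) →ₗ[ℂ] lp (fun _ : ι × ι => ℂ) 2 where
  toFun u := ⟨fun p => u p, memℓp_finsupp u⟩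
  map_add' u v := by ext p; rfl
  map_smul' c u := by ext p; rfl

lemma coreMap_apply (u : ι × ι →₀ ℂ) (p : ι × ι) : coreMap u p = u p := rfl

lemma inner_coreMap (u : ι × ι →₀ ℂ) (y : lp (fun _ : ι × ι => ℂ) 2) :
    ⟪coreMap u, y⟫_ℂ = u.sum fun p c => star c * y p := by
  rw [lp.inner_eq_tsum, tsum_eq_sum (L := SummationFilter.unconditional _) (s := u.support)]
  · refine Finset.sum_congr rfl fun p _ => ?_
    rw [coreMap_apply]; exact mul_comm _ _
  · intro p hp
    rw [coreMap_apply, Finsupp.notMem_support_iff.1 hp, inner_zero_left]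

lemma inner_coreMap_single (p : ι × ι) (y : lp (fun _ : ι × ι => ℂ) 2) :
    ⟪coreMap (Finsupp.single p 1), y⟫_ℂ = y p := by
  rw [inner_coreMap, Finsupp.sum_single_index] <;> simp

lemma inner_outer_outer (a b : ι →₀ ℂ) :
    ⟪coreMap (outer a), coreMap (outer b)⟫_ℂ = dot a b * star (dot a b) := by
  classical
  rw [inner_coreMap, outer_sum subset_rfl fun p => by simp, dot_eq subset_rfl, star_sum,
    Finset.sum_mul_sum]
  refine Finset.sum_congr rfl fun i _ => Finset.sum_congr rfl fun j _ => ?_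
  rw [coreMap_apply, outer_apply]
  simp only [star_mul', star_star]
  ring

lemma norm_coreMap_adj_sub (u : ι × ι →₀ ℂ) {y : lp (fun _ : ι × ι => ℂ) 2}
    (hy : ∀ p, y p.swap = star (y p)) : ‖coreMap (adj u) - y‖ = ‖coreMap u - y‖ := by
  have h1 := hasSum_norm_sq_lp (coreMap (adj u) - y)
  have h2 := (Equiv.prodComm ι ι).hasSum_iff.2 (hasSum_norm_sq_lp (coreMap u - y))
  have h3 : ‖coreMap (adj u) - y‖ ^ 2 = ‖coreMap u - y‖ ^ 2 := by
    refine (h1.congr_fun fun p => ?_).unique h2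
    simp only [Function.comp_apply, Equiv.prodComm_apply, lp.coeFn_sub, Pi.sub_apply,
      coreMap_apply, adj_apply, hy]
    rw [← norm_star, star_sub, star_star]
  exact (sq_eq_sq₀ (norm_nonneg _) (norm_nonneg _)).1 h3

/-- Positive semidefinite Hilbert-Schmidt matrices. -/
def IsPSD (y : lp (fun _ : ι × ι => ℂ) 2) : Prop :=
  (∀ p, y p.swap = star (y p)) ∧ ∀ a : ι →₀ ℂ, 0 ≤ (⟪coreMap (outer a), y⟫_ℂ).re

lemma isClosed_isPSD : IsClosed {y : lp (fun _ : ι × ι => ℂ) 2 | IsPSD y} := by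
  have hc : ∀ p, Continuous fun y : lp (fun _ : ι × ι => ℂ) 2 => y p := fun p => by
    simp_rw [← inner_coreMap_single]; fun_prop
  simp only [IsPSD, Set.ofPred_and, Set.ofPred_forall]
  refine IsClosed.inter (isClosed_iInter fun p => ?_) (isClosed_iInter fun a => ?_)
  · exact isClosed_eq (hc _) (continuous_star.comp (hc _))
  · exact isClosed_le continuous_const (Complex.continuous_re.comp (by fun_prop))

lemma isPSD_outer (v : ι →₀ ℂ) : IsPSD (coreMap (outer v)) := by
  refine ⟨fun p => ?_, fun a => ?_⟩
  · simp only [coreMap_apply, outer_apply, Prod.fst_swap, Prod.snd_swap, star_mul', star_star]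
    exact mul_comm _ _
  · rw [inner_outer_outer, Complex.star_def, Complex.mul_conj, Complex.ofReal_re]
    exact Complex.normSq_nonneg _

lemma IsPSD.add {y z : lp (fun _ : ι × ι => ℂ) 2} (hy : IsPSD y) (hz : IsPSD z) :
    IsPSD (y + z) := by
  refine ⟨fun p => ?_, fun a => ?_⟩
  · simp only [lp.coeFn_add, Pi.add_apply, hy.1, hz.1, star_add]
  · rw [inner_add_right, Complex.add_re]; exact add_nonneg (hy.2 a) (hz.2 a)

lemma IsPSD.smul {y : lp (fun _ : ι × ι => ℂ) 2} (hy : IsPSD y) {c : ℝ} (hc : 0 ≤ c) :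
    IsPSD ((c : ℂ) • y) := by
  refine ⟨fun p => ?_, fun a => ?_⟩
  · simp only [lp.coeFn_smul, Pi.smul_apply, hy.1, smul_eq_mul, star_mul', Complex.star_def,
      Complex.conj_ofReal]
  · rw [inner_smul_right, Complex.re_ofReal_mul]; exact mul_nonneg hc (hy.2 a)

lemma IsPSD.zero : IsPSD (0 : lp (fun _ : ι × ι => ℂ) 2) :=
  ⟨fun p => by simp, fun a => by simp⟩

lemma IsPSD.sum {R : Type*} (s : Finset R) {y : R → lp (fun _ : ι × ι => ℂ) 2}
    (hy : ∀ r ∈ s, IsPSD (y r)) : IsPSD (∑ r ∈ s, y r) := by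
  classical
  induction s using Finset.induction_on with
  | empty => simpa using IsPSD.zero
  | insert a s ha ih =>
    rw [Finset.sum_insert ha]
    exact (hy a (Finset.mem_insert_self _ _)).add
      (ih fun r hr => hy r (Finset.mem_insert_of_mem hr))

namespace System
variable [Fintype 𝒜] {S : System ι 𝒜 𝓗} {f : 𝓢(ℝ, ℂ)} {β σ : ℝ}

/-- The positive part of a matrix has a smaller form and is closer to a positive matrix. -/
lemma exists_psd_le (hE : IsPosForm (S.formMap β σ f)) (hσ : 0 < σ) {h : ℝ} (hh : 0 < h)
    {y : lp (fun _ : ι × ι => ℂ) 2} (hy : IsPSD y) (u : ι × ι →₀ ℂ) :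
    ∃ u', IsPSD (coreMap u') ∧
      h * (S.formMap β σ f u' u').re + ‖coreMap u' - y‖ ^ 2 ≤
        h * (S.formMap β σ f u u).re + ‖coreMap u - y‖ ^ 2 := by
  classical
  set E := S.formMap β σ f with hEdef
  set w : ι × ι →₀ ℂ := (2⁻¹ : ℂ) • (u + adj u) with hw
  have hadj : adj w = w := by
    ext p
    simp only [hw, adj_apply, Finsupp.smul_apply, Finsupp.add_apply, smul_eq_mul, star_mul',
      star_add, star_star, Prod.swap_swap]
    rw [add_comm]
    congr 1
    simp
  have hwle : h * (E w w).re + ‖coreMap w - y‖ ^ 2 ≤ h * (E u u).re + ‖coreMap u - y‖ ^ 2 := by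
    have h1 : (E (adj u) (adj u)).re = (E u u).re := by
      rw [hEdef, formMap_adj]; simp
    have h2 : (E w w).re ≤ (E u u).re := by
      have e : (E w w).re = 4⁻¹ * (E (u + adj u) (u + adj u)).re := by
        rw [hw]
        rw [map_smul, LinearMap.map_smulₛₗ₂, smul_eq_mul, smul_eq_mul, map_inv₀, ← mul_assoc]
        have : (starRingEnd ℂ) 2 = 2 := Complex.conj_ofNat 2
        rw [this, show (2⁻¹ : ℂ) * 2⁻¹ = ((4⁻¹ : ℝ) : ℂ) by norm_num, Complex.re_ofReal_mul]
      have h3 := hE.nonneg (u - adj u)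
      rw [hE.re_sub] at h3
      rw [e, hE.re_add]
      linarith
    have h4 : ‖coreMap w - y‖ ≤ ‖coreMap u - y‖ := by
      have e : coreMap w - y = (2⁻¹ : ℂ) • ((coreMap u - y) + (coreMap (adj u) - y)) := by
        rw [hw, map_smul, map_add]
        module
      rw [e, norm_smul]
      have := norm_add_le (coreMap u - y) (coreMap (adj u) - y)
      rw [norm_coreMap_adj_sub u hy.1] at this
      have h5 : ‖(2⁻¹ : ℂ)‖ = 2⁻¹ := by norm_num
      rw [h5]; linarith
    have := pow_le_pow_left₀ (norm_nonneg _) h4 2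
    have := mul_le_mul_of_nonneg_left h2 hh.le
    linarith
  obtain ⟨s, c, v, hwv, hv⟩ := exists_spectral hadj
  set a : ι × ι →₀ ℂ := ∑ r, ((max (c r) 0 : ℝ) : ℂ) • outer (v r) with ha
  set b : ι × ι →₀ ℂ := ∑ r, ((max (-c r) 0 : ℝ) : ℂ) • outer (v r) with hb
  have hwab : w = a - b := by
    rw [hwv, ha, hb, ← Finset.sum_sub_distrib]
    refine Finset.sum_congr rfl fun r _ => ?_
    rw [← sub_smul, ← Complex.ofReal_sub]
    congr 2
    rcases le_total (c r) 0 with hc | hc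
    · rw [max_eq_right hc, max_eq_left (by linarith)]; ring
    · rw [max_eq_left hc, max_eq_right (by linarith)]; ring
  have hprod : ∀ r, max (c r) 0 * max (-c r) 0 = 0 := fun r => by
    rcases le_total (c r) 0 with hc | hc
    · rw [max_eq_right hc, zero_mul]
    · rw [max_eq_right (a := -c r) (by linarith), mul_zero]
  have hpsd : ∀ d : s → ℝ, (∀ r, 0 ≤ d r) →
      IsPSD (coreMap (∑ r, (d r : ℂ) • outer (v r))) := fun d hd => by
    rw [map_sum]
    refine IsPSD.sum _ fun r _ => ?_
    rw [map_smul]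
    exact (isPSD_outer _).smul (hd r)
  have hJ : ⟪coreMap a, coreMap b⟫_ℂ = 0 := by
    rw [ha, hb, map_sum, map_sum, sum_inner]
    refine Finset.sum_eq_zero fun r _ => ?_
    rw [inner_sum]
    refine Finset.sum_eq_zero fun r' _ => ?_
    rw [map_smul, map_smul, inner_smul_left, inner_smul_right, inner_outer_outer,
      Complex.conj_ofReal]
    by_cases hr : r = r'
    · subst hr
      rw [← mul_assoc, ← Complex.ofReal_mul, hprod, Complex.ofReal_zero, zero_mul]
    · rw [hv _ _ hr]; simp
  have hab : (E a b).re ≤ 0 := by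
    rw [ha, hb]
    rw [map_sum, Complex.re_sum]
    refine Finset.sum_nonpos fun r' _ => ?_
    rw [LinearMap.map_sum₂, Complex.re_sum]
    refine Finset.sum_nonpos fun r _ => ?_
    rw [map_smul, LinearMap.map_smulₛₗ₂, smul_eq_mul, smul_eq_mul, Complex.conj_ofReal]
    rw [← mul_assoc, ← Complex.ofReal_mul, Complex.re_ofReal_mul]
    by_cases hr : r = r'
    · subst hr
      rw [mul_comm (max (-_) _), hprod, zero_mul]
    · have h1 := re_formMap_outer_nonpos (S := S) (f := f) (β := β) hσ (hv _ _ hr)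
      exact mul_nonpos_of_nonneg_of_nonpos (by positivity) h1
  refine ⟨a, hpsd _ fun r => le_max_right _ _, le_trans ?_ hwle⟩
  have h1 : (E a a).re ≤ (E w w).re := by
    rw [hwab, hE.re_sub]
    linarith [hE.nonneg b]
  have h2 : ‖coreMap a - y‖ ^ 2 ≤ ‖coreMap w - y‖ ^ 2 := by
    have e : coreMap w - y = (coreMap a - y) - coreMap b := by rw [hwab, map_sub]; abel
    have hyb : 0 ≤ (⟪coreMap b, y⟫_ℂ).re := by
      rw [hb, map_sum, sum_inner, Complex.re_sum]
      refine Finset.sum_nonneg fun r _ => ?_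
      rw [map_smul, inner_smul_left, Complex.conj_ofReal, Complex.re_ofReal_mul]
      exact mul_nonneg (le_max_right _ _) (hy.2 _)
    rw [e, norm_sub_sq (𝕜 := ℂ) (coreMap a - y), inner_sub_left, hJ]
    have h3 : RCLike.re (0 - ⟪y, coreMap b⟫_ℂ) = -(⟪coreMap b, y⟫_ℂ).re := by
      rw [zero_sub, map_neg]
      exact congrArg Neg.neg (inner_re_symm (𝕜 := ℂ) _ _)
    rw [h3]
    nlinarith [sq_nonneg ‖coreMap b‖]
  have := mul_le_mul_of_nonneg_left h1 hh.le
  linarith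

end System
end Core

section Energy
open Filter Topology MeasureTheory

variable {ι 𝒜 𝓗 : Type*} [NormedAddCommGroup 𝓗] [InnerProductSpace ℂ 𝓗] [CompleteSpace 𝓗]

lemma applyAt_eq {X : 𝓗 →ₗ.[ℂ] 𝓗} {ψ : 𝓗} (h : ψ ∈ X.domain) : applyAt X ψ = X ⟨ψ, h⟩ :=
  dif_pos h

lemma inner_applyAt_adjoint {X Y : 𝓗 →ₗ.[ℂ] 𝓗} (hX : Dense (X.domain : Set 𝓗))
    (hY : Y = X.adjoint) {φ ψ : 𝓗} (hφ : φ ∈ Y.domain) (hψ : ψ ∈ X.domain) :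
    ⟪applyAt Y φ, ψ⟫_ℂ = ⟪φ, applyAt X ψ⟫_ℂ := by
  subst hY
  rw [applyAt_eq hφ, applyAt_eq hψ]
  exact LinearPMap.adjoint_isFormalAdjoint hX ⟨φ, hφ⟩ ⟨ψ, hψ⟩

lemma rpow_le_exp {γ b : ℝ} (hb : 0 < b) :
    ∃ K : ℝ, 0 ≤ K ∧ ∀ x : ℝ, 1 ≤ x → x ^ γ ≤ K * Real.exp (b * x) := by
  obtain ⟨n, hn⟩ := exists_nat_ge γ
  refine ⟨n.factorial / b ^ n, by positivity, fun x hx => ?_⟩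
  have h1 : x ^ γ ≤ x ^ n := by
    rw [← Real.rpow_natCast]; exact Real.rpow_le_rpow_of_exponent_le hx hn
  have h2 := Real.pow_div_factorial_le_exp (b * x) (by positivity) n
  refine h1.trans ?_
  rw [div_mul_eq_mul_div, le_div_iff₀ (by positivity)]
  rw [div_le_iff₀ (by positivity), mul_pow] at h2
  linarith

namespace System
variable {S : System ι 𝒜 𝓗} {f : 𝓢(ℝ, ℂ)} {β σ : ℝ}

lemma negPow_basis (γ : ℝ) (i : ι) :
    S.negPow γ (S.basis i) = (((S.energy i + S.h₀ + 1) ^ (-γ) : ℝ) : ℂ) • S.basis i := by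
  classical
  refine S.hasSum_fun_H fun j => ?_
  rw [inner_smul_right, S.inner_basis_eq]
  split_ifs with h
  · rw [h]
  · simp

section Jumps
variable (hG : S.IsGibbs) {τ : Equiv.Perm 𝒜} (hA : S.JumpCondition τ)
include hG hA

lemma exists_jumpVec_bound : ∃ γ C : ℝ, ∀ α i, S.basis i ∈ (S.A α).domain ∧
    ‖S.jumpVec α i‖ ≤ C * (S.energy i + S.h₀ + 1) ^ γ := by
  obtain ⟨γ, μ, C, -, -, h⟩ := hA.bounds
  refine ⟨γ, C, fun α i => ?_⟩
  obtain ⟨hd, η, h1, h2⟩ := (h α).1 (S.basis i)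
  have hx : 0 < S.energy i + S.h₀ + 1 := by linarith [hG.lower i]
  set c : ℂ := (((S.energy i + S.h₀ + 1) ^ (-γ) : ℝ) : ℂ) with hc
  have hc0 : c ≠ 0 := by rw [hc]; exact_mod_cast (Real.rpow_pos_of_pos hx _).ne'
  rw [negPow_basis] at hd
  have hm : S.basis i ∈ (S.A α).domain := ((S.A α).domain.smul_mem_iff hc0).1 hd
  refine ⟨hm, ?_⟩
  have h3 : η = c • S.jumpVec α i := by
    rw [jumpVec, applyAt_eq hm, ← LinearPMap.map_smul]
    refine h1.trans ?_
    congr 1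
    exact Subtype.ext (negPow_basis γ i)
  rw [h3, norm_smul, S.basis.orthonormal.1 i, mul_one, hc, Complex.norm_real,
    Real.norm_of_nonneg (Real.rpow_nonneg hx.le _), Real.rpow_neg hx.le] at h2
  have hp := Real.rpow_pos_of_pos hx γ
  rwa [inv_mul_le_iff₀ hp, mul_comm] at h2

lemma basis_mem_domain (α : 𝒜) (i : ι) : S.basis i ∈ (S.A α).domain := by
  obtain ⟨γ, C, h⟩ := exists_jumpVec_bound hG hA
  exact (h α i).1

lemma entry_adjoint (α : 𝒜) (k l : ι) : S.entry (τ α) k l = star (S.entry α l k) := by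
  rw [entry, ← inner_conj_symm, jumpVec, inner_applyAt_adjoint (hA.dense α) (hA.adjoint α)
    (basis_mem_domain hG hA _ _) (basis_mem_domain hG hA _ _)]
  rfl

lemma summable_jumpVec {b : ℝ} (hb : 0 < b) (α : 𝒜) :
    Summable fun k => Real.exp (-(b * S.energy k)) * ‖S.jumpVec α k‖ ^ 2 := by
  obtain ⟨γ, C, h⟩ := exists_jumpVec_bound hG hA
  obtain ⟨K, hK, hexp⟩ := rpow_le_exp (γ := 2 * γ) (half_pos hb)
  refine Summable.of_nonneg_of_le (fun k => by positivity) (fun k => ?_)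
    ((hG.summable _ (half_pos hb)).mul_left (C ^ 2 * K * Real.exp (b / 2 * (S.h₀ + 1))))
  have hx : 1 ≤ S.energy k + S.h₀ + 1 := by linarith [hG.lower k]
  have h1 := pow_le_pow_left₀ (norm_nonneg _) (h α k).2 2
  have h2 : ((S.energy k + S.h₀ + 1) ^ γ) ^ 2 ≤ K * Real.exp (b / 2 * (S.energy k + S.h₀ + 1)) := by
    rw [← Real.rpow_natCast, ← Real.rpow_mul (by linarith), mul_comm]
    exact hexp _ hx
  rw [mul_pow] at h1
  have h3 : ‖S.jumpVec α k‖ ^ 2 ≤ C ^ 2 * (K * Real.exp (b / 2 * (S.energy k + S.h₀ + 1))) :=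
    h1.trans (mul_le_mul_of_nonneg_left h2 (sq_nonneg C))
  refine (mul_le_mul_of_nonneg_left h3 (Real.exp_pos _).le).trans (le_of_eq ?_)
  have e : Real.exp (-(b * S.energy k)) * Real.exp (b / 2 * (S.energy k + S.h₀ + 1)) =
      Real.exp (b / 2 * (S.h₀ + 1)) * Real.exp (-(b / 2 * S.energy k)) := by
    rw [← Real.exp_add, ← Real.exp_add]; congr 1; ring
  linear_combination (C ^ 2 * K) * e

lemma summable_lindVec (hf : Integrable f) {b : ℝ} (hb : 0 < b) (α : 𝒜) :
    Summable fun k => Real.exp (-(b * S.energy k)) * ‖S.lindVec f α k‖ ^ 2 := by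
  refine Summable.of_nonneg_of_le (fun k => by positivity) (fun k => ?_)
    ((summable_jumpVec hG hA hb α).mul_left ((∫ s, ‖f s‖) ^ 2))
  have h1 := pow_le_pow_left₀ (norm_nonneg _) (S.norm_average_le hf k (S.jumpVec α k)) 2
  rw [mul_pow] at h1
  refine (mul_le_mul_of_nonneg_left h1 (Real.exp_pos _).le).trans (le_of_eq ?_)
  ring

end Jumps

section Gibbs
variable (hG : S.IsGibbs) (hβ : 0 < β)
include hG hβ

lemma gibbsWeight_pos (i : ι) : 0 < S.gibbsWeight β i :=
  div_pos (Real.exp_pos _) ((Real.exp_pos _).trans_le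
    ((hG.summable β hβ).le_tsum i fun _ _ => (Real.exp_pos _).le))

lemma hasSum_gibbsWeight [Nonempty ι] : HasSum (S.gibbsWeight β) 1 := by
  have h := hG.summable β hβ
  have hZ : 0 < ∑' j, Real.exp (-(β * S.energy j)) :=
    (Real.exp_pos _).trans_le (h.le_tsum (Classical.arbitrary ι) fun _ _ => (Real.exp_pos _).le)
  have := h.hasSum.div_const (∑' j, Real.exp (-(β * S.energy j)))
  rwa [div_self hZ.ne'] at this

lemma gibbsWeight_rpow (s : ℝ) (i : ι) : S.gibbsWeight β i ^ s =
    (∑' j, Real.exp (-(β * S.energy j))) ^ (-s) * Real.exp (-(s * β * S.energy i)) := by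
  have hZ : 0 < ∑' j, Real.exp (-(β * S.energy j)) :=
    (Real.exp_pos _).trans_le ((hG.summable β hβ).le_tsum i fun _ _ => (Real.exp_pos _).le)
  rw [gibbsWeight, Real.div_rpow (Real.exp_pos _).le hZ.le, ← Real.exp_mul, Real.rpow_neg hZ.le,
    div_eq_mul_inv, mul_comm]
  congr 2
  ring

lemma memℓp_ground (c : ℂ) : Memℓp (fun p : ι × ι => open Classical in
    if p.1 = p.2 then c * (Real.sqrt (S.gibbsWeight β p.1) : ℂ) else 0) 2 := by
  classical
  rw [memℓp_two_iff]
  have h1 : Function.Injective fun i : ι => (i, i) := fun i j h => congrArg Prod.fst h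
  rw [← h1.summable_iff (f := fun p : ι × ι => _)]
  · simp only [Function.comp_def, if_true, norm_mul, Complex.norm_real, mul_pow]
    have := ((hG.summable β hβ).div_const (∑' j, Real.exp (-(β * S.energy j)))).mul_left (‖c‖ ^ 2)
    refine this.congr fun i => ?_
    rw [Real.norm_of_nonneg (Real.sqrt_nonneg _), Real.sq_sqrt (gibbsWeight_pos hG hβ i).le]
    rfl
  · rintro ⟨i, j⟩ hij
    rw [if_neg]
    · simp
    · intro h
      exact hij ⟨i, Prod.ext rfl h⟩

lemma coreVec_apply (x : ι × ι →₀ ℂ) (c : ℂ) (p : ι × ι) : S.coreVec β x c p =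
    x p + open Classical in
      if p.1 = p.2 then c * (Real.sqrt (S.gibbsWeight β p.1) : ℂ) else 0 :=
  toHS_apply ((memℓp_finsupp x).add (memℓp_ground hG hβ c)) p

lemma coreVec_eq (x : ι × ι →₀ ℂ) (c : ℂ) :
    S.coreVec β x c = coreMap x + c • S.coreVec β 0 1 := by
  ext p
  rw [lp.coeFn_add, lp.coeFn_smul, Pi.add_apply, Pi.smul_apply, coreVec_apply hG hβ,
    coreVec_apply hG hβ, coreMap_apply]
  split_ifs <;> simp

/-- The core of the Dirichlet form as a linear map. -/
lemma exists_coreVec_linear : ∃ J : (ι × ι →₀ ℂ) × ℂ →ₗ[ℂ] lp (fun _ : ι × ι => ℂ) 2,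
    ∀ x c, J (x, c) = S.coreVec β x c :=
  ⟨coreMap.coprod ((LinearMap.id : ℂ →ₗ[ℂ] ℂ).smulRight (S.coreVec β 0 1)), fun x c => by
    rw [coreVec_eq hG hβ x c]; rfl⟩

end Gibbs

section Resolvent
variable [Fintype 𝒜] (hG : S.IsGibbs) {τ : Equiv.Perm 𝒜} (hA : S.JumpCondition τ)
  (hf : Integrable f) (hβ : 0 < β) (hσ : 0 < σ)
include hG hA hf hβ hσ

lemma norm_genEntry_le (α : 𝒜) (p q : ι × ι) : ‖S.genEntry β σ f α p q‖ ≤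
    (‖S.lindVec f α q.1‖ + open Classical in if p.1 = q.1 then 1 + ‖S.lindVec f α p.1‖ else 0) *
    (‖S.lindVec f α q.2‖ + open Classical in if p.2 = q.2 then 1 + ‖S.lindVec f α p.2‖ else 0) *
    (1 + ‖S.lindVec f α p.1‖ + ‖S.lindVec f α p.2‖) := by
  classical
  have hg : ∀ ω, ‖((freqGauss σ ω : ℝ) : ℂ)‖ ≤ 1 := fun ω => by
    rw [Complex.norm_real, freqGauss, Real.norm_of_nonneg (Real.exp_pos _).le]
    exact Real.exp_le_one_iff.2 (neg_nonpos.2 (by positivity))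
  have hd : ∀ ω, ‖((driftWeight β σ ω : ℝ) : ℂ)‖ ≤ 1 := fun ω => by
    have h1 : 0 < Real.exp (β * ω / 2) := Real.exp_pos _
    rw [Complex.norm_real, driftWeight, Real.norm_of_nonneg (by positivity)]
    rw [div_le_one (by positivity)]
    exact (Real.exp_le_one_iff.2 (neg_nonpos.2 (by positivity))).trans (by linarith)
  have hb : ∀ i j, ‖⟪S.basis i, S.lindVec f α j⟫_ℂ‖ ≤ ‖S.lindVec f α j‖ := fun i j => by
    simpa [S.basis.orthonormal.1 i] using norm_inner_le_norm (𝕜 := ℂ) (S.basis i) (S.lindVec f α j)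
  set a := ‖S.lindVec f α q.1‖ with ha
  set b := ‖S.lindVec f α q.2‖ with hb'
  set c := ‖S.lindVec f α p.1‖ with hc
  set d := ‖S.lindVec f α p.2‖ with hd'
  have ha0 : 0 ≤ a := norm_nonneg _
  have hb0 : 0 ≤ b := norm_nonneg _
  have hc0 : 0 ≤ c := norm_nonneg _
  have hd0 : 0 ≤ d := norm_nonneg _
  have t1 : ‖(freqGauss σ (S.energy p.1 - S.energy q.1 - (S.energy p.2 - S.energy q.2)) : ℂ) *
      (⟪S.basis p.1, S.lindVec f α q.1⟫_ℂ * star ⟪S.basis p.2, S.lindVec f α q.2⟫_ℂ)‖ ≤ a * b := by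
    rw [norm_mul, norm_mul, norm_star]
    have := mul_le_mul (hb p.1 q.1) (hb p.2 q.2) (norm_nonneg _) ha0
    calc _ ≤ 1 * (a * b) := mul_le_mul (hg _) this (by positivity) zero_le_one
      _ = a * b := one_mul _
  have t2 : ‖if p.2 = q.2 then (driftWeight β σ (S.energy p.1 - S.energy q.1) : ℂ) *
      ⟪S.lindVec f α p.1, S.lindVec f α q.1⟫_ℂ else 0‖ ≤ if p.2 = q.2 then a * c else 0 := by
    split_ifs
    · rw [norm_mul]
      calc _ ≤ 1 * (c * a) := mul_le_mul (hd _) (norm_inner_le_norm _ _) (norm_nonneg _) zero_le_one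
        _ = a * c := by ring
    · simp
  have t3 : ‖if p.1 = q.1 then (driftWeight β σ (S.energy p.2 - S.energy q.2) : ℂ) *
      ⟪S.lindVec f α q.2, S.lindVec f α p.2⟫_ℂ else 0‖ ≤ if p.1 = q.1 then b * d else 0 := by
    split_ifs
    · rw [norm_mul]
      calc _ ≤ 1 * (b * d) := mul_le_mul (hd _) (norm_inner_le_norm _ _) (norm_nonneg _) zero_le_one
        _ = b * d := one_mul _
    · simp
  rw [genEntry]
  refine (norm_sub_le _ _).trans ((add_le_add_left ((norm_sub_le _ _).trans
    (add_le_add t1 t2)) _).trans ((add_le_add_right t3 _).trans ?_))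
  have hab : 0 ≤ a * b := by positivity
  have hac : 0 ≤ a * c := by positivity
  have had : 0 ≤ a * d := by positivity
  have hbc : 0 ≤ b * c := by positivity
  have hbd : 0 ≤ b * d := by positivity
  have hcd : 0 ≤ c * d := by positivity
  have m1 : 0 ≤ a * b * c := by positivity
  have m2 : 0 ≤ a * b * d := by positivity
  rw [← sub_nonneg]
  split_ifs <;> ring_nf <;> positivity

lemma summable_genEntry_bound (α : 𝒜) (j : ι) : Summable fun k =>
    (Real.exp (-(β * S.energy k / 4)) * (‖S.lindVec f α k‖ +
      open Classical in if j = k then 1 + ‖S.lindVec f α j‖ else 0)) ^ 2 := by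
  classical
  have h1 : Summable fun k => 2 * (Real.exp (-(β / 2 * S.energy k)) * ‖S.lindVec f α k‖ ^ 2) +
      2 * (if j = k then (Real.exp (-(β * S.energy k / 4)) * (1 + ‖S.lindVec f α j‖)) ^ 2
        else 0) := by
    refine ((summable_lindVec hG hA hf (half_pos hβ) α).mul_left 2).add (Summable.mul_left 2 ?_)
    exact summable_of_ne_finset_zero (s := {j}) fun k hk =>
      if_neg fun h => hk (Finset.mem_singleton.2 h.symm)
  refine Summable.of_nonneg_of_le (fun k => sq_nonneg _) (fun k => ?_) h1
  have e : Real.exp (-(β / 2 * S.energy k)) = Real.exp (-(β * S.energy k / 4)) ^ 2 := by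
    rw [← Real.exp_nat_mul]; congr 1; push_cast; ring
  rw [e, ← mul_pow, ← mul_add, mul_add (Real.exp _)]
  refine le_trans add_sq_le (le_of_eq ?_)
  split_ifs <;> simp

lemma memℓp_genEntry (p : ι × ι) (α : 𝒜) : Memℓp (fun q => (Real.exp (-(β *
    (S.energy q.1 + S.energy q.2 - S.energy p.1 - S.energy p.2) / 4)) : ℂ) *
      S.genEntry β σ f α p q) 2 := by
  classical
  have hg := summable_genEntry_bound hG hA hf hβ hσ α
  have hsum := ((hg p.1).mul_of_nonneg (hg p.2) (fun _ => sq_nonneg _) fun _ =>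
    sq_nonneg _).mul_left ((Real.exp (β * (S.energy p.1 + S.energy p.2) / 4) *
      (1 + ‖S.lindVec f α p.1‖ + ‖S.lindVec f α p.2‖)) ^ 2)
  rw [memℓp_two_iff]
  refine Summable.of_nonneg_of_le (fun q => sq_nonneg _) (fun q => ?_) hsum
  have h1 := norm_genEntry_le hG hA hf hβ hσ α p q
  have e2 : Real.exp (-(β * (S.energy q.1 + S.energy q.2 - S.energy p.1 - S.energy p.2) / 4)) =
      Real.exp (β * (S.energy p.1 + S.energy p.2) / 4) *
      (Real.exp (-(β * S.energy q.1 / 4)) * Real.exp (-(β * S.energy q.2 / 4))) := by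
    rw [← Real.exp_add, ← Real.exp_add]; congr 1; ring
  rw [norm_mul, Complex.norm_real, Real.norm_of_nonneg (Real.exp_pos _).le, e2]
  have h2 : ∀ a b c x y z g : ℝ, 0 ≤ a → 0 ≤ b → 0 ≤ c → 0 ≤ g → g ≤ x * y * z →
      (a * (b * c) * g) ^ 2 ≤ (a * z) ^ 2 * ((b * x) ^ 2 * (c * y) ^ 2) := by
    intro a b c x y z g ha hb hc hg h
    rw [← mul_pow, ← mul_pow]
    refine pow_le_pow_left₀ (by positivity) ((mul_le_mul_of_nonneg_left h (by positivity)).trans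
      (le_of_eq ?_)) 2
    ring
  exact h2 _ _ _ _ _ _ _ (Real.exp_pos _).le (Real.exp_pos _).le (Real.exp_pos _).le
    (norm_nonneg _) h1

lemma memℓp_formEntry (p : ι × ι) : Memℓp (fun q => S.formEntry β σ f p q) 2 := by
  have h := (Memℓp.finsetSum Finset.univ fun α _ => memℓp_genEntry hG hA hf hβ hσ p α).neg
  have e : (fun q => S.formEntry β σ f p q) = -fun q => ∑ α, (Real.exp (-(β *
      (S.energy q.1 + S.energy q.2 - S.energy p.1 - S.energy p.2) / 4)) : ℂ) *
        S.genEntry β σ f α p q := by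
    ext q
    rw [Pi.neg_apply, formEntry, Finset.mul_sum]
  rw [e]
  exact h

/-- The form against a matrix unit is continuous in the Hilbert-Schmidt norm. -/
lemma exists_formVec (p : ι × ι) : ∃ v : lp (fun _ : ι × ι => ℂ) 2,
    (∀ q, v q = star (S.formEntry β σ f p q)) ∧
    ∀ u, S.formMap β σ f (Finsupp.single p 1) u = ⟪v, coreMap u⟫_ℂ := by
  have hm : Memℓp (fun q => star (S.formEntry β σ f p q)) 2 := by
    have := memℓp_formEntry hG hA hf hβ hσ p
    rw [memℓp_two_iff] at this ⊢
    simpa only [norm_star] using this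
  refine ⟨⟨_, hm⟩, fun q => rfl, fun u => ?_⟩
  rw [formMap_apply, Finsupp.sum_single_index (by simp), ← inner_conj_symm, inner_coreMap,
    Finsupp.sum, Finsupp.sum, map_sum]
  refine Finset.sum_congr rfl fun q _ => ?_
  simp

/-- The form along the finite sections of `√σ_β` tends to zero. -/
lemma tendsto_formMap_ground : Tendsto (fun F : Finset ι => (S.formMap β σ f
      (∑ i ∈ F, (Real.sqrt (S.gibbsWeight β i) : ℂ) • Finsupp.single (i, i) 1)
      (∑ i ∈ F, (Real.sqrt (S.gibbsWeight β i) : ℂ) • Finsupp.single (i, i) 1)).re)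
    atTop (𝓝 0) := by
  classical
  have hw0 := gibbsWeight_pos hG hβ
  have key : ∀ F : Finset ι, (S.formMap β σ f
      (∑ i ∈ F, (Real.sqrt (S.gibbsWeight β i) : ℂ) • Finsupp.single (i, i) 1)
      (∑ i ∈ F, (Real.sqrt (S.gibbsWeight β i) : ℂ) • Finsupp.single (i, i) 1)).re =
      ∑ α, (∑ k ∈ F, S.gibbsWeight β k * ‖S.lindVec f α k‖ ^ 2 -
        ∑ z ∈ F ×ˢ F, S.gibbsWeight β z.1 * ‖⟪S.basis z.2, S.lindVec f α z.1⟫_ℂ‖ ^ 2) := by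
    intro F
    rw [map_sum, Complex.re_sum]
    simp only [Finset.sum_product]
    rw [Finset.sum_congr rfl fun α _ => (Finset.sum_sub_distrib _ _).symm, Finset.sum_comm]
    refine Finset.sum_congr rfl fun k hk => ?_
    rw [LinearMap.map_sum₂, Complex.re_sum]
    have e : ∀ i ∈ F, (S.formMap β σ f ((Real.sqrt (S.gibbsWeight β i) : ℂ) •
        Finsupp.single (i, i) 1) ((Real.sqrt (S.gibbsWeight β k) : ℂ) •
          Finsupp.single (k, k) 1)).re = ∑ α, ((if i = k then S.gibbsWeight β k *
            ‖S.lindVec f α k‖ ^ 2 else 0) -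
            S.gibbsWeight β k * ‖⟪S.basis i, S.lindVec f α k⟫_ℂ‖ ^ 2) := by
      intro i hi
      rw [map_smul, LinearMap.map_smulₛₗ₂, smul_eq_mul, smul_eq_mul, Complex.conj_ofReal,
        formMap_apply, Finsupp.sum_single_index (by simp), Finsupp.sum_single_index (by simp),
        star_one, one_mul, one_mul, formEntry]
      have e1 : Real.sqrt (S.gibbsWeight β k) * Real.sqrt (S.gibbsWeight β i) *
          Real.exp (-(β * (S.energy k + S.energy k - S.energy i - S.energy i) / 4)) =
          S.gibbsWeight β k := by
        have e2 : Real.exp (-(β * (S.energy k + S.energy k - S.energy i - S.energy i) / 4)) =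
            Real.sqrt (S.gibbsWeight β k) / Real.sqrt (S.gibbsWeight β i) := by
          rw [Real.sqrt_eq_rpow, Real.sqrt_eq_rpow, gibbsWeight_rpow hG hβ,
            gibbsWeight_rpow hG hβ, mul_div_mul_left, ← Real.exp_sub]
          · congr 1; ring
          · exact (Real.rpow_pos_of_pos ((Real.exp_pos _).trans_le
              ((hG.summable β hβ).le_tsum i fun _ _ => (Real.exp_pos _).le)) _).ne'
        have h1 : Real.sqrt (S.gibbsWeight β i) ≠ 0 := (Real.sqrt_pos.2 (hw0 i)).ne'
        rw [e2]
        field_simp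
        exact Real.sq_sqrt (hw0 k).le
      have e3 : ∀ α, S.genEntry β σ f α (i, i) (k, k) =
          ((‖⟪S.basis i, S.lindVec f α k⟫_ℂ‖ ^ 2 - if i = k then ‖S.lindVec f α k‖ ^ 2 else 0 : ℝ) : ℂ) := by
        intro α
        have hf0 : freqGauss σ 0 = 1 := by simp [freqGauss]
        have hd0 : driftWeight β σ 0 = 1 / 2 := by simp [driftWeight]; norm_num
        have hs : ∀ z : ℂ, z * star z = ((‖z‖ ^ 2 : ℝ) : ℂ) := fun z => by
          rw [Complex.star_def, Complex.mul_conj, Complex.normSq_eq_norm_sq]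
        rw [genEntry, hs, sub_self, hf0]
        split_ifs with h
        · dsimp only at h
          subst h
          simp only [sub_self, hd0]
          rw [inner_self_eq_norm_sq_to_K]
          push_cast
          norm_num
          ring
        · simp
      rw [Finset.sum_congr rfl fun α _ => e3 α, ← Complex.ofReal_sum, ← Complex.ofReal_mul,
        ← Complex.ofReal_neg, ← Complex.ofReal_mul, ← Complex.ofReal_mul, Complex.ofReal_re]
      dsimp only
      rw [← mul_assoc, mul_neg, ← mul_assoc, e1, Finset.mul_sum, ← Finset.sum_neg_distrib]
      refine Finset.sum_congr rfl fun α _ => ?_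
      split_ifs <;> ring
    rw [Finset.sum_congr rfl e, Finset.sum_comm]
    refine Finset.sum_congr rfl fun α _ => ?_
    rw [Finset.sum_sub_distrib, Finset.sum_ite_eq', if_pos hk]
  simp_rw [key]
  rw [show (0 : ℝ) = ∑ α : 𝒜, 0 by simp]
  refine tendsto_finsetSum _ fun α _ => ?_
  have hs : Summable fun k => S.gibbsWeight β k * ‖S.lindVec f α k‖ ^ 2 := by
    refine ((summable_lindVec hG hA hf hβ α).mul_left
      (∑' j, Real.exp (-(β * S.energy j)))⁻¹).congr fun k => ?_
    rw [gibbsWeight]; ring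
  have hb : ∀ k, HasSum (fun i => S.gibbsWeight β k * ‖⟪S.basis i, S.lindVec f α k⟫_ℂ‖ ^ 2)
      (S.gibbsWeight β k * ‖S.lindVec f α k‖ ^ 2) := fun k => by
    have := hasSum_norm_sq_lp (S.basis.repr (S.lindVec f α k))
    simp only [S.basis.repr_apply_apply, LinearIsometryEquiv.norm_map] at this
    exact this.mul_left _
  have h2 : Summable fun z : ι × ι =>
      S.gibbsWeight β z.1 * ‖⟪S.basis z.2, S.lindVec f α z.1⟫_ℂ‖ ^ 2 := by
    rw [summable_prod_of_nonneg fun z => mul_nonneg (hw0 _).le (sq_nonneg _)]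
    exact ⟨fun k => (hb k).summable, hs.congr fun k => (hb k).tsum_eq.symm⟩
  have h3 : HasSum (fun z : ι × ι =>
      S.gibbsWeight β z.1 * ‖⟪S.basis z.2, S.lindVec f α z.1⟫_ℂ‖ ^ 2)
      (∑' k, S.gibbsWeight β k * ‖S.lindVec f α k‖ ^ 2) := by
    have := h2.hasSum.prod_fiberwise hb
    rw [this.tsum_eq]
    exact h2.hasSum
  have h4 : Tendsto (fun F : Finset ι => ∑ k ∈ F, S.gibbsWeight β k * ‖S.lindVec f α k‖ ^ 2) atTop
      (𝓝 (∑' k, S.gibbsWeight β k * ‖S.lindVec f α k‖ ^ 2)) := hs.hasSum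
  have h5 : Tendsto (fun F : Finset ι => ∑ z ∈ F ×ˢ F,
      S.gibbsWeight β z.1 * ‖⟪S.basis z.2, S.lindVec f α z.1⟫_ℂ‖ ^ 2) atTop
      (𝓝 (∑' k, S.gibbsWeight β k * ‖S.lindVec f α k‖ ^ 2)) := h3.comp tendsto_prod_self_atTop
  simpa only [sub_self] using h4.sub h5

end Resolvent

end System
end Energy

namespace System

section Resolvents
open Filter Topology MeasureTheory

variable {ι 𝒜 𝓗 : Type*} [NormedAddCommGroup 𝓗] [InnerProductSpace ℂ 𝓗] [CompleteSpace 𝓗]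
  {S : System ι 𝒜 𝓗} {f : 𝓢(ℝ, ℂ)} {β σ : ℝ}
variable [Fintype 𝒜] (hG : S.IsGibbs) {τ : Equiv.Perm 𝒜} (hA : S.JumpCondition τ)
  (hf : Integrable f) (hβ : 0 < β) (hσ : 0 < σ)

section
include hG hβ

lemma tendsto_section_ground : Tendsto (fun F : Finset ι => coreMap
      (∑ i ∈ F, (Real.sqrt (S.gibbsWeight β i) : ℂ) • Finsupp.single (i, i) 1))
    atTop (𝓝 (S.coreVec β 0 1)) := by
  classical
  have h1 := lp.hasSum_single (p := 2) (by norm_num) (S.coreVec β 0 1)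
  have h2 : Function.Injective fun i : ι => (i, i) := fun i j h => congrArg Prod.fst h
  rw [← h2.hasSum_iff] at h1
  · have h3 : Tendsto _ _ _ := h1
    refine h3.congr fun F => ?_
    rw [map_sum]
    refine Finset.sum_congr rfl fun i _ => ?_
    ext p
    rw [Function.comp_apply, lp.single_apply, coreMap_apply, coreVec_apply hG hβ,
      Finsupp.smul_apply, Finsupp.single_apply]
    by_cases h : p = (i, i)
    · subst h; simp
    · rw [if_neg (Ne.symm h), Pi.single_eq_of_ne h]; simp
  · rintro ⟨i, j⟩ hij
    ext p
    have : i ≠ j := fun h => hij ⟨i, Prod.ext rfl h⟩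
    rw [coreVec_apply hG hβ, lp.single_apply]
    by_cases h : p = (i, j)
    · subst h; simp [this]
    · rw [Pi.single_eq_of_ne h]; simp

end

include hG hA hf hβ hσ

lemma inner_formVec_ground (hE : IsPosForm (S.formMap β σ f)) (p : ι × ι)
    {v : lp (fun _ : ι × ι => ℂ) 2}
    (hv : ∀ u, S.formMap β σ f (Finsupp.single p 1) u = ⟪v, coreMap u⟫_ℂ) :
    ⟪v, S.coreVec β 0 1⟫_ℂ = 0 := by
  have h1 : Tendsto (fun F : Finset ι => ⟪v, coreMap
      (∑ i ∈ F, (Real.sqrt (S.gibbsWeight β i) : ℂ) • Finsupp.single (i, i) 1)⟫_ℂ)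
    atTop (𝓝 ⟪v, S.coreVec β 0 1⟫_ℂ) := tendsto_const_nhds.inner (tendsto_section_ground hG hβ)
  refine tendsto_nhds_unique h1 ?_
  have h2 := ((tendsto_formMap_ground hG hA hf hβ hσ).sqrt).const_mul
    (Real.sqrt (S.formMap β σ f (Finsupp.single p 1) (Finsupp.single p 1)).re)
  rw [Real.sqrt_zero, mul_zero] at h2
  refine squeeze_zero_norm (fun F => ?_) h2
  rw [← hv]
  exact hE.cauchy_schwarz _ _

/-- The graph of the generator acts on matrix elements by the matrix of the form. -/
lemma negGenerator_apply (hkms : IsKMSFilter β f) {w} (hw : w ∈ S.negGenerator β σ f)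
    (p : ι × ι) : HasSum (fun q => S.formEntry β σ f p q * w.1 q) (w.2 p) := by
  have hτ := entry_adjoint hG hA
  have hE := isPosForm_formMap (β := β) (σ := σ) hf hσ hkms hτ
  obtain ⟨v, hv, hv'⟩ := exists_formVec hG hA hf hβ hσ p
  obtain ⟨u, c, h1, -, h3⟩ := hw
  have h4 : Tendsto (fun n => ⟪v, S.coreVec β (u n) (c n)⟫_ℂ) atTop (𝓝 ⟪v, w.1⟫_ℂ) :=
    tendsto_const_nhds.inner h1
  have h5 := h3 (Finsupp.single p 1) 0
  rw [coreVec_eq hG hβ, zero_smul, add_zero, inner_coreMap_single] at h5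
  have h6 : w.2 p = ⟪v, w.1⟫_ℂ := by
    refine tendsto_nhds_unique (h5.congr fun n => ?_) h4
    rw [form_eq_formMap hf hkms hτ, hv', coreVec_eq hG hβ, inner_add_right, inner_smul_right,
      inner_formVec_ground hG hA hf hβ hσ hE p hv', mul_zero, add_zero]
  rw [h6]
  refine (lp.hasSum_inner v w.1).congr_fun fun q => ?_
  rw [hv]
  simp [mul_comm]

/-- The resolvents of the generator: contractions that preserve positivity and the ground state. -/
theorem exists_resolvents (hkms : IsKMSFilter β f) :
    ∃ R : ℝ → lp (fun _ : ι × ι => ℂ) 2 →L[ℂ] lp (fun _ : ι × ι => ℂ) 2, ∀ h, 0 < h →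
      ‖R h‖ ≤ 1 ∧ IsSelfAdjoint (R h) ∧ (∀ x, 0 ≤ (⟪x, R h x⟫_ℂ).re) ∧
      (∀ y, (R h y, (h : ℂ)⁻¹ • (y - R h y)) ∈ S.negGenerator β σ f) ∧
      (∀ y, IsPSD y → IsPSD (R h y)) ∧ R h (S.coreVec β 0 1) = S.coreVec β 0 1 ∧
      ∀ x y, (x, (h : ℂ)⁻¹ • (y - x)) ∈ S.negGenerator β σ f → x = R h y := by
  have hτ := entry_adjoint hG hA
  have hE := isPosForm_formMap (β := β) (σ := σ) hf hσ hkms hτ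
  obtain ⟨J, hJ⟩ := exists_coreVec_linear (S := S) hG hβ
  have hgr : S.negGenerator β σ f = formGraph (S.formMap β σ f) J := by
    simp only [negGenerator, formGraph, hJ, form_eq_formMap hf hkms hτ]
  have key : ∀ h : ℝ, 0 < h → ∃ R : lp (fun _ : ι × ι => ℂ) 2 →L[ℂ] lp (fun _ : ι × ι => ℂ) 2,
      ‖R‖ ≤ 1 ∧ IsSelfAdjoint R ∧ (∀ x, 0 ≤ (⟪x, R x⟫_ℂ).re) ∧
      (∀ y, (R y, (h : ℂ)⁻¹ • (y - R y)) ∈ S.negGenerator β σ f) ∧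
      (∀ y, IsPSD y → IsPSD (R y)) ∧ R (S.coreVec β 0 1) = S.coreVec β 0 1 ∧
      ∀ x y, (x, (h : ℂ)⁻¹ • (y - x)) ∈ S.negGenerator β σ f → x = R y := by
    intro h hh
    obtain ⟨R, h1, h2, h3, h4, h5⟩ := exists_form_resolvent hE coreMap hh
    have h6 : ∀ y, (R y, (h : ℂ)⁻¹ • (y - R y)) ∈ S.negGenerator β σ f := by
      intro y
      obtain ⟨u, u1, u2, u3⟩ := h4 y
      have hground : ⟪S.coreVec β 0 1, (h : ℂ)⁻¹ • (y - R y)⟫_ℂ = 0 := by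
        have a1 : Tendsto (fun F : Finset ι => ⟪coreMap (∑ i ∈ F,
            (Real.sqrt (S.gibbsWeight β i) : ℂ) • Finsupp.single (i, i) 1),
            (h : ℂ)⁻¹ • (y - R y)⟫_ℂ) atTop (𝓝 ⟪S.coreVec β 0 1, (h : ℂ)⁻¹ • (y - R y)⟫_ℂ) :=
          (tendsto_section_ground hG hβ).inner tendsto_const_nhds
        refine tendsto_nhds_unique a1 ?_
        obtain ⟨n₁, hn₁⟩ := u2 1 one_pos
        set B : ℝ := 2 * 1 + 2 * (S.formMap β σ f (u n₁) (u n₁)).re with hB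
        have hbd : ∀ n ≥ n₁, (S.formMap β σ f (u n) (u n)).re ≤ B := by
          intro n hn
          have a := hn₁ n hn n₁ le_rfl
          rw [hE.norm_self] at a
          have b := hE.re_sub_le (u n - u n₁) (-u n₁)
          rw [sub_neg_eq_add, sub_add_cancel] at b
          simp only [map_neg, LinearMap.neg_apply, neg_neg] at b
          linarith
        have a2 := ((tendsto_formMap_ground hG hA hf hβ hσ).sqrt).mul_const (Real.sqrt B)
        rw [Real.sqrt_zero, zero_mul] at a2
        refine squeeze_zero_norm (fun F => ?_) a2
        refine le_of_tendsto (u3 _).norm (eventually_atTop.2 ⟨n₁, fun n hn => ?_⟩)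
        exact (hE.cauchy_schwarz _ _).trans
          (mul_le_mul_of_nonneg_left (Real.sqrt_le_sqrt (hbd n hn)) (Real.sqrt_nonneg _))
      refine ⟨u, fun _ => 0, ?_, ?_, fun z d => ?_⟩
      · simpa only [coreVec_eq hG hβ _ (0 : ℂ), zero_smul, add_zero] using u1
      · simpa only [form_eq_formMap hf hkms hτ] using u2
      · simp only [form_eq_formMap hf hkms hτ]
        rw [coreVec_eq hG hβ, inner_add_left, inner_smul_left, hground, mul_zero, add_zero]
        exact u3 z
    have h7 : ∀ x y, (x, (h : ℂ)⁻¹ • (y - x)) ∈ S.negGenerator β σ f → x = R y :=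
      fun x y hxy => by
        have := h6 y
        rw [hgr] at hxy this
        exact formGraph_resolvent_unique hE hh hxy this
    refine ⟨R, h1, h2, h3, h6, fun y hy => ?_, (h7 _ _ ?_).symm, h7⟩
    · exact h5 y {y | IsPSD y} isClosed_isPSD fun u => exists_psd_le hE hσ hh hy u
    · rw [sub_self, smul_zero]
      refine ⟨fun _ => 0, fun _ => 1, tendsto_const_nhds, fun ε hε => ⟨0, fun m _ n _ => ?_⟩,
        fun z d => ?_⟩
      · rw [sub_self, form_eq_formMap hf hkms hτ, map_zero, norm_zero]; exact hε
      · simp only [form_eq_formMap hf hkms hτ, map_zero, inner_zero_right]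
        exact tendsto_const_nhds
  choose! R hR using key
  exact ⟨R, hR⟩

end Resolvents
end System

/-! ### The weights `e^{-s N^κ}` -/

section Weights
open Filter Topology MeasureTheory ContinuousLinearMap

/-- The function `φ(1/x - 1)` for `φ(n) = e^{-s n^κ}`. -/
def powWeight (κ s x : ℝ) : ℝ := if 0 < x then Real.exp (-(s * (1 / x - 1) ^ κ)) else 0

lemma continuous_powWeight {κ s : ℝ} (hκ : 0 < κ) (hs : 0 < s) : Continuous (powWeight κ s) := by
  rw [continuous_iff_continuousAt]
  intro x
  rcases lt_trichotomy x 0 with hx | rfl | hx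
  · refine ContinuousAt.congr (f := fun _ => 0) continuousAt_const ?_
    filter_upwards [eventually_lt_nhds hx] with y hy
    rw [powWeight, if_neg (by linarith)]
  · have h1 : Tendsto (fun x : ℝ => Real.exp (-(s * (1 / x - 1) ^ κ))) (𝓝[>] 0) (𝓝 0) := by
      refine Real.tendsto_exp_atBot.comp (tendsto_neg_atTop_atBot.comp
        (Tendsto.const_mul_atTop hs ((tendsto_rpow_atTop hκ).comp ?_)))
      simp only [one_div]
      exact tendsto_atTop_add_const_right _ (-1) tendsto_inv_nhdsGT_zero
    have h2 : Tendsto (powWeight κ s) (𝓝[≤] 0 ⊔ 𝓝[>] 0) (𝓝 0) := by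
      refine Tendsto.sup ?_ ?_
      · refine Tendsto.congr' ?_ tendsto_const_nhds
        filter_upwards [self_mem_nhdsWithin] with y hy
        rw [powWeight, if_neg (not_lt.2 hy)]
      · refine h1.congr' ?_
        filter_upwards [self_mem_nhdsWithin] with y hy
        rw [powWeight, if_pos (Set.mem_Ioi.1 hy)]
    rw [nhdsLE_sup_nhdsGT] at h2
    rwa [ContinuousAt, show powWeight κ s 0 = 0 from if_neg (lt_irrefl _)]
  · refine ContinuousAt.congr (f := fun x => Real.exp (-(s * (1 / x - 1) ^ κ))) ?_ ?_
    · have : ContinuousAt (fun x : ℝ => (1 / x - 1) ^ κ) x :=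
        ((continuousAt_const.div continuousAt_id hx.ne').sub continuousAt_const).rpow_const
          (Or.inr hκ.le)
      fun_prop
    · filter_upwards [eventually_gt_nhds hx] with y hy
      rw [powWeight, if_pos (Set.mem_Ioi.1 hy)]

lemma norm_powWeight_le {κ s : ℝ} (hκ₀ : 0 < κ) (hκ₁ : κ < 1 / 2) (hs : 0 < s) (x : ℝ) :
    ‖powWeight κ s x‖ ≤ 1 := by
  rw [powWeight]
  split_ifs with hx
  · rw [Real.norm_of_nonneg (Real.exp_pos _).le, Real.exp_le_one_iff, neg_nonpos]
    refine mul_nonneg hs.le ?_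
    rcases le_or_gt 0 (1 / x - 1) with h | h
    · exact Real.rpow_nonneg h _
    · rw [Real.rpow_def_of_neg h]
      refine mul_nonneg (Real.exp_pos _).le (Real.cos_nonneg_of_mem_Icc ⟨?_, ?_⟩) <;>
        nlinarith [Real.pi_pos]
  · simp

variable {𝓗 : Type*} [NormedAddCommGroup 𝓗] [InnerProductSpace ℂ 𝓗] [CompleteSpace 𝓗]
  {N : 𝓗 →ₗ.[ℂ] 𝓗} {κ : ℝ}

lemma expNegPow_eq (N : 𝓗 →ₗ.[ℂ] 𝓗) (κ s : ℝ) :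
    expNegPow N κ s = cfc (powWeight κ s) (resolventOne (N.graph : Set (𝓗 × 𝓗))) := rfl

lemma expNegPow_two (hκ₀ : 0 < κ) : expNegPow N κ 2 = expNegPow N κ 1 * expNegPow N κ 1 := by
  rw [expNegPow_eq, expNegPow_eq, ← cfc_mul (powWeight κ 1) (powWeight κ 1) _
    (continuous_powWeight hκ₀ one_pos).continuousOn (continuous_powWeight hκ₀ one_pos).continuousOn]
  congr 1
  ext x
  simp only [powWeight]
  split_ifs
  · rw [← Real.exp_add]; congr 1; ring
  · simp

lemma exists_of_expPowForm_ne_top {k : ℝ} {ψ : 𝓗} (h : expPowForm N κ k ψ ≠ ⊤) :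
    ∃ η, expNegPow N κ (k / 2) η = ψ := by
  by_contra! hn
  exact h (by simp [expPowForm, hn])

lemma expPowForm_eq {k : ℝ} (hinj : Function.Injective (expNegPow N κ (k / 2))) (η : 𝓗) :
    expPowForm N κ k (expNegPow N κ (k / 2) η) = ENNReal.ofReal (‖η‖ ^ 2) := by
  refine le_antisymm (iInf₂_le_of_le η rfl le_rfl) (le_iInf₂ fun η' h => ?_)
  rw [hinj h]

lemma isWeight_expNegPow {s : ℝ} (hκ₀ : 0 < κ) (hκ₁ : κ < 1 / 2) (hs : 0 < s)
    (hd : DenseRange (expNegPow N κ s)) : IsWeight (expNegPow N κ s) where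
  selfAdjoint := by
    rw [expNegPow_eq]; exact cfc_predicate _ _
  dense := hd
  norm_le := norm_cfc_le zero_le_one fun x _ => norm_powWeight_le hκ₀ hκ₁ hs x

variable {ι 𝒜 : Type*} {S : System ι 𝒜 𝓗} {β : ℝ}

lemma denseRange_of_basis {D : 𝓗 →L[ℂ] 𝓗} (h : ∀ i, ∃ η, D η = S.basis i) : DenseRange D := by
  have h1 : (⊤ : Submodule ℂ 𝓗) ≤ (LinearMap.range (D : 𝓗 →ₗ[ℂ] 𝓗)).topologicalClosure := by
    rw [← S.basis.dense_span]
    refine Submodule.topologicalClosure_mono (Submodule.span_le.2 ?_)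
    rintro _ ⟨i, rfl⟩
    exact h i
  rw [DenseRange, dense_iff_closure_eq]
  have := congrArg (fun W : Submodule ℂ 𝓗 => (W : Set 𝓗)) (top_le_iff.1 h1)
  exact (Submodule.topologicalClosure_coe _).symm.trans this

section
variable (hG : S.IsGibbs) (hβ : 0 < β) (hκ₀ : 0 < κ) (hκ₁ : κ < 1 / 2)
  (hE : S.gibbsEnergy β N κ ≠ ⊤)
include hG hβ hE

lemma exists_expNegPow_basis (i : ι) : ∃ η, expNegPow N κ 2 η = S.basis i := by
  have h1 := ENNReal.ne_top_of_tsum_ne_top hE i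
  have h2 : expPowForm N κ 4 (S.basis i) ≠ ⊤ := fun h => h1 (by
    rw [h, ENNReal.mul_top]
    exact (ENNReal.ofReal_pos.2 (System.gibbsWeight_pos hG hβ i)).ne')
  have := exists_of_expPowForm_ne_top h2
  norm_num at this
  exact this

include hκ₀ hκ₁

lemma isWeight_two : IsWeight (expNegPow N κ 2) :=
  isWeight_expNegPow hκ₀ hκ₁ two_pos (denseRange_of_basis (exists_expNegPow_basis hG hβ hE))

lemma isWeight_expNegPow_one : IsWeight (expNegPow N κ 1) :=
  isWeight_expNegPow hκ₀ hκ₁ one_pos (denseRange_of_basis (S := S) fun i => by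
    obtain ⟨η, h⟩ := exists_expNegPow_basis hG hβ hE i
    rw [expNegPow_two hκ₀] at h
    exact ⟨_, h⟩)

lemma bdd_two_one : Bdd (expNegPow N κ 2) (expNegPow N κ 1) 1 1 := by
  rintro φ c ⟨η, rfl, hη⟩
  refine ⟨expNegPow N κ 1 η, ?_, ?_⟩
  · rw [expNegPow_two hκ₀]; rfl
  · rw [one_mul]
    exact ((isWeight_expNegPow_one hG hβ hκ₀ hκ₁ hE).norm_apply_le η).trans hη

/-- The Gibbs energy is the sum of the weighted norms of the eigenvectors. -/
lemma hasSum_gibbsEnergy {η : ι → 𝓗} (hη : ∀ i, expNegPow N κ 2 (η i) = S.basis i) :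
    HasSum (fun i => S.gibbsWeight β i * ‖η i‖ ^ 2) (S.gibbsEnergy β N κ).toReal := by
  have hinj := (isWeight_two hG hβ hκ₀ hκ₁ hE).injective
  have h1 : ∀ i, ENNReal.ofReal (S.gibbsWeight β i) * expPowForm N κ 4 (S.basis i) =
      ENNReal.ofReal (S.gibbsWeight β i * ‖η i‖ ^ 2) := fun i => by
    have := expPowForm_eq (N := N) (κ := κ) (k := 4) (by norm_num; exact hinj) (η i)
    rw [ENNReal.ofReal_mul (System.gibbsWeight_pos hG hβ i).le, ← this]
    congr 2
    norm_num
    exact (hη i).symm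
  have h0 : ∀ i, 0 ≤ S.gibbsWeight β i * ‖η i‖ ^ 2 := fun i =>
    mul_nonneg (System.gibbsWeight_pos hG hβ i).le (sq_nonneg _)
  rw [System.gibbsEnergy] at hE ⊢
  simp only [h1] at hE ⊢
  have hs : Summable fun i => S.gibbsWeight β i * ‖η i‖ ^ 2 := by
    have := ENNReal.summable_toReal hE
    simpa only [ENNReal.toReal_ofReal (h0 _)] using this
  rw [← ENNReal.ofReal_tsum_of_nonneg h0 hs, ENNReal.toReal_ofReal (tsum_nonneg h0)]
  exact hs.hasSum

end

/-- The growth function `e^{(r/2)|s|^{2κ}}`. -/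
def growthFun (r κ s : ℝ) : ℝ := Real.exp (r / 2 * |s| ^ (2 * κ))

lemma growthFun_sq (r κ s : ℝ) : growthFun r κ s ^ 2 = Real.exp (r * |s| ^ (2 * κ)) := by
  rw [growthFun, ← Real.exp_nat_mul]; congr 1; push_cast; ring

lemma isGrowth_growthFun {r : ℝ} (hr : 0 ≤ r) : IsGrowth (growthFun r κ) where
  one_le s := Real.one_le_exp (by positivity)
  even s := by rw [growthFun, growthFun, abs_neg]

lemma growsBy_of_expPowForm {r k : ℝ} (hD : IsWeight (expNegPow N κ (k / 2)))
    (h : ∀ (t : ℝ) (ψ : 𝓗), expPowForm N κ k (S.evolve t ψ) ≤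
      ENNReal.ofReal (Real.exp (r * |t| ^ (2 * κ))) * expPowForm N κ k ψ) :
    GrowsBy S.flow (expNegPow N κ (k / 2)) (growthFun r κ) := by
  rintro s φ c ⟨η, rfl, hη⟩
  have h1 := h s (expNegPow N κ (k / 2) η)
  rw [expPowForm_eq hD.injective, System.evolve_eq, ← ENNReal.ofReal_mul (Real.exp_pos _).le] at h1
  obtain ⟨η', h2⟩ := exists_of_expPowForm_ne_top (ne_top_of_le_ne_top ENNReal.ofReal_ne_top h1)
  rw [← h2, expPowForm_eq hD.injective, ENNReal.ofReal_le_ofReal_iff (by positivity),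
    ← growthFun_sq, ← mul_pow] at h1
  have h3 : 0 ≤ growthFun r κ s := (Real.exp_pos _).le
  refine ⟨η', h2, (abs_le_of_sq_le_sq' h1 (by positivity)).2.trans ?_⟩
  gcongr

end Weights

/-! ### The truncations -/

section Truncations
open Filter Topology MeasureTheory ContinuousLinearMap

variable {𝓗 : Type*} [NormedAddCommGroup 𝓗] [InnerProductSpace ℂ 𝓗] [CompleteSpace 𝓗]

lemma compress_eq {X : 𝓗 →ₗ.[ℂ] 𝓗} {π B : 𝓗 →L[ℂ] 𝓗} (hB : ∀ ψ, π ψ ∈ X.domain ∧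
    B ψ = π (applyAt X (π ψ))) : compress X π = B := by
  have h : ∃ B : 𝓗 →L[ℂ] 𝓗, ∀ ψ, ∃ h : π ψ ∈ X.domain, B ψ = π (X ⟨π ψ, h⟩) :=
    ⟨B, fun ψ => ⟨(hB ψ).1, (hB ψ).2.trans (congrArg π (applyAt_eq (hB ψ).1))⟩⟩
  rw [compress, dif_pos h]
  ext ψ
  obtain ⟨h1, h2⟩ := h.choose_spec ψ
  rw [h2, (hB ψ).2, applyAt_eq h1]

lemma compress_cases (X : 𝓗 →ₗ.[ℂ] 𝓗) (π : 𝓗 →L[ℂ] 𝓗) :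
    (∀ ψ, π ψ ∈ X.domain ∧ compress X π ψ = π (applyAt X (π ψ))) ∨
    ((¬ ∃ B : 𝓗 →L[ℂ] 𝓗, ∀ ψ, π ψ ∈ X.domain ∧ B ψ = π (applyAt X (π ψ))) ∧
      compress X π = 0) := by
  by_cases h : ∃ B : 𝓗 →L[ℂ] 𝓗, ∀ ψ, π ψ ∈ X.domain ∧ B ψ = π (applyAt X (π ψ))
  · obtain ⟨B, hB⟩ := h
    rw [compress_eq hB]
    exact Or.inl hB
  · refine Or.inr ⟨h, ?_⟩
    rw [compress, dif_neg]
    rintro ⟨B, hB⟩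
    exact h ⟨B, fun ψ => ⟨(hB ψ).1, (hB ψ).2.trans (congrArg π (applyAt_eq (hB ψ).1).symm)⟩⟩

/-- The compressions of two formally adjoint operators are adjoint. -/
lemma adjoint_compress {X Y : 𝓗 →ₗ.[ℂ] 𝓗} {π : 𝓗 →L[ℂ] 𝓗} (hπ : IsSelfAdjoint π)
    (hX : ∀ ψ, π ψ ∈ X.domain) (hY : ∀ ψ, π ψ ∈ Y.domain)
    (hXY : ∀ φ ψ, φ ∈ Y.domain → ψ ∈ X.domain → ⟪applyAt Y φ, ψ⟫_ℂ = ⟪φ, applyAt X ψ⟫_ℂ) :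
    adjoint (compress X π) = compress Y π := by
  have hs : ∀ φ ψ, ⟪π φ, ψ⟫_ℂ = ⟪φ, π ψ⟫_ℂ := fun φ ψ => by
    rw [← adjoint_inner_right, hπ.adjoint_eq]
  have key : ∀ (X Y : 𝓗 →ₗ.[ℂ] 𝓗), (∀ ψ, π ψ ∈ Y.domain) → (∀ φ ψ, φ ∈ Y.domain →
      ψ ∈ X.domain → ⟪applyAt Y φ, ψ⟫_ℂ = ⟪φ, applyAt X ψ⟫_ℂ) → ∀ B : 𝓗 →L[ℂ] 𝓗,
      (∀ ψ, π ψ ∈ X.domain ∧ B ψ = π (applyAt X (π ψ))) →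
      ∀ ψ, π ψ ∈ Y.domain ∧ adjoint B ψ = π (applyAt Y (π ψ)) := by
    intro X Y hY hXY B hB ψ
    refine ⟨hY ψ, ext_inner_right ℂ fun χ => ?_⟩
    rw [adjoint_inner_left, (hB χ).2, hs, ← hs, hXY _ _ (hY ψ) (hB χ).1]
  rcases compress_cases X π with h | ⟨h, h0⟩
  · exact (compress_eq (key X Y hY hXY _ h)).symm
  · rcases compress_cases Y π with h' | ⟨-, h0'⟩
    · exact absurd ⟨_, key Y X hX (fun φ ψ hφ hψ => by
        rw [← inner_conj_symm, ← hXY _ _ hψ hφ, inner_conj_symm]) _ h'⟩ h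
    · rw [h0, h0', map_zero]

lemma SandwichBound.sub_ofBounded {Q T : 𝓗 → 𝓗} {X : 𝓗 →ₗ.[ℂ] 𝓗} {B : 𝓗 →L[ℂ] 𝓗} {c : ℝ}
    (h : SandwichBound Q (X - ofBounded B) T c) (ψ : 𝓗) : T ψ ∈ X.domain ∧
      ∃ η, Q η = applyAt X (T ψ) - B (T ψ) ∧ ‖η‖ ≤ c * ‖ψ‖ := by
  obtain ⟨h1, η, h2, h3⟩ := h ψ
  have hm : T ψ ∈ X.domain := h1.1
  refine ⟨hm, η, ?_, h3⟩
  rw [h2, applyAt_eq hm, LinearPMap.sub_apply]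
  rfl

variable {ι 𝒜 : Type*} {S : System ι 𝒜 𝓗}

section Hamiltonian
variable (hG : S.IsGibbs)
include hG

lemma inner_applyAt_H {φ ψ : 𝓗} (hφ : φ ∈ S.H.domain) (hψ : ψ ∈ S.H.domain) :
    ⟪applyAt S.H φ, ψ⟫_ℂ = ⟪φ, applyAt S.H ψ⟫_ℂ := by
  refine inner_applyAt_adjoint ?_ (LinearPMap.isSelfAdjoint_def.1 hG.selfAdjoint).symm hφ hψ
  have h1 : (⊤ : Submodule ℂ 𝓗) ≤ S.H.domain.topologicalClosure := by
    rw [← S.basis.dense_span]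
    refine Submodule.topologicalClosure_mono (Submodule.span_le.2 ?_)
    rintro _ ⟨i, rfl⟩
    exact (hG.eigen i).1
  have := congrArg (fun W : Submodule ℂ 𝓗 => (W : Set 𝓗)) (top_le_iff.1 h1)
  rw [dense_iff_closure_eq]
  exact (Submodule.topologicalClosure_coe _).symm.trans this

lemma inner_basis_H {ψ : 𝓗} (hψ : ψ ∈ S.H.domain) (j : ι) :
    ⟪S.basis j, applyAt S.H ψ⟫_ℂ = S.energy j * ⟪S.basis j, ψ⟫_ℂ := by
  obtain ⟨hj, e⟩ := hG.eigen j
  rw [← inner_applyAt_H hG hj hψ, applyAt_eq hj, e, inner_smul_left, Complex.conj_ofReal]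

lemma applyAt_H_flow {ψ : 𝓗} (hψ : ψ ∈ S.H.domain) {s : ℝ} (hs : S.flow s ψ ∈ S.H.domain) :
    applyAt S.H (S.flow s ψ) = S.flow s (applyAt S.H ψ) := by
  refine S.ext_basis fun j => ?_
  rw [inner_basis_H hG hs, S.inner_basis_flow, S.inner_basis_flow, inner_basis_H hG hψ]
  ring

lemma hasDerivAt_flow {ψ : 𝓗} (hψ : ψ ∈ S.H.domain) (s : ℝ) :
    HasDerivAt (fun s => S.flow s ψ) (Complex.I • S.flow s (applyAt S.H ψ)) s := by
  have hc : Continuous fun s => Complex.I • S.flow s (applyAt S.H ψ) :=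
    (S.flow.cont _).const_smul _
  have e : (fun s => S.flow s ψ) =
      fun s => ψ + ∫ u in (0 : ℝ)..s, Complex.I • S.flow u (applyAt S.H ψ) := by
    funext s
    refine S.ext_basis fun j => ?_
    have h1 : ⟪S.basis j, ∫ u in (0 : ℝ)..s, Complex.I • S.flow u (applyAt S.H ψ)⟫_ℂ =
        ∫ u in (0 : ℝ)..s, ⟪S.basis j, Complex.I • S.flow u (applyAt S.H ψ)⟫_ℂ :=
      ((innerSL ℂ (S.basis j)).intervalIntegral_comp_comm (hc.intervalIntegrable 0 s)).symm
    have h2 : ∀ u ∈ Set.uIcc 0 s, HasDerivAt (fun u : ℝ => S.phase u j * ⟪S.basis j, ψ⟫_ℂ)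
        ⟪S.basis j, Complex.I • S.flow u (applyAt S.H ψ)⟫_ℂ u := by
      intro u _
      have h3 : HasDerivAt (fun u : ℝ => Complex.I * (u : ℂ) * S.energy j)
          (Complex.I * 1 * S.energy j) u :=
        ((Complex.ofRealCLM.hasDerivAt (x := u)).const_mul Complex.I).mul_const _
      refine (h3.cexp.mul_const _).congr_deriv ?_
      rw [inner_smul_right, S.inner_basis_flow, inner_basis_H hG hψ, System.phase]
      ring
    rw [inner_add_right, h1, intervalIntegral.integral_eq_sub_of_hasDerivAt h2
      ((continuous_const.inner hc).intervalIntegrable 0 s), S.inner_basis_flow]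
    simp [System.phase]
  rw [e]
  exact (intervalIntegral.integral_hasDerivAt_right (hc.intervalIntegrable 0 s)
    hc.aestronglyMeasurable.stronglyMeasurableAtFilter hc.continuousAt).const_add ψ

/-- Duhamel's formula: the flow of the truncated Hamiltonian is close to the exact flow. -/
lemma bdd_flow_sub {D : 𝓗 →L[ℂ] 𝓗} {γ : ℝ → ℝ}
    (hmono : ∀ s t, |s| ≤ |t| → γ s ≤ γ t) (hU : GrowsBy S.flow D γ)
    {B : 𝓗 →L[ℂ] 𝓗} (hB : IsSelfAdjoint B) {π : ℝ} (hπ : 0 ≤ π)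
    (hleak : SandwichBound id (S.H - ofBounded B) D π) (t : ℝ) :
    Bdd D 1 (S.flow t - expFlow hB t) (|t| * γ t * π) := by
  rintro φ c hφ
  have hc := hφ.nonneg
  rw [reg_one]
  have hdom : ∀ {ψ d}, Reg D ψ d → ψ ∈ S.H.domain ∧ ‖applyAt S.H ψ - B ψ‖ ≤ π * d := by
    rintro ψ d ⟨η, rfl, hη⟩
    obtain ⟨h1, ζ, h2, h3⟩ := hleak.sub_ofBounded η
    rw [← h2]
    exact ⟨h1, h3.trans (by gcongr)⟩
  have hφd := (hdom hφ).1
  set V := expFlow hB with hV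
  have hVd : ∀ s : ℝ, HasDerivAt (fun s : ℝ => V (-s)) (V (-s) * (-Complex.I • B)) s := by
    intro s
    have e : ∀ s : ℝ, V (-s) = NormedSpace.exp (s • (-Complex.I • B)) := fun s => by
      show NormedSpace.exp ((Complex.I * ((-s : ℝ) : ℂ)) • B) = _
      congr 1
      rw [← Complex.coe_smul, smul_smul]
      congr 1
      push_cast; ring
    simp only [e]
    exact hasDerivAt_exp_smul_const (-Complex.I • B) s
  have hv : ∀ s : ℝ, HasDerivAt (fun s : ℝ => V (-s) (S.flow s φ))
      (V (-s) (Complex.I • (S.flow s (applyAt S.H φ) - B (S.flow s φ)))) s := by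
    intro s
    have h1 := (restrictScalarsL ℂ 𝓗 𝓗 ℝ ℝ).hasFDerivAt.comp_hasDerivAt s (hVd s)
    refine (h1.clm_apply (hasDerivAt_flow hG hφd s)).congr_deriv ?_
    show (V (-s) * (-Complex.I • B)) (S.flow s φ) + V (-s) (Complex.I • S.flow s (applyAt S.H φ)) = _
    rw [mul_apply_eq_comp, smul_apply, ← map_add]
    congr 1
    module
  have hbound : ∀ s ∈ Set.uIcc 0 t,
      ‖V (-s) (Complex.I • (S.flow s (applyAt S.H φ) - B (S.flow s φ)))‖ ≤ π * (γ t * c) := by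
    intro s hs
    have hst : |s| ≤ |t| := by
      have := Set.abs_sub_left_of_mem_uIcc hs
      simpa using this
    have h1 := hdom (hU s φ c hφ)
    rw [V.norm_map, norm_smul, Complex.norm_I, one_mul, ← applyAt_H_flow hG hφd h1.1]
    refine h1.2.trans ?_
    have := hmono s t hst
    gcongr
  have key := (convex_uIcc (0 : ℝ) t).norm_image_sub_le_of_norm_hasDerivWithin_le
    (fun s _ => (hv s).hasDerivWithinAt) hbound (Set.left_mem_uIcc) (Set.right_mem_uIcc)
  have h0 : S.flow 0 φ = φ := S.ext_basis fun j => by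
    rw [S.inner_basis_flow]; simp [System.phase]
  have hV0 : ∀ ψ, V (-0) ψ = ψ := fun ψ => by
    show NormedSpace.exp ((Complex.I * ((-0 : ℝ) : ℂ)) • B) ψ = ψ
    simp [NormedSpace.exp_zero]
  have hVV : ∀ ψ, V (-t) (V t ψ) = ψ := fun ψ => by
    show NormedSpace.exp ((Complex.I * ((-t : ℝ) : ℂ)) • B) (NormedSpace.exp ((Complex.I * (t : ℂ)) • B) ψ) = ψ
    rw [← mul_apply_eq_comp, exp_smul_mul_exp_smul]
    simp [NormedSpace.exp_zero]
  have e : ‖(S.flow t - V t) φ‖ = ‖V (-t) (S.flow t φ) - V (-0) (S.flow 0 φ)‖ := by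
    rw [hV0, h0, ← V.norm_map (-t) ((S.flow t - V t) φ), sub_apply, map_sub, hVV]
  rw [e]
  refine key.trans (le_of_eq ?_)
  rw [sub_zero, Real.norm_eq_abs]
  ring

end Hamiltonian
end Truncations

section TruncationBounds
open Filter Topology MeasureTheory ContinuousLinearMap

lemma isKernel_filter {r κ : ℝ} {f : 𝓢(ℝ, ℂ)} (hr : 0 ≤ r) (hκ₀ : 0 < κ)
    (hf : Integrable fun t : ℝ => |t| * Real.exp (r * |t| ^ (2 * κ)) * ‖f t‖) :
    IsKernel (growthFun r κ) f := by
  have hfi : Integrable f := f.integrable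
  refine ⟨hfi, ?_⟩
  have h1 : Continuous fun s : ℝ => |s| ^ (2 * κ) :=
    continuous_abs.rpow_const fun s => Or.inr (by linarith)
  refine ((hf.const_mul 2).add (hfi.norm.const_mul (2 * Real.exp r))).mono' ?_
    (Eventually.of_forall fun s => ?_)
  · simp only [growthFun_sq]
    have := f.continuous
    exact Continuous.aestronglyMeasurable (by fun_prop)
  · rw [growthFun_sq, Real.norm_of_nonneg (by positivity), Pi.add_apply]
    have hn := norm_nonneg (f s)
    rcases le_total |s| 1 with hs | hs
    · have h2 : Real.exp (r * |s| ^ (2 * κ)) ≤ Real.exp r := by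
        apply Real.exp_le_exp.2
        have := Real.rpow_le_one (abs_nonneg s) hs (by linarith : 0 ≤ 2 * κ)
        nlinarith
      calc ‖f s‖ * ((1 + |s|) * Real.exp (r * |s| ^ (2 * κ))) ≤ ‖f s‖ * (2 * Real.exp r) := by
            gcongr; linarith
        _ ≤ _ := by
            have : 0 ≤ 2 * (|s| * Real.exp (r * |s| ^ (2 * κ)) * ‖f s‖) := by positivity
            linarith
    · calc ‖f s‖ * ((1 + |s|) * Real.exp (r * |s| ^ (2 * κ))) ≤
            ‖f s‖ * ((2 * |s|) * Real.exp (r * |s| ^ (2 * κ))) := by gcongr; linarith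
        _ ≤ _ := by
            have : 0 ≤ 2 * Real.exp r * ‖f s‖ := by positivity
            linarith

lemma isKernel_driftKernel {β σ r κ : ℝ} (hβ : 0 < β) (hσ : 0 < σ) (hr : 0 ≤ r) (hκ₀ : 0 < κ)
    (hκ₁ : κ < 1 / 2) : IsKernel (growthFun r κ) (driftKernel β σ) := by
  refine ⟨integrable_driftKernel hβ hσ, ?_⟩
  simp only [growthFun_sq]
  refine (integrable_weighted_driftKernel hβ hσ hr hκ₀ hκ₁).congr (Eventually.of_forall fun s => ?_)
  exact mul_comm _ _

lemma integrable_gaussWeight_growth {σ r κ : ℝ} (hσ : 0 < σ) (hr : 0 ≤ r) (hκ₀ : 0 < κ)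
    (hκ₁ : κ < 1 / 2) :
    Integrable fun s => gaussWeight σ s * ((1 + |s|) * growthFun r κ s ^ 4) := by
  have h := (integrable_subexp_mul_exp (a := 1) (r := 2 * r) one_pos (by linarith) hκ₀ hκ₁).const_mul
    (Real.exp (1 / (8 * σ ^ 2)))
  have h1 : Continuous fun s : ℝ => |s| ^ (2 * κ) :=
    continuous_abs.rpow_const fun s => Or.inr (by linarith)
  have h4 : ∀ s, growthFun r κ s ^ 4 = Real.exp (2 * r * |s| ^ (2 * κ)) := fun s => by
    rw [growthFun, ← Real.exp_nat_mul]; congr 1; push_cast; ring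
  simp only [h4, gaussWeight]
  refine h.mono' (Continuous.aestronglyMeasurable (by fun_prop)) (Eventually.of_forall fun s => ?_)
  rw [Real.norm_of_nonneg (by positivity)]
  have h2 : Real.exp (-(2 * σ ^ 2 * s ^ 2)) ≤
      Real.exp (1 / (8 * σ ^ 2)) * Real.exp (-(1 * |s|)) := by
    rw [← Real.exp_add]
    apply Real.exp_le_exp.2
    have h3 : 0 ≤ 2 * σ ^ 2 * (|s| - 1 / (4 * σ ^ 2)) ^ 2 := by positivity
    have h5 : 2 * σ ^ 2 * (|s| - 1 / (4 * σ ^ 2)) ^ 2 =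
        2 * σ ^ 2 * s ^ 2 - |s| + 1 / (8 * σ ^ 2) := by
      have : σ ≠ 0 := hσ.ne'
      rw [← sq_abs s]
      field_simp
      ring
    linarith
  calc _ ≤ Real.exp (1 / (8 * σ ^ 2)) * Real.exp (-(1 * |s|)) *
        ((1 + |s|) * Real.exp (2 * r * |s| ^ (2 * κ))) := by gcongr
    _ = _ := by ring

variable {ι 𝒜 𝓗 : Type*} [NormedAddCommGroup 𝓗] [InnerProductSpace ℂ 𝓗] [CompleteSpace 𝓗]
  {S : System ι 𝒜 𝓗} {T : Truncation 𝒜 𝓗}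

lemma Reg.neg {D : 𝓗 →L[ℂ] 𝓗} {φ : 𝓗} {c : ℝ} (h : Reg D φ c) : Reg D (-φ) c := by
  obtain ⟨η, rfl, hη⟩ := h
  exact ⟨-η, map_neg _ _, by rwa [norm_neg]⟩

/-- The truncated jump `π A π`. -/
def truncJump (S : System ι 𝒜 𝓗) (T : Truncation 𝒜 𝓗) (M : ℕ) (α : 𝒜) : 𝓗 →L[ℂ] 𝓗 :=
  compress (S.A α) (T.proj α M)

/-- The leakage `|q(M)| e^{-M^κ}`. -/
def leakage (κ : ℝ) (q : ℕ → ℝ) (M : ℕ) : ℝ := |q M| * Real.exp (-(M : ℝ) ^ κ)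

lemma leakage_nonneg (κ : ℝ) (q : ℕ → ℝ) (M : ℕ) : 0 ≤ leakage κ q M := by
  unfold leakage; positivity

lemma le_leakage (κ : ℝ) (q : ℕ → ℝ) (M : ℕ) : q M * Real.exp (-(M : ℝ) ^ κ) ≤ leakage κ q M := by
  unfold leakage; gcongr; exact le_abs_self _

variable [Fintype 𝒜] {τ : Equiv.Perm 𝒜} {κ r C_A β : ℝ} {q q' : ℕ → ℝ} {p : ℕ → ℕ → ℝ}
  (hG : S.IsGibbs) (hA : S.JumpCondition τ) (hT : TruncationCondition S T τ κ r C_A q q' p)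
  (hr : 0 ≤ r) (hκ₀ : 0 < κ) (hκ₁ : κ < 1 / 2) (hβ : 0 < β) (hE : S.gibbsEnergy β T.N κ ≠ ⊤)

include hT

lemma growsBy_weight_one (hw : IsWeight (expNegPow T.N κ 1)) :
    GrowsBy S.flow (expNegPow T.N κ 1) (growthFun r κ) := by
  have h : (2 : ℝ) / 2 = 1 := by norm_num
  have := growsBy_of_expPowForm (S := S) (k := 2) (by rwa [h]) (hT.growth 2 (Or.inl rfl))
  rwa [h] at this

lemma growsBy_weight_two (hw : IsWeight (expNegPow T.N κ 2)) :
    GrowsBy S.flow (expNegPow T.N κ 2) (growthFun r κ) := by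
  have h : (4 : ℝ) / 2 = 2 := by norm_num
  have := growsBy_of_expPowForm (S := S) (k := 4) (by rwa [h]) (hT.growth 4 (Or.inr rfl))
  rwa [h] at this

lemma norm_truncJump_le (α : 𝒜) {M : ℕ} (hM : 1 ≤ M) : ‖truncJump S T M α‖ ≤ |q' M| :=
  (hT.norm_jump α M hM).trans (le_abs_self _)

lemma bdd_truncJump (α : 𝒜) {M : ℕ} (hM : 1 ≤ M) :
    Bdd (expNegPow T.N κ 1) (expNegPow T.N κ 1) (truncJump S T M α) |q' M| := by
  refine bdd_of_forall (abs_nonneg _) fun η => ?_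
  obtain ⟨h1, η', h2, h3⟩ := hT.norm_jump_left α M hM η
  exact ⟨η', h2, h3.trans (by gcongr; exact le_abs_self _)⟩

lemma truncJump_leak_one (α : 𝒜) {M : ℕ} (hM : 1 ≤ M) {φ : 𝓗} {c : ℝ}
    (hφ : Reg (expNegPow T.N κ 1) φ c) : φ ∈ (S.A α).domain ∧
      ‖applyAt (S.A α) φ - truncJump S T M α φ‖ ≤ leakage κ q M * c := by
  obtain ⟨η, rfl, hη⟩ := hφ
  obtain ⟨h1, ζ, h2, h3⟩ := (hT.leak_one α M hM).sub_ofBounded η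
  refine ⟨h1, ?_⟩
  rw [truncJump, ← h2, id]
  refine h3.trans ((mul_le_mul_of_nonneg_right (le_leakage κ q M) (norm_nonneg _)).trans ?_)
  exact mul_le_mul_of_nonneg_left hη (leakage_nonneg _ _ _)

lemma truncJump_leak_two (α : 𝒜) {M : ℕ} (hM : 1 ≤ M) {φ : 𝓗} {c : ℝ}
    (hφ : Reg (expNegPow T.N κ 2) φ c) :
      Reg (expNegPow T.N κ 1) (applyAt (S.A α) φ - truncJump S T M α φ) (leakage κ q M * c) := by
  obtain ⟨η, rfl, hη⟩ := hφ
  obtain ⟨h1, ζ, h2, h3⟩ := (hT.leak_two α M hM).sub_ofBounded η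
  refine ⟨ζ, h2, h3.trans ((mul_le_mul_of_nonneg_right (le_leakage κ q M) (norm_nonneg _)).trans ?_)⟩
  exact mul_le_mul_of_nonneg_left hη (leakage_nonneg _ _ _)

include hG hA in
lemma jump_weighted [Nonempty ι] (α : 𝒜) :
    (∀ φ c, Reg (expNegPow T.N κ 1) φ c → ‖applyAt (S.A α) φ‖ ≤ |C_A| * c) ∧
    ∀ φ c, Reg (expNegPow T.N κ 2) φ c →
      Reg (expNegPow T.N κ 1) (applyAt (S.A α) φ) (|C_A| * c) := by
  obtain ⟨c₁, c₂, c₃, hsum, h1, h2, h3⟩ := hT.weighted α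
  have i : ι := Classical.arbitrary ι
  have hn : ‖S.basis i‖ = 1 := S.basis.orthonormal.1 i
  have p1 : 0 ≤ c₁ := by
    obtain ⟨-, η, -, h⟩ := h1 (S.basis i)
    rw [hn, mul_one] at h
    exact (norm_nonneg _).trans h
  have p2 : 0 ≤ c₂ := by
    obtain ⟨-, η, -, h⟩ := h2 (S.basis i)
    rw [hn, mul_one] at h
    exact (norm_nonneg _).trans h
  have p3 : 0 ≤ c₃ := by
    have := h3 ⟨S.basis i, System.basis_mem_domain hG hA α i⟩
    rw [hn, mul_one] at this
    exact (norm_nonneg _).trans this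
  have hC := le_abs_self C_A
  constructor
  · rintro φ c ⟨η, rfl, hη⟩
    obtain ⟨hd, ζ, e, h⟩ := h2 η
    rw [applyAt_eq hd, ← e, id]
    exact h.trans (by gcongr; linarith)
  · rintro φ c ⟨η, rfl, hη⟩
    obtain ⟨hd, ζ, e, h⟩ := h1 η
    rw [applyAt_eq hd]
    exact ⟨ζ, e, h.trans (by gcongr; linarith)⟩

include hG hA in
lemma bdd_truncJump_one [Nonempty ι] (α : 𝒜) {M : ℕ} (hM : 1 ≤ M) :
    Bdd (expNegPow T.N κ 1) 1 (truncJump S T M α) (|C_A| + leakage κ q M) := by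
  intro φ c hφ
  rw [reg_one]
  have h1 := (truncJump_leak_one hT α hM hφ).2
  have h2 := (jump_weighted hG hA hT α).1 φ c hφ
  have h3 := norm_sub_le (applyAt (S.A α) φ) (applyAt (S.A α) φ - truncJump S T M α φ)
  rw [sub_sub_cancel] at h3
  linarith

include hG hA in
lemma bdd_truncJump_two [Nonempty ι] (α : 𝒜) {M : ℕ} (hM : 1 ≤ M) :
    Bdd (expNegPow T.N κ 2) (expNegPow T.N κ 1) (truncJump S T M α) (|C_A| + leakage κ q M) := by
  intro φ c hφ
  have h1 := Reg.neg (truncJump_leak_two hT α hM hφ)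
  have h2 := ((jump_weighted hG hA hT α).2 φ c hφ).add h1
  rw [neg_sub, add_sub_cancel] at h2
  rwa [add_mul]

lemma bdd_truncJump_sub_one (α : 𝒜) {M M' : ℕ} (hM : 1 ≤ M) (hM' : 1 ≤ M') :
    Bdd (expNegPow T.N κ 1) 1 (truncJump S T M' α - truncJump S T M α)
      (leakage κ q M + leakage κ q M') := by
  intro φ c hφ
  rw [reg_one, sub_apply]
  have h1 := (truncJump_leak_one hT α hM hφ).2
  have h2 := (truncJump_leak_one hT α hM' hφ).2
  have h3 := norm_sub_le (applyAt (S.A α) φ - truncJump S T M α φ)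
    (applyAt (S.A α) φ - truncJump S T M' α φ)
  rw [sub_sub_sub_cancel_left] at h3
  linarith

lemma bdd_truncJump_sub_two (α : 𝒜) {M M' : ℕ} (hM : 1 ≤ M) (hM' : 1 ≤ M') :
    Bdd (expNegPow T.N κ 2) (expNegPow T.N κ 1) (truncJump S T M' α - truncJump S T M α)
      (leakage κ q M + leakage κ q M') := by
  intro φ c hφ
  have h1 := (truncJump_leak_two hT α hM hφ).add
    (Reg.neg (truncJump_leak_two hT α hM' hφ))
  rw [neg_sub, sub_add_sub_cancel'] at h1
  rw [add_mul]
  exact h1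

include hA in
lemma adjoint_truncJump (α : 𝒜) {M : ℕ} (hM : 1 ≤ M) :
    adjoint (truncJump S T M α) = truncJump S T M (τ α) := by
  rw [truncJump, truncJump, hT.proj_adjoint α M hM]
  refine adjoint_compress (hT.proj_star α M hM).isSelfAdjoint (hT.proj_mem α M hM) ?_ ?_
  · intro ψ
    have := hT.proj_mem (τ α) M hM ψ
    rwa [hT.proj_adjoint α M hM] at this
  · exact fun φ ψ hφ hψ => inner_applyAt_adjoint (hA.dense α) (hA.adjoint α) hφ hψ

include hG in
lemma isSelfAdjoint_truncH {M : ℕ} (hM : 1 ≤ M) : IsSelfAdjoint (compress S.H (T.P M)) :=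
  isSelfAdjoint_iff'.2 (adjoint_compress (hT.P_star M hM).isSelfAdjoint (hT.P_mem M hM)
    (hT.P_mem M hM) fun _ _ hφ hψ => inner_applyAt_H hG hφ hψ)

end TruncationBounds

section Comparison
open Filter Topology MeasureTheory ContinuousLinearMap

/-- Polynomial growth is absorbed by the stretched exponential. -/
lemma tendsto_pow_mul_exp_neg_rpow {κ : ℝ} (hκ₀ : 0 < κ) (k : ℕ) :
    Tendsto (fun M : ℕ => (1 + M : ℝ) ^ k * Real.exp (-(M : ℝ) ^ κ)) atTop (𝓝 0) := by
  have h1 : Tendsto (fun x : ℝ => x ^ ((k : ℝ) / κ) * Real.exp (-x)) atTop (𝓝 0) :=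
    tendsto_rpow_mul_exp_neg_mul_atTop_nhds_zero ((k : ℝ) / κ) 1 one_pos |>.congr fun x => by simp
  have h2 : Tendsto (fun M : ℕ => (M : ℝ) ^ κ) atTop atTop :=
    (tendsto_rpow_atTop hκ₀).comp tendsto_natCast_atTop_atTop
  have h3 := (h1.comp h2).const_mul (2 ^ k)
  rw [mul_zero] at h3
  refine squeeze_zero' (Eventually.of_forall fun M => by positivity) ?_ h3
  filter_upwards [eventually_ge_atTop 1] with M hM
  have hM' : (1 : ℝ) ≤ M := by exact_mod_cast hM
  simp only [Function.comp_apply]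
  rw [← Real.rpow_mul (by positivity), mul_div_cancel₀ _ hκ₀.ne', Real.rpow_natCast, ← mul_assoc,
    ← mul_pow]
  gcongr
  linarith

lemma tendsto_leakage {κ : ℝ} (hκ₀ : 0 < κ) {q : ℕ → ℝ} (hq : PolyBounded q) :
    Tendsto (leakage κ q) atTop (𝓝 0) := by
  obtain ⟨C, k, h⟩ := hq
  have h1 := (tendsto_pow_mul_exp_neg_rpow hκ₀ k).const_mul C
  rw [mul_zero] at h1
  refine squeeze_zero (fun M => leakage_nonneg κ q M) (fun M => ?_) h1
  rw [leakage, ← mul_assoc]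
  gcongr
  exact h M

lemma exists_leakage_le {κ : ℝ} (hκ₀ : 0 < κ) {q : ℕ → ℝ} (hq : PolyBounded q) :
    ∃ C : ℝ, 0 ≤ C ∧ ∀ M, leakage κ q M ≤ C := by
  obtain ⟨C, hC⟩ := (tendsto_leakage hκ₀ hq).bddAbove_range
  exact ⟨C, (leakage_nonneg κ q 0).trans (hC ⟨0, rfl⟩), fun M => hC ⟨M, rfl⟩⟩

variable {ι 𝒜 𝓗 : Type*} [NormedAddCommGroup 𝓗] [InnerProductSpace ℂ 𝓗] [CompleteSpace 𝓗]
  [Fintype 𝒜]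

lemma pureGen_add {σ : ℝ} (hσ : 0 < σ) (U : UnitaryFlow 𝓗) (G : 𝓗 →L[ℂ] 𝓗) (L : 𝒜 → 𝓗 →L[ℂ] 𝓗)
    (Z Z' : 𝓗 →L[ℂ] 𝓗) (φ : 𝓗) :
    pureGen σ U G L (Z + Z') φ = pureGen σ U G L Z φ + pureGen σ U G L Z' φ := by
  simp only [pureGen, add_apply, inner_add_right, mul_add,
    integral_add (integrable_gauss_inner hσ U (L _) Z φ φ)
      (integrable_gauss_inner hσ U (L _) Z' φ φ), Finset.sum_add_distrib]
  ring

lemma pureGen_smul {σ : ℝ} (U : UnitaryFlow 𝓗) (G : 𝓗 →L[ℂ] 𝓗) (L : 𝒜 → 𝓗 →L[ℂ] 𝓗) (c : ℂ)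
    (Z : 𝓗 →L[ℂ] 𝓗) (φ : 𝓗) : pureGen σ U G L (c • Z) φ = c * pureGen σ U G L Z φ := by
  simp only [pureGen, smul_apply, inner_smul_right, mul_left_comm _ c, integral_const_mul,
    ← Finset.mul_sum]
  ring

/-- The matrix elements `⟨a, 𝓛(T) b⟩` of the generator with drift `G` and jumps `L`. -/
def matGen (σ : ℝ) (U : UnitaryFlow 𝓗) (G : 𝓗 →L[ℂ] 𝓗) (L : 𝒜 → 𝓗 →L[ℂ] 𝓗) (a b : 𝓗)
    (T : 𝓗 →L[ℂ] 𝓗) : ℂ :=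
  ⟪adjoint G a, T b⟫_ℂ + ⟪a, T (adjoint G b)⟫_ℂ + (gaussCoeff σ : ℂ) *
    ∑ α, ∫ s, (gaussWeight σ s : ℂ) * ⟪U.conj (adjoint (L α)) s a, T (U.conj (adjoint (L α)) s b)⟫_ℂ

section matGen
variable {σ : ℝ} (hσ : 0 < σ) (U : UnitaryFlow 𝓗) (G : 𝓗 →L[ℂ] 𝓗) (L : 𝒜 → 𝓗 →L[ℂ] 𝓗) (a b : 𝓗)
include hσ

lemma matGen_add (T T' : 𝓗 →L[ℂ] 𝓗) :
    matGen σ U G L a b (T + T') = matGen σ U G L a b T + matGen σ U G L a b T' := by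
  simp only [matGen, add_apply, inner_add_right, mul_add,
    integral_add (integrable_gauss_inner hσ U (adjoint (L _)) T a b)
      (integrable_gauss_inner hσ U (adjoint (L _)) T' a b), Finset.sum_add_distrib]
  ring

lemma matGen_smul (c : ℂ) (T : 𝓗 →L[ℂ] 𝓗) :
    matGen σ U G L a b (c • T) = c * matGen σ U G L a b T := by
  simp only [matGen, smul_apply, inner_smul_right, mul_left_comm _ c, integral_const_mul,
    ← Finset.mul_sum]
  ring

lemma norm_matGen_le {C : ℝ} (ha : ‖a‖ ≤ 1) (hb : ‖b‖ ≤ 1)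
    (hGa : ‖adjoint G a‖ ≤ C) (hGb : ‖adjoint G b‖ ≤ C)
    (hLa : ∀ α s, ‖U.conj (adjoint (L α)) s a‖ ≤ C)
    (hLb : ∀ α s, ‖U.conj (adjoint (L α)) s b‖ ≤ C) (T : 𝓗 →L[ℂ] 𝓗) :
    ‖matGen σ U G L a b T‖ ≤ (2 * C + gaussCoeff σ * (Fintype.card 𝒜 *
      ((∫ s, gaussWeight σ s) * C ^ 2))) * ‖T‖ := by
  have hC : 0 ≤ C := (norm_nonneg _).trans hGa
  have h1 : ‖⟪adjoint G a, T b⟫_ℂ‖ ≤ C * ‖T‖ := (norm_inner_map_le _ _ _).trans (by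
    calc ‖T‖ * (‖adjoint G a‖ * ‖b‖) ≤ ‖T‖ * (C * 1) := by gcongr
      _ = _ := by ring)
  have h2 : ‖⟪a, T (adjoint G b)⟫_ℂ‖ ≤ C * ‖T‖ := (norm_inner_map_le _ _ _).trans (by
    calc ‖T‖ * (‖a‖ * ‖adjoint G b‖) ≤ ‖T‖ * (1 * C) := by gcongr
      _ = _ := by ring)
  have h3 : ∀ α, ‖∫ s, (gaussWeight σ s : ℂ) *
      ⟪U.conj (adjoint (L α)) s a, T (U.conj (adjoint (L α)) s b)⟫_ℂ‖ ≤
      (∫ s, gaussWeight σ s) * C ^ 2 * ‖T‖ := by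
    intro α
    rw [mul_assoc, ← integral_mul_const]
    refine norm_integral_le_of_norm_le ((integrable_gaussWeight hσ).mul_const _)
      (Eventually.of_forall fun s => ?_)
    rw [norm_mul, Complex.norm_real, Real.norm_of_nonneg (gaussWeight_nonneg σ s)]
    refine mul_le_mul_of_nonneg_left ((norm_inner_map_le _ _ _).trans ?_) (gaussWeight_nonneg σ s)
    calc _ ≤ ‖T‖ * (C * C) := by gcongr <;> [exact hLa α s; exact hLb α s]
      _ = _ := by ring
  have h4 := norm_sum_le_of_le Finset.univ fun α _ => h3 α
  rw [Finset.sum_const, Finset.card_univ, nsmul_eq_mul] at h4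
  have h5 := mul_le_mul_of_nonneg_left h4 (gaussCoeff_nonneg hσ)
  rw [matGen]
  refine (norm_add₃_le).trans ?_
  rw [norm_mul, Complex.norm_real, Real.norm_of_nonneg (gaussCoeff_nonneg hσ)]
  linarith

/-- The matrix elements of the generator as a sum over a decomposition into pure states. -/
lemma hasSum_pureGen {ι : Type*} {φ : ι → 𝓗} {ρ : 𝓗 →L[ℂ] 𝓗}
    (hφ : ∀ a b, HasSum (fun m => ⟪a, φ m⟫_ℂ * ⟪φ m, b⟫_ℂ) ⟪a, ρ b⟫_ℂ)
    (hs : Summable fun m => ‖φ m‖ ^ 2) [Countable ι] :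
    HasSum (fun m => pureGen σ U G L (InnerProductSpace.rankOne ℂ b a) (φ m))
      (matGen σ U G L a b ρ) := by
  have hz : ∀ x y : 𝓗, ⟪x, InnerProductSpace.rankOne ℂ b a y⟫_ℂ = ⟪a, y⟫_ℂ * ⟪x, b⟫_ℂ :=
    fun x y => by rw [InnerProductSpace.rankOne_apply, inner_smul_right]
  have hL : ∀ α s (x y : 𝓗), ⟪x, U.conj (L α) s y⟫_ℂ = ⟪U.conj (adjoint (L α)) s x, y⟫_ℂ := by
    intro α s x y
    rw [U.inner_conj, adjoint_adjoint]
  refine ((?_ : HasSum _ _).add ?_).add (HasSum.mul_left _ (hasSum_sum fun α _ => ?_))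
  · refine (hφ (adjoint G a) b).congr_fun fun m => ?_
    rw [hz, adjoint_inner_left]
  · refine (hφ a (adjoint G b)).congr_fun fun m => ?_
    rw [hz, adjoint_inner_right]
  · have hsum := hs.mul_left (∫ s, gaussWeight σ s * (‖L α‖ ^ 2 * (‖a‖ * ‖b‖)))
    have hF : ∀ m, Integrable fun s => (gaussWeight σ s : ℂ) * ⟪U.conj (L α) s (φ m),
        InnerProductSpace.rankOne ℂ b a (U.conj (L α) s (φ m))⟫_ℂ := fun m =>
      integrable_gauss_inner hσ U (L α) _ (φ m) (φ m)
    have hbd : ∀ m s, ‖(gaussWeight σ s : ℂ) * ⟪U.conj (L α) s (φ m),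
        InnerProductSpace.rankOne ℂ b a (U.conj (L α) s (φ m))⟫_ℂ‖ ≤
        gaussWeight σ s * (‖L α‖ ^ 2 * (‖a‖ * ‖b‖)) * ‖φ m‖ ^ 2 := by
      intro m s
      have n1 := U.norm_conj_apply_le (L α) s (φ m)
      have n2 := norm_inner_le_norm (𝕜 := ℂ) a (U.conj (L α) s (φ m))
      have n3 := norm_inner_le_norm (𝕜 := ℂ) (U.conj (L α) s (φ m)) b
      rw [norm_mul, Complex.norm_real, Real.norm_of_nonneg (gaussWeight_nonneg σ s), hz, norm_mul,
        mul_assoc]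
      refine mul_le_mul_of_nonneg_left ?_ (gaussWeight_nonneg σ s)
      calc _ ≤ (‖a‖ * (‖L α‖ * ‖φ m‖)) * ((‖L α‖ * ‖φ m‖) * ‖b‖) := by
            gcongr
            · exact n2.trans (by gcongr)
            · exact n3.trans (by gcongr)
        _ = _ := by ring
    have key := hasSum_integral_of_summable_integral_norm hF (by
      refine Summable.of_nonneg_of_le (fun m => integral_nonneg fun s => norm_nonneg _)
        (fun m => ?_) hsum
      rw [← integral_mul_const]
      exact integral_mono (hF m).norm (((integrable_gaussWeight hσ).mul_const _).mul_const _)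
        (hbd m))
    have e : ∀ s, ∑' m, (gaussWeight σ s : ℂ) * ⟪U.conj (L α) s (φ m),
        InnerProductSpace.rankOne ℂ b a (U.conj (L α) s (φ m))⟫_ℂ = (gaussWeight σ s : ℂ) *
        ⟪U.conj (adjoint (L α)) s a, ρ (U.conj (adjoint (L α)) s b)⟫_ℂ := by
      intro s
      refine HasSum.tsum_eq (HasSum.mul_left _ ((hφ _ _).congr_fun fun m => ?_))
      rw [hz, hL, ← inner_conj_symm _ b, hL, inner_conj_symm]
    simpa only [e] using key

end matGen

end Comparison

section Approximation
open Filter Topology MeasureTheory ContinuousLinearMap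

variable {ι 𝒜 𝓗 : Type*} [NormedAddCommGroup 𝓗] [InnerProductSpace ℂ 𝓗] [CompleteSpace 𝓗]
  [Fintype 𝒜] {S : System ι 𝒜 𝓗} {T : Truncation 𝒜 𝓗}

/-- The truncated jump, integrated along the exact flow. -/
def flowJump (S : System ι 𝒜 𝓗) (T : Truncation 𝒜 𝓗) {f : ℝ → ℂ} (hf : Integrable f) (M : ℕ)
    (α : 𝒜) : 𝓗 →L[ℂ] 𝓗 := twirl S.flow f hf (truncJump S T M α)

/-- The drift of the truncated jumps along the exact flow. -/
def flowDrift (S : System ι 𝒜 𝓗) (T : Truncation 𝒜 𝓗) {f g : ℝ → ℂ} (hf : Integrable f)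
    (hg : Integrable g) (M : ℕ) : 𝓗 →L[ℂ] 𝓗 := driftOp S.flow g hg (flowJump S T hf M)

/-- The prefactor in the comparison of generators. -/
def genConst (γ : ℝ → ℝ) (σ : ℝ) (f g : ℝ → ℂ) : ℝ :=
  12 * kernelWeight γ g * kernelWeight γ f ^ 2 + 8 * gaussCoeff σ * kernelWeight γ f ^ 2 *
    ∫ s, gaussWeight σ s * ((1 + |s|) * γ s ^ 4)

lemma genConst_nonneg {γ : ℝ → ℝ} {σ : ℝ} (hσ : 0 < σ) (f g : ℝ → ℂ) : 0 ≤ genConst γ σ f g := by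
  have h1 := kernelWeight_nonneg γ g
  have h2 := gaussCoeff_nonneg hσ
  have h3 : 0 ≤ ∫ s, gaussWeight σ s * ((1 + |s|) * γ s ^ 4) :=
    integral_nonneg fun s => mul_nonneg (gaussWeight_nonneg _ _) (by positivity)
  unfold genConst
  positivity

lemma growthFun_mono {r κ : ℝ} (hr : 0 ≤ r) (hκ₀ : 0 < κ) {s t : ℝ} (h : |s| ≤ |t|) :
    growthFun r κ s ≤ growthFun r κ t := by
  unfold growthFun; gcongr

variable {τ : Equiv.Perm 𝒜} {κ r C_A β σ : ℝ} {q q' : ℕ → ℝ} {p : ℕ → ℕ → ℝ}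
  (hG : S.IsGibbs) (hA : S.JumpCondition τ) (hT : TruncationCondition S T τ κ r C_A q q' p)
  (hr : 0 ≤ r) (hκ₀ : 0 < κ) (hκ₁ : κ < 1 / 2) (hβ : 0 < β) (hσ : 0 < σ)
  (hE : S.gibbsEnergy β T.N κ ≠ ⊤) {f g : ℝ → ℂ} (hf : IsKernel (growthFun r κ) f)
  (hg : IsKernel (growthFun r κ) g)

include hG hA hT hr hκ₀ hκ₁ hβ hE

/-- The truncated generator is close to the generator with exact flow and finer jumps. -/
theorem norm_pureGen_trunc_sub_le [Nonempty ι] (hσ : 0 < σ) {M M' : ℕ} (hM : 1 ≤ M) (hM' : 1 ≤ M')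
    {φ : 𝓗} {c : ℝ} (hφ : Reg (expNegPow T.N κ 2) φ c) (Z : 𝓗 →L[ℂ] 𝓗) :
    ‖pureGen σ S.flow (flowDrift S T hf.1 hg.1 M') (flowJump S T hf.1 M') Z φ -
      pureGen σ (expFlow (isSelfAdjoint_truncH hG hT hM))
        (driftOp (expFlow (isSelfAdjoint_truncH hG hT hM)) g hg.1
          fun α => twirl (expFlow (isSelfAdjoint_truncH hG hT hM)) f hf.1 (truncJump S T M α))
        (fun α => twirl (expFlow (isSelfAdjoint_truncH hG hT hM)) f hf.1 (truncJump S T M α)) Z φ‖ ≤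
      ‖Z‖ * (Fintype.card 𝒜 * genConst (growthFun r κ) σ f g *
        ((|C_A| + leakage κ q M + leakage κ q M') * (leakage κ q M + leakage κ q M') +
          |q' M| ^ 2 * leakage κ (p (Fintype.card 𝒜)) M) * c ^ 2) := by
  have hγ := isGrowth_growthFun (κ := κ) hr
  have hw₁ := isWeight_expNegPow_one hG hβ hκ₀ hκ₁ hE
  have hw₂ := isWeight_two hG hβ hκ₀ hκ₁ hE
  have h21 := bdd_two_one hG hβ hκ₀ hκ₁ hE
  have hU₁ := growsBy_weight_one hT hw₁
  have hU₂ := growsBy_weight_two hT hw₂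
  have hN := integrable_gaussWeight_growth (r := r) hσ hr hκ₀ hκ₁
  set lk := leakage κ q
  have lk0 : ∀ M, 0 ≤ lk M := leakage_nonneg κ q
  have hc := hφ.nonneg
  set a := |C_A| + lk M + lk M' with ha
  have ha0 : 0 ≤ a := by have := lk0 M; have := lk0 M'; positivity
  have hMa : |C_A| + lk M ≤ a := by have := lk0 M'; linarith
  have hM'a : |C_A| + lk M' ≤ a := by have := lk0 M; linarith
  set e := lk M + lk M' with he
  have he0 : 0 ≤ e := add_nonneg (lk0 M) (lk0 M')
  have J := (norm_pureGen_jump_sub_le hγ hσ hw₁ h21 hU₁ hU₂ hN hf hg ha0 he0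
    (B := truncJump S T M) (B' := truncJump S T M')
    (L := flowJump S T hf.1 M) (L' := flowJump S T hf.1 M')
    (fun α => (bdd_truncJump_one hG hA hT α hM).mono hMa)
    (fun α => (bdd_truncJump_two hG hA hT α hM).mono hMa)
    (fun α => (bdd_truncJump_one hG hA hT α hM').mono hM'a)
    (fun α => by
      rw [adjoint_truncJump hA hT α hM']
      exact (bdd_truncJump_one hG hA hT (τ α) hM').mono hM'a)
    (fun α => bdd_truncJump_sub_one hT α hM hM')
    (fun α => by
      rw [adjoint_truncJump hA hT α hM', adjoint_truncJump hA hT α hM]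
      exact bdd_truncJump_sub_one hT (τ α) hM hM')
    (fun α => bdd_truncJump_sub_two hT α hM hM') (fun _ => rfl) (fun _ => rfl)).2.2.2 φ c hφ Z
  set π := leakage κ (p (Fintype.card 𝒜)) M
  have hπ : 0 ≤ π := leakage_nonneg _ _ _
  have hleak : SandwichBound id (S.H - ofBounded (compress S.H (T.P M))) (expNegPow T.N κ 1) π := by
    intro ψ
    obtain ⟨h, η, h1, h2⟩ := hT.leak_H M hM ψ
    exact ⟨h, η, h1, h2.trans (by gcongr; exact le_leakage _ _ _)⟩
  have Fl := norm_pureGen_flow_sub_le (U := S.flow)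
    (U' := expFlow (isSelfAdjoint_truncH hG hT hM)) hγ hσ hw₁ hU₁ hπ
    (bdd_flow_sub hG (fun s t => growthFun_mono hr hκ₀) hU₁ (isSelfAdjoint_truncH hG hT hM) hπ hleak)
    hN hf hg (B := truncJump S T M) (b := |q' M|) (abs_nonneg _)
    (fun α => norm_truncJump_le hT α hM) (fun α => bdd_truncJump hT α hM)
    (fun α => by rw [adjoint_truncJump hA hT α hM]; exact bdd_truncJump hT (τ α) hM)
    (L := flowJump S T hf.1 M)
    (L' := fun α => twirl (expFlow (isSelfAdjoint_truncH hG hT hM)) f hf.1 (truncJump S T M α))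
    (fun _ => rfl) (fun _ => rfl) (φ := φ) (c := c) (by simpa using h21 φ c hφ) Z
  set kg := kernelWeight (growthFun r κ) g
  set kf := kernelWeight (growthFun r κ) f
  set N4 := ∫ s, gaussWeight σ s * ((1 + |s|) * growthFun r κ s ^ 4)
  have hkg : 0 ≤ kg := kernelWeight_nonneg _ _
  have hN4 : 0 ≤ N4 := integral_nonneg fun s => mul_nonneg (gaussWeight_nonneg _ _) (by positivity)
  have hgc := gaussCoeff_nonneg hσ
  have hle : 4 * kg * kf ^ 2 + 2 * gaussCoeff σ * kf ^ 2 * N4 ≤ genConst (growthFun r κ) σ f g := by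
    have h1 : 0 ≤ kg * kf ^ 2 := by positivity
    have h2 : 0 ≤ gaussCoeff σ * kf ^ 2 * N4 := by positivity
    unfold genConst
    linarith
  have J' : ‖pureGen σ S.flow (flowDrift S T hf.1 hg.1 M') (flowJump S T hf.1 M') Z φ -
      pureGen σ S.flow (flowDrift S T hf.1 hg.1 M) (flowJump S T hf.1 M) Z φ‖ ≤
      ‖Z‖ * (Fintype.card 𝒜 * genConst (growthFun r κ) σ f g * (a * e) * c ^ 2) :=
    J.trans (by gcongr)
  refine (norm_sub_le_norm_sub_add_norm_sub _
    (pureGen σ S.flow (flowDrift S T hf.1 hg.1 M) (flowJump S T hf.1 M) Z φ) _).trans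
    ((add_le_add J' Fl).trans (le_of_eq ?_))
  unfold genConst
  ring

/-- Uniform bounds on the columns of the adjoints. -/
lemma exists_norm_adjoint_le [Nonempty ι] (hq : PolyBounded q) (i : ι) :
    ∃ C, ∀ M, 1 ≤ M → ‖adjoint (flowDrift S T hf.1 hg.1 M) (S.basis i)‖ ≤ C ∧
      ∀ α s, ‖S.flow.conj (adjoint (flowJump S T hf.1 M α)) s (S.basis i)‖ ≤ C := by
  have hγ := isGrowth_growthFun (κ := κ) hr
  have hw₁ := isWeight_expNegPow_one hG hβ hκ₀ hκ₁ hE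
  have hw₂ := isWeight_two hG hβ hκ₀ hκ₁ hE
  have h21 := bdd_two_one hG hβ hκ₀ hκ₁ hE
  have hU₁ := growsBy_weight_one hT hw₁
  have hU₂ := growsBy_weight_two hT hw₂
  have hU₀ := growsBy_one hγ S.flow
  obtain ⟨Cq, hCq, hlk⟩ := exists_leakage_le hκ₀ hq
  obtain ⟨η, hη⟩ := exists_expNegPow_basis hG hβ hE i
  have hreg : Reg (expNegPow T.N κ 2) (S.basis i) ‖η‖ := ⟨η, hη, le_rfl⟩
  have hreg1 : Reg (expNegPow T.N κ 1) (S.basis i) ‖η‖ := by simpa using h21 _ _ hreg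
  set a := |C_A| + Cq with ha
  have ha0 : 0 ≤ a := by positivity
  set kf := kernelWeight (growthFun r κ) f
  have hkf : 0 ≤ kf := kernelWeight_nonneg _ _
  have hadj : ∀ M, 1 ≤ M → ∀ α, Bdd (expNegPow T.N κ 1) 1 (adjoint (flowJump S T hf.1 M α)) (kf * a) := by
    intro M hM α
    rw [flowJump, adjoint_twirl, adjoint_truncJump hA hT α hM]
    have := bdd_twirl_growth hγ hf.star isWeight_one hU₁ hU₀ ha0
      ((bdd_truncJump_one hG hA hT (τ α) hM).mono (by rw [ha]; linarith [hlk M]))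
    rwa [kernelWeight_star] at this
  have hj : ∀ M, 1 ≤ M → ∀ α, Bdd (expNegPow T.N κ 2) (expNegPow T.N κ 1)
      (flowJump S T hf.1 M α) (kf * a) := fun M hM α =>
    bdd_twirl_growth hγ hf hw₁ hU₂ hU₁ ha0
      ((bdd_truncJump_two hG hA hT α hM).mono (by rw [ha]; linarith [hlk M]))
  refine ⟨max (Fintype.card 𝒜 * (kernelWeight (growthFun r κ) g * (kf * a * (kf * a))) * ‖η‖)
    (kf * a * ‖η‖), fun M hM => ⟨le_max_of_le_left ?_, fun α s => le_max_of_le_right ?_⟩⟩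
  · have e : adjoint (flowDrift S T hf.1 hg.1 M) = -∑ α, twirl S.flow (fun s => star (g s))
        hg.star.1 (adjoint (flowJump S T hf.1 M α) ∘L flowJump S T hf.1 M α) := by
      rw [flowDrift, driftOp, map_neg, map_sum]
      simp only [adjoint_twirl, adjoint_comp, adjoint_adjoint]
    have := (bdd_sum Finset.univ fun α (_ : α ∈ Finset.univ) =>
      bdd_twirl_growth hγ hg.star isWeight_one hU₂ hU₀ (by positivity)
        ((hadj M hM α).comp (hj M hM α))).neg.norm_le hreg
    rw [← e, kernelWeight_star, Finset.sum_const, Finset.card_univ, nsmul_eq_mul] at this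
    exact this
  · rw [UnitaryFlow.conj_apply, S.flow.norm_map, S.flow_basis, map_smul, norm_smul, S.norm_phase,
      one_mul]
    exact (hadj M hM α).norm_le hreg1

end Approximation

section Entries
open Filter Topology MeasureTheory ContinuousLinearMap

variable {ι 𝒜 𝓗 : Type*} [NormedAddCommGroup 𝓗] [InnerProductSpace ℂ 𝓗] [CompleteSpace 𝓗]
  [Fintype 𝒜] {S : System ι 𝒜 𝓗} {β σ : ℝ}

lemma inner_basis_conj (B : 𝓗 →L[ℂ] 𝓗) (s : ℝ) (i k : ι) :
    ⟪S.basis i, S.flow.conj B s (S.basis k)⟫_ℂ =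
      Complex.exp (Complex.I * s * ((S.energy i - S.energy k : ℝ) : ℂ)) *
        ⟪S.basis i, B (S.basis k)⟫_ℂ := by
  rw [UnitaryFlow.conj_apply, S.flow_basis, map_smul, map_smul, inner_smul_right,
    S.inner_basis_flow, System.phase, System.phase, ← mul_assoc, ← Complex.exp_add]
  congr 2
  push_cast
  ring

lemma inner_basis_driftOp (hβ : 0 < β) (hσ : 0 < σ) (L : 𝒜 → 𝓗 →L[ℂ] 𝓗) (i k : ι) :
    ⟪S.basis i, driftOp S.flow (driftKernel β σ) (integrable_driftKernel hβ hσ) L (S.basis k)⟫_ℂ =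
      -∑ α, (driftWeight β σ (S.energy i - S.energy k) : ℂ) *
        ⟪L α (S.basis i), L α (S.basis k)⟫_ℂ := by
  rw [driftOp, neg_apply, inner_neg_right, sum_apply, inner_sum]
  congr 1
  refine Finset.sum_congr rfl fun α _ => ?_
  rw [inner_twirl, ← integral_driftKernel_mul_exp hβ hσ, ← integral_mul_const]
  refine integral_congr_ae (Eventually.of_forall fun s => ?_)
  simp only [inner_basis_conj, comp_apply, adjoint_inner_right]
  ring

/-- The matrix of the generator in matrix units. -/
lemma matGen_unit (hβ : 0 < β) (hσ : 0 < σ) (L : 𝒜 → 𝓗 →L[ℂ] 𝓗) (p q : ι × ι)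
    [Decidable (p.2 = q.2)] [Decidable (p.1 = q.1)] :
    matGen σ S.flow (driftOp S.flow (driftKernel β σ) (integrable_driftKernel hβ hσ) L) L
      (S.basis p.1) (S.basis p.2) (InnerProductSpace.rankOne ℂ (S.basis q.1) (S.basis q.2)) =
    ∑ α, ((freqGauss σ (S.energy p.1 - S.energy q.1 - (S.energy p.2 - S.energy q.2)) : ℂ) *
      (⟪S.basis p.1, L α (S.basis q.1)⟫_ℂ * star ⟪S.basis p.2, L α (S.basis q.2)⟫_ℂ) -
      (if p.2 = q.2 then (driftWeight β σ (S.energy p.1 - S.energy q.1) : ℂ) *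
        ⟪L α (S.basis p.1), L α (S.basis q.1)⟫_ℂ else 0) -
      (if p.1 = q.1 then (driftWeight β σ (S.energy p.2 - S.energy q.2) : ℂ) *
        ⟪L α (S.basis q.2), L α (S.basis p.2)⟫_ℂ else 0)) := by
  classical
  set G := driftOp S.flow (driftKernel β σ) (integrable_driftKernel hβ hσ) L with hGdef
  have t1 : ⟪adjoint G (S.basis p.1), InnerProductSpace.rankOne ℂ (S.basis q.1) (S.basis q.2)
      (S.basis p.2)⟫_ℂ = -∑ α, if p.2 = q.2 then
        (driftWeight β σ (S.energy p.1 - S.energy q.1) : ℂ) *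
          ⟪L α (S.basis p.1), L α (S.basis q.1)⟫_ℂ else 0 := by
    rw [InnerProductSpace.rankOne_apply, S.inner_basis_eq, inner_smul_right, adjoint_inner_left,
      hGdef, inner_basis_driftOp hβ hσ]
    by_cases h : p.2 = q.2
    · simp [h]
    · simp [h, Ne.symm h]
  have t2 : ⟪S.basis p.1, InnerProductSpace.rankOne ℂ (S.basis q.1) (S.basis q.2)
      (adjoint G (S.basis p.2))⟫_ℂ = -∑ α, if p.1 = q.1 then
        (driftWeight β σ (S.energy p.2 - S.energy q.2) : ℂ) *
          ⟪L α (S.basis q.2), L α (S.basis p.2)⟫_ℂ else 0 := by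
    rw [InnerProductSpace.rankOne_apply, inner_smul_right, S.inner_basis_eq, adjoint_inner_right,
      ← inner_conj_symm, hGdef, inner_basis_driftOp hβ hσ]
    by_cases h : p.1 = q.1
    · simp only [h, if_true, mul_one, map_neg, map_sum, map_mul, inner_conj_symm, Complex.conj_ofReal]
    · simp [h]
  have t3 : ∀ α, (gaussCoeff σ : ℂ) * ∫ s, (gaussWeight σ s : ℂ) *
      ⟪S.flow.conj (adjoint (L α)) s (S.basis p.1),
        InnerProductSpace.rankOne ℂ (S.basis q.1) (S.basis q.2)
          (S.flow.conj (adjoint (L α)) s (S.basis p.2))⟫_ℂ =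
      (freqGauss σ (S.energy p.1 - S.energy q.1 - (S.energy p.2 - S.energy q.2)) : ℂ) *
      (⟪S.basis p.1, L α (S.basis q.1)⟫_ℂ * star ⟪S.basis p.2, L α (S.basis q.2)⟫_ℂ) := by
    intro α
    set X := ⟪S.basis p.1, L α (S.basis q.1)⟫_ℂ * star ⟪S.basis p.2, L α (S.basis q.2)⟫_ℂ with hX
    set ω := S.energy p.1 - S.energy q.1 - (S.energy p.2 - S.energy q.2) with hω
    have e : ∀ s : ℝ, (gaussWeight σ s : ℂ) *
      ⟪S.flow.conj (adjoint (L α)) s (S.basis p.1),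
        InnerProductSpace.rankOne ℂ (S.basis q.1) (S.basis q.2)
          (S.flow.conj (adjoint (L α)) s (S.basis p.2))⟫_ℂ =
        (Real.exp (-(2 * σ ^ 2 * s ^ 2)) : ℂ) * Complex.exp (Complex.I * s * ω) * X := by
      intro s
      rw [InnerProductSpace.rankOne_apply, inner_smul_right, S.flow.inner_conj, adjoint_adjoint,
        ← inner_conj_symm (S.basis q.2), S.flow.inner_conj, adjoint_adjoint, inner_basis_conj,
        inner_basis_conj, map_mul, ← Complex.exp_conj, gaussWeight]
      have : Complex.exp (Complex.I * s * ω) =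
          Complex.exp (Complex.I * s * ((S.energy p.1 - S.energy q.1 : ℝ) : ℂ)) *
          Complex.exp (starRingEnd ℂ (Complex.I * s * ((S.energy p.2 - S.energy q.2 : ℝ) : ℂ))) := by
        rw [← Complex.exp_add, hω]
        congr 1
        simp only [map_mul, Complex.conj_I, Complex.conj_ofReal]
        push_cast
        ring
      rw [this, hX, Complex.star_def]
      ring
    simp only [e]
    rw [integral_mul_const, gaussian_integral_exp hσ, ← mul_assoc, ← Complex.ofReal_mul,
      ← mul_assoc (gaussCoeff σ), gaussCoeff, gauss_coeff hσ, one_mul, freqGauss]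
  rw [matGen, t1, t2, Finset.mul_sum, Finset.sum_congr rfl fun α _ => t3 α,
    ← sub_eq_add_neg, Finset.sum_sub_distrib, Finset.sum_sub_distrib]
  ring

end Entries

section HilbertSchmidt
open Filter Topology MeasureTheory ContinuousLinearMap

variable {ι 𝒜 𝓗 : Type*} [NormedAddCommGroup 𝓗] [InnerProductSpace ℂ 𝓗] [CompleteSpace 𝓗]
  {S : System ι 𝒜 𝓗} {β σ : ℝ}

/-- The matrix `(σ_i σ_j)^{1/4}`. -/
def rootWeight (S : System ι 𝒜 𝓗) (β : ℝ) (p : ι × ι) : ℝ :=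
  (S.gibbsWeight β p.1 * S.gibbsWeight β p.2) ^ (1 / 4 : ℝ)

/-- The operator `σ_β^{1/4} x σ_β^{1/4}`. -/
def hsOp (S : System ι 𝒜 𝓗) (β : ℝ) (x : lp (fun _ : ι × ι => ℂ) 2) : 𝓗 →L[ℂ] 𝓗 :=
  S.ofMatrix fun p => (rootWeight S β p : ℂ) * x p

lemma countable_of_isGibbs (hG : S.IsGibbs) : Countable ι := by
  have h := (hG.summable 1 one_pos).countable_support
  rw [Function.support_eq_univ fun i => (Real.exp_pos _).ne'] at h
  exact Set.countable_univ_iff.1 h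

variable (hG : S.IsGibbs) (hβ : 0 < β)
include hG hβ

lemma rootWeight_pos (p : ι × ι) : 0 < rootWeight S β p :=
  Real.rpow_pos_of_pos (mul_pos (System.gibbsWeight_pos hG hβ _)
    (System.gibbsWeight_pos hG hβ _)) _

lemma rootWeight_swap (p : ι × ι) : rootWeight S β p.swap = rootWeight S β p := by
  rw [rootWeight, rootWeight, Prod.fst_swap, Prod.snd_swap, mul_comm]

lemma rootWeight_sq (p : ι × ι) : rootWeight S β p ^ 2 =
    Real.sqrt (S.gibbsWeight β p.1) * Real.sqrt (S.gibbsWeight β p.2) := by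
  have h1 := System.gibbsWeight_pos hG hβ p.1
  have h2 := System.gibbsWeight_pos hG hβ p.2
  rw [rootWeight, ← Real.rpow_natCast, ← Real.rpow_mul (by positivity), ← Real.sqrt_mul h1.le,
    Real.sqrt_eq_rpow]
  norm_num

lemma summable_sqrt_gibbsWeight : Summable fun i => Real.sqrt (S.gibbsWeight β i) := by
  simp only [Real.sqrt_eq_rpow, System.gibbsWeight_rpow hG hβ]
  exact (hG.summable (1 / 2 * β) (by positivity)).mul_left _

lemma summable_rootWeight_sq : Summable fun p : ι × ι => rootWeight S β p ^ 2 := by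
  simp only [rootWeight_sq hG hβ]
  have h := summable_sqrt_gibbsWeight hG hβ
  exact h.mul_of_nonneg h (fun i => Real.sqrt_nonneg _) fun i => Real.sqrt_nonneg _

lemma summable_rootWeight_mul (x : lp (fun _ : ι × ι => ℂ) 2) :
    Summable fun p => rootWeight S β p * ‖x p‖ := by
  refine Summable.of_nonneg_of_le
    (fun p => mul_nonneg (rootWeight_pos hG hβ p).le (norm_nonneg _)) (fun p => ?_)
    ((summable_rootWeight_sq hG hβ).add (hasSum_norm_sq_lp x).summable)
  nlinarith [two_mul_le_add_sq (rootWeight S β p) ‖x p‖,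
    mul_nonneg (rootWeight_pos hG hβ p).le (norm_nonneg (x p))]

lemma hasSum_hsOp (x : lp (fun _ : ι × ι => ℂ) 2) :
    HasSum (fun p => ((rootWeight S β p : ℂ) * x p) •
      InnerProductSpace.rankOne ℂ (S.basis p.1) (S.basis p.2)) (hsOp S β x) := by
  refine Summable.hasSum (Summable.of_norm ((summable_rootWeight_mul hG hβ x).congr fun p => ?_))
  have h1 : ∀ i, ‖S.basis i‖ = 1 := S.basis.orthonormal.1
  rw [norm_smul, norm_mul, Complex.norm_real, Real.norm_of_nonneg (rootWeight_pos hG hβ p).le,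
    InnerProductSpace.norm_rankOne, h1, h1, mul_one, mul_one]

/-- The matrix elements of `σ_β^{1/4} x σ_β^{1/4}`. -/
lemma inner_basis_hsOp (x : lp (fun _ : ι × ι => ℂ) 2) (i j : ι) :
    ⟪S.basis i, hsOp S β x (S.basis j)⟫_ℂ = (rootWeight S β (i, j) : ℂ) * x (i, j) := by
  classical
  have h1 := ((innerSL ℂ (S.basis i)).comp (ContinuousLinearMap.apply ℂ 𝓗 (S.basis j))).hasSum
    (hasSum_hsOp hG hβ x)
  have h2 := hasSum_ite_eq (i, j) ((rootWeight S β (i, j) : ℂ) * x (i, j))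
  refine HasSum.unique (h1.congr_fun fun p => ?_) h2
  simp only [ContinuousLinearMap.comp_apply, apply_apply, innerSL_apply_apply, smul_apply,
    InnerProductSpace.rankOne_apply, inner_smul_right, S.inner_basis_eq]
  by_cases hp : p = (i, j)
  · subst hp; simp
  · rw [if_neg hp]
    by_cases h3 : p.2 = j
    · have : i ≠ p.1 := fun h => hp (Prod.ext h.symm h3)
      simp [this]
    · simp [h3]

lemma hsOp_add (x y : lp (fun _ : ι × ι => ℂ) 2) : hsOp S β (x + y) = hsOp S β x + hsOp S β y := by
  refine HasSum.unique ((hasSum_hsOp hG hβ (x + y)).congr_fun fun p => ?_)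
    ((hasSum_hsOp hG hβ x).add (hasSum_hsOp hG hβ y))
  rw [lp.coeFn_add, Pi.add_apply, mul_add, add_smul]

lemma hsOp_smul (c : ℂ) (x : lp (fun _ : ι × ι => ℂ) 2) : hsOp S β (c • x) = c • hsOp S β x := by
  refine HasSum.unique ((hasSum_hsOp hG hβ (c • x)).congr_fun fun p => ?_)
    ((hasSum_hsOp hG hβ x).const_smul c)
  rw [lp.coeFn_smul, Pi.smul_apply, smul_smul, smul_eq_mul, mul_left_comm]

lemma hsOp_sub (x y : lp (fun _ : ι × ι => ℂ) 2) : hsOp S β (x - y) = hsOp S β x - hsOp S β y := by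
  rw [sub_eq_add_neg, ← neg_one_smul ℂ y, hsOp_add hG hβ, hsOp_smul hG hβ]
  simp [sub_eq_add_neg]

end HilbertSchmidt

section Limit
open Filter Topology MeasureTheory ContinuousLinearMap

variable {ι 𝒜 𝓗 : Type*} [NormedAddCommGroup 𝓗] [InnerProductSpace ℂ 𝓗] [CompleteSpace 𝓗]
  [Fintype 𝒜] {S : System ι 𝒜 𝓗} {T : Truncation 𝒜 𝓗}
variable {τ : Equiv.Perm 𝒜} {κ r C_A β σ : ℝ} {q q' : ℕ → ℝ} {p : ℕ → ℕ → ℝ}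
  (hG : S.IsGibbs) (hA : S.JumpCondition τ) (hT : TruncationCondition S T τ κ r C_A q q' p)
  (hr : 0 ≤ r) (hκ₀ : 0 < κ) (hκ₁ : κ < 1 / 2) (hβ : 0 < β) (hσ : 0 < σ)
  (hE : S.gibbsEnergy β T.N κ ≠ ⊤) {f : 𝓢(ℝ, ℂ)} (hf : IsKernel (growthFun r κ) f)
  (hq : PolyBounded q)

lemma hasSum_matGen (hσ : 0 < σ) (U : UnitaryFlow 𝓗) (G : 𝓗 →L[ℂ] 𝓗) (L : 𝒜 → 𝓗 →L[ℂ] 𝓗) (a b : 𝓗) {C : ℝ}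
    (hC : ∀ X, ‖matGen σ U G L a b X‖ ≤ C * ‖X‖) {J : Type*} {X : J → 𝓗 →L[ℂ] 𝓗} {X₀ : 𝓗 →L[ℂ] 𝓗}
    (h : HasSum X X₀) : HasSum (fun j => matGen σ U G L a b (X j)) (matGen σ U G L a b X₀) :=
  (LinearMap.mkContinuous (σ := RingHom.id ℂ)
    { toFun := matGen σ U G L a b
      map_add' := matGen_add hσ U G L a b
      map_smul' := matGen_smul hσ U G L a b } C hC).hasSum h

include hG hT hκ₀ hκ₁ hβ hE hq in
/-- The columns of the truncated jumps converge. -/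
lemma tendsto_flowJump (α : 𝒜) (k : ι) :
    Tendsto (fun M => flowJump S T hf.1 M α (S.basis k)) atTop (𝓝 (S.lindVec f α k)) := by
  obtain ⟨η, hη⟩ := exists_expNegPow_basis hG hβ hE k
  have hreg : Reg (expNegPow T.N κ 1) (S.basis k) ‖η‖ := by
    simpa using bdd_two_one hG hβ hκ₀ hκ₁ hE _ _ ⟨η, hη, le_rfl⟩
  have h1 := ((tendsto_leakage hκ₀ hq).mul_const ‖η‖).const_mul (∫ s, ‖f s‖)
  rw [zero_mul, mul_zero] at h1
  refine tendsto_iff_norm_sub_tendsto_zero.2 (squeeze_zero' (Eventually.of_forall fun M =>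
    norm_nonneg _) ?_ h1)
  filter_upwards [eventually_ge_atTop 1] with M hM
  rw [flowJump, S.twirl_flow_basis hf.1, System.lindVec, ← S.average_sub hf.1]
  refine (S.norm_average_le hf.1 _ _).trans ?_
  refine mul_le_mul_of_nonneg_left ?_ (integral_nonneg fun s => norm_nonneg _)
  rw [norm_sub_rev]
  exact (truncJump_leak_one hT α hM hreg).2

variable (hg : IsKernel (growthFun r κ) (driftKernel β σ))

include hG hT hκ₀ hκ₁ hβ hE hq hσ in
lemma tendsto_matGen_unit (z w : ι × ι) :
    Tendsto (fun M => matGen σ S.flow (flowDrift S T hf.1 hg.1 M) (flowJump S T hf.1 M)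
      (S.basis z.1) (S.basis z.2) (InnerProductSpace.rankOne ℂ (S.basis w.1) (S.basis w.2))) atTop
      (𝓝 (∑ α, S.genEntry β σ f α z w)) := by
  classical
  have h := tendsto_flowJump hG hT hκ₀ hκ₁ hβ hE hf hq
  have e : ∀ M, flowDrift S T hf.1 hg.1 M = driftOp S.flow (driftKernel β σ)
    (integrable_driftKernel hβ hσ) (flowJump S T hf.1 M) := fun M => rfl
  simp only [e, matGen_unit hβ hσ, System.genEntry]
  refine tendsto_finsetSum _ fun α _ => ((Tendsto.const_mul _ (Tendsto.mul
    (tendsto_const_nhds.inner (h α _)) (tendsto_const_nhds.inner (h α _)).star)).sub ?_).sub ?_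
  · split_ifs
    · exact ((h α _).inner (h α _)).const_mul _
    · exact tendsto_const_nhds
  · split_ifs
    · exact ((h α _).inner (h α _)).const_mul _
    · exact tendsto_const_nhds

include hG hA hT hr hκ₀ hκ₁ hβ hE hq hσ in
/-- The generators of the finer truncations converge weakly to the exact generator. -/
theorem tendsto_matGen_hsOp [Nonempty ι] (hkms : IsKMSFilter β f)
    {w : lp (fun _ : ι × ι => ℂ) 2 × lp (fun _ : ι × ι => ℂ) 2} (hw : w ∈ S.negGenerator β σ f)
    (z : ι × ι) :
    Tendsto (fun M => matGen σ S.flow (flowDrift S T hf.1 hg.1 M) (flowJump S T hf.1 M)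
      (S.basis z.1) (S.basis z.2) (hsOp S β w.1)) atTop
      (𝓝 (-((rootWeight S β z : ℂ) * w.2 z))) := by
  have hn : ∀ i, ‖S.basis i‖ = 1 := S.basis.orthonormal.1
  obtain ⟨C₁, h1⟩ := exists_norm_adjoint_le hG hA hT hr hκ₀ hκ₁ hβ hE hf hg hq z.1
  obtain ⟨C₂, h2⟩ := exists_norm_adjoint_le hG hA hT hr hκ₀ hκ₁ hβ hE hf hg hq z.2
  set C := max C₁ C₂
  set C' := 2 * C + gaussCoeff σ * (Fintype.card 𝒜 * ((∫ s, gaussWeight σ s) * C ^ 2))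
  have hbd : ∀ M, 1 ≤ M → ∀ X, ‖matGen σ S.flow (flowDrift S T hf.1 hg.1 M) (flowJump S T hf.1 M)
      (S.basis z.1) (S.basis z.2) X‖ ≤ C' * ‖X‖ := fun M hM =>
    norm_matGen_le hσ _ _ _ _ _ (hn _).le (hn _).le
      ((h1 M hM).1.trans (le_max_left _ _)) ((h2 M hM).1.trans (le_max_right _ _))
      (fun α s => ((h1 M hM).2 α s).trans (le_max_left _ _))
      (fun α s => ((h2 M hM).2 α s).trans (le_max_right _ _))
  have hx := hasSum_hsOp hG hβ w.1
  have key := tendsto_tsum_of_dominated_convergence (𝓕 := atTop)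
    (f := fun M y => matGen σ S.flow (flowDrift S T hf.1 hg.1 M) (flowJump S T hf.1 M)
      (S.basis z.1) (S.basis z.2) (((rootWeight S β y : ℂ) * w.1 y) •
        InnerProductSpace.rankOne ℂ (S.basis y.1) (S.basis y.2)))
    (g := fun y => ((rootWeight S β y : ℂ) * w.1 y) * ∑ α, S.genEntry β σ f α z y)
    (bound := fun y => C' * (rootWeight S β y * ‖w.1 y‖))
    ((summable_rootWeight_mul hG hβ w.1).mul_left _) (fun y => by
      simp only [matGen_smul hσ]
      exact (tendsto_matGen_unit hG hT hκ₀ hκ₁ hβ hσ hE hf hq hg z y).const_mul _) (by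
      filter_upwards [eventually_ge_atTop 1] with M hM y
      refine (hbd M hM _).trans (le_of_eq ?_)
      rw [norm_smul, norm_mul, Complex.norm_real, Real.norm_of_nonneg (rootWeight_pos hG hβ y).le,
        InnerProductSpace.norm_rankOne, hn, hn, mul_one, mul_one])
  have e1 : ∑' y, ((rootWeight S β y : ℂ) * w.1 y) * ∑ α, S.genEntry β σ f α z y =
      -((rootWeight S β z : ℂ) * w.2 z) := by
    have h3 := (System.negGenerator_apply hG hA hf.1 hβ hσ hkms hw z).mul_left
      (-(rootWeight S β z : ℂ))
    rw [neg_mul] at h3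
    refine HasSum.tsum_eq (h3.congr_fun fun y => ?_)
    have e2 : rootWeight S β y = rootWeight S β z *
        Real.exp (-(β * (S.energy y.1 + S.energy y.2 - S.energy z.1 - S.energy z.2) / 4)) := by
      have hp := fun i => (System.gibbsWeight_pos hG hβ i).le
      rw [rootWeight, rootWeight, Real.mul_rpow (hp _) (hp _), Real.mul_rpow (hp _) (hp _)]
      simp only [System.gibbsWeight_rpow hG hβ]
      have : Real.exp (-(1 / 4 * β * S.energy y.1)) * Real.exp (-(1 / 4 * β * S.energy y.2)) =
        Real.exp (-(1 / 4 * β * S.energy z.1)) * Real.exp (-(1 / 4 * β * S.energy z.2)) *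
        Real.exp (-(β * (S.energy y.1 + S.energy y.2 - S.energy z.1 - S.energy z.2) / 4)) := by
        simp only [← Real.exp_add]
        congr 1
        ring
      set Z := (∑' j, Real.exp (-(β * S.energy j))) ^ (-(1 / 4 : ℝ))
      linear_combination Z ^ 2 * this
    rw [System.formEntry, e2]
    push_cast
    ring
  rw [e1] at key
  refine key.congr' ?_
  filter_upwards [eventually_ge_atTop 1] with M hM
  exact (hasSum_matGen hσ _ _ _ _ _ (hbd M hM) hx).tsum_eq

end Limit

section BasisTools
open Filter Topology MeasureTheory ContinuousLinearMap

variable {ι 𝓗 : Type*} [NormedAddCommGroup 𝓗] [InnerProductSpace ℂ 𝓗] [CompleteSpace 𝓗]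
  (b : HilbertBasis ι ℂ 𝓗)

lemma hasSum_norm_inner_sq (ψ : 𝓗) : HasSum (fun i => ‖⟪b i, ψ⟫_ℂ‖ ^ 2) (‖ψ‖ ^ 2) := by
  have := hasSum_norm_sq_lp (b.repr ψ)
  simpa only [b.repr_apply_apply, LinearIsometryEquiv.norm_map] using this

/-- A bounded operator with square-summable columns. -/
lemma exists_of_columns {v : ι → 𝓗} (hv : Summable fun i => ‖v i‖ ^ 2) :
    ∃ Y : 𝓗 →L[ℂ] 𝓗, ∀ i, Y (b i) = v i := by
  classical
  let V : lp (fun _ : ι => ℂ) 2 := ⟨fun i => (‖v i‖ : ℂ), (memℓp_two_iff _).2 (by simpa using hv)⟩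
  have hsq : ∀ ψ : 𝓗, Summable fun i => ‖((‖⟪b i, ψ⟫_ℂ‖ : ℝ) : ℂ)‖ ^ 2 := fun ψ => by
    simpa using (hasSum_norm_inner_sq b ψ).summable
  have key : ∀ ψ : 𝓗, ∃ s, HasSum (fun i => ‖⟪b i, ψ⟫_ℂ • v i‖) s ∧ s ≤ ‖V‖ * ‖ψ‖ := by
    intro ψ
    let A : lp (fun _ : ι => ℂ) 2 := ⟨fun i => (‖⟪b i, ψ⟫_ℂ‖ : ℂ), (memℓp_two_iff _).2 (hsq ψ)⟩
    have hA : ‖A‖ = ‖ψ‖ := by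
      have h1 := hasSum_norm_sq_lp A
      have h2 := hasSum_norm_inner_sq b ψ
      refine (sq_eq_sq₀ (norm_nonneg _) (norm_nonneg _)).1 (h1.unique (h2.congr_fun fun i => ?_))
      simp [A]
    have h3 := Complex.hasSum_re (lp.hasSum_inner V A)
    refine ⟨_, h3.congr_fun fun i => ?_, (Complex.re_le_norm _).trans
      ((norm_inner_le_norm V A).trans (by rw [hA]))⟩
    rw [norm_smul]
    simp [V, A, ← Complex.ofReal_mul]
  have hs : ∀ ψ : 𝓗, Summable fun i => ⟪b i, ψ⟫_ℂ • v i := fun ψ =>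
    Summable.of_norm (key ψ).choose_spec.1.summable
  refine ⟨LinearMap.mkContinuous
    { toFun := fun ψ => ∑' i, ⟪b i, ψ⟫_ℂ • v i
      map_add' := fun φ ψ => by
        rw [← (hs φ).tsum_add (hs ψ)]; simp only [inner_add_right, add_smul]
      map_smul' := fun c ψ => by
        rw [RingHom.id_apply, ← (hs ψ).tsum_const_smul]
        simp only [inner_smul_right, mul_smul] } ‖V‖ fun ψ => ?_, fun i => ?_⟩
  · obtain ⟨s, h1, h2⟩ := key ψ
    exact ((hs ψ).hasSum.norm_le_of_bounded h1 fun i => le_rfl).trans h2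
  · refine (tsum_eq_single i fun j hj => ?_).trans ?_
    · rw [b.orthonormal.2 hj, zero_smul]
    · rw [inner_self_eq_norm_sq_to_K, b.orthonormal.1 i]; simp

/-- The square of the Hilbert-Schmidt norm. -/
def hsNormSq (A : 𝓗 →L[ℂ] 𝓗) : ENNReal := ∑' m, ENNReal.ofReal (‖A (b m)‖ ^ 2)

lemma tsum_ofReal_norm_inner_sq (ψ : 𝓗) :
    ∑' i, ENNReal.ofReal (‖⟪b i, ψ⟫_ℂ‖ ^ 2) = ENNReal.ofReal (‖ψ‖ ^ 2) := by
  have h := hasSum_norm_inner_sq b ψ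
  rw [← h.tsum_eq, ENNReal.ofReal_tsum_of_nonneg (fun _ => sq_nonneg _) h.summable]

lemma hsNormSq_adjoint (A : 𝓗 →L[ℂ] 𝓗) : hsNormSq b (adjoint A) = hsNormSq b A := by
  simp only [hsNormSq, ← tsum_ofReal_norm_inner_sq b]
  rw [ENNReal.tsum_comm]
  simp only [adjoint_inner_right, norm_inner_symm]

lemma hsNormSq_comp_le (B A : 𝓗 →L[ℂ] 𝓗) {c : ℝ} (hB : ∀ ψ, ‖B ψ‖ ^ 2 ≤ c * ‖ψ‖ ^ 2) (hc : 0 ≤ c) :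
    hsNormSq b (B ∘L A) ≤ ENNReal.ofReal c * hsNormSq b A := by
  rw [hsNormSq, hsNormSq, ← ENNReal.tsum_mul_left]
  refine ENNReal.tsum_le_tsum fun m => ?_
  rw [← ENNReal.ofReal_mul hc]
  exact ENNReal.ofReal_le_ofReal (hB _)

lemma hsNormSq_of_hasSum {A : 𝓗 →L[ℂ] 𝓗} {s : ℝ} (h : HasSum (fun m => ‖A (b m)‖ ^ 2) s) :
    hsNormSq b A = ENNReal.ofReal s := by
  rw [hsNormSq, ← ENNReal.ofReal_tsum_of_nonneg (fun _ => sq_nonneg _) h.summable, h.tsum_eq]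

lemma summable_of_hsNormSq_le {A : 𝓗 →L[ℂ] 𝓗} {s : ℝ} (hs : 0 ≤ s)
    (h : hsNormSq b A ≤ ENNReal.ofReal s) :
    Summable (fun m => ‖A (b m)‖ ^ 2) ∧ ∑' m, ‖A (b m)‖ ^ 2 ≤ s := by
  have h1 : Summable fun m => ‖A (b m)‖ ^ 2 := by
    have := ENNReal.summable_toReal (ne_top_of_le_ne_top ENNReal.ofReal_ne_top h)
    simpa only [ENNReal.toReal_ofReal (sq_nonneg _)] using this
  refine ⟨h1, ?_⟩
  rwa [hsNormSq, ← ENNReal.ofReal_tsum_of_nonneg (fun _ => sq_nonneg _) h1,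
    ENNReal.ofReal_le_ofReal_iff hs] at h

/-- Factorization of an operator dominated by another one with dense range. -/
lemma exists_factor {R Q : 𝓗 →L[ℂ] 𝓗} (hQ : DenseRange Q) {c : ℝ} (hc : 0 ≤ c)
    (h : ∀ ψ, ‖R ψ‖ ^ 2 ≤ c * ‖Q ψ‖ ^ 2) :
    ∃ K : 𝓗 →L[ℂ] 𝓗, R = K ∘L Q ∧ ∀ ψ, ‖K ψ‖ ^ 2 ≤ c * ‖ψ‖ ^ 2 := by
  have h' : ∀ ψ, ‖R ψ‖ ≤ Real.sqrt c * ‖Q ψ‖ := fun ψ => by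
    refine (abs_le_of_sq_le_sq' ?_ (by positivity)).2
    rw [mul_pow, Real.sq_sqrt hc]
    exact h ψ
  set K : 𝓗 →L[ℂ] 𝓗 := (R : 𝓗 →ₗ[ℂ] 𝓗).extendOfNorm (Q : 𝓗 →ₗ[ℂ] 𝓗) with hK
  refine ⟨K, ?_, fun ψ => ?_⟩
  · ext ψ
    exact (LinearMap.extendOfNorm_eq (e := (Q : 𝓗 →ₗ[ℂ] 𝓗)) hQ ⟨_, h'⟩ ψ).symm
  · have := LinearMap.norm_extendOfNorm_apply_le (e := (Q : 𝓗 →ₗ[ℂ] 𝓗)) hQ _ h' ψ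
    have := pow_le_pow_left₀ (norm_nonneg _) this 2
    rwa [mul_pow, Real.sq_sqrt hc] at this

lemma norm_adjoint_sq_le {K : 𝓗 →L[ℂ] 𝓗} {c : ℝ} (hc : 0 ≤ c) (h : ∀ ψ, ‖K ψ‖ ^ 2 ≤ c * ‖ψ‖ ^ 2)
    (ψ : 𝓗) : ‖adjoint K ψ‖ ^ 2 ≤ c * ‖ψ‖ ^ 2 := by
  have h1 : ‖K‖ ≤ Real.sqrt c := opNorm_le_bound _ (Real.sqrt_nonneg _) fun ψ => by
    refine (abs_le_of_sq_le_sq' ?_ (by positivity)).2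
    rw [mul_pow, Real.sq_sqrt hc]
    exact h ψ
  have h2 := pow_le_pow_left₀ (norm_nonneg _) ((adjoint K).le_of_opNorm_le
    ((LinearIsometryEquiv.norm_map _ K).trans_le h1) ψ) 2
  rwa [mul_pow, Real.sq_sqrt hc] at h2

end BasisTools

section States
open Filter Topology MeasureTheory ContinuousLinearMap

variable {ι 𝒜 𝓗 : Type*} [NormedAddCommGroup 𝓗] [InnerProductSpace ℂ 𝓗] [CompleteSpace 𝓗]
  {S : System ι 𝒜 𝓗} {β : ℝ} (hG : S.IsGibbs) (hβ : 0 < β)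

lemma ext_of_entries {A B : 𝓗 →L[ℂ] 𝓗}
    (h : ∀ i j, ⟪S.basis i, A (S.basis j)⟫_ℂ = ⟪S.basis i, B (S.basis j)⟫_ℂ) : A = B := by
  refine ContinuousLinearMap.ext_on (s := Set.range S.basis) ?_ ?_
  · rw [dense_iff_closure_eq, ← Submodule.topologicalClosure_coe, S.basis.dense_span]; rfl
  · rintro - ⟨j, rfl⟩
    exact S.ext_basis fun i => h i j

include hG hβ

/-- The operator `√σ_β`. -/
lemma exists_sqrt_gibbs : ∃ Q : 𝓗 →L[ℂ] 𝓗,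
    ∀ i, Q (S.basis i) = (Real.sqrt (S.gibbsWeight β i) : ℂ) • S.basis i := by
  refine exists_of_columns S.basis ?_
  have h : Summable (S.gibbsWeight β) := (hG.summable β hβ).div_const _
  refine h.congr fun i => ?_
  rw [norm_smul, Complex.norm_real, Real.norm_of_nonneg (Real.sqrt_nonneg _), S.basis.orthonormal.1,
    mul_one, Real.sq_sqrt (System.gibbsWeight_pos hG hβ i).le]

section Sqrt
variable {Q : 𝓗 →L[ℂ] 𝓗}
    (hQ : ∀ i, Q (S.basis i) = (Real.sqrt (S.gibbsWeight β i) : ℂ) • S.basis i)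
include hQ

lemma denseRange_sqrt : DenseRange Q := by
  refine denseRange_of_basis (S := S) fun i => ?_
  have h := System.gibbsWeight_pos hG hβ i
  refine ⟨((Real.sqrt (S.gibbsWeight β i))⁻¹ : ℂ) • S.basis i, ?_⟩
  rw [map_smul, hQ, smul_smul, inv_mul_cancel₀, one_smul]
  exact_mod_cast (Real.sqrt_pos.2 h).ne'

lemma adjoint_sqrt : adjoint Q = Q := by
  classical
  refine ext_of_entries (S := S) fun i j => ?_
  rw [adjoint_inner_right, hQ, hQ, inner_smul_left, inner_smul_right, S.inner_basis_eq,
    Complex.conj_ofReal]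
  by_cases h : i = j
  · rw [h]
  · simp [h]

/-- The Gibbs state corresponds to the ground state. -/
lemma sqrt_comp_sqrt : Q ∘L Q = hsOp S β (S.coreVec β 0 1) := by
  classical
  refine ext_of_entries (S := S) fun i j => ?_
  have h := System.gibbsWeight_pos hG hβ j
  rw [inner_basis_hsOp hG hβ, System.coreVec_apply hG hβ, comp_apply, hQ, map_smul, hQ, smul_smul,
    inner_smul_right, S.inner_basis_eq]
  by_cases hij : i = j
  · subst hij
    have h2 : rootWeight S β (i, i) = Real.sqrt (S.gibbsWeight β i) := by
      have := rootWeight_sq hG hβ (i, i)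
      rw [← sq] at this
      exact (sq_eq_sq₀ (rootWeight_pos hG hβ _).le (Real.sqrt_nonneg _)).1 this
    simp [h2]
  · simp [hij]

end Sqrt

lemma gibbsState_eq : S.gibbsState β = hsOp S β (S.coreVec β 0 1) := by
  classical
  obtain ⟨Q, hQ⟩ := exists_sqrt_gibbs hG hβ
  rw [← sqrt_comp_sqrt hG hβ hQ]
  have hs : Summable fun i => (S.gibbsWeight β i : ℂ) •
      InnerProductSpace.rankOne ℂ (S.basis i) (S.basis i) := by
    have h : Summable (S.gibbsWeight β) := (hG.summable β hβ).div_const _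
    refine Summable.of_norm (h.congr fun i => ?_)
    rw [norm_smul, Complex.norm_real, Real.norm_of_nonneg (System.gibbsWeight_pos hG hβ i).le,
      InnerProductSpace.norm_rankOne, S.basis.orthonormal.1, mul_one, mul_one]
  refine ext_of_entries (S := S) fun i j => ?_
  have h1 := ((innerSL ℂ (S.basis i)).comp (ContinuousLinearMap.apply ℂ 𝓗 (S.basis j))).hasSum
    hs.hasSum
  have h2 := hasSum_ite_eq j (if i = j then (S.gibbsWeight β j : ℂ) else 0)
  refine (h1.unique (h2.congr_fun fun k => ?_)).trans ?_
  · simp only [ContinuousLinearMap.comp_apply, apply_apply, innerSL_apply_apply, smul_apply,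
      InnerProductSpace.rankOne_apply, inner_smul_right, S.inner_basis_eq]
    by_cases hk : k = j
    · subst hk; by_cases h : i = k <;> simp [h]
    · simp [hk]
  · rw [comp_apply, hQ, map_smul, hQ, smul_smul, inner_smul_right, S.inner_basis_eq,
      ← Complex.ofReal_mul, Real.mul_self_sqrt (System.gibbsWeight_pos hG hβ j).le]
    simp

end States

section Entries
open Filter Topology MeasureTheory ContinuousLinearMap

lemma hasSum_entries_sq {ι 𝓗 : Type*} [NormedAddCommGroup 𝓗] [InnerProductSpace ℂ 𝓗]
    [CompleteSpace 𝓗] (b : HilbertBasis ι ℂ 𝓗) {X : 𝓗 →L[ℂ] 𝓗}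
    (h : Summable fun m => ‖X (b m)‖ ^ 2) :
    HasSum (fun p : ι × ι => ‖⟪b p.1, X (b p.2)⟫_ℂ‖ ^ 2) (∑' m, ‖X (b m)‖ ^ 2) := by
  have e : ∀ m, ∑' i, ‖⟪b i, X (b m)⟫_ℂ‖ ^ 2 = ‖X (b m)‖ ^ 2 := fun m =>
    (hasSum_norm_inner_sq b _).tsum_eq
  have a1 : Summable fun p : ι × ι => ‖⟪b p.2, X (b p.1)⟫_ℂ‖ ^ 2 := by
    rw [summable_prod_of_nonneg fun _ => sq_nonneg _]
    refine ⟨fun m => (hasSum_norm_inner_sq b (X (b m))).summable, h.congr fun m => (e m).symm⟩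
  have a2 : ∑' p : ι × ι, ‖⟪b p.2, X (b p.1)⟫_ℂ‖ ^ 2 = ∑' m, ‖X (b m)‖ ^ 2 := by
    rw [a1.tsum_prod]
    exact tsum_congr e
  have a3 := a1.hasSum
  rw [a2] at a3
  exact (Equiv.prodComm ι ι).hasSum_iff.1 a3

end Entries

section Decomposition
open Filter Topology MeasureTheory ContinuousLinearMap

variable {ι 𝒜 𝓗 : Type*} [NormedAddCommGroup 𝓗] [InnerProductSpace ℂ 𝓗] [CompleteSpace 𝓗]
  {S : System ι 𝒜 𝓗} {β : ℝ} (hG : S.IsGibbs) (hβ : 0 < β)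

include hG hβ

/-- The expectation of `σ_β^{1/4} y σ_β^{1/4}` in a finite combination of eigenvectors. -/
lemma inner_hsOp_finsupp (y : lp (fun _ : ι × ι => ℂ) 2) (c a : ι →₀ ℂ)
    (hs : c.support = a.support) (ha : ∀ i, a i = (S.gibbsWeight β i ^ (1 / 4 : ℝ) : ℝ) * c i) :
    ⟪c.sum fun i z => z • S.basis i, hsOp S β y (c.sum fun i z => z • S.basis i)⟫_ℂ =
      ⟪coreMap (outer a), y⟫_ℂ := by
  rw [inner_coreMap, outer_sum subset_rfl fun p => by simp, Finsupp.sum, map_sum, sum_inner, hs]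
  refine Finset.sum_congr rfl fun i _ => ?_
  rw [inner_sum]
  refine Finset.sum_congr rfl fun j _ => ?_
  have hp := fun i => (System.gibbsWeight_pos hG hβ i).le
  rw [map_smul, inner_smul_left, inner_smul_right, inner_basis_hsOp hG hβ, rootWeight,
    Real.mul_rpow (hp _) (hp _), ha, ha]
  simp only [star_mul', Complex.star_def, Complex.conj_ofReal, Complex.conj_conj]
  push_cast
  ring

/-- Positivity can be read off from the matrix. -/
lemma isPositive_hsOp_iff {y : lp (fun _ : ι × ι => ℂ) 2} :
    (hsOp S β y).IsPositive ↔ IsPSD y := by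
  classical
  have hw := fun i => Real.rpow_pos_of_pos (System.gibbsWeight_pos hG hβ i) (1 / 4)
  have hwc : ∀ i, ((S.gibbsWeight β i ^ (1 / 4 : ℝ) : ℝ) : ℂ) ≠ 0 := fun i => by
    exact_mod_cast (hw i).ne'
  constructor
  · intro h
    refine ⟨fun p => ?_, fun a => ?_⟩
    · have h1 := h.isSelfAdjoint.adjoint_eq
      have h2 : ⟪S.basis p.2, hsOp S β y (S.basis p.1)⟫_ℂ =
          star ⟪S.basis p.1, hsOp S β y (S.basis p.2)⟫_ℂ := by
        rw [Complex.star_def, inner_conj_symm, ← adjoint_inner_left, h1]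
      rw [inner_basis_hsOp hG hβ, inner_basis_hsOp hG hβ, star_mul', Complex.star_def,
        Complex.conj_ofReal] at h2
      have h3 := rootWeight_swap hG hβ p
      have h4 : (rootWeight S β p : ℂ) ≠ 0 := by exact_mod_cast (rootWeight_pos hG hβ p).ne'
      rw [Prod.swap] at h3 ⊢
      rw [h3] at h2
      exact mul_left_cancel₀ h4 h2
    · let c : ι →₀ ℂ := Finsupp.onFinset a.support
        (fun i => ((S.gibbsWeight β i ^ (1 / 4 : ℝ) : ℝ) : ℂ)⁻¹ * a i) fun i hi =>
          Finsupp.mem_support_iff.2 (right_ne_zero_of_mul hi)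
      rw [← inner_hsOp_finsupp hG hβ y c a ?_ fun i => ?_]
      · exact (h.re_inner_nonneg_right _)
      · ext i
        simp only [c, Finsupp.mem_support_iff, Ne, Finsupp.onFinset_apply, mul_eq_zero, inv_eq_zero,
          hwc i, false_or]
      · rw [Finsupp.onFinset_apply, mul_inv_cancel_left₀ (hwc i)]
  · intro h
    have hsa : IsSelfAdjoint (hsOp S β y) := by
      rw [isSelfAdjoint_iff']
      refine ext_of_entries (S := S) fun i j => ?_
      have h1 := h.1 (i, j)
      have h2 := rootWeight_swap hG hβ (i, j)
      rw [Prod.swap] at h1 h2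
      rw [adjoint_inner_right, ← inner_conj_symm, inner_basis_hsOp hG hβ, inner_basis_hsOp hG hβ,
        map_mul, Complex.conj_ofReal, ← Complex.star_def, h1, star_star, h2]
    rw [isPositive_def']
    refine ⟨hsa, fun ψ => ?_⟩
    have hcl : IsClosed {ψ | 0 ≤ (hsOp S β y).reApplyInnerSelf ψ} :=
      isClosed_le continuous_const (hsOp S β y).reApplyInnerSelf_continuous
    have hd : Dense (Submodule.span ℂ (Set.range S.basis) : Set 𝓗) := by
      rw [dense_iff_closure_eq, ← Submodule.topologicalClosure_coe, S.basis.dense_span]; rfl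
    refine hd.induction (P := fun ψ => 0 ≤ (hsOp S β y).reApplyInnerSelf ψ) (fun ψ hψ => ?_) hcl ψ
    obtain ⟨c, rfl⟩ := Finsupp.mem_span_range_iff_exists_finsupp.1 hψ
    let a : ι →₀ ℂ := Finsupp.onFinset c.support
        (fun i => ((S.gibbsWeight β i ^ (1 / 4 : ℝ) : ℝ) : ℂ) * c i) fun i hi =>
          Finsupp.mem_support_iff.2 (right_ne_zero_of_mul hi)
    have h1 := inner_hsOp_finsupp hG hβ y c a (by
      ext i
      simp only [a, Finsupp.mem_support_iff, Ne, Finsupp.onFinset_apply, mul_eq_zero,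
        hwc i, false_or]) fun i => rfl
    rw [reApplyInnerSelf_apply, inner_re_symm, h1]
    exact h.2 a

variable {Q : 𝓗 →L[ℂ] 𝓗}
    (hQ : ∀ i, Q (S.basis i) = (Real.sqrt (S.gibbsWeight β i) : ℂ) • S.basis i)
include hQ

/-- A positive operator below a multiple of the Gibbs state. -/
lemma exists_sqrt_factor {ρ : 𝓗 →L[ℂ] 𝓗} {𝔠 : ℝ} (h𝔠 : 0 ≤ 𝔠) (hρ : ρ.IsPositive)
    (hle : ρ ≤ (𝔠 : ℂ) • S.gibbsState β) :
    ∃ R K : 𝓗 →L[ℂ] 𝓗, adjoint R = R ∧ R ∘L R = ρ ∧ R = Q ∘L adjoint K ∧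
      ∀ ψ, ‖K ψ‖ ^ 2 ≤ 𝔠 * ‖ψ‖ ^ 2 := by
  have hρ0 : 0 ≤ ρ := (nonneg_iff_isPositive ρ).2 hρ
  set R := CFC.sqrt ρ with hR
  have hRsa : adjoint R = R := (CFC.sqrt_nonneg ρ).isSelfAdjoint
  have hRR : R ∘L R = ρ := CFC.sqrt_mul_sqrt_self ρ hρ0
  have hQa := adjoint_sqrt hG hβ hQ
  have h1 : ∀ ψ, ‖R ψ‖ ^ 2 ≤ 𝔠 * ‖Q ψ‖ ^ 2 := by
    intro ψ
    have a1 : ((‖R ψ‖ ^ 2 : ℝ) : ℂ) = ⟪ψ, ρ ψ⟫_ℂ := by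
      rw [← hRR, comp_apply, ← adjoint_inner_left, hRsa, inner_self_eq_norm_sq_to_K]
      simp
    have a2 : ((‖Q ψ‖ ^ 2 : ℝ) : ℂ) = ⟪ψ, S.gibbsState β ψ⟫_ℂ := by
      rw [gibbsState_eq hG hβ, ← sqrt_comp_sqrt hG hβ hQ, comp_apply, ← adjoint_inner_left, hQa,
        inner_self_eq_norm_sq_to_K]
      simp
    have a3 := ((le_def _ _).1 hle).re_inner_nonneg_right ψ
    rw [sub_apply, inner_sub_right, smul_apply, inner_smul_right, ← a1, ← a2, ← Complex.ofReal_mul,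
      ← Complex.ofReal_sub] at a3
    have a4 : 0 ≤ 𝔠 * ‖Q ψ‖ ^ 2 - ‖R ψ‖ ^ 2 := a3
    linarith
  obtain ⟨K, hK, hKn⟩ := exists_factor (denseRange_sqrt hG hβ hQ) h𝔠 h1
  refine ⟨R, K, hRsa, hRR, ?_, hKn⟩
  have := congrArg adjoint hK
  rwa [hRsa, adjoint_comp, hQa] at this

end Decomposition

section RootDensity
open Filter Topology MeasureTheory ContinuousLinearMap

variable {ι 𝒜 𝓗 : Type*} [NormedAddCommGroup 𝓗] [InnerProductSpace ℂ 𝓗] [CompleteSpace 𝓗]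
  {S : System ι 𝒜 𝓗} {β κ : ℝ} (hG : S.IsGibbs) (hβ : 0 < β)
include hG hβ

/-- States below a multiple of the Gibbs state decompose into vectors of finite energy. -/
theorem exists_decomposition {N : 𝓗 →ₗ.[ℂ] 𝓗} (hκ₀ : 0 < κ) (hκ₁ : κ < 1 / 2)
    (hE : S.gibbsEnergy β N κ ≠ ⊤) {ρ : 𝓗 →L[ℂ] 𝓗} {𝔠 : ℝ} (h𝔠 : 0 ≤ 𝔠) (hρ : ρ.IsPositive)
    (hle : ρ ≤ (𝔠 : ℂ) • S.gibbsState β) :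
    ∃ (φ : ι → 𝓗) (c : ι → ℝ), (∀ m, Reg (expNegPow N κ 2) (φ m) (c m)) ∧
      (Summable fun m => c m ^ 2) ∧ ∑' m, c m ^ 2 ≤ 𝔠 * (S.gibbsEnergy β N κ).toReal ∧
      ∀ a b, HasSum (fun m => ⟪a, φ m⟫_ℂ * ⟪φ m, b⟫_ℂ) ⟪a, ρ b⟫_ℂ := by
  obtain ⟨Q, hQ⟩ := exists_sqrt_gibbs hG hβ
  obtain ⟨R, K, hRa, hRR, hRQ, hK⟩ := exists_sqrt_factor hG hβ hQ h𝔠 hρ hle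
  choose η hη using exists_expNegPow_basis hG hβ hE
  have hsum := hasSum_gibbsEnergy hG hβ hκ₀ hκ₁ hE hη
  have hn : ∀ i, ‖(Real.sqrt (S.gibbsWeight β i) : ℂ) • η i‖ ^ 2 = S.gibbsWeight β i * ‖η i‖ ^ 2 := by
    intro i
    rw [norm_smul, Complex.norm_real, Real.norm_of_nonneg (Real.sqrt_nonneg _), mul_pow,
      Real.sq_sqrt (System.gibbsWeight_pos hG hβ i).le]
  obtain ⟨Y, hY⟩ := exists_of_columns S.basis (v := fun i => (Real.sqrt (S.gibbsWeight β i) : ℂ) • η i)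
    (by simpa only [hn] using hsum.summable)
  have hDY : expNegPow N κ 2 ∘L Y = Q := by
    refine ext_of_entries (S := S) fun i j => ?_
    rw [comp_apply, hY, map_smul, hη, hQ]
  have hYs : hsNormSq S.basis Y = ENNReal.ofReal (S.gibbsEnergy β N κ).toReal :=
    hsNormSq_of_hasSum _ (by simpa only [hY, hn] using hsum)
  have hYK : hsNormSq S.basis (Y ∘L adjoint K) ≤
      ENNReal.ofReal (𝔠 * (S.gibbsEnergy β N κ).toReal) := by
    rw [← hsNormSq_adjoint, adjoint_comp, adjoint_adjoint, ENNReal.ofReal_mul h𝔠, ← hYs,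
      ← hsNormSq_adjoint _ Y]
    exact hsNormSq_comp_le _ _ _ hK h𝔠
  obtain ⟨h1, h2⟩ := summable_of_hsNormSq_le S.basis (by positivity) hYK
  refine ⟨fun m => R (S.basis m), fun m => ‖(Y ∘L adjoint K) (S.basis m)‖, fun m => ?_, h1, h2,
    fun a b => ?_⟩
  · refine ⟨_, ?_, le_rfl⟩
    rw [hRQ, ← hDY]; rfl
  · have := S.basis.hasSum_inner_mul_inner (R a) (R b)
    rw [← adjoint_inner_right, hRa, ← comp_apply, hRR] at this
    refine this.congr_fun fun m => ?_
    rw [← adjoint_inner_right R a, ← adjoint_inner_right R _ b, hRa]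

/-- The Hilbert-Schmidt operator `σ_β^{-1/4} ρ σ_β^{-1/4}`. -/
def rootDensity (S : System ι 𝒜 𝓗) (β : ℝ) (ρ : 𝓗 →L[ℂ] 𝓗) : lp (fun _ : ι × ι => ℂ) 2 :=
  System.toHS fun p => ((rootWeight S β p)⁻¹ : ℂ) * ⟪S.basis p.1, ρ (S.basis p.2)⟫_ℂ

lemma rootDensity_spec {ρ : 𝓗 →L[ℂ] 𝓗} {𝔠 : ℝ} (h𝔠 : 0 ≤ 𝔠) (hρ : S.IsState ρ)
    (hle : ρ ≤ (𝔠 : ℂ) • S.gibbsState β) :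
    hsOp S β (rootDensity S β ρ) = ρ ∧ ‖rootDensity S β ρ‖ ^ 2 ≤ 𝔠 := by
  obtain ⟨Q, hQ⟩ := exists_sqrt_gibbs hG hβ
  obtain ⟨R, K, hRa, hRR, hRQ, hK⟩ := exists_sqrt_factor hG hβ hQ h𝔠 hρ.1 hle
  have hQa := adjoint_sqrt hG hβ hQ
  have hRs : hsNormSq S.basis R = ENNReal.ofReal 1 := by
    refine hsNormSq_of_hasSum _ ?_
    have := Complex.hasSum_re hρ.2
    rw [Complex.one_re] at this
    refine this.congr_fun fun m => ?_
    rw [← hRR, comp_apply, ← adjoint_inner_left, hRa, inner_self_eq_norm_sq_to_K]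
    simp [← Complex.ofReal_pow]
  have hKR : hsNormSq S.basis (adjoint K ∘L R) ≤ ENNReal.ofReal 𝔠 := by
    refine (hsNormSq_comp_le S.basis (adjoint K) R (norm_adjoint_sq_le h𝔠 hK) h𝔠).trans ?_
    rw [hRs, ENNReal.ofReal_one, mul_one]
  obtain ⟨h1, h2⟩ := summable_of_hsNormSq_le S.basis h𝔠 hKR
  set X := adjoint K ∘L R with hX
  have hX2 : HasSum (fun p : ι × ι => ‖⟪S.basis p.1, X (S.basis p.2)⟫_ℂ‖ ^ 2)
      (∑' m, ‖X (S.basis m)‖ ^ 2) :=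
    hasSum_entries_sq S.basis h1
  have hentry : ∀ i j, ⟪S.basis i, ρ (S.basis j)⟫_ℂ =
      (Real.sqrt (S.gibbsWeight β i) : ℂ) * ⟪S.basis i, X (S.basis j)⟫_ℂ := by
    intro i j
    have : ρ = Q ∘L X := by
      rw [hX, ← ContinuousLinearMap.comp_assoc, ← hRQ, hRR]
    rw [this, comp_apply, ← adjoint_inner_left, hQa, hQ, inner_smul_left, Complex.conj_ofReal]
  have hsym : ∀ i j, ‖⟪S.basis i, ρ (S.basis j)⟫_ℂ‖ = ‖⟪S.basis j, ρ (S.basis i)⟫_ℂ‖ := by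
    intro i j
    rw [← hρ.1.isSelfAdjoint.adjoint_eq, adjoint_inner_right, norm_inner_symm,
      hρ.1.isSelfAdjoint.adjoint_eq]
  have hbd : ∀ p : ι × ι, ‖((rootWeight S β p)⁻¹ : ℂ) * ⟪S.basis p.1, ρ (S.basis p.2)⟫_ℂ‖ ^ 2 ≤
      2⁻¹ * (‖⟪S.basis p.1, X (S.basis p.2)⟫_ℂ‖ ^ 2 + ‖⟪S.basis p.2, X (S.basis p.1)⟫_ℂ‖ ^ 2) := by
    intro p
    set x := ‖⟪S.basis p.1, X (S.basis p.2)⟫_ℂ‖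
    set y := ‖⟪S.basis p.2, X (S.basis p.1)⟫_ℂ‖
    have e1 : ‖⟪S.basis p.1, ρ (S.basis p.2)⟫_ℂ‖ = Real.sqrt (S.gibbsWeight β p.1) * x := by
      rw [hentry, norm_mul, Complex.norm_real, Real.norm_of_nonneg (Real.sqrt_nonneg _)]
    have e2 : ‖⟪S.basis p.1, ρ (S.basis p.2)⟫_ℂ‖ = Real.sqrt (S.gibbsWeight β p.2) * y := by
      rw [hsym, hentry, norm_mul, Complex.norm_real, Real.norm_of_nonneg (Real.sqrt_nonneg _)]
    have hw := rootWeight_pos hG hβ p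
    have e3 : ‖((rootWeight S β p)⁻¹ : ℂ) * ⟪S.basis p.1, ρ (S.basis p.2)⟫_ℂ‖ ^ 2 = x * y := by
      rw [norm_mul, norm_inv, Complex.norm_real, Real.norm_of_nonneg hw.le, mul_pow, inv_pow,
        rootWeight_sq hG hβ, sq ‖⟪S.basis p.1, ρ (S.basis p.2)⟫_ℂ‖]
      nth_rw 1 [e1]
      rw [e2]
      have q1 := (Real.sqrt_pos.2 (System.gibbsWeight_pos hG hβ p.1)).ne'
      have q2 := (Real.sqrt_pos.2 (System.gibbsWeight_pos hG hβ p.2)).ne'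
      field_simp
    rw [e3]
    nlinarith [sq_nonneg (x - y)]
  have hX2' := (Equiv.prodComm ι ι).hasSum_iff.2 hX2
  have hmaj := (hX2.add hX2').mul_left 2⁻¹
  have hsq : Summable fun p : ι × ι =>
      ‖((rootWeight S β p)⁻¹ : ℂ) * ⟪S.basis p.1, ρ (S.basis p.2)⟫_ℂ‖ ^ 2 :=
    Summable.of_nonneg_of_le (fun _ => sq_nonneg _) hbd hmaj.summable
  have hmem : Memℓp (fun p : ι × ι => ((rootWeight S β p)⁻¹ : ℂ) *
      ⟪S.basis p.1, ρ (S.basis p.2)⟫_ℂ) 2 := (memℓp_two_iff _).2 hsq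
  have happ := toHS_apply hmem
  constructor
  · refine ext_of_entries (S := S) fun i j => ?_
    have hw : (rootWeight S β (i, j) : ℂ) ≠ 0 := by exact_mod_cast (rootWeight_pos hG hβ _).ne'
    rw [inner_basis_hsOp hG hβ, rootDensity, happ, mul_inv_cancel_left₀ hw]
  · have h3 := hasSum_norm_sq_lp (rootDensity S β ρ)
    simp only [rootDensity, happ] at h3
    have h4 := hasSum_le hbd h3 hmaj
    rw [rootDensity]
    linarith

end RootDensity

section Functionals
open Filter Topology MeasureTheory ContinuousLinearMap

variable {ι 𝒜 𝓗 : Type*} [NormedAddCommGroup 𝓗] [InnerProductSpace ℂ 𝓗] [CompleteSpace 𝓗]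

/-- The functional `Z ↦ ∑ m, ⟨φ m, Z φ m⟩`. -/
lemma exists_functional {φ : ι → 𝓗} {c : ι → ℝ} {ρ : 𝓗 →L[ℂ] 𝓗} {s : ℝ}
    (hφ : ∀ a b, HasSum (fun m => ⟪a, φ m⟫_ℂ * ⟪φ m, b⟫_ℂ) ⟪a, ρ b⟫_ℂ)
    (hc : ∀ m, ‖φ m‖ ≤ c m) (hsum : Summable fun m => c m ^ 2) (hle : ∑' m, c m ^ 2 ≤ s) :
    ∃ ω : (𝓗 →L[ℂ] 𝓗) →L[ℂ] ℂ, ‖ω‖ ≤ s ∧ Represents ω ρ ∧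
      ∀ Z, HasSum (fun m => ⟪φ m, Z (φ m)⟫_ℂ) (ω Z) := by
  have hb : ∀ (Z : 𝓗 →L[ℂ] 𝓗) m, ‖⟪φ m, Z (φ m)⟫_ℂ‖ ≤ ‖Z‖ * c m ^ 2 := fun Z m => by
    refine (norm_inner_map_le Z _ _).trans ?_
    rw [← sq]
    gcongr
    exact hc m
  have hs : ∀ Z : 𝓗 →L[ℂ] 𝓗, Summable fun m => ⟪φ m, Z (φ m)⟫_ℂ := fun Z =>
    Summable.of_norm_bounded (hsum.mul_left ‖Z‖) (hb Z)
  have hs0 : 0 ≤ s := (tsum_nonneg fun m => sq_nonneg (c m)).trans hle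
  let ω : (𝓗 →L[ℂ] 𝓗) →L[ℂ] ℂ := LinearMap.mkContinuous (σ := RingHom.id ℂ)
    { toFun := fun Z => ∑' m, ⟪φ m, Z (φ m)⟫_ℂ
      map_add' := fun Z Z' => by
        rw [← (hs Z).tsum_add (hs Z')]; simp only [add_apply, inner_add_right]
      map_smul' := fun c Z => by
        rw [RingHom.id_apply, smul_eq_mul, ← tsum_mul_left]
        simp only [smul_apply, inner_smul_right] } s fun Z => by
    have h1 := (hs Z).hasSum.norm_le_of_bounded (hsum.hasSum.mul_left ‖Z‖) (hb Z)
    refine h1.trans ?_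
    rw [mul_comm]
    gcongr
  have hω : ∀ Z, HasSum (fun m => ⟪φ m, Z (φ m)⟫_ℂ) (ω Z) := fun Z => (hs Z).hasSum
  refine ⟨ω, LinearMap.mkContinuous_norm_le _ hs0 _, fun a b => ?_, hω⟩
  refine (hφ a b).unique ((hω _).congr_fun fun m => ?_)
  rw [InnerProductSpace.rankOne_apply, inner_smul_right]

/-- The implicit Euler step and the exponential agree to first order. -/
lemma tendsto_mul_norm_euler {X : Type*} [NormedRing X] [NormedAlgebra ℂ X] [CompleteSpace X]
    (D : X) {t : ℝ} (ht : 0 < t) :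
    Tendsto (fun n : ℕ => (n : ℝ) * ‖1 - (1 - ((t / n : ℝ) : ℂ) • D) *
      NormedSpace.exp (((t / n : ℝ) : ℂ) • D)‖) atTop (𝓝 0) := by
  let _ : NormedAlgebra ℚ X := NormedAlgebra.restrictScalars ℚ ℂ X
  have h1 : HasDerivAt (fun z : ℂ => (1 - z • D) * NormedSpace.exp (z • D)) 0 0 := by
    have a1 : HasDerivAt (fun z : ℂ => 1 - z • D) (-((1 : ℂ) • D)) 0 :=
      ((hasDerivAt_id (0 : ℂ)).smul_const D).const_sub 1
    have a2 := hasDerivAt_exp_smul_const (𝕂 := ℂ) D (0 : ℂ)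
    refine (a1.mul a2).congr_deriv ?_
    simp
  have h2 := h1.tendsto_slope_zero
  simp only [zero_add, zero_smul, sub_zero, NormedSpace.exp_zero, mul_one] at h2
  have h3 : Tendsto (fun n : ℕ => ((t / n : ℝ) : ℂ)) atTop (𝓝[≠] 0) := by
    refine tendsto_nhdsWithin_iff.2 ⟨?_, ?_⟩
    · have := tendsto_const_div_atTop_nhds_zero_nat t
      exact (Complex.continuous_ofReal.tendsto 0).comp this
    · filter_upwards [eventually_gt_atTop 0] with n hn
      have : t / n ≠ 0 := by positivity
      exact Complex.ofReal_ne_zero.2 this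
  have h4 := ((h2.comp h3).norm).const_mul t
  rw [norm_zero, mul_zero] at h4
  refine h4.congr' ?_
  filter_upwards [eventually_gt_atTop 0] with n hn
  have hn' : (0 : ℝ) < n := by exact_mod_cast hn
  rw [Function.comp_apply, norm_smul, norm_inv, Complex.norm_real, Real.norm_of_nonneg (by positivity),
    ← mul_assoc, norm_sub_rev]
  congr 1
  field_simp

end Functionals

section Step
open Filter Topology MeasureTheory ContinuousLinearMap

variable {ι 𝒜 𝓗 : Type*} [NormedAddCommGroup 𝓗] [InnerProductSpace ℂ 𝓗] [CompleteSpace 𝓗]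
  [Fintype 𝒜] {S : System ι 𝒜 𝓗} {T : Truncation 𝒜 𝓗}

/-- The generator in the Heisenberg picture for bare jumps `B`. -/
def heisGen (σ : ℝ) (U : UnitaryFlow 𝓗) {f g : ℝ → ℂ} (hf : Integrable f) (hg : Integrable g)
    (B : 𝒜 → 𝓗 →L[ℂ] 𝓗) : (𝓗 →L[ℂ] 𝓗) →L[ℂ] (𝓗 →L[ℂ] 𝓗) :=
  dualGen σ U (driftOp U g hg fun α => twirl U f hf (B α)) fun α => twirl U f hf (B α)

/-- The error rate of the truncation. -/
def truncError (κ r σ C_A : ℝ) (f g : ℝ → ℂ) (q q' : ℕ → ℝ) (p : ℕ → ℕ → ℝ) (n M : ℕ) : ℝ :=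
  n * genConst (growthFun r κ) σ f g *
    ((|C_A| + leakage κ q M) * leakage κ q M + |q' M| ^ 2 * leakage κ (p n) M)

variable {τ : Equiv.Perm 𝒜} {κ r C_A β σ : ℝ} {q q' : ℕ → ℝ} {p : ℕ → ℕ → ℝ}

lemma truncError_nonneg (hσ : 0 < σ) (f g : ℝ → ℂ) (n M : ℕ) :
    0 ≤ truncError κ r σ C_A f g q q' p n M := by
  have h1 := genConst_nonneg (γ := growthFun r κ) hσ f g
  have h2 := leakage_nonneg κ q M
  have h3 := leakage_nonneg κ (p n) M
  unfold truncError
  positivity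

variable
  (hG : S.IsGibbs) (hA : S.JumpCondition τ) (hT : TruncationCondition S T τ κ r C_A q q' p)
  (hr : 0 ≤ r) (hκ₀ : 0 < κ) (hκ₁ : κ < 1 / 2) (hβ : 0 < β) (hσ : 0 < σ)
  (hE : S.gibbsEnergy β T.N κ ≠ ⊤) {f : 𝓢(ℝ, ℂ)} (hf : IsKernel (growthFun r κ) f)
  (hg : IsKernel (growthFun r κ) (driftKernel β σ)) (hq : PolyBounded q)
include hG hA hT hr hκ₀ hκ₁ hβ hσ hE hf hg hq

/-- One step of the implicit Euler scheme for the exact dynamics almost solves the scheme for the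
truncated dynamics. -/
theorem norm_euler_step_le [Nonempty ι] (hkms : IsKMSFilter β f) {M : ℕ} (hM : 1 ≤ M)
    {x y : lp (fun _ : ι × ι => ℂ) 2} {h s : ℝ} (hh : 0 < h)
    (hxy : (x, (h : ℂ)⁻¹ • (y - x)) ∈ S.negGenerator β σ f)
    {φ : ι → 𝓗} {c : ι → ℝ} (hφ : ∀ a b, HasSum (fun m => ⟪a, φ m⟫_ℂ * ⟪φ m, b⟫_ℂ) ⟪a, hsOp S β x b⟫_ℂ)
    (hreg : ∀ m, Reg (expNegPow T.N κ 2) (φ m) (c m)) (hsum : Summable fun m => c m ^ 2)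
    (hle : ∑' m, c m ^ 2 ≤ s)
    {ω ω' : (𝓗 →L[ℂ] 𝓗) →L[ℂ] ℂ} (hω : Represents ω (hsOp S β x))
    (hωφ : ∀ Z, HasSum (fun m => ⟪φ m, Z (φ m)⟫_ℂ) (ω Z))
    (hω' : Represents ω' (hsOp S β y)) {Z : 𝓗 →L[ℂ] 𝓗} (hZ : Z ∈ unitSpan S.basis) :
    ‖ω Z - ω' Z - (h : ℂ) * ω (heisGen σ (expFlow (isSelfAdjoint_truncH hG hT hM)) hf.1 hg.1
      (truncJump S T M) Z)‖ ≤
      h * (truncError κ r σ C_A f (driftKernel β σ) q q' p (Fintype.card 𝒜) M * s) * ‖Z‖ := by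
  have := countable_of_isGibbs hG
  set U := expFlow (isSelfAdjoint_truncH hG hT hM) with hU
  have hUc : Continuous fun s => U s := continuous_expFlow _
  set D := heisGen σ U hf.1 hg.1 (truncJump S T M) with hD
  have hw₁ := isWeight_expNegPow_one hG hβ hκ₀ hκ₁ hE
  have hw₂ := isWeight_two hG hβ hκ₀ hκ₁ hE
  have hφn : ∀ m, ‖φ m‖ ≤ c m := fun m => by
    obtain ⟨η, h1, h2⟩ := hreg m
    rw [← h1]; exact (hw₂.norm_apply_le η).trans h2
  have hsφ : Summable fun m => ‖φ m‖ ^ 2 :=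
    Summable.of_nonneg_of_le (fun m => sq_nonneg _)
      (fun m => pow_le_pow_left₀ (norm_nonneg _) (hφn m) 2) hsum
  set F := fun (M' : ℕ) (Z : 𝓗 →L[ℂ] 𝓗) (m : ι) =>
    pureGen σ S.flow (flowDrift S T hf.1 hg.1 M') (flowJump S T hf.1 M') Z (φ m) with hF
  have hlim : ∀ Z ∈ Submodule.span ℂ (Set.range fun p : ι × ι =>
      InnerProductSpace.rankOne ℂ (S.basis p.1) (S.basis p.2)), ∃ v : ℕ → ℂ,
      (∀ M', HasSum (F M' Z) (v M')) ∧ Tendsto v atTop (𝓝 ((h : ℂ)⁻¹ * (ω Z - ω' Z))) := by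
    intro Z hZ
    induction hZ using Submodule.span_induction with
    | mem Z hZ =>
      obtain ⟨⟨j, i⟩, rfl⟩ := hZ
      refine ⟨_, fun M' => hasSum_pureGen hσ S.flow _ _ (S.basis i) (S.basis j) hφ hsφ, ?_⟩
      have h1 := tendsto_matGen_hsOp hG hA hT hr hκ₀ hκ₁ hβ hσ hE hf hq hg hkms hxy (i, j)
      convert h1 using 2
      simp only
      rw [← hω, ← hω', inner_basis_hsOp hG hβ, inner_basis_hsOp hG hβ, lp.coeFn_smul, lp.coeFn_sub,
        Pi.smul_apply, Pi.sub_apply, smul_eq_mul]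
      ring
    | zero =>
      refine ⟨fun _ => 0, fun M' => ?_, ?_⟩
      · simp only [hF]
        refine hasSum_zero.congr_fun fun m => ?_
        simp [pureGen]
      · simp
    | add Z Z' _ _ h1 h2 =>
      obtain ⟨v, hv, hv'⟩ := h1
      obtain ⟨w, hw, hw'⟩ := h2
      refine ⟨fun n => v n + w n, fun M' => ((hv M').add (hw M')).congr_fun fun m =>
        pureGen_add hσ _ _ _ _ _ _, ?_⟩
      convert hv'.add hw' using 2
      rw [map_add, map_add]; ring
    | smul a Z _ h1 =>
      obtain ⟨v, hv, hv'⟩ := h1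
      refine ⟨fun n => a * v n, fun M' => ((hv M').mul_left a).congr_fun fun m =>
        pureGen_smul _ _ _ _ _ _, ?_⟩
      convert hv'.const_mul a using 2
      rw [map_smul, map_smul, smul_eq_mul, smul_eq_mul]; ring
  have hs0 : 0 ≤ s := (tsum_nonneg fun m => sq_nonneg (c m)).trans hle
  set lk := leakage κ q
  set π := leakage κ (p (Fintype.card 𝒜)) M
  set e : ℕ → ℝ := fun M' => Fintype.card 𝒜 * genConst (growthFun r κ) σ f (driftKernel β σ) *
        ((|C_A| + lk M + lk M') * (lk M + lk M') + |q' M| ^ 2 * π) with he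
  have helim : Tendsto e atTop (𝓝 (truncError κ r σ C_A f (driftKernel β σ) q q' p
      (Fintype.card 𝒜) M)) := by
    have h0 := tendsto_leakage hκ₀ hq
    have h1 := ((((h0.const_add (|C_A| + lk M)).mul (h0.const_add (lk M))).add_const
      (|q' M| ^ 2 * π)).const_mul
      (Fintype.card 𝒜 * genConst (growthFun r κ) σ f (driftKernel β σ)))
    simp only [add_zero] at h1
    exact h1
  have hspan : ∀ Z ∈ Submodule.span ℂ (Set.range fun p : ι × ι =>
      InnerProductSpace.rankOne ℂ (S.basis p.1) (S.basis p.2)),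
      ‖(h : ℂ)⁻¹ * (ω Z - ω' Z) - ω (D Z)‖ ≤ truncError κ r σ C_A f (driftKernel β σ) q q' p
      (Fintype.card 𝒜) M * s * ‖Z‖ := by
    intro Z hZ
    obtain ⟨v, hv, hv'⟩ := hlim Z hZ
    refine le_of_tendsto_of_tendsto (hv'.sub_const (ω (D Z))).norm
      ((helim.mul_const s).mul_const ‖Z‖) ?_
    filter_upwards [eventually_ge_atTop 1] with M' hM'
    have h1 := (hv M').sub (hωφ (D Z))
    have he0 : 0 ≤ e M' := by
      have := genConst_nonneg (γ := growthFun r κ) hσ f (driftKernel β σ)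
      have := leakage_nonneg κ q M
      have := leakage_nonneg κ q M'
      have := leakage_nonneg κ (p (Fintype.card 𝒜)) M
      simp only [he]
      positivity
    have h2 : ∀ m, ‖F M' Z m - ⟪φ m, D Z (φ m)⟫_ℂ‖ ≤ e M' * ‖Z‖ * c m ^ 2 := by
      intro m
      rw [hD, heisGen, ← pureGen_eq_inner_dualGen hUc hσ]
      refine (norm_pureGen_trunc_sub_le hG hA hT hr hκ₀ hκ₁ hβ hE hf hg hσ hM hM' (hreg m) Z).trans
        (le_of_eq ?_)
      simp only [he]
      ring
    refine (h1.norm_le_of_bounded (hsum.hasSum.mul_left _) h2).trans ?_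
    calc e M' * ‖Z‖ * ∑' m, c m ^ 2 ≤ e M' * ‖Z‖ * s := by gcongr
      _ = _ := by ring
  have hcl : IsClosed {Z : 𝓗 →L[ℂ] 𝓗 | ‖(h : ℂ)⁻¹ * (ω Z - ω' Z) - ω (D Z)‖ ≤
      truncError κ r σ C_A f (driftKernel β σ) q q' p (Fintype.card 𝒜) M * s * ‖Z‖} :=
    isClosed_le (by fun_prop) (by fun_prop)
  have hall := closure_minimal hspan hcl (by
    rw [unitSpan, ← SetLike.mem_coe, Submodule.topologicalClosure_coe] at hZ; exact hZ)
  have hh' : (h : ℂ) ≠ 0 := by exact_mod_cast hh.ne'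
  have e2 : ω Z - ω' Z - (h : ℂ) * ω (D Z) = (h : ℂ) * ((h : ℂ)⁻¹ * (ω Z - ω' Z) - ω (D Z)) := by
    field_simp
  rw [e2, norm_mul, Complex.norm_real, Real.norm_of_nonneg hh.le, mul_assoc]
  exact mul_le_mul_of_nonneg_left hall hh.le

end Step

section TraceBound
open Filter Topology MeasureTheory ContinuousLinearMap

variable {ι 𝒜 𝓗 : Type*} [NormedAddCommGroup 𝓗] [InnerProductSpace ℂ 𝓗] [CompleteSpace 𝓗]
  {S : System ι 𝒜 𝓗} {β : ℝ} (hG : S.IsGibbs) (hβ : 0 < β)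

include hG hβ

lemma norm_sum_inner_hsOp_le [Nonempty ι] (z : lp (fun _ : ι × ι => ℂ) 2) {n : ℕ}
    (e f : Fin n → 𝓗) (u : Fin n → ℂ)
    (hV : ‖∑ i, u i • InnerProductSpace.rankOne ℂ (f i) (e i)‖ ≤ 1) :
    ‖∑ i, u i * ⟪e i, hsOp S β z (f i)⟫_ℂ‖ ≤ ‖z‖ := by
  rcases eq_or_ne z 0 with rfl | hz
  · have : hsOp S β 0 = 0 := by
      have := hsOp_smul hG hβ 0 (0 : lp (fun _ : ι × ι => ℂ) 2)
      rwa [zero_smul, zero_smul] at this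
    simp [this]
  set V := ∑ i, u i • InnerProductSpace.rankOne ℂ (f i) (e i) with hVdef
  have hz0 : 0 < ‖z‖ := norm_pos_iff.2 hz
  obtain ⟨Q, hQ⟩ := exists_sqrt_gibbs hG hβ
  have hσ1 := System.hasSum_gibbsWeight hG hβ
  have hcol : ∀ B : 𝓗 →L[ℂ] 𝓗, ‖B‖ ≤ 1 → ∃ s ≤ 1, HasSum (fun p : ι × ι =>
      ‖⟪S.basis p.1, (B ∘L Q) (S.basis p.2)⟫_ℂ‖ ^ 2) s := by
    intro B hB
    have h1 : ∀ m, ‖(B ∘L Q) (S.basis m)‖ ^ 2 ≤ S.gibbsWeight β m := fun m => by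
      rw [comp_apply, hQ, map_smul, norm_smul, Complex.norm_real,
        Real.norm_of_nonneg (Real.sqrt_nonneg _), mul_pow,
        Real.sq_sqrt (System.gibbsWeight_pos hG hβ m).le]
      have h2 : ‖B (S.basis m)‖ ≤ 1 := by
        simpa [S.basis.orthonormal.1 m] using B.le_of_opNorm_le hB (S.basis m)
      exact mul_le_of_le_one_right (System.gibbsWeight_pos hG hβ m).le
        (pow_le_one₀ (norm_nonneg _) h2)
    have h2 : Summable fun m => ‖(B ∘L Q) (S.basis m)‖ ^ 2 :=
      Summable.of_nonneg_of_le (fun m => sq_nonneg _) h1 hσ1.summable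
    exact ⟨_, hasSum_le h1 h2.hasSum hσ1, hasSum_entries_sq S.basis h2⟩
  obtain ⟨s₁, hs₁, h1⟩ := hcol V hV
  obtain ⟨s₂, hs₂, h2⟩ := hcol (adjoint V) ((LinearIsometryEquiv.norm_map _ V).trans_le hV)
  have h1' := (Equiv.prodComm ι ι).hasSum_iff.2 h1
  have hmain : HasSum (fun p => ((rootWeight S β p : ℂ) * z p) * ⟪S.basis p.2, V (S.basis p.1)⟫_ℂ)
      (∑ i, u i * ⟪e i, hsOp S β z (f i)⟫_ℂ) := by
    have a1 : ∀ i, HasSum (fun p => u i * ⟪e i, (((rootWeight S β p : ℂ) * z p) •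
        InnerProductSpace.rankOne ℂ (S.basis p.1) (S.basis p.2)) (f i)⟫_ℂ)
        (u i * ⟪e i, hsOp S β z (f i)⟫_ℂ) := fun i =>
      (((innerSL ℂ (e i)).comp (ContinuousLinearMap.apply ℂ 𝓗 (f i))).hasSum
        (hasSum_hsOp hG hβ z)).mul_left (u i)
    refine (hasSum_sum fun i _ => a1 i).congr_fun fun p => ?_
    rw [hVdef, sum_apply, inner_sum, Finset.mul_sum]
    refine Finset.sum_congr rfl fun i _ => ?_
    simp only [smul_apply, InnerProductSpace.rankOne_apply, inner_smul_right]
    ring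
  have hmaj := ((hasSum_norm_sq_lp z).div_const ‖z‖).add ((h1'.add h2).mul_left (‖z‖ / 2))
  have hb := hmain.norm_le_of_bounded (hmaj.mul_left 2⁻¹) fun p => ?_
  · refine hb.trans ?_
    rw [sq, mul_div_cancel_right₀ _ hz0.ne']
    nlinarith
  · set a := ‖z p‖
    set v := ‖⟪S.basis p.2, V (S.basis p.1)⟫_ℂ‖
    have hw := rootWeight_pos hG hβ p
    have e1 : ‖⟪S.basis p.2, (V ∘L Q) (S.basis p.1)⟫_ℂ‖ = Real.sqrt (S.gibbsWeight β p.1) * v := by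
      rw [comp_apply, hQ, map_smul, inner_smul_right, norm_mul, Complex.norm_real,
        Real.norm_of_nonneg (Real.sqrt_nonneg _)]
    have e2 : ‖⟪S.basis p.1, (adjoint V ∘L Q) (S.basis p.2)⟫_ℂ‖ =
        Real.sqrt (S.gibbsWeight β p.2) * v := by
      rw [comp_apply, hQ, map_smul, inner_smul_right, norm_mul, Complex.norm_real,
        Real.norm_of_nonneg (Real.sqrt_nonneg _), adjoint_inner_right, norm_inner_symm]
    simp only [Function.comp_apply, Equiv.prodComm_apply, Prod.fst_swap, Prod.snd_swap]
    rw [e1, e2, norm_mul, norm_mul, Complex.norm_real, Real.norm_of_nonneg hw.le]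
    have e3 := rootWeight_sq hG hβ p
    generalize Real.sqrt (S.gibbsWeight β p.1) = x at *
    generalize Real.sqrt (S.gibbsWeight β p.2) = y at *
    generalize rootWeight S β p = w at *
    have hb0 : 0 < ‖z‖ := hz0
    generalize ‖z‖ = Z at *
    have e4 : a ^ 2 / Z + Z / 2 * ((x * v) ^ 2 + (y * v) ^ 2) - 2 * (w * a * v) =
        (a - Z * (w * v)) ^ 2 / Z + Z / 2 * (v * (x - y)) ^ 2 := by
      field_simp
      linear_combination (-2 * Z ^ 2 * v ^ 2) * e3
    have e5 : 0 ≤ (a - Z * (w * v)) ^ 2 / Z + Z / 2 * (v * (x - y)) ^ 2 := by positivity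
    change w * a * v ≤ _
    linarith

lemma traceNorm_hsOp_le [Nonempty ι] (z : lp (fun _ : ι × ι => ℂ) 2) :
    traceNorm (hsOp S β z) ≤ ENNReal.ofReal ‖z‖ :=
  traceNorm_le_of_forall fun _ e f u hu => norm_sum_inner_hsOp_le hG hβ z e f u hu

end TraceBound

section TraceNormComparison
open Filter Topology MeasureTheory ContinuousLinearMap

variable {ι 𝒜 𝓗 : Type*} [NormedAddCommGroup 𝓗] [InnerProductSpace ℂ 𝓗] [CompleteSpace 𝓗]
  [Fintype 𝒜] {S : System ι 𝒜 𝓗} {T : Truncation 𝒜 𝓗}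
variable {τ : Equiv.Perm 𝒜} {κ r C_A β σ : ℝ} {q q' : ℕ → ℝ} {p : ℕ → ℕ → ℝ}

lemma nonempty_of_isState {ρ : 𝓗 →L[ℂ] 𝓗} (h : S.IsState ρ) : Nonempty ι := by
  by_contra hne
  rw [not_nonempty_iff] at hne
  have := h.2.unique hasSum_empty
  exact one_ne_zero this

variable
  (hG : S.IsGibbs) (hA : S.JumpCondition τ) (hT : TruncationCondition S T τ κ r C_A q q' p)
  (hr : 0 ≤ r) (hκ₀ : 0 < κ) (hκ₁ : κ < 1 / 2) (hβ : 0 < β) (hσ : 0 < σ)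
  (hE : S.gibbsEnergy β T.N κ ≠ ⊤) {f : 𝓢(ℝ, ℂ)} (hf : IsKernel (growthFun r κ) f)
  (hg : IsKernel (growthFun r κ) (driftKernel β σ)) (hq : PolyBounded q)
include hG hA hT hr hκ₀ hκ₁ hβ hσ hE hf hg hq

/-- The truncated dynamics is close to the exact dynamics. -/
theorem traceNorm_dynamics_sub_le (hkms : IsKMSFilter β f) {M : ℕ} (hM : 1 ≤ M) {𝔠 : ℝ}
    (h𝔠 : 0 ≤ 𝔠) {ρ : 𝓗 →L[ℂ] 𝓗} (hρ : S.IsState ρ) (hle : ρ ≤ (𝔠 : ℂ) • S.gibbsState β) {t : ℝ}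
    (ht : 0 ≤ t) :
    traceNorm (S.exactDynamics β σ f t ρ - truncDynamics S T β σ f M t ρ) ≤
      ENNReal.ofReal (t * (truncError κ r σ C_A f (driftKernel β σ) q q' p (Fintype.card 𝒜) M *
        (𝔠 * (S.gibbsEnergy β T.N κ).toReal))) := by
  have := nonempty_of_isState hρ
  have hexact : S.exactDynamics β σ f t ρ =
    hsOp S β (expNegSemigroup (S.negGenerator β σ f) t (rootDensity S β ρ)) := rfl
  set x₀ := rootDensity S β ρ with hx₀
  have hρx : hsOp S β x₀ = ρ := (rootDensity_spec hG hβ h𝔠 hρ hle).1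
  rw [hexact, truncDynamics, lindbladian_eq_lindGen hf.1 hg.1 (isSelfAdjoint_truncH hG hT hM)]
  rcases ht.eq_or_lt with rfl | ht
  · have hz : ∀ X : (𝓗 →L[ℂ] 𝓗) →L[ℂ] (𝓗 →L[ℂ] 𝓗),
        NormedSpace.exp (((0 : ℝ) : ℂ) • X) ρ = ρ := fun X => by
      have h0 : ((0 : ℝ) : ℂ) • X = 0 := by rw [Complex.ofReal_zero]; exact zero_smul ℂ X
      rw [h0, NormedSpace.exp_zero, one_apply_eq_self]
    rw [expNegSemigroup, if_pos rfl, one_apply_eq_self, hρx, hz, sub_self]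
    exact traceNorm_le_of_forall fun n e f u _ => by simp
  set U := expFlow (isSelfAdjoint_truncH hG hT hM) with hU
  have hUc : Continuous fun s => U s := continuous_expFlow _
  set D := heisGen σ U hf.1 hg.1 (truncJump S T M) with hD
  set 𝓛 := lindGen σ U (driftOp U (driftKernel β σ) hg.1
      fun α => twirl U f hf.1 (compress (S.A α) (T.proj α M)))
      fun α => twirl U f hf.1 (compress (S.A α) (T.proj α M)) with h𝓛
  have hdual : IsDual (NormedSpace.exp ((t : ℂ) • D)) (NormedSpace.exp ((t : ℂ) • 𝓛)) :=
    ((isDual_lindGen hUc hσ _ _).smul (t : ℂ)).exp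
  set s := 𝔠 * (S.gibbsEnergy β T.N κ).toReal with hs
  set δ := truncError κ r σ C_A f (driftKernel β σ) q q' p (Fintype.card 𝒜) M with hδ
  have hs0 : 0 ≤ s := by positivity
  have hδ0 : 0 ≤ δ := truncError_nonneg hσ _ _ _ _
  obtain ⟨R, hR⟩ := System.exists_resolvents hG hA hf.1 hβ hσ hkms
  set x := expNegSemigroup (S.negGenerator β σ f) t x₀ with hx
  have hlim : Tendsto (fun n : ℕ => (R (t / n) ^ n) x₀) atTop (𝓝 x) := by
    have h1 := tendsto_resolvent_pow (K := S.negGenerator β σ f) (R := R) (fun h hh => (hR h hh).1)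
      (fun h hh => (hR h hh).2.1) (fun h hh => (hR h hh).2.2.1) (fun h hh => (hR h hh).2.2.2.1)
      (fun h hh x x' y h1 h2 => ((hR h hh).2.2.2.2.2.2 x y h1).trans
        ((hR h hh).2.2.2.2.2.2 x' y h2).symm) ht
    exact ((ContinuousLinearMap.apply ℂ _ x₀).continuous.tendsto _).comp h1
  have hPSD0 : IsPSD x₀ := (isPositive_hsOp_iff hG hβ).1 (hρx.symm ▸ hρ.1)
  have hPSD1 : IsPSD ((𝔠 : ℂ) • S.coreVec β 0 1 - x₀) := by
    rw [← isPositive_hsOp_iff hG hβ, hsOp_sub hG hβ, hsOp_smul hG hβ, ← gibbsState_eq hG hβ, hρx]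
    exact (le_def _ _).1 hle
  have hdata : ∀ h : ℝ, 0 < h → ∀ k : ℕ, ∃ (φ : ι → 𝓗) (c : ι → ℝ) (ω : (𝓗 →L[ℂ] 𝓗) →L[ℂ] ℂ),
      (∀ m, Reg (expNegPow T.N κ 2) (φ m) (c m)) ∧ (Summable fun m => c m ^ 2) ∧
      ∑' m, c m ^ 2 ≤ s ∧
      (∀ a b, HasSum (fun m => ⟪a, φ m⟫_ℂ * ⟪φ m, b⟫_ℂ) ⟪a, hsOp S β ((R h ^ k) x₀) b⟫_ℂ) ∧
      ‖ω‖ ≤ s ∧ Represents ω (hsOp S β ((R h ^ k) x₀)) ∧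
      ∀ Z, HasSum (fun m => ⟪φ m, Z (φ m)⟫_ℂ) (ω Z) := by
    intro h hh k
    obtain ⟨-, -, -, -, hpsd, hgr, -⟩ := hR h hh
    have h1 : IsPSD ((R h ^ k) x₀) ∧ IsPSD ((𝔠 : ℂ) • S.coreVec β 0 1 - (R h ^ k) x₀) := by
      induction k with
      | zero => exact ⟨hPSD0, hPSD1⟩
      | succ k ih =>
        rw [pow_succ', mul_apply_eq_comp]
        refine ⟨hpsd _ ih.1, ?_⟩
        have := hpsd _ ih.2
        rwa [map_sub, map_smul, hgr] at this
    have h2 : hsOp S β ((R h ^ k) x₀) ≤ (𝔠 : ℂ) • S.gibbsState β := by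
      rw [ContinuousLinearMap.le_def, gibbsState_eq hG hβ, ← hsOp_smul hG hβ, ← hsOp_sub hG hβ]
      exact (isPositive_hsOp_iff hG hβ).2 h1.2
    obtain ⟨φ, c, a1, a2, a3, a4⟩ := exists_decomposition hG hβ hκ₀ hκ₁ hE h𝔠
      ((isPositive_hsOp_iff hG hβ).2 h1.1) h2
    have hφn : ∀ m, ‖φ m‖ ≤ c m := fun m => by
      obtain ⟨η, h1, h2⟩ := a1 m
      rw [← h1]; exact ((isWeight_two hG hβ hκ₀ hκ₁ hE).norm_apply_le η).trans h2
    obtain ⟨ω, b1, b2, b3⟩ := exists_functional a4 hφn a2 a3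
    exact ⟨φ, c, ω, a1, a2, a3, a4, b1, b2, b3⟩
  refine traceNorm_le_of_forall fun j e f' u hu => ?_
  have hbound : ∀ n : ℕ, 0 < n → ‖∑ i, u i * ⟪e i, (hsOp S β x -
      NormedSpace.exp ((t : ℂ) • 𝓛) ρ) (f' i)⟫_ℂ‖ ≤ ‖x - (R (t / n) ^ n) x₀‖ +
        (t * (δ * s) + s * ((n : ℝ) * ‖1 - (1 - ((t / n : ℝ) : ℂ) • D) *
          NormedSpace.exp (((t / n : ℝ) : ℂ) • D)‖)) := by
    intro n hn
    have hn' : (0 : ℝ) < n := by exact_mod_cast hn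
    have hh : 0 < t / n := by positivity
    choose φ c Ω a1 a2 a3 a4 a5 a6 a7 using hdata (t / n) hh
    set h := t / n with hhdef
    set E := NormedSpace.exp ((h : ℂ) • D) with hEdef
    have hE1 : ‖E‖ ≤ 1 := norm_exp_dualGen_le_one hUc hσ hg.1 (driftKernel_add_star β hσ) _ hh.le
    have hDW : ∀ Z ∈ unitSpan S.basis, D Z ∈ unitSpan S.basis := fun Z hZ =>
      dualGen_mem_unitSpan S.basis hUc hσ _ _ hZ
    have hEW : ∀ Z ∈ unitSpan S.basis, E Z ∈ unitSpan S.basis := fun Z hZ =>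
      exp_mem_of_isClosed (isClosed_unitSpan S.basis) (fun Z hZ =>
        Submodule.smul_mem _ _ (hDW Z hZ)) hZ
    set V := ∑ i, u i • InnerProductSpace.rankOne ℂ (f' i) (e i) with hV
    have hVW : V ∈ unitSpan S.basis := sum_mem fun i _ =>
      Submodule.smul_mem _ _ (rankOne_mem_unitSpan S.basis _ _)
    have hEu := norm_euler_sub_le hE1 hEW (h := h) (δ := h * (δ * s)) (n := n) (by positivity)
      a5 (fun k _ Z hZ => norm_euler_step_le hG hA hT hr hκ₀ hκ₁ hβ hσ hE hf hg hq hkms hM hh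
        (x := (R h ^ (k + 1)) x₀) (y := (R h ^ k) x₀) (by
          rw [pow_succ', mul_apply_eq_comp]; exact (hR h hh).2.2.2.1 _)
        (a4 (k + 1)) (a1 (k + 1)) (a2 (k + 1)) (a3 (k + 1)) (a6 (k + 1)) (a7 (k + 1)) (a6 k) hZ) hVW
    have hEn : E ^ n = NormedSpace.exp ((t : ℂ) • D) := by
      let _ : NormedAlgebra ℚ ((𝓗 →L[ℂ] 𝓗) →L[ℂ] (𝓗 →L[ℂ] 𝓗)) := NormedAlgebra.restrictScalars ℚ ℂ _
      rw [hEdef, ← NormedSpace.exp_nsmul]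
      congr 1
      rw [← Nat.cast_smul_eq_nsmul ℂ, smul_smul, hhdef]
      congr 1
      have : (n : ℂ) ≠ 0 := by exact_mod_cast hn'.ne'
      push_cast
      field_simp
    have e1 : ∑ i, u i * ⟪e i, hsOp S β ((R h ^ n) x₀) (f' i)⟫_ℂ = Ω n V := (a6 n).sum_inner e f' u
    have e2 : ∑ i, u i * ⟪e i, NormedSpace.exp ((t : ℂ) • 𝓛) ρ (f' i)⟫_ℂ = Ω 0 ((E ^ n) V) := by
      have h0 : Represents (Ω 0) ρ := by
        have := a6 0
        rwa [pow_zero, one_apply_eq_self, hρx] at this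
      rw [hEn]
      exact (hdual _ _ h0).sum_inner e f' u
    have e3 : ∑ i, u i * ⟪e i, (hsOp S β x - NormedSpace.exp ((t : ℂ) • 𝓛) ρ) (f' i)⟫_ℂ =
        ∑ i, u i * ⟪e i, hsOp S β (x - (R h ^ n) x₀) (f' i)⟫_ℂ + (Ω n V - Ω 0 ((E ^ n) V)) := by
      rw [← e1, ← e2, ← Finset.sum_sub_distrib, ← Finset.sum_add_distrib]
      refine Finset.sum_congr rfl fun i _ => ?_
      rw [hsOp_sub hG hβ, sub_apply, sub_apply, inner_sub_right, inner_sub_right]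
      ring
    rw [e3]
    refine (norm_add_le _ _).trans (add_le_add (norm_sum_inner_hsOp_le hG hβ _ e f' u hu)
      (hEu.trans ?_))
    refine (mul_le_of_le_one_right (by positivity) hu).trans (le_of_eq ?_)
    have : (n : ℝ) * h = t := by rw [hhdef]; field_simp
    rw [mul_add, ← mul_assoc (n : ℝ) h, this]
    ring
  have hrhs : Tendsto (fun n : ℕ => ‖x - (R (t / n) ^ n) x₀‖ +
        (t * (δ * s) + s * ((n : ℝ) * ‖1 - (1 - ((t / n : ℝ) : ℂ) • D) *
          NormedSpace.exp (((t / n : ℝ) : ℂ) • D)‖))) atTop (𝓝 (0 + (t * (δ * s) + s * 0))) := by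
    refine Tendsto.add ?_ (((tendsto_mul_norm_euler D ht).const_mul s).const_add _)
    have := (hlim.const_sub x).norm
    rwa [sub_self, norm_zero] at this
  rw [zero_add, mul_zero, add_zero] at hrhs
  exact ge_of_tendsto hrhs ((eventually_gt_atTop 0).mono hbound)

end TraceNormComparison

section SpectralGap
open Filter Topology ContinuousLinearMap

lemma traceNorm_sub_le {F : Type*} [NormedAddCommGroup F] [InnerProductSpace ℂ F]
    (A B C : F →L[ℂ] F) : traceNorm (A - B) ≤ traceNorm (C - A) + traceNorm (C - B) := by
  refine iSup_le fun n => iSup_le fun e => iSup_le fun f => iSup_le fun he => iSup_le fun hf => ?_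
  have h : ∀ D : F →L[ℂ] F, ∑ i, ENNReal.ofReal ‖⟪e i, D (f i)⟫_ℂ‖ ≤ traceNorm D := fun D =>
    le_iSup_of_le n (le_iSup_of_le e (le_iSup_of_le f (le_iSup_of_le he (le_iSup_of_le hf le_rfl))))
  refine le_trans ?_ (add_le_add (h (C - A)) (h (C - B)))
  rw [← Finset.sum_add_distrib]
  refine Finset.sum_le_sum fun i _ => ?_
  rw [← ENNReal.ofReal_add (norm_nonneg _) (norm_nonneg _)]
  refine ENNReal.ofReal_le_ofReal ?_
  have : ⟪e i, (A - B) (f i)⟫_ℂ = ⟪e i, (C - B) (f i)⟫_ℂ - ⟪e i, (C - A) (f i)⟫_ℂ := by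
    simp only [sub_apply, inner_sub_right]; ring
  rw [this, add_comm]
  exact norm_sub_le _ _

variable {ι 𝒜 𝓗 : Type*} [NormedAddCommGroup 𝓗] [InnerProductSpace ℂ 𝓗] [CompleteSpace 𝓗]
  [Fintype 𝒜] {S : System ι 𝒜 𝓗} {τ : Equiv.Perm 𝒜} {κ β σ : ℝ}
  (hG : S.IsGibbs) (hβ : 0 < β)
include hG hβ

lemma hasSum_inner_ground (x : lp (fun _ : ι × ι => ℂ) 2) :
    HasSum (fun i => (Real.sqrt (S.gibbsWeight β i) : ℂ) * x (i, i)) ⟪S.coreVec β 0 1, x⟫_ℂ := by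
  have h := lp.hasSum_inner (𝕜 := ℂ) (S.coreVec β 0 1) x
  have hinj : Function.Injective fun i : ι => (i, i) := fun i j h => congrArg Prod.fst h
  refine ((hinj.hasSum_iff fun p hp => ?_).2 h).congr_fun fun i => ?_
  · have hne : p.1 ≠ p.2 := fun h' => hp ⟨p.1, Prod.ext rfl h'⟩
    rw [System.coreVec_apply hG hβ, if_neg hne]
    simp
  · rw [Function.comp_apply, System.coreVec_apply hG hβ, if_pos rfl]
    simp [mul_comm]

lemma norm_ground [Nonempty ι] : ‖S.coreVec β 0 1‖ = 1 := by
  have h := hasSum_inner_ground hG hβ (S.coreVec β 0 1)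
  have h1 : HasSum (fun i => ((S.gibbsWeight β i : ℝ) : ℂ)) ((1 : ℝ) : ℂ) :=
    Complex.hasSum_ofReal.2 (System.hasSum_gibbsWeight hG hβ)
  have h2 := h.unique (h1.congr_fun fun i => by
    rw [System.coreVec_apply hG hβ, if_pos rfl, Finsupp.coe_zero, Pi.zero_apply, zero_add, one_mul,
      ← Complex.ofReal_mul, Real.mul_self_sqrt (System.gibbsWeight_pos hG hβ i).le])
  have h3 : ‖S.coreVec β 0 1‖ ^ 2 = 1 := by
    rw [← inner_self_eq_norm_sq (𝕜 := ℂ), h2]; exact Complex.one_re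
  nlinarith [norm_nonneg (S.coreVec β 0 1)]

lemma inner_ground_rootDensity {ρ : 𝓗 →L[ℂ] 𝓗} {𝔠 : ℝ} (h𝔠 : 0 ≤ 𝔠) (hρ : S.IsState ρ)
    (hle : ρ ≤ (𝔠 : ℂ) • S.gibbsState β) : ⟪S.coreVec β 0 1, rootDensity S β ρ⟫_ℂ = 1 := by
  refine (hasSum_inner_ground hG hβ _).unique (hρ.2.congr_fun fun i => ?_)
  have hw : Real.sqrt (S.gibbsWeight β i) = rootWeight S β (i, i) := by
    have := System.gibbsWeight_pos hG hβ i
    rw [← Real.sqrt_sq (rootWeight_pos hG hβ (i, i)).le, rootWeight_sq hG hβ,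
      Real.mul_self_sqrt this.le]
  conv_rhs => rw [← (rootDensity_spec hG hβ h𝔠 hρ hle).1]
  rw [inner_basis_hsOp hG hβ, hw]

variable (hA : S.JumpCondition τ) (hσ : 0 < σ) {f : 𝓢(ℝ, ℂ)}
  (hf : MeasureTheory.Integrable (f : ℝ → ℂ)) (hkms : IsKMSFilter β f)
include hA hσ hf hkms

/-- Relaxation at the rate of the spectral gap, and invariance of the ground state. -/
lemma exp_gap_mul_norm_le (hgap : 0 < S.spectralGap β σ f) {t : ℝ} (ht : 0 < t) :
    expNegSemigroup (S.negGenerator β σ f) t (S.coreVec β 0 1) = S.coreVec β 0 1 ∧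
    ∀ y, ⟪S.coreVec β 0 1, y⟫_ℂ = 0 → Real.exp (t * S.spectralGap β σ f) *
      ‖expNegSemigroup (S.negGenerator β σ f) t y‖ ≤ ‖y‖ := by
  obtain ⟨R, hR⟩ := System.exists_resolvents hG hA hf hβ hσ hkms
  set g := S.coreVec β 0 1 with hg
  set γ := S.spectralGap β σ f with hγ
  have hlim : ∀ x, Tendsto (fun n : ℕ => (R (t / n) ^ n) x) atTop
      (𝓝 (expNegSemigroup (S.negGenerator β σ f) t x)) := by
    intro x
    have h1 := tendsto_resolvent_pow (K := S.negGenerator β σ f) (R := R) (fun h hh => (hR h hh).1)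
      (fun h hh => (hR h hh).2.1) (fun h hh => (hR h hh).2.2.1) (fun h hh => (hR h hh).2.2.2.1)
      (fun h hh x x' y h1 h2 => ((hR h hh).2.2.2.2.2.2 x y h1).trans
        ((hR h hh).2.2.2.2.2.2 x' y h2).symm) ht
    exact ((ContinuousLinearMap.apply ℂ _ x).continuous.tendsto _).comp h1
  have hpos : ∀ w ∈ S.negGenerator β σ f, 0 ≤ (⟪w.1, w.2⟫_ℂ).re := by
    intro w hw
    by_contra! hneg
    set a := (⟪w.1, w.2⟫_ℂ).re with ha
    set h := -a / (‖w.2‖ ^ 2 + 1) with hh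
    have hpd : 0 < ‖w.2‖ ^ 2 + 1 := by positivity
    have h0 : 0 < h := div_pos (by linarith) hpd
    have hx : w.1 = R h (w.1 + (h : ℂ) • w.2) := by
      refine (hR h h0).2.2.2.2.2.2 _ _ ?_
      have : (h : ℂ) ≠ 0 := by exact_mod_cast h0.ne'
      rwa [add_sub_cancel_left, smul_smul, inv_mul_cancel₀ this, one_smul]
    have h1 : ‖w.1‖ ≤ ‖w.1 + (h : ℂ) • w.2‖ := by
      conv_lhs => rw [hx]
      exact ((R h).le_opNorm _).trans (mul_le_of_le_one_left (norm_nonneg _) (hR h h0).1)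
    have h2 : ‖w.1 + (h : ℂ) • w.2‖ ^ 2 = ‖w.1‖ ^ 2 + 2 * (h * a) + h ^ 2 * ‖w.2‖ ^ 2 := by
      rw [norm_add_sq (𝕜 := ℂ), inner_smul_right, norm_smul, Complex.norm_real,
        Real.norm_of_nonneg h0.le, mul_pow]
      simp [ha]
    have h3 : h * (‖w.2‖ ^ 2 + 1) = -a := by rw [hh]; field_simp
    have h4 := pow_le_pow_left₀ (norm_nonneg _) h1 2
    rw [h2] at h4
    have h5 : h ^ 2 * ‖w.2‖ ^ 2 = h * (-a) - h ^ 2 := by rw [← h3]; ring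
    have h6 : h * a < 0 := mul_neg_of_pos_of_neg h0 hneg
    nlinarith [sq_nonneg h]
  have horth : ∀ h : ℝ, 0 < h → ∀ y, ⟪g, y⟫_ℂ = 0 → ⟪g, R h y⟫_ℂ = 0 := by
    intro h hh y hy
    obtain ⟨-, hsa, -, -, -, hfix, -⟩ := hR h hh
    rw [← adjoint_inner_left, isSelfAdjoint_iff'.1 hsa, hfix, hy]
  have hstep : ∀ h : ℝ, 0 < h → ∀ y, ⟪g, y⟫_ℂ = 0 → (1 + h * γ) * ‖R h y‖ ≤ ‖y‖ := by
    intro h hh y hy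
    rcases eq_or_ne (R h y) 0 with h0 | h0
    · rw [h0, norm_zero, mul_zero]; exact norm_nonneg _
    have hn : 0 < ‖R h y‖ := norm_pos_iff.2 h0
    set c := ‖R h y‖⁻¹ with hc
    have hc0 : 0 < c := inv_pos.2 hn
    have hle : γ ≤ (⟪R h ((c : ℂ) • y),
        (h : ℂ)⁻¹ • ((c : ℂ) • y - R h ((c : ℂ) • y))⟫_ℂ).re := by
      refine csInf_le ⟨0, ?_⟩ ⟨_, (hR h hh).2.2.2.1 ((c : ℂ) • y), ?_, ?_, rfl⟩
      · rintro _ ⟨w, hw, -, -, rfl⟩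
        exact hpos w hw
      · exact horth h hh _ (by rw [inner_smul_right, hy, mul_zero])
      · rw [map_smul, norm_smul, Complex.norm_real, Real.norm_of_nonneg hc0.le,
          inv_mul_cancel₀ hn.ne']
    have e : (⟪R h ((c : ℂ) • y), (h : ℂ)⁻¹ • ((c : ℂ) • y - R h ((c : ℂ) • y))⟫_ℂ).re =
        h⁻¹ * c ^ 2 * ((⟪R h y, y⟫_ℂ).re - ‖R h y‖ ^ 2) := by
      have : ⟪R h ((c : ℂ) • y), (h : ℂ)⁻¹ • ((c : ℂ) • y - R h ((c : ℂ) • y))⟫_ℂ =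
          ((h⁻¹ * c ^ 2 : ℝ) : ℂ) * (⟪R h y, y⟫_ℂ - ⟪R h y, R h y⟫_ℂ) := by
        rw [map_smul, inner_smul_right, ← smul_sub, inner_smul_right, inner_smul_left,
          Complex.conj_ofReal, inner_sub_right]
        push_cast
        ring
      rw [this, Complex.re_ofReal_mul, Complex.sub_re, inner_self_eq_norm_sq_to_K]
      norm_cast
    have h1 : (⟪R h y, y⟫_ℂ).re ≤ ‖R h y‖ * ‖y‖ :=
      (Complex.re_le_norm _).trans (norm_inner_le_norm _ _)
    rw [e] at hle
    have h2 : γ * (h * ‖R h y‖ ^ 2) ≤ (⟪R h y, y⟫_ℂ).re - ‖R h y‖ ^ 2 := by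
      have := mul_le_mul_of_nonneg_right hle (by positivity : 0 ≤ h * ‖R h y‖ ^ 2)
      refine this.trans (le_of_eq ?_)
      rw [hc]
      field_simp
    refine le_of_mul_le_mul_right ?_ hn
    nlinarith
  have hpow : ∀ h : ℝ, 0 < h → ∀ (n : ℕ) y, ⟪g, y⟫_ℂ = 0 →
      (1 + h * γ) ^ n * ‖(R h ^ n) y‖ ≤ ‖y‖ := by
    intro h hh n
    induction n with
    | zero => intro y _; rw [pow_zero, pow_zero, one_mul, one_apply_eq_self]
    | succ n ih =>
      intro y hy
      have h1 := ih _ (horth h hh y hy)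
      have h2 := hstep h hh y hy
      rw [pow_succ (R h), mul_apply_eq_comp, pow_succ, mul_right_comm]
      have : 0 ≤ 1 + h * γ := by positivity
      nlinarith
  constructor
  · refine tendsto_nhds_unique (hlim g) (tendsto_const_nhds.congr' ?_)
    filter_upwards [eventually_gt_atTop 0] with n hn
    have hh : 0 < t / n := div_pos ht (by exact_mod_cast hn)
    have : ∀ k : ℕ, (R (t / n) ^ k) g = g := fun k => by
      induction k with
      | zero => rw [pow_zero, one_apply_eq_self]
      | succ k ih => rw [pow_succ, mul_apply_eq_comp, (hR _ hh).2.2.2.2.2.1, ih]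
    exact (this n).symm
  · intro y hy
    refine le_of_tendsto ((Real.tendsto_one_add_div_pow_exp (t * γ)).mul (hlim y).norm) ?_
    filter_upwards [eventually_gt_atTop 0] with n hn
    have := hpow (t / n) (div_pos ht (by exact_mod_cast hn)) n y hy
    rwa [div_mul_eq_mul_div] at this

/-- The exact dynamics converges to the Gibbs state. -/
theorem traceNorm_exactDynamics_sub_gibbsState_le (hgap : 0 < S.spectralGap β σ f) {𝔠 : ℝ}
    (h𝔠 : 1 ≤ 𝔠) {ρ : 𝓗 →L[ℂ] 𝓗} (hρ : S.IsState ρ) (hle : ρ ≤ (𝔠 : ℂ) • S.gibbsState β) {t : ℝ}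
    (ht : 0 < t) : traceNorm (S.exactDynamics β σ f t ρ - S.gibbsState β) ≤
      ENNReal.ofReal (Real.exp (-(t * S.spectralGap β σ f)) * (2 * 𝔠)) := by
  have := nonempty_of_isState hρ
  have hexact : S.exactDynamics β σ f t ρ =
    hsOp S β (expNegSemigroup (S.negGenerator β σ f) t (rootDensity S β ρ)) := rfl
  obtain ⟨hfix, hdec⟩ := exp_gap_mul_norm_le hG hβ hA hσ hf hkms hgap ht
  have hn := (rootDensity_spec hG hβ (by linarith) hρ hle).2
  have hin := inner_ground_rootDensity hG hβ (by linarith) hρ hle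
  have hg1 := norm_ground hG hβ
  set x₀ := rootDensity S β ρ with hx₀
  set g := S.coreVec β 0 1 with hg
  rw [hexact, gibbsState_eq hG hβ, ← hsOp_sub hG hβ]
  refine (traceNorm_hsOp_le hG hβ _).trans (ENNReal.ofReal_le_ofReal ?_)
  have h1 : ⟪g, x₀ - g⟫_ℂ = 0 := by
    rw [inner_sub_right, hin, inner_self_eq_norm_sq_to_K, hg1]; simp
  have h2 := hdec _ h1
  rw [map_sub, hfix] at h2
  have h3 : ‖x₀ - g‖ ≤ 2 * 𝔠 := by
    have := norm_sub_le x₀ g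
    nlinarith [norm_nonneg x₀]
  rw [Real.exp_neg, ← div_eq_inv_mul, le_div_iff₀' (Real.exp_pos _)]
  exact h2.trans h3

end SpectralGap

section Levels
open Filter Topology

/-- The polynomial prefactor of the error bound. -/
def errorPoly (q q' : ℕ → ℝ) (p : ℕ → ℕ → ℝ) (a M : ℕ) : ℝ :=
  a * (1 + |q M| + |q' M| + |p a M|) ^ 3

lemma errorPoly_nonneg (q q' : ℕ → ℝ) (p : ℕ → ℕ → ℝ) (a M : ℕ) : 0 ≤ errorPoly q q' p a M := by
  unfold errorPoly; positivity

lemma exists_errorPoly_le {q q' : ℕ → ℝ} {p : ℕ → ℕ → ℝ} (hq : PolyBounded q)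
    (hq' : PolyBounded q') (hp : PolyBounded₂ p) : ∃ (D : ℝ) (k : ℕ), 0 ≤ D ∧
      ∀ a M : ℕ, errorPoly q q' p a M ≤ D * a * (1 + a + M : ℝ) ^ k := by
  obtain ⟨C₁, k₁, h₁⟩ := hq
  obtain ⟨C₂, k₂, h₂⟩ := hq'
  obtain ⟨C₃, k₃, h₃⟩ := hp
  refine ⟨(1 + |C₁| + |C₂| + |C₃|) ^ 3, (k₁ + k₂ + k₃) * 3, by positivity, fun a M => ?_⟩
  set x : ℝ := 1 + a + M with hx
  have ha : (0 : ℝ) ≤ a := a.cast_nonneg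
  have hM : (0 : ℝ) ≤ M := M.cast_nonneg
  have hx1 : 1 ≤ x := by linarith
  have hb : ∀ (C : ℝ) (k : ℕ) (y z : ℝ), k ≤ k₁ + k₂ + k₃ → 0 ≤ y → y ≤ x → z ≤ C * y ^ k →
      z ≤ |C| * x ^ (k₁ + k₂ + k₃) := fun C k y z hk hy0 hy hz => by
    refine hz.trans (mul_le_mul (le_abs_self C) ?_ (by positivity) (abs_nonneg C))
    exact (pow_le_pow_left₀ hy0 hy k).trans (pow_le_pow_right₀ hx1 hk)
  have b1 := hb C₁ k₁ (1 + M) _ (by omega) (by positivity) (by linarith) (h₁ M)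
  have b2 := hb C₂ k₂ (1 + M) _ (by omega) (by positivity) (by linarith) (h₂ M)
  have b3 := hb C₃ k₃ x _ (by omega) (by positivity) le_rfl (h₃ a M)
  have b0 : 1 ≤ x ^ (k₁ + k₂ + k₃) := one_le_pow₀ hx1
  have h := pow_le_pow_left₀ (by positivity) (show 1 + |q M| + |q' M| + |p a M| ≤
    (1 + |C₁| + |C₂| + |C₃|) * x ^ (k₁ + k₂ + k₃) by linarith) 3
  rw [mul_pow, ← pow_mul] at h
  rw [errorPoly, mul_comm _ (a : ℝ), mul_assoc]
  gcongr

lemma polyBounded_errorPoly {q q' : ℕ → ℝ} {p : ℕ → ℕ → ℝ} (hq : PolyBounded q)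
    (hq' : PolyBounded q') (hp : PolyBounded₂ p) : PolyBounded₂ (errorPoly q q' p) := by
  obtain ⟨D, k, hD, h⟩ := exists_errorPoly_le hq hq' hp
  refine ⟨D, k + 1, fun a M => ?_⟩
  rw [abs_of_nonneg (errorPoly_nonneg _ _ _ _ _)]
  refine (h a M).trans ?_
  rw [pow_succ', ← mul_assoc]
  gcongr
  linarith [(M.cast_nonneg : (0 : ℝ) ≤ M)]

lemma truncError_le {κ r σ C_A : ℝ} (hσ : 0 < σ) (f g : ℝ → ℂ) (q q' : ℕ → ℝ)
    (p : ℕ → ℕ → ℝ) (a M : ℕ) : truncError κ r σ C_A f g q q' p a M ≤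
      genConst (growthFun r κ) σ f g * (|C_A| + 2) * errorPoly q q' p a M *
        Real.exp (-(M : ℝ) ^ κ) := by
  have hc := genConst_nonneg (γ := growthFun r κ) hσ f g
  set c := genConst (growthFun r κ) σ f g with hcdef
  set e := Real.exp (-(M : ℝ) ^ κ) with he
  have he0 : 0 ≤ e := (Real.exp_pos _).le
  have he1 : e ≤ 1 := Real.exp_le_one_iff.2 (neg_nonpos.2 (by positivity))
  rw [truncError, errorPoly, leakage, leakage, ← hcdef, ← he]
  have hx := abs_nonneg (q M)
  have hy := abs_nonneg (q' M)
  have hz := abs_nonneg (p a M)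
  set x := |q M|
  set y := |q' M|
  set z := |p a M|
  set w := 1 + x + y + z with hw
  have hA := abs_nonneg C_A
  have hw1 : 1 ≤ w := by linarith
  have h1 : (|C_A| + x * e) * x ≤ (|C_A| + 1) * w ^ 3 := by
    have a1 : |C_A| + x * e ≤ (|C_A| + 1) * w := by nlinarith
    have a2 : (|C_A| + x * e) * x ≤ (|C_A| + 1) * w * w :=
      mul_le_mul a1 (by linarith) hx (by positivity)
    have a3 : w ^ 2 ≤ w ^ 3 := pow_le_pow_right₀ hw1 (by norm_num)
    nlinarith
  have h2 : y ^ 2 * z ≤ w ^ 3 := by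
    rw [pow_succ w 2]
    gcongr <;> linarith
  have h3 : (|C_A| + x * e) * (x * e) + y ^ 2 * (z * e) ≤ (|C_A| + 2) * w ^ 3 * e := by
    have := mul_le_mul_of_nonneg_right (add_le_add h1 h2) he0
    linarith
  calc _ ≤ a * c * ((|C_A| + 2) * w ^ 3 * e) := by gcongr
    _ = _ := by ring

lemma exists_pow_mul_exp_half_le {κ : ℝ} (hκ₀ : 0 < κ) (k : ℕ) : ∃ B : ℝ, 0 ≤ B ∧ ∀ M : ℕ,
    (1 + M : ℝ) ^ k * Real.exp (-((M : ℝ) ^ κ / 2)) ≤ B := by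
  obtain ⟨B, hB⟩ := (tendsto_pow_mul_exp_neg_rpow hκ₀ (2 * k)).bddAbove_range
  have h : ∀ M : ℕ, ((1 + M : ℝ) ^ k * Real.exp (-((M : ℝ) ^ κ / 2))) ^ 2 ≤ B := fun M => by
    have := hB ⟨M, rfl⟩
    refine le_of_eq_of_le ?_ this
    rw [mul_pow, ← pow_mul, mul_comm k, ← Real.exp_nat_mul]
    congr 2
    push_cast
    ring
  have hB0 : 0 ≤ B := (sq_nonneg _).trans (h 0)
  refine ⟨B + 1, by positivity, fun M => ?_⟩
  nlinarith [h M, sq_nonneg ((1 + M : ℝ) ^ k * Real.exp (-((M : ℝ) ^ κ / 2)) - 1)]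

/-- The truncation level beyond which the leakage beats the polynomial prefactors. -/
lemma exists_level {κ : ℝ} (hκ₀ : 0 < κ) {D : ℝ} (hD : 0 ≤ D) (k : ℕ) :
    ∃ (K : ℝ) (m : ℕ), 0 < K ∧ ∀ (a M : ℕ) (X l : ℝ), 1 ≤ X → 0 ≤ l →
      K * Real.log (Real.exp 1 + X * a) ^ (1 / κ) * (1 + Real.log (1 + l)) ^ m ≤ M →
      1 ≤ M ∧ D * X * a * (1 + l) * (1 + a + M : ℝ) ^ k * Real.exp (-(M : ℝ) ^ κ) ≤ 1 := by
  obtain ⟨B, hB0, hB⟩ := exists_pow_mul_exp_half_le hκ₀ k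
  set c : ℝ := 2 * (D * B + k + 2) with hc
  have hc0 : 0 < c := by positivity
  refine ⟨c ^ (1 / κ), ⌈1 / κ⌉₊, by positivity, fun a M X l hX hl hM => ?_⟩
  set Λ := Real.log (Real.exp 1 + X * a) with hΛ
  set u := 1 + Real.log (1 + l) with hu
  have ha : (0 : ℝ) ≤ a := a.cast_nonneg
  have hM0 : (0 : ℝ) ≤ M := M.cast_nonneg
  have hXa : (a : ℝ) ≤ X * a := le_mul_of_one_le_left ha hX
  have hpos : 0 < Real.exp 1 + X * a := by positivity
  have heΛ : Real.exp Λ = Real.exp 1 + X * a := Real.exp_log hpos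
  have hΛ1 : 1 ≤ Λ := by
    rw [← Real.exp_le_exp, heΛ]; exact le_add_of_nonneg_right (ha.trans hXa)
  have hu1 : 1 ≤ u := le_add_of_nonneg_right (Real.log_nonneg (by linarith))
  have hlev : 0 < c ^ (1 / κ) * Λ ^ (1 / κ) * u ^ ⌈1 / κ⌉₊ := by positivity
  have hMpos : 1 ≤ M := by
    have : (0 : ℝ) < M := hlev.trans_le hM
    exact_mod_cast this
  refine ⟨hMpos, ?_⟩
  have hMκ : c * (Λ * u) ≤ (M : ℝ) ^ κ := by
    have h1 := Real.rpow_le_rpow hlev.le hM hκ₀.le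
    refine le_trans ?_ h1
    rw [Real.mul_rpow (by positivity) (by positivity), Real.mul_rpow (by positivity)
      (by positivity), ← Real.rpow_mul hc0.le, ← Real.rpow_mul (by positivity),
      one_div_mul_cancel hκ₀.ne', Real.rpow_one, Real.rpow_one, mul_assoc c Λ,
      ← Real.rpow_natCast, ← Real.rpow_mul (by positivity)]
    have h2 : u ≤ u ^ ((⌈1 / κ⌉₊ : ℝ) * κ) := by
      refine Real.self_le_rpow_of_one_le hu1 ?_
      have := mul_le_mul_of_nonneg_right (Nat.le_ceil (1 / κ)) hκ₀.le
      rwa [one_div_mul_cancel hκ₀.ne'] at this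
    exact mul_le_mul_of_nonneg_left (mul_le_mul_of_nonneg_left h2 (by linarith)) hc0.le
  have e1 : X * a ≤ Real.exp Λ := by rw [heΛ]; linarith [Real.exp_pos 1]
  have e2 : (1 + a + M : ℝ) ^ k ≤ Real.exp (k * Λ) * (1 + M : ℝ) ^ k := by
    rw [Real.exp_nat_mul, ← mul_pow]
    refine pow_le_pow_left₀ (by positivity) ?_ k
    have h3 : 1 + (a : ℝ) ≤ Real.exp Λ := by
      rw [heΛ]; linarith [Real.add_one_le_exp (1 : ℝ)]
    nlinarith
  have e3 : 1 + l ≤ Real.exp u := by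
    rw [hu, Real.exp_add, Real.exp_log (by linarith)]
    exact le_mul_of_one_le_left (by linarith) (Real.one_le_exp zero_le_one)
  have e4 : D * B ≤ Real.exp (D * B) := by linarith [Real.add_one_le_exp (D * B)]
  have e5 : Real.exp (-(M : ℝ) ^ κ) = Real.exp (-((M : ℝ) ^ κ / 2)) *
      Real.exp (-((M : ℝ) ^ κ / 2)) := by rw [← Real.exp_add]; congr 1; ring
  calc D * X * a * (1 + l) * (1 + a + M : ℝ) ^ k * Real.exp (-(M : ℝ) ^ κ)
      = D * (X * a) * (1 + l) * (1 + a + M : ℝ) ^ k * Real.exp (-(M : ℝ) ^ κ) := by ring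
    _ ≤ D * Real.exp Λ * Real.exp u * (Real.exp (k * Λ) * (1 + M : ℝ) ^ k) *
        Real.exp (-(M : ℝ) ^ κ) := by gcongr
    _ = D * ((1 + M : ℝ) ^ k * Real.exp (-((M : ℝ) ^ κ / 2))) * (Real.exp Λ * Real.exp u *
        Real.exp (k * Λ) * Real.exp (-((M : ℝ) ^ κ / 2))) := by rw [e5]; ring
    _ ≤ Real.exp (D * B) * (Real.exp Λ * Real.exp u *
        Real.exp (k * Λ) * Real.exp (-((M : ℝ) ^ κ / 2))) := by
      gcongr
      exact (mul_le_mul_of_nonneg_left (hB M) hD).trans e4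
    _ = Real.exp (D * B + (Λ + u + k * Λ - (M : ℝ) ^ κ / 2)) := by
      simp only [← Real.exp_add]; ring_nf
    _ ≤ 1 := by
      rw [Real.exp_le_one_iff]
      have hk : (0 : ℝ) ≤ k := k.cast_nonneg
      have hDB : 0 ≤ D * B := by positivity
      have h4 : Λ ≤ Λ * u := le_mul_of_one_le_right (by linarith) hu1
      have h5 : u ≤ Λ * u := le_mul_of_one_le_left (by linarith) hΛ1
      have h6 : (k : ℝ) * Λ ≤ k * (Λ * u) := by gcongr
      have h7 : D * B ≤ D * B * (Λ * u) := le_mul_of_one_le_right hDB (hΛ1.trans h4)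
      rw [hc] at hMκ
      linarith

end Levels
end GibbsSampler

end

open GibbsSampler in
theorem mainTheorem10
    (β r κ σ_E C_A : ℝ) (f : 𝓢(ℝ, ℂ))
    (hβ : 0 < β) (hr : 0 ≤ r) (hκ₀ : 0 < κ) (hκ₁ : κ < 1 / 2) (hσ_E : 0 < σ_E)
    (hf : IsKMSFilter β f)
    (hf_int : MeasureTheory.Integrable
      (fun t : ℝ => |t| * Real.exp (r * |t| ^ (2 * κ)) * ‖f t‖)) :
    ∃ C₁ K₀ : ℝ, 0 ≤ C₁ ∧ 0 < K₀ ∧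
    ∀ (q q' : ℕ → ℝ) (p : ℕ → ℕ → ℝ), PolyBounded q → PolyBounded q' → PolyBounded₂ p →
    ∃ p₄ : ℕ → ℕ → ℝ, PolyBounded₂ p₄ ∧ (∀ a M, 0 ≤ p₄ a M) ∧
    ∃ (K : ℝ) (m : ℕ), 0 < K ∧
    ∀ (𝓗 : Type*) [NormedAddCommGroup 𝓗] [InnerProductSpace ℂ 𝓗] [CompleteSpace 𝓗]
      (ι 𝒜 : Type*) [Fintype 𝒜] (S : System ι 𝒜 𝓗) (T : Truncation 𝒜 𝓗) (τ : Equiv.Perm 𝒜),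
      S.IsGibbs → S.JumpCondition τ → TruncationCondition S T τ κ r C_A q q' p →
      S.gibbsEnergy β T.N κ ≠ ⊤ →
    ∀ (𝔠 : ℝ) (ρ : 𝓗 →L[ℂ] 𝓗), 1 ≤ 𝔠 → S.IsState ρ → ρ ≤ (𝔠 : ℂ) • S.gibbsState β →
      -- the error bound
      (∀ (t : ℝ) (M : ℕ), 0 ≤ t → 1 ≤ M →
        traceNorm (S.exactDynamics β σ_E f t ρ - truncDynamics S T β σ_E f M t ρ) ≤
          ENNReal.ofReal (t * C₁ * 𝔠 * p₄ (Fintype.card 𝒜) M *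
            (S.gibbsEnergy β T.N κ).toReal * Real.exp (-(M : ℝ) ^ κ))) ∧
      -- the sufficient truncation level
      (∀ (t ε : ℝ) (M : ℕ), 0 ≤ t → 0 < ε →
        let Λ : ℝ := Real.log (Real.exp 1 +
          (1 + t * 𝔠 * (S.gibbsEnergy β T.N κ).toReal / ε) * Fintype.card 𝒜)
        K * Λ ^ (1 / κ) * (1 + Real.log Λ) ^ m ≤ M →
        traceNorm (S.exactDynamics β σ_E f t ρ - truncDynamics S T β σ_E f M t ρ) ≤
          ENNReal.ofReal ε) ∧
      -- preparation of the Gibbs state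
      (0 < S.spectralGap β σ_E f → ∀ (ε : ℝ) (M : ℕ), 0 < ε →
        let gap : ℝ := S.spectralGap β σ_E f
        let Λ : ℝ := Real.log (Real.exp 1 +
          (1 + 𝔠 * (S.gibbsEnergy β T.N κ).toReal / (gap * ε)) * Fintype.card 𝒜)
        K * Λ ^ (1 / κ) * (1 + Real.log (1 + Real.log (1 + 𝔠 / ε))) ^ m ≤ M →
        traceNorm (truncDynamics S T β σ_E f M (K₀ / gap * Real.log (1 + 𝔠 / ε)) ρ -
          S.gibbsState β) ≤ ENNReal.ofReal ε) := by
  have hfK := isKernel_filter hr hκ₀ hf_int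
  have hgK : IsKernel (growthFun r κ) (driftKernel β σ_E) :=
    isKernel_driftKernel hβ hσ_E hr hκ₀ hκ₁
  set C₁ := genConst (growthFun r κ) σ_E f (driftKernel β σ_E) * (|C_A| + 2) with hC₁
  have hC₁0 : 0 ≤ C₁ := mul_nonneg (genConst_nonneg hσ_E _ _) (by positivity)
  refine ⟨C₁, 2, hC₁0, two_pos, fun q q' p hq hq' hp => ⟨errorPoly q q' p,
    polyBounded_errorPoly hq hq' hp, errorPoly_nonneg q q' p, ?_⟩⟩
  obtain ⟨D, k, hD, hDk⟩ := exists_errorPoly_le hq hq' hp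
  obtain ⟨K, m, hK, hlevel⟩ := exists_level hκ₀ (D := 4 * (C₁ * D)) (by positivity) k
  refine ⟨K, m, hK, ?_⟩
  intro 𝓗 _ _ _ ι 𝒜 _ S T τ hG hA hT hE 𝔠 ρ h𝔠 hρ hle
  set E := (S.gibbsEnergy β T.N κ).toReal with hEdef
  have hE0 : 0 ≤ E := ENNReal.toReal_nonneg
  have h𝔠0 : 0 ≤ 𝔠 := zero_le_one.trans h𝔠
  have herr : ∀ (t : ℝ) (M : ℕ), 0 ≤ t → 1 ≤ M →
      traceNorm (S.exactDynamics β σ_E f t ρ - truncDynamics S T β σ_E f M t ρ) ≤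
        ENNReal.ofReal (t * C₁ * 𝔠 * errorPoly q q' p (Fintype.card 𝒜) M * E *
          Real.exp (-(M : ℝ) ^ κ)) := fun t M ht hM => by
    refine (traceNorm_dynamics_sub_le hG hA hT hr hκ₀ hκ₁ hβ hσ_E hE hfK hgK hq hf hM h𝔠0 hρ hle
      ht).trans (ENNReal.ofReal_le_ofReal ?_)
    have h := truncError_le (κ := κ) (r := r) (C_A := C_A) hσ_E f (driftKernel β σ_E) q q' p
      (Fintype.card 𝒜) M
    calc _ ≤ t * (C₁ * errorPoly q q' p (Fintype.card 𝒜) M * Real.exp (-(M : ℝ) ^ κ) *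
          (𝔠 * E)) := by gcongr
      _ = _ := by ring
  have hsmall : ∀ (t ε X l : ℝ) (M : ℕ), 0 ≤ t → 0 < ε → 1 ≤ X → 0 ≤ l →
      t * 𝔠 * E ≤ 2 * ε * X * (1 + l) →
      K * Real.log (Real.exp 1 + X * Fintype.card 𝒜) ^ (1 / κ) * (1 + Real.log (1 + l)) ^ m ≤ M →
      traceNorm (S.exactDynamics β σ_E f t ρ - truncDynamics S T β σ_E f M t ρ) ≤
        ENNReal.ofReal (ε / 2) := fun t ε X l M ht hε hX hl htX hM => by
    obtain ⟨hM1, hM2⟩ := hlevel _ M X l hX hl hM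
    refine (herr t M ht hM1).trans (ENNReal.ofReal_le_ofReal ?_)
    have hd := hDk (Fintype.card 𝒜) M
    set a : ℝ := (Fintype.card 𝒜 : ℝ)
    set Y := (1 + a + M : ℝ) ^ k
    have hY : 0 ≤ Y := by positivity
    set e := Real.exp (-(M : ℝ) ^ κ)
    have he : 0 ≤ e := (Real.exp_pos _).le
    have ha : 0 ≤ a := Nat.cast_nonneg _
    have hp0 := errorPoly_nonneg q q' p (Fintype.card 𝒜) M
    calc _ = t * 𝔠 * E * (C₁ * errorPoly q q' p (Fintype.card 𝒜) M * e) := by ring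
      _ ≤ 2 * ε * X * (1 + l) * (C₁ * (D * a * Y) * e) := by gcongr
      _ = ε / 2 * (4 * (C₁ * D) * X * a * (1 + l) * Y * e) := by ring
      _ ≤ ε / 2 * 1 := by gcongr
      _ = ε / 2 := mul_one _
  refine ⟨herr, ?_, ?_⟩
  · intro t ε M ht hε Λ hM
    set X := 1 + t * 𝔠 * E / ε with hX
    have hX1 : 1 ≤ X := le_add_of_nonneg_right (by positivity)
    have hΛ : 1 ≤ Λ := by
      rw [Real.le_log_iff_exp_le (by positivity)]
      exact le_add_of_nonneg_right (by positivity)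
    refine (hsmall t ε X 0 M ht hε hX1 le_rfl ?_ ?_).trans
      (ENNReal.ofReal_le_ofReal (by linarith))
    · have : t * 𝔠 * E = ε * (X - 1) := by rw [hX]; field_simp; ring
      nlinarith
    · rw [add_zero, Real.log_one, add_zero, one_pow, mul_one]
      refine le_trans (le_mul_of_one_le_right (by positivity) (one_le_pow₀ ?_)) hM
      exact le_add_of_nonneg_right (Real.log_nonneg hΛ)
  · intro hgap ε M hε gap Λ hM
    set l := Real.log (1 + 𝔠 / ε) with hl
    have hy : 0 < 𝔠 / ε := by positivity
    have hl0 : 0 < l := Real.log_pos (by linarith)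
    set X := 1 + 𝔠 * E / (gap * ε) with hX
    have hX1 : 1 ≤ X := le_add_of_nonneg_right (by positivity)
    have ht : 0 < 2 / gap * l := by positivity
    have h1 := hsmall (2 / gap * l) ε X l M ht.le hε hX1 hl0.le (by
      have h2 : 2 / gap * l * 𝔠 * E = 2 * ε * (X - 1) * l := by
        have : gap ≠ 0 := hgap.ne'
        rw [hX]; field_simp; ring
      have : 0 ≤ ε * X := by positivity
      have : 0 ≤ ε * l := by positivity
      nlinarith) hM
    have h2 := traceNorm_exactDynamics_sub_gibbsState_le hG hβ hA hσ_E hfK.1 hf hgap h𝔠 hρ hle ht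
    have h3 : Real.exp (-(2 / gap * l * gap)) * (2 * 𝔠) ≤ ε / 2 := by
      have e1 : 2 / gap * l * gap = ((2 : ℕ) : ℝ) * l := by
        have : gap ≠ 0 := hgap.ne'
        push_cast
        field_simp
      rw [e1, Real.exp_neg, Real.exp_nat_mul, hl, Real.exp_log (by linarith), ← div_eq_inv_mul,
        div_le_iff₀ (by positivity)]
      have e2 : 𝔠 = ε * (𝔠 / ε) := by field_simp
      set y := 𝔠 / ε
      rw [e2]
      nlinarith [mul_nonneg hε.le (sq_nonneg (y - 1))]
    refine (traceNorm_sub_le _ _ _).trans ((add_le_add h1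
      (h2.trans (ENNReal.ofReal_le_ofReal h3))).trans (le_of_eq ?_))
    rw [← ENNReal.ofReal_add (by positivity) (by positivity), add_halves]
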